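/- Fix $c\in\mathbb{C}\setminus\{0\}$ and put $$g(u,v)=\frac{c}{u-v},\quad f(u,v)=\frac{u-v+c}{u-v},\quad h(u,v)=\frac{u-v+c}{c},\quad t(u,v)=\frac{c^2}{(u-v)(u-v+c)}.$$ For a function of one or two variables, a set in place of an argument means the product over that set. For $\bar x=(x_1,\dots,x_n)$ let $\Delta'_n(\bar x)=\prod_{j<k}g(x_j,x_k)$ and $\Delta_n(\bar x)=\prod_{j>k}g(x_j,x_k)$. Let $[1]=[2]=0$, $[3]=1$. **Model.** Let $V$ be a complex vector space and let $T_{ij}(u)\in\mathrm{End}(V)$ ($i,j\in\{1,2,3\}$, $u\in\mathbb{C}$) satisfy the $\mathfrak{gl}(2|1)$ $RTT$-relation, i.e. for $u\ne v$ $$T_{ij}(u)T_{kl}(v)-(-1)^{([i]+[j])([k]+[l])}T_{kl}(v)T_{ij}(u)=(-1)^{[i]([k]+[l])+[k][l]}g(u,v)\bigl(T_{kj}(v)T_{il}(u)-T_{kj}(u)T_{il}(v)\bigr).$$ Let $|0\rangle\in V$ and $\langle0|\in V^*$ satisfy $\langle 0|0\rangle=1$, $T_{ii}(u)|0\rangle=\lambda_i(u)|0\rangle$,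 $\langle0|T_{ii}(u)=\lambda_i(u)\langle0|$ for $i=1,2,3$, and $T_{ji}(u)|0\rangle=0$, $\langle0|T_{ij}(u)=0$ for $i<j$, with functions $\lambda_i:\mathbb{C}\to\mathbb{C}$. Put $r_1=\lambda_1/\lambda_2$, $r_3=\lambda_3/\lambda_2$. **Bethe vectors.** For $i=1,2$ put $$\mathbb{T}_{i3}(x_1,\dots,x_n)=\frac{T_{i3}(x_1)\cdots T_{i3}(x_n)}{\prod_{j<k}h(x_k,x_j)},\qquad \mathbb{T}_{3i}(x_1,\dots,x_n)=\frac{T_{3i}(x_1)\cdots T_{3i}(x_n)}{\prod_{j<k}h(x_j,x_k)}.$$ For $\bar u=(u_1,\dots,u_a)$ and $\bar v=(v_1,\dots,v_b)$ the Bethe vector and the dual Bethe vector are $$\mathbb{B}_{a,b}(\bar u;\bar v)=\sum W\;\mathbb{T}_{13}(\bar u_{\rm I})\,T_{12}(\bar u_{\rm II})\,\mathbb{T}_{23}(\bar v_{\rm II})|0\rangle,\qquad \mathbb{C}_{a,b}(\bar u;\bar v)=(-1)^{b(b-1)/2}\sum W\;\langle0|\,\mathbb{T}_{32}(\bar v_{\rm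 II})\,T_{21}(\bar u_{\rm II})\,\mathbb{T}_{31}(\bar u_{\rm I}),$$ $$W=\frac{g(\bar v_{\rm I},\bar u_{\rm I})\,f(\bar u_{\rm I},\bar u_{\rm II})\,g(\bar v_{\rm II},\bar v_{\rm I})\,h(\bar u_{\rm I},\bar u_{\rm I})}{\lambda_2(\bar u)\,\lambda_2(\bar v_{\rm II})\,f(\bar v,\bar u)},$$ where the sums run over all partitions $\bar u\Rightarrow\{\bar u_{\rm I},\bar u_{\rm II}\}$, $\bar v\Rightarrow\{\bar v_{\rm I},\bar v_{\rm II}\}$ with $\#\bar u_{\rm I}=\#\bar v_{\rm I}$, the elements of every subset being taken in the order of increasing index. **Proposition.** Let $a,b\ge0$, and let $\bar u^C,\bar u^B$ (of size $a$) and $\bar v^C,\bar v^B$ (of size $b$) be generic: the $2a+2b$ numbers are pairwise distinct, no two of them differ by $c$, and $\lambda_2$ vanishes at none of them. Let $\varkappa\in\mathbb{C}\setminus\{0\}$ and suppose that $$r_1(u^C_j)=\varkappa\prod_{k\ne j}\frac{f(u^C_j,u^C_k)}{f(u^C_k,u^C_j)}\prod_{l=1}^b f(v^C_l,u^C_j)\quad(1\le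 j\le a),\qquad r_3(v^B_k)=\prod_{l=1}^a f(v^B_k,u^B_l)\quad(1\le k\le b).$$ Let $\bar x=(u^B_1,\dots,u^B_a,v^C_1,\dots,v^C_b)$ and let $\mathcal{N}$ be the $(a+b)\times(a+b)$ matrix with entries, for $k=1,\dots,a+b$, $$\mathcal{N}_{jk}=\frac{(-1)^{a-1}r_1(x_k)}{f(\bar v^C,x_k)}\,t(u^C_j,x_k)\,h(\bar u^C,x_k)+\varkappa\,t(x_k,u^C_j)\,h(x_k,\bar u^C),\qquad j=1,\dots,a,$$ $$\mathcal{N}_{a+j,k}=\frac{g(x_k,\bar v^B)}{g(x_k,\bar v^C)}\left(1-\frac{r_3(x_k)}{f(x_k,\bar u^B)}\right)\left(g(x_k,v^C_j)\,h(x_k,\bar u^B)+\frac{(-1)^{a-1}r_1(x_k)\,r_3(v^C_j)\,h(\bar u^B,x_k)}{\varkappa\, f(v^C_j,\bar u^C)\,f(\bar v^B,x_k)\,h(v^C_j,x_k)}\right),\qquad j=1,\dots,b,$$ where at coinciding arguments $1/f(y,y)=1/g(y,y)=0$ and $g(x_k,v^C_j)/g(x_k,\bar v^C)$ means $\prod_{l\ne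 j}1/g(x_k,v^C_l)$ (a term containing a zero factor $1/f(y,y)$ or $1/g(y,y)$ is zero). Then the scalar product $S_{a,b}=\mathbb{C}_{a,b}(\bar u^C;\bar v^C)\,\mathbb{B}_{a,b}(\bar u^B;\bar v^B)$ satisfies $$S_{a,b}=\Delta_{a+b}(\bar x)\,\Delta'_a(\bar u^C)\,\Delta'_b(\bar v^C)\,\det_{a+b}\mathcal{N}.$$ -/

import Mathlib

open scoped BigOperators

noncomputable section

namespace GL21

/-- `g(u,v) = c / (u - v)`. -/
def g (c u v : ℂ) : ℂ := c / (u - v)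

/-- `f(u,v) = 1 + g(u,v) = (u - v + c) / (u - v)` for `u ≠ v`. In this form `(f c u u)⁻¹ = 0`, which is
the value of `1 / f(u,v) = (u - v) / (u - v + c)` at `v = u`; likewise `(g c u u)⁻¹ = 0` is the value
of `1 / g(u,v) = (u - v) / c` at `v = u`. -/
def f (c u v : ℂ) : ℂ := (u - v + c) / (u - v)

/-- `h(u,v) = f(u,v) / g(u,v)`. -/
def h (c u v : ℂ) : ℂ := (u - v + c) / c

/-- `t(u,v) = g(u,v) / h(u,v)`. -/
def t (c u v : ℂ) : ℂ := c ^ 2 / ((u - v) * (u - v + c))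

/-- `Δ'_n(x) = ∏_{j<k} g(x_j, x_k)`. -/
def DeltaPrime (c : ℂ) {n : ℕ} (x : Fin n → ℂ) : ℂ :=
  ∏ j, ∏ k ∈ Finset.Ioi j, g c (x j) (x k)

/-- `Δ_n(x) = ∏_{j>k} g(x_j, x_k)`. -/
def Delta (c : ℂ) {n : ℕ} (x : Fin n → ℂ) : ℂ :=
  ∏ j, ∏ k ∈ Finset.Iio j, g c (x j) (x k)

/-- The grading of `ℂ^{2|1}`: `[1] = [2] = 0`, `[3] = 1` (indices `1, 2, 3` are `0, 1, 2 : Fin 3`). -/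
def par : Fin 3 → ℕ := ![0, 0, 1]

/-- A `gl(2|1)`-based model on a complex vector space `V`: a monodromy matrix `T_{ij}(u)` obeying the
`RTT`-relation with `R(u,v) = 1 + g(u,v) P` (`P` the graded permutation), written in components, together
with a pseudovacuum and a dual pseudovacuum with vacuum eigenvalues `λ_i(u)`. -/
structure Model (c : ℂ) (V : Type*) [AddCommGroup V] [Module ℂ V] where
  /-- the entries `T_{ij}(u)` of the monodromy matrix -/
  T : Fin 3 → Fin 3 → ℂ → Module.End ℂ V
  /-- `[T_{ij}(u), T_{kl}(v)} = (-1)^{[i]([k]+[l])+[k][l]} g(u,v) (T_{kj}(v)T_{il}(u) - T_{kj}(u)T_{il}(v))` -/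
  rtt : ∀ (i j k l : Fin 3) (u v : ℂ), u ≠ v →
    T i j u * T k l v
        - ((-1 : ℂ) ^ ((par i + par j) * (par k + par l))) • (T k l v * T i j u)
      = ((-1 : ℂ) ^ (par i * (par k + par l) + par k * par l) * g c u v) •
          (T k j v * T i l u - T k j u * T i l v)
  /-- the pseudovacuum `|0⟩` -/
  vac : V
  /-- the dual pseudovacuum `⟨0|` -/
  dualVac : Module.Dual ℂ V
  /-- the vacuum eigenvalues `λ_i(u)` -/
  lam : Fin 3 → ℂ → ℂ
  dualVac_vac : dualVac vac = 1
  diag_vac : ∀ (i : Fin 3) (u : ℂ), T i i u vac = lam i u • vac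
  dualVac_diag : ∀ (i : Fin 3) (u : ℂ), dualVac ∘ₗ T i i u = lam i u • dualVac
  lower_vac : ∀ (i j : Fin 3) (u : ℂ), i < j → T j i u vac = 0
  dualVac_upper : ∀ (i j : Fin 3) (u : ℂ), i < j → dualVac ∘ₗ T i j u = 0

namespace Model

variable {c : ℂ} {V : Type*} [AddCommGroup V] [Module ℂ V] (M : Model c V)

/-- `r_1(u) = λ_1(u) / λ_2(u)`. -/
def r₁ (u : ℂ) : ℂ := M.lam 0 u / M.lam 1 u

/-- `r_3(u) = λ_3(u) / λ_2(u)`. -/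
def r₃ (u : ℂ) : ℂ := M.lam 2 u / M.lam 1 u

/-- The product `T_{ij}(x_{k_1}) T_{ij}(x_{k_2}) ⋯` over `I = {k_1 < k_2 < ⋯}`, in the natural order. -/
def opProd (i j : Fin 3) {n : ℕ} (x : Fin n → ℂ) (I : Finset (Fin n)) : Module.End ℂ V :=
  (((List.finRange n).filter (fun k => k ∈ I)).map (fun k => M.T i j (x k))).prod

/-- For `i = 1, 2`: the symmetric product `𝕋_{i3}(x_I) = ∏_{j<k} h(x_k,x_j)⁻¹ T_{i3}(x_{k_1}) T_{i3}(x_{k_2}) ⋯`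
of odd creation operators. -/
def oddUp (i : Fin 3) {n : ℕ} (x : Fin n → ℂ) (I : Finset (Fin n)) : Module.End ℂ V :=
  (∏ j ∈ I, ∏ k ∈ I with j < k, h c (x k) (x j))⁻¹ • M.opProd i 2 x I

/-- For `i = 1, 2`: the symmetric product `𝕋_{3i}(x_I) = ∏_{j<k} h(x_j,x_k)⁻¹ T_{3i}(x_{k_1}) T_{3i}(x_{k_2}) ⋯`
of odd annihilation operators. -/
def oddDown (i : Fin 3) {n : ℕ} (x : Fin n → ℂ) (I : Finset (Fin n)) : Module.End ℂ V :=
  (∏ j ∈ I, ∏ k ∈ I with j < k, h c (x j) (x k))⁻¹ • M.opProd 2 i x I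

/-- The coefficient
`g(v_I,u_I) f(u_I,u_II) g(v_II,v_I) h(u_I,u_I) / (λ_2(u) λ_2(v_II) f(v,u))` of the term of a (dual) Bethe
vector that belongs to the partitions `u ⇒ {u_I, u_II}`, `v ⇒ {v_I, v_II}`; here `u_I`, `v_I` are indexed
by `I`, `J` and `u_II`, `v_II` by the complements. -/
def coeff {a b : ℕ} (u : Fin a → ℂ) (v : Fin b → ℂ) (I : Finset (Fin a)) (J : Finset (Fin b)) : ℂ :=
  (∏ j ∈ J, ∏ i ∈ I, g c (v j) (u i)) * (∏ i ∈ I, ∏ k ∈ Iᶜ, f c (u i) (u k)) *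
      (∏ j ∈ Jᶜ, ∏ k ∈ J, g c (v j) (v k)) * (∏ i ∈ I, ∏ k ∈ I, h c (u i) (u k)) /
    ((∏ i, M.lam 1 (u i)) * (∏ j ∈ Jᶜ, M.lam 1 (v j)) * ∏ j, ∏ i, f c (v j) (u i))

/-- The Bethe vector `𝔹_{a,b}(u; v)`: the sum over partitions `u ⇒ {u_I, u_II}`, `v ⇒ {v_I, v_II}` with
`#u_I = #v_I` of `coeff • 𝕋_{13}(u_I) T_{12}(u_II) 𝕋_{23}(v_II) |0⟩`. -/
def betheVector {a b : ℕ} (u : Fin a → ℂ) (v : Fin b → ℂ) : V :=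
  ∑ I : Finset (Fin a), ∑ J : Finset (Fin b) with J.card = I.card,
    M.coeff u v I J • (M.oddUp 0 u I * M.opProd 0 1 u Iᶜ * M.oddUp 1 v Jᶜ) M.vac

/-- The dual Bethe vector `ℂ_{a,b}(u; v)`: `(-1)^{b(b-1)/2}` times the sum over the same partitions of
`coeff • ⟨0| 𝕋_{32}(v_II) T_{21}(u_II) 𝕋_{31}(u_I)`. -/
def dualBetheVector {a b : ℕ} (u : Fin a → ℂ) (v : Fin b → ℂ) : Module.Dual ℂ V :=
  ((-1 : ℂ) ^ (b * (b - 1) / 2)) •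
    ∑ I : Finset (Fin a), ∑ J : Finset (Fin b) with J.card = I.card,
      M.coeff u v I J •
        (M.dualVac ∘ₗ (M.oddDown 1 v Jᶜ * M.opProd 1 0 u Iᶜ * M.oddDown 0 u I))

/-- The scalar product `S_{a,b} = ℂ_{a,b}(u^C; v^C) 𝔹_{a,b}(u^B; v^B)`. -/
def scalarProduct {a b : ℕ} (uC : Fin a → ℂ) (vC : Fin b → ℂ) (uB : Fin a → ℂ) (vB : Fin b → ℂ) : ℂ :=
  M.dualBetheVector uC vC (M.betheVector uB vB)

/-- The entry in row `j ≤ a` of the column of `𝒩` with parameter `x`. -/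
def upperEntry (ϰ : ℂ) {a b : ℕ} (uC : Fin a → ℂ) (vC : Fin b → ℂ) (j : Fin a) (x : ℂ) : ℂ :=
  (-1) ^ (a + 1) * M.r₁ x * (∏ l, (f c (vC l) x)⁻¹) * t c (uC j) x * (∏ i, h c (uC i) x)
    + ϰ * t c x (uC j) * ∏ i, h c x (uC i)

/-- The entry in row `a + j` of the column of `𝒩` with parameter `x`. The factor `1 / g(x, v^C)` is
distributed over the last bracket: `g(x, v^C_j) / g(x, v^C) = ∏_{l ≠ j} 1 / g(x, v^C_l)` in the first term
(so that the entry is right also at `x = v^C_j`), and `∏_l 1 / g(x, v^C_l)` in the second. -/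
def lowerEntry (ϰ : ℂ) {a b : ℕ} (uC : Fin a → ℂ) (vC : Fin b → ℂ) (uB : Fin a → ℂ) (vB : Fin b → ℂ)
    (j : Fin b) (x : ℂ) : ℂ :=
  (∏ l, g c x (vB l)) * (1 - M.r₃ x * ∏ i, (f c x (uB i))⁻¹) *
    ((∏ l ∈ Finset.univ.erase j, (g c x (vC l))⁻¹) * (∏ i, h c x (uB i))
      + (∏ l, (g c x (vC l))⁻¹) *
        ((-1) ^ (a + 1) * M.r₁ x * M.r₃ (vC j) * (∏ i, h c (uB i) x) /
          (ϰ * (∏ i, f c (vC j) (uC i)) * (∏ l, f c (vB l) x) * h c (vC j) x)))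

/-- The `(a+b) × (a+b)` matrix `𝒩`, with columns labelled by `x = {u^B, v^C}`. -/
def matrixN (ϰ : ℂ) {a b : ℕ} (uC : Fin a → ℂ) (vC : Fin b → ℂ) (uB : Fin a → ℂ) (vB : Fin b → ℂ) :
    Matrix (Fin (a + b)) (Fin (a + b)) ℂ :=
  Matrix.of fun i k =>
    Fin.append (fun j => M.upperEntry ϰ uC vC j (Fin.append uB vC k))
      (fun j => M.lowerEntry ϰ uC vC uB vB j (Fin.append uB vC k)) i

end Model

/-- Genericity of a family of parameters: they are pairwise distinct and no two of them differ by `c`. -/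
def Generic (c : ℂ) {ι : Type*} (z : ι → ℂ) : Prop :=
  ∀ i j, i ≠ j → z i ≠ z j ∧ z i - z j ≠ c

end GL21

end

open scoped BigOperators TensorProduct

noncomputable section

namespace GL21

universe u

/-! Both sides are reduced to the same finite sum, `mixedSum`. Let A, B, W, Y be the sets of values
of u^C, u^B, v^C, v^B.

Operator side. Normal ordering by the RTT relation turns any product of entries T_{ij} at distinct
points, taken between the two vacua, into a combination of monomials in the vacuum eigenvalues in
which every point occurs once; the coefficients do not depend on the model (`vev_mem_lamSpan`).
Hence the scalar product of generic Bethe vectors is determined by its values on models in which, at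
each of the 2a+2b points, exactly one eigenvalue is nonzero (`eq_sum_of_mem_lamSpan`). Such
indicator models exist for every labelling of generic points, as composites of one-site models
(`exists_indicator_model`). The composite of an indicator model N with itself is an indicator model
with the same labels, and there a Bethe vector collapses to a single tensor (`Splitting.bet_eq`),
because the labels kill all but one term of the coproduct at each point. Transposition makes dual
Bethe vectors into Bethe vectors of a model on the dual space, so they collapse too, and the scalar
product becomes a product of two vacuum expectation values in N, each of which is a highest
coefficient `zf` (`Model.dualVac_eq_zf`). The outcome is the sum formula `sc_eq_sumFormula`: a sum
over partitions of all four sets of products of two highest coefficients.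

On-shell summation. The highest coefficient has a second representation `zfDual` (`zf_eq_zfDual`):
both are Cauchy–Binet sums for determinants whose entries are proportional, by a residue
computation. Use one factor in each form and eliminate r_1 on A and r_3 on Y by the Bethe equations.
Then the sums over partitions of A and of Y can be carried out: the first is a convolution of domain
wall partition functions (`dw_convolution`), the second is the Laplace expansion of a Cauchy
determinant. What remains is `mixedSum`, over subsets of B and W (`sumFormula_eq_mixedSum`).

Determinant side. `alt` is a determinant multiplied by Vandermonde-type products of g, which makes
it a function of sets of rows and columns and removes all signs from its expansions. A column at x
in B is the sum of a part free of r_1 and a part that is, up to a factor, a column of the same kind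
at x - c; moving the latter there changes only the Vandermonde factor. A Laplace expansion then
separates the rows A, whose minors are Izergin determinants for `dw`, from the rows W, which are
sums of two multiples of the Lagrange basis of W and have explicit minors. This gives `alt_entry`:
the determinant yields g(A, W) times `mixedSum`, and g(A, W) is exactly the factor by which Δ' of
the concatenated rows differs from Δ'_a Δ'_b. -/

/-- The product of `k x y` over `x ∈ S`, `y ∈ T`. -/
def pp (k : ℂ → ℂ → ℂ) (S T : Finset ℂ) : ℂ := ∏ x ∈ S, ∏ y ∈ T, k x y

/-! ### Products over pairs of finite sets -/

section pp
variable (k l : ℂ → ℂ → ℂ) {S S' T T' : Finset ℂ} {x y : ℂ}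

@[simp] theorem pp_empty_left : pp k ∅ T = 1 := by simp [pp]

@[simp] theorem pp_empty_right : pp k S ∅ = 1 := by simp [pp]

theorem pp_singleton_left : pp k {x} T = ∏ y ∈ T, k x y := by simp [pp]

theorem pp_singleton_right : pp k S {y} = ∏ x ∈ S, k x y := by simp [pp]

@[simp] theorem pp_pair : pp k {x} {y} = k x y := by simp [pp]

theorem pp_union_left (h : Disjoint S S') : pp k (S ∪ S') T = pp k S T * pp k S' T := by
  simp [pp, Finset.prod_union h]

theorem pp_union_right (h : Disjoint T T') : pp k S (T ∪ T') = pp k S T * pp k S T' := by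
  simp [pp, Finset.prod_union h, Finset.prod_mul_distrib]

theorem pp_insert_left (h : x ∉ S) : pp k (insert x S) T = pp k {x} T * pp k S T := by
  rw [Finset.insert_eq, pp_union_left k (by simpa using h)]

theorem pp_insert_right (h : y ∉ T) : pp k S (insert y T) = pp k S {y} * pp k S T := by
  rw [Finset.insert_eq, pp_union_right k (by simpa using h)]

theorem pp_erase_left (h : x ∈ S) : pp k {x} T * pp k (S.erase x) T = pp k S T := by
  rw [← pp_insert_left k (Finset.notMem_erase x S), Finset.insert_erase h]

theorem pp_erase_right (h : y ∈ T) : pp k S {y} * pp k S (T.erase y) = pp k S T := by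
  rw [← pp_insert_right k (Finset.notMem_erase y T), Finset.insert_erase h]

theorem pp_sdiff_left (h : S' ⊆ S) : pp k S' T * pp k (S \ S') T = pp k S T := by
  rw [← pp_union_left k Finset.disjoint_sdiff, Finset.union_sdiff_of_subset h]

theorem pp_sdiff_right (h : T' ⊆ T) : pp k S T' * pp k S (T \ T') = pp k S T := by
  rw [← pp_union_right k Finset.disjoint_sdiff, Finset.union_sdiff_of_subset h]

variable {k l}

theorem pp_ne_zero (h : ∀ x ∈ S, ∀ y ∈ T, k x y ≠ 0) : pp k S T ≠ 0 :=
  Finset.prod_ne_zero_iff.2 fun x hx => Finset.prod_ne_zero_iff.2 fun y hy => h x hx y hy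

theorem pp_eq_zero (hx : x ∈ S) (hy : y ∈ T) (h : k x y = 0) : pp k S T = 0 :=
  Finset.prod_eq_zero hx (Finset.prod_eq_zero hy h)

theorem pp_congr (h : ∀ x ∈ S, ∀ y ∈ T, k x y = l x y) : pp k S T = pp l S T :=
  Finset.prod_congr rfl fun x hx => Finset.prod_congr rfl fun y hy => h x hx y hy

theorem pp_mul (k l : ℂ → ℂ → ℂ) : pp (fun x y => k x y * l x y) S T = pp k S T * pp l S T := by
  simp [pp, Finset.prod_mul_distrib]

theorem pp_inv (k : ℂ → ℂ → ℂ) : pp (fun x y => (k x y)⁻¹) S T = (pp k S T)⁻¹ := by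
  simp [pp]

theorem pp_flip (k : ℂ → ℂ → ℂ) : pp (fun x y => k y x) S T = pp k T S := by
  simp only [pp]; exact Finset.prod_comm

theorem pp_neg (k : ℂ → ℂ → ℂ) :
    pp (fun x y => - k x y) S T = (-1) ^ (S.card * T.card) * pp k S T := by
  simp only [pp, Finset.prod_neg, Finset.prod_mul_distrib, Finset.prod_const, ← pow_mul]
  rw [mul_comm T.card]

end pp

/-! ### Elementary properties of g, f and h -/

section scalar
variable (c : ℂ)

theorem g_antisymm (x y : ℂ) : g c x y = - g c y x := by
  rw [g, g, ← neg_sub y x, div_neg]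

theorem pp_g_swap (S T : Finset ℂ) :
    pp (g c) S T = (-1) ^ (S.card * T.card) * pp (g c) T S := by
  rw [← pp_flip (g c) (S := S), ← pp_neg]
  exact pp_congr fun x _ y _ => g_antisymm c x y

variable {c}

theorem g_ne_zero (hc : c ≠ 0) {x y : ℂ} (h : x ≠ y) : g c x y ≠ 0 :=
  div_ne_zero hc (sub_ne_zero.2 h)

theorem pp_g_ne_zero (hc : c ≠ 0) {S T : Finset ℂ} (h : Disjoint S T) : pp (g c) S T ≠ 0 :=
  pp_ne_zero fun _ hx _ hy => g_ne_zero hc fun e => Finset.disjoint_left.1 h hx (e ▸ hy)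

theorem f_eq (hc : c ≠ 0) (x y : ℂ) : f c x y = g c x y * h c x y := by
  rw [f, g, h]; field_simp

theorem f_eq_one_add {x y : ℂ} (hxy : x ≠ y) : f c x y = 1 + g c x y := by
  rw [f, g, ← sub_ne_zero] at *; field_simp

theorem h_self (hc : c ≠ 0) (x : ℂ) : h c x x = 1 := by simp [h, hc]

theorem pp_f_eq (hc : c ≠ 0) (S T : Finset ℂ) :
    pp (f c) S T = pp (g c) S T * pp (h c) S T := by
  rw [← pp_mul]; exact pp_congr fun x _ y _ => f_eq hc x y

end scalar

/-! ### Alternants: determinants normalized by products of g -/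

/-- The alternant `Δ'(w) Δ(X) det (φ(w_i, x_j))` with rows labelled by a list and columns by a finite set. -/
def altL (c : ℂ) (φ : ℂ → ℂ → ℂ) : List ℂ → Finset ℂ → ℂ
  | [], X => if X = ∅ then 1 else 0
  | w :: l, X => ∑ x ∈ X, φ w x * (∏ y ∈ X.erase x, g c y x) * (l.map (g c w)).prod *
      altL c φ l (X.erase x)

section altL
variable {c : ℂ} {φ ψ : ℂ → ℂ → ℂ}

theorem sum_erase_comm {M : Type*} [AddCommMonoid M] (X : Finset ℂ) (F : ℂ → ℂ → M) :
    ∑ x ∈ X, ∑ y ∈ X.erase x, F x y = ∑ y ∈ X, ∑ x ∈ X.erase y, F x y := by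
  refine Finset.sum_comm' fun x y => ?_
  simp only [Finset.mem_erase, ne_eq]
  grind

theorem prod_erase_pair (X : Finset ℂ) {x y : ℂ} (hy : y ∈ X.erase x) (u : ℂ → ℂ) :
    ∏ z ∈ X.erase x, u z = u y * ∏ z ∈ (X.erase x).erase y, u z :=
  (Finset.mul_prod_erase _ _ hy).symm

/-- Swapping the first two rows only exchanges the names of the two columns they take. The two
factors that see the order, g of the columns and g of the rows, both change sign, so nothing changes
in total. This is why rows and columns may be labelled by sets and why no signs occur in the
expansions below. -/
theorem altL_perm {l l' : List ℂ} (h : l.Perm l') (X : Finset ℂ) :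
    altL c φ l X = altL c φ l' X := by
  induction h generalizing X with
  | nil => rfl
  | cons w h ih => simp only [altL, ih, (h.map (g c w)).prod_eq]
  | swap v w l =>
    simp only [altL, List.map_cons, List.prod_cons, Finset.mul_sum]
    rw [sum_erase_comm]
    refine Finset.sum_congr rfl fun x hx => Finset.sum_congr rfl fun y hy => ?_
    have hx' : x ∈ X.erase y := by
      simp only [Finset.mem_erase, ne_eq] at *; grind
    rw [prod_erase_pair X hy, prod_erase_pair X hx', Finset.erase_right_comm, g_antisymm c x y,
      g_antisymm c w v]
    ring
  | trans _ _ ih₁ ih₂ => rw [ih₁, ih₂]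

theorem altL_congr {l : List ℂ} {X : Finset ℂ} (h : ∀ w ∈ l, ∀ x ∈ X, φ w x = ψ w x) :
    altL c φ l X = altL c ψ l X := by
  induction l generalizing X with
  | nil => rfl
  | cons w l ih =>
    refine Finset.sum_congr rfl fun x hx => ?_
    rw [h w (by simp) x hx, ih fun v hv y hy => h v (by simp [hv]) y (Finset.mem_of_mem_erase hy)]

theorem altL_eq_zero {l : List ℂ} {X : Finset ℂ} (h : l.length ≠ X.card) : altL c φ l X = 0 := by
  induction l generalizing X with
  | nil => simp only [altL, ite_eq_right_iff]; rintro rfl; simp at h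
  | cons w l ih =>
    refine Finset.sum_eq_zero fun x hx => ?_
    rw [ih, mul_zero]
    rw [Finset.card_erase_of_mem hx]
    have := Finset.card_pos.2 ⟨x, hx⟩
    simp at h; omega

end altL

/-- The alternant `Δ'(W) Δ(X) det (φ(w, x))`; it does not depend on the enumerations of `W` and `X`. -/
def alt (c : ℂ) (φ : ℂ → ℂ → ℂ) (W X : Finset ℂ) : ℂ := altL c φ W.toList X

section alt
variable {c : ℂ} {φ ψ : ℂ → ℂ → ℂ} {W X : Finset ℂ}

theorem alt_eq_altL {l : List ℂ} (hl : l.Nodup) (h : ∀ w, w ∈ l ↔ w ∈ W) :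
    alt c φ W X = altL c φ l X :=
  altL_perm ((List.perm_ext_iff_of_nodup W.nodup_toList hl).2 fun w => by simp [h]) X

@[simp] theorem alt_empty_empty : alt c φ ∅ ∅ = 1 := by simp [alt, altL]

theorem alt_empty (X : Finset ℂ) : alt c φ ∅ X = if X = ∅ then 1 else 0 := by simp [alt, altL]

theorem alt_eq_zero (h : W.card ≠ X.card) : alt c φ W X = 0 :=
  altL_eq_zero (by simpa using h)

theorem alt_congr (h : ∀ w ∈ W, ∀ x ∈ X, φ w x = ψ w x) : alt c φ W X = alt c ψ W X :=
  altL_congr (by simpa using h)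

theorem alt_insert {w : ℂ} (hw : w ∉ W) (X : Finset ℂ) :
    alt c φ (insert w W) X = ∑ x ∈ X, φ w x * pp (g c) (X.erase x) {x} * pp (g c) {w} W *
      alt c φ W (X.erase x) := by
  rw [alt_eq_altL (l := w :: W.toList) (by simp [hw, W.nodup_toList]) (by simp)]
  simp only [altL, alt, pp_singleton_left, pp_singleton_right, Finset.prod_map_toList]

theorem alt_row {w : ℂ} (hw : w ∈ W) (X : Finset ℂ) :
    alt c φ W X = ∑ x ∈ X, φ w x * pp (g c) (X.erase x) {x} * pp (g c) {w} (W.erase w) *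
      alt c φ (W.erase w) (X.erase x) := by
  conv_lhs => rw [← Finset.insert_erase hw]
  exact alt_insert (Finset.notMem_erase w W) X

theorem pp_erase_right_singleton {X : Finset ℂ} {x y : ℂ} (hy : y ∈ X.erase x) (k : ℂ → ℂ → ℂ) :
    pp k (X.erase x) {x} = k y x * pp k ((X.erase x).erase y) {x} := by
  rw [pp_singleton_right, pp_singleton_right, prod_erase_pair X hy]

/-- The cofactor sign is hidden in the products of g, so the weights are those of the row expansion.
In the induction, the terms in which the new row v takes a column other than x are expanded twice;
reversing the order of the two expansions flips one g of columns and one g of rows. -/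
theorem alt_col {x : ℂ} (hx : x ∈ X) (W : Finset ℂ) :
    alt c φ W X = ∑ w ∈ W, φ w x * pp (g c) (X.erase x) {x} * pp (g c) {w} (W.erase w) *
      alt c φ (W.erase w) (X.erase x) := by
  induction W using Finset.induction_on generalizing X with
  | empty => rw [alt_empty, if_neg (Finset.ne_empty_of_mem hx)]; simp
  | insert v W hv ih =>
    rw [alt_insert hv, Finset.sum_insert hv, Finset.erase_insert hv,
      ← Finset.add_sum_erase _ _ hx]
    congr 1
    have h1 : ∀ y ∈ X.erase x, φ v y * pp (g c) (X.erase y) {y} * pp (g c) {v} W *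
        alt c φ W (X.erase y) = ∑ w ∈ W, φ v y * pp (g c) (X.erase y) {y} * pp (g c) {v} W *
        (φ w x * pp (g c) ((X.erase y).erase x) {x} * pp (g c) {w} (W.erase w) *
          alt c φ (W.erase w) ((X.erase y).erase x)) := by
      intro y hy
      have hxy : x ∈ X.erase y := by simp only [Finset.mem_erase, ne_eq] at *; grind
      rw [ih hxy, Finset.mul_sum]
    rw [Finset.sum_congr rfl h1, Finset.sum_comm]
    refine Finset.sum_congr rfl fun w hw => ?_
    have hvw : v ≠ w := fun e => hv (e ▸ hw)
    rw [Finset.erase_insert_of_ne hvw, alt_insert (by simp [hv]), Finset.mul_sum,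
      pp_insert_right _ (by simp [hv])]
    refine Finset.sum_congr rfl fun y hy => ?_
    have hxy : x ∈ X.erase y := by simp only [Finset.mem_erase, ne_eq] at *; grind
    rw [pp_erase_right_singleton hxy, pp_erase_right_singleton hy, Finset.erase_right_comm (a := y),
      ← pp_erase_right (g c) hw, pp_pair, pp_pair, g_antisymm c x y, g_antisymm c v w]
    ring

end alt

/-! ### Reindexing of sums over subsets -/

section powerset
variable {M : Type*} [AddCommMonoid M]

theorem sum_powerset_sdiff (X : Finset ℂ) (F : ℂ → Finset ℂ → M) :
    ∑ Z ∈ X.powerset, ∑ x ∈ X \ Z, F x Z = ∑ x ∈ X, ∑ Z ∈ (X.erase x).powerset, F x Z := by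
  refine Finset.sum_comm' fun Z x => ?_
  simp only [Finset.mem_powerset, Finset.mem_sdiff, Finset.subset_erase]
  tauto

theorem sum_powerset_mem (X : Finset ℂ) (F : ℂ → Finset ℂ → M) :
    ∑ Z ∈ X.powerset, ∑ x ∈ Z, F x (Z.erase x) = ∑ x ∈ X, ∑ Z ∈ (X.erase x).powerset, F x Z := by
  have h1 : ∑ Z ∈ X.powerset, ∑ x ∈ Z, F x (Z.erase x)
      = ∑ x ∈ X, ∑ Z ∈ X.powerset with x ∈ Z, F x (Z.erase x) := by
    refine Finset.sum_comm' fun Z x => ?_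
    simp only [Finset.mem_powerset, Finset.mem_filter]
    exact ⟨fun h => ⟨h, h.1 h.2⟩, fun h => h.1⟩
  rw [h1]
  refine Finset.sum_congr rfl fun x hx => ?_
  refine Finset.sum_nbij' (fun Z => Z.erase x) (fun Z => insert x Z) ?_ ?_ ?_ ?_ ?_
  · intro Z hZ
    simp only [Finset.mem_filter, Finset.mem_powerset] at hZ ⊢
    exact Finset.erase_subset_erase x hZ.1
  · intro Z hZ
    simp only [Finset.mem_filter, Finset.mem_powerset] at hZ ⊢
    exact ⟨Finset.insert_subset hx (hZ.trans (Finset.erase_subset _ _)), Finset.mem_insert_self _ _⟩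
  · intro Z hZ
    exact Finset.insert_erase (Finset.mem_filter.1 hZ).2
  · intro Z hZ
    refine Finset.erase_insert fun h => ?_
    exact Finset.notMem_erase x X (Finset.mem_powerset.1 hZ h)
  · intros; rfl

theorem sum_powerset_compl (X : Finset ℂ) (F : Finset ℂ → Finset ℂ → M) :
    ∑ Z ∈ X.powerset, F Z (X \ Z) = ∑ Z ∈ X.powerset, F (X \ Z) Z := by
  refine Finset.sum_nbij' (fun Z => X \ Z) (fun Z => X \ Z) ?_ ?_ ?_ ?_ ?_ <;> intro Z hZ
  · simp
  · simp
  · exact Finset.sdiff_sdiff_eq_self (Finset.mem_powerset.1 hZ)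
  · exact Finset.sdiff_sdiff_eq_self (Finset.mem_powerset.1 hZ)
  · rw [Finset.sdiff_sdiff_eq_self (Finset.mem_powerset.1 hZ)]

end powerset

/-! ### Multilinearity and Laplace expansions of alternants -/

section alt
variable {c : ℂ} {φ ψ : ℂ → ℂ → ℂ} {W X : Finset ℂ}

/-- Transposition reverses the arguments in both weights g. The two resulting signs agree because
the minor is square, or else the minor vanishes. -/
theorem alt_transpose (c : ℂ) (φ : ℂ → ℂ → ℂ) (W X : Finset ℂ) :
    alt c φ W X = alt c (fun x w => φ w x) X W := by
  induction W using Finset.induction_on generalizing X with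
  | empty =>
    by_cases hX : X = ∅
    · subst hX; simp
    · rw [alt_empty, if_neg hX, alt_eq_zero]; simpa using hX
  | insert v W hv ih =>
    rw [alt_insert hv, alt_col (Finset.mem_insert_self v W) X, Finset.erase_insert hv]
    refine Finset.sum_congr rfl fun x hx => ?_
    rw [ih]
    by_cases hcard : (X.erase x).card = W.card
    · rw [pp_g_swap c (X.erase x) {x}, pp_g_swap c W {v}, hcard, Finset.card_singleton, mul_one,
        Finset.card_singleton, mul_one]
      rcases neg_one_pow_eq_or ℂ (W.card) with h | h <;> rw [h] <;> ring
    · rw [alt_eq_zero hcard]; ring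

theorem alt_mul_row (r : ℂ → ℂ) (W X : Finset ℂ) :
    alt c (fun w x => r w * φ w x) W X = (∏ w ∈ W, r w) * alt c φ W X := by
  induction W using Finset.induction_on generalizing X with
  | empty => simp [alt_empty]
  | insert v W hv ih =>
    rw [alt_insert hv, alt_insert hv, Finset.prod_insert hv, Finset.mul_sum]
    refine Finset.sum_congr rfl fun x _ => ?_
    rw [ih]; ring

theorem alt_mul_col (r : ℂ → ℂ) (W X : Finset ℂ) :
    alt c (fun w x => r x * φ w x) W X = (∏ x ∈ X, r x) * alt c φ W X := by
  rw [alt_transpose, alt_mul_row, ← alt_transpose]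

/-- Multilinearity in the rows combined with the Laplace expansion: J collects the rows that take ψ,
Z the columns of their minor. The Laplace sign is absorbed by the two products of g. -/
theorem alt_add (φ ψ : ℂ → ℂ → ℂ) (W X : Finset ℂ) :
    alt c (fun w x => φ w x + ψ w x) W X = ∑ J ∈ W.powerset, ∑ Z ∈ X.powerset,
      pp (g c) (W \ J) J * pp (g c) Z (X \ Z) * alt c φ (W \ J) (X \ Z) * alt c ψ J Z := by
  induction W using Finset.induction_on generalizing X with
  | empty =>
    simp only [alt_empty, Finset.powerset_empty, Finset.sum_singleton, Finset.empty_sdiff, pp_empty_left,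
      one_mul]
    rw [Finset.sum_eq_single ∅]
    · simp
    · intro Z _ hZ; simp [hZ]
    · simp
  | insert v W hv ih =>
    rw [alt_insert hv, Finset.sum_powerset_insert hv]
    simp only [add_mul, Finset.sum_add_distrib]
    congr 1
    · have h1 : ∀ J ∈ W.powerset, ∑ Z ∈ X.powerset, pp (g c) (insert v W \ J) J * pp (g c) Z (X \ Z) *
          alt c φ (insert v W \ J) (X \ Z) * alt c ψ J Z
          = ∑ x ∈ X, ∑ Z ∈ (X.erase x).powerset, φ v x * pp (g c) (X.erase x) {x} * pp (g c) {v} W *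
            (pp (g c) (W \ J) J * pp (g c) Z (X.erase x \ Z) *
              alt c φ (W \ J) (X.erase x \ Z) * alt c ψ J Z) := by
        intro J hJ
        have hJ' := Finset.mem_powerset.1 hJ
        have hvJ : v ∉ J := fun h => hv (hJ' h)
        rw [← sum_powerset_sdiff]
        refine Finset.sum_congr rfl fun Z hZ => ?_
        have hZ' := Finset.mem_powerset.1 hZ
        rw [Finset.insert_sdiff_of_notMem _ hvJ, alt_insert (by simp [hv]), Finset.mul_sum,
          Finset.sum_mul]
        refine Finset.sum_congr rfl fun x hx => ?_
        have hx' := Finset.mem_sdiff.1 hx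
        have e1 : X.erase x = Z ∪ (X \ Z).erase x := by
          ext y; simp only [Finset.mem_erase, Finset.mem_union, Finset.mem_sdiff]; grind
        have e2 : X.erase x \ Z = (X \ Z).erase x := by
          ext y; simp only [Finset.mem_erase, Finset.mem_sdiff]; tauto
        have d1 : Disjoint Z ((X \ Z).erase x) :=
          Finset.disjoint_sdiff.mono_right (Finset.erase_subset _ _)
        rw [e2, e1, pp_union_left _ d1, pp_insert_left _ (by simp [hv]),
          ← pp_erase_right (g c) (S := Z) hx, ← pp_sdiff_right (g c) (S := {v}) hJ']
        ring
      rw [Finset.sum_congr rfl h1, Finset.sum_comm]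
      refine Finset.sum_congr rfl fun x hx => ?_
      rw [ih, Finset.mul_sum]
      refine Finset.sum_congr rfl fun J _ => ?_
      rw [Finset.mul_sum]
    · have h1 : ∀ J ∈ W.powerset, ∑ Z ∈ X.powerset, pp (g c) (insert v W \ insert v J) (insert v J) *
          pp (g c) Z (X \ Z) * alt c φ (insert v W \ insert v J) (X \ Z) * alt c ψ (insert v J) Z
          = ∑ x ∈ X, ∑ Z ∈ (X.erase x).powerset, ψ v x * pp (g c) (X.erase x) {x} * pp (g c) {v} W *
            (pp (g c) (W \ J) J * pp (g c) Z (X.erase x \ Z) *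
              alt c φ (W \ J) (X.erase x \ Z) * alt c ψ J Z) := by
        intro J hJ
        have hJ' := Finset.mem_powerset.1 hJ
        have hvJ : v ∉ J := fun h => hv (hJ' h)
        rw [← sum_powerset_mem]
        refine Finset.sum_congr rfl fun Z hZ => ?_
        have hZ' := Finset.mem_powerset.1 hZ
        have e0 : insert v W \ insert v J = W \ J := by
          ext y; simp only [Finset.mem_sdiff, Finset.mem_insert]; grind
        rw [e0, alt_insert hvJ, Finset.mul_sum]
        refine Finset.sum_congr rfl fun x hx => ?_
        have e1 : X.erase x = Z.erase x ∪ (X \ Z) := by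
          ext y; simp only [Finset.mem_erase, Finset.mem_union, Finset.mem_sdiff]; grind
        have e2 : X.erase x \ Z.erase x = X \ Z := by
          ext y; simp only [Finset.mem_erase, Finset.mem_sdiff]; grind
        have d1 : Disjoint (Z.erase x) (X \ Z) :=
          Finset.disjoint_sdiff.mono_left (Finset.erase_subset _ _)
        -- Bringing v and x to the right side of the two products costs the signs with exponents |W
        -- \ J| and |X \ Z|. They cancel for a square minor; any other minor is zero.
        by_cases hcard : (W \ J).card = (X \ Z).card
        · rw [e2, e1, pp_union_left _ d1, pp_insert_right _ hvJ,
            ← pp_erase_left (g c) (T := X \ Z) hx, ← pp_sdiff_right (g c) (S := {v}) hJ',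
            pp_g_swap c (W \ J) {v}, pp_g_swap c {x} (X \ Z), hcard]
          rcases neg_one_pow_eq_or ℂ ((X \ Z).card) with h | h <;> simp [h] <;> ring
        · rw [e2, alt_eq_zero hcard]; ring
      rw [Finset.sum_congr rfl h1, Finset.sum_comm]
      refine Finset.sum_congr rfl fun x hx => ?_
      rw [ih, Finset.mul_sum]
      refine Finset.sum_congr rfl fun J _ => ?_
      rw [Finset.mul_sum]

theorem alt_union (φ : ℂ → ℂ → ℂ) {A W : Finset ℂ} (hAW : Disjoint A W) (X : Finset ℂ) :
    alt c φ (A ∪ W) X = ∑ Z ∈ X.powerset,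
      pp (g c) A W * pp (g c) Z (X \ Z) * alt c φ A (X \ Z) * alt c φ W Z := by
  induction A using Finset.induction_on generalizing X with
  | empty =>
    rw [Finset.sum_eq_single X]
    · simp
    · intro Z hZ hZX
      rw [alt_empty, if_neg]; · ring
      rw [Finset.sdiff_eq_empty_iff_subset]
      exact fun h => hZX (Finset.Subset.antisymm (Finset.mem_powerset.1 hZ) h)
    · simp
  | insert v A hv ih =>
    have hvW : v ∉ W := Finset.disjoint_left.1 hAW (Finset.mem_insert_self _ _)
    have hd : Disjoint A W := hAW.mono_left (Finset.subset_insert _ _)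
    have hv' : v ∉ A ∪ W := by simp [hv, hvW]
    rw [Finset.insert_union, alt_insert hv']
    have h1 : ∀ Z ∈ X.powerset, pp (g c) (insert v A) W * pp (g c) Z (X \ Z) *
        alt c φ (insert v A) (X \ Z) * alt c φ W Z = ∑ x ∈ X \ Z,
          φ v x * pp (g c) (X.erase x) {x} * pp (g c) {v} (A ∪ W) *
          (pp (g c) A W * pp (g c) Z (X.erase x \ Z) * alt c φ A (X.erase x \ Z) * alt c φ W Z) := by
      intro Z hZ
      have hZ' := Finset.mem_powerset.1 hZ
      rw [alt_insert hv, Finset.mul_sum, Finset.sum_mul]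
      refine Finset.sum_congr rfl fun x hx => ?_
      have hx' := Finset.mem_sdiff.1 hx
      have e1 : X.erase x = Z ∪ (X \ Z).erase x := by
        ext y; simp only [Finset.mem_erase, Finset.mem_union, Finset.mem_sdiff]; grind
      have e2 : X.erase x \ Z = (X \ Z).erase x := by
        ext y; simp only [Finset.mem_erase, Finset.mem_sdiff]; tauto
      have d1 : Disjoint Z ((X \ Z).erase x) :=
        Finset.disjoint_sdiff.mono_right (Finset.erase_subset _ _)
      rw [e2, e1, pp_union_left _ d1, pp_insert_left _ hv,
        ← pp_erase_right (g c) (S := Z) hx, pp_union_right (g c) hd]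
      ring
    rw [Finset.sum_congr rfl h1, sum_powerset_sdiff]
    refine Finset.sum_congr rfl fun x hx => ?_
    rw [ih hd, Finset.mul_sum]

/-- Multilinearity in the columns, this time without a Laplace expansion: the selected columns stay
in place so that `alt_shift` can move them. -/
theorem alt_add_col (φ ψ : ℂ → ℂ → ℂ) (W X : Finset ℂ) :
    alt c (fun w x => φ w x + ψ w x) W X = ∑ I ∈ X.powerset,
      alt c (fun w x => if x ∈ I then ψ w x else φ w x) W X := by
  induction W using Finset.induction_on generalizing X with
  | empty =>
    by_cases hX : X = ∅
    · subst hX; simp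
    · simp [alt_empty, hX]
  | insert v W hv ih =>
    have h1 : ∀ I ∈ X.powerset, alt c (fun w x => if x ∈ I then ψ w x else φ w x) (insert v W) X
        = ∑ x ∈ X \ I, φ v x * pp (g c) (X.erase x) {x} * pp (g c) {v} W *
            alt c (fun w x => if x ∈ I then ψ w x else φ w x) W (X.erase x) +
          ∑ x ∈ I, ψ v x * pp (g c) (X.erase x) {x} * pp (g c) {v} W *
            alt c (fun w y => if y ∈ I.erase x then ψ w y else φ w y) W (X.erase x) := by
      intro I hI
      rw [alt_insert hv, ← Finset.sum_sdiff (Finset.mem_powerset.1 hI)]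
      congr 1
      · refine Finset.sum_congr rfl fun x hx => ?_
        rw [if_neg (Finset.mem_sdiff.1 hx).2]
      · refine Finset.sum_congr rfl fun x hx => ?_
        rw [if_pos hx]
        congr 1
        refine alt_congr fun w _ y hy => ?_
        simp [Finset.ne_of_mem_erase hy]
    rw [Finset.sum_congr rfl h1, Finset.sum_add_distrib, sum_powerset_sdiff,
      sum_powerset_mem X (fun x I => ψ v x * pp (g c) (X.erase x) {x} * pp (g c) {v} W *
            alt c (fun w y => if y ∈ I then ψ w y else φ w y) W (X.erase x)),
      ← Finset.sum_add_distrib, alt_insert hv]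
    refine Finset.sum_congr rfl fun x hx => ?_
    rw [ih, ← Finset.mul_sum, ← Finset.mul_sum]
    ring

end alt

/-! ### Lagrange interpolation -/

section interpolation

/-- The sum of the residues of P / ∏ (z - x) is minus the residue at infinity. In particular it
vanishes when the degree of P is at most |X| - 2. Several rational identities of the proof are
instances. -/
theorem sum_eval_div (X : Finset ℂ) (P : Polynomial ℂ) (hP : P.degree < X.card) :
    ∑ x ∈ X, P.eval x / ∏ y ∈ X.erase x, (x - y) = P.coeff (X.card - 1) := by
  have := Lagrange.coeff_eq_sum (s := X) (v := fun x : ℂ => x) (fun _ _ _ _ h => h) hP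
  exact this.symm

theorem eval_eq_sum (X : Finset ℂ) (P : Polynomial ℂ) (hP : P.degree < X.card) (w : ℂ) :
    P.eval w = ∑ x ∈ X, P.eval x * ∏ y ∈ X.erase x, ((w - y) / (x - y)) := by
  have := Lagrange.eq_interpolate (s := X) (v := fun x : ℂ => x) (fun _ _ _ _ h => h) hP
  conv_lhs => rw [this]
  rw [Lagrange.interpolate_apply, Polynomial.eval_finsetSum]
  refine Finset.sum_congr rfl fun x _ => ?_
  rw [Polynomial.eval_mul, Polynomial.eval_C, Lagrange.basis, Polynomial.eval_prod]
  congr 1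
  refine Finset.prod_congr rfl fun y _ => ?_
  simp [Lagrange.basisDivisor, div_eq_inv_mul]

/-- The polynomial `∏_{v ∈ V} (X - v)`. -/
def nod (V : Finset ℂ) : Polynomial ℂ := ∏ v ∈ V, (Polynomial.X - Polynomial.C v)

theorem eval_nod (V : Finset ℂ) (x : ℂ) : (nod V).eval x = ∏ v ∈ V, (x - v) := by
  simp [nod, Polynomial.eval_prod]

theorem degree_nod (V : Finset ℂ) : (nod V).degree = V.card := by
  simp [nod, Polynomial.degree_prod]

theorem monic_nod (V : Finset ℂ) : (nod V).Monic :=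
  Polynomial.monic_prod_of_monic _ _ fun v _ => Polynomial.monic_X_sub_C v

theorem natDegree_nod (V : Finset ℂ) : (nod V).natDegree = V.card :=
  Polynomial.natDegree_eq_of_degree_eq_some (degree_nod V)

end interpolation

/-! ### Shifted columns; Lagrange, Cauchy and Andréief determinants -/

section alt
variable {c : ℂ} {φ ψ : ℂ → ℂ → ℂ} {W X : Finset ℂ}

/-- The matrix of values is untouched; only the Vandermonde product of the columns changes. Pairs on
the same side of I keep their difference, so just the mixed pairs contribute ratios. The hypothesis
on I keeps the moved points distinct from the unmoved ones. -/
theorem alt_shift (s : ℂ) (I : Finset ℂ) (hI : ∀ x ∈ X, ∀ y ∈ X, x ∉ I → y ∈ I → x ≠ y - s)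
    (hc : c ≠ 0) (W : Finset ℂ) :
    alt c (fun w x => φ w (if x ∈ I then x - s else x)) W X =
      pp (fun x y => g c x y / g c x (y - s)) (X.filter (· ∉ I)) (X.filter (· ∈ I)) *
      alt c φ W (X.image fun x => if x ∈ I then x - s else x) := by
  set e : ℂ → ℂ := fun x => if x ∈ I then x - s else x with he
  have hinj : Set.InjOn e X := by
    intro x hx y hy hxy
    simp only [he] at hxy
    split_ifs at hxy with h1 h2 h2
    · exact sub_left_injective hxy
    · exact absurd hxy.symm (hI y hy x hx h2 h1)
    · exact absurd hxy (hI x hx y hy h1 h2)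
    · exact hxy
  induction W using Finset.induction_on generalizing X with
  | empty =>
    by_cases hX : X = ∅
    · subst hX; simp
    · simp [alt_empty, hX]
  | insert v W hv ih =>
    rw [alt_insert hv, alt_insert hv, Finset.sum_image hinj, Finset.mul_sum]
    refine Finset.sum_congr rfl fun x hx => ?_
    have hsub : X.erase x ⊆ X := Finset.erase_subset x X
    have e1 : (X.image e).erase (e x) = (X.erase x).image e := by
      ext y
      simp only [Finset.mem_erase, Finset.mem_image]
      constructor
      · rintro ⟨h1, z, hz, rfl⟩
        exact ⟨z, ⟨fun h => h1 (h ▸ rfl), hz⟩, rfl⟩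
      · rintro ⟨z, ⟨h1, hz⟩, rfl⟩
        exact ⟨fun h => h1 (hinj hz hx h), z, hz, rfl⟩
    rw [ih (fun x hx y hy => hI x (hsub hx) y (hsub hy)) (hinj.mono (by simp)), e1]
    have e2 : pp (g c) ((X.erase x).image e) {e x} = ∏ y ∈ X.erase x, g c (e y) (e x) := by
      rw [pp_singleton_right, Finset.prod_image]
      exact hinj.mono (by simp)
    rw [e2, pp_singleton_right]
    have key : (∏ y ∈ X.erase x, g c y x) *
        pp (fun x y => g c x y / g c x (y - s)) ((X.erase x).filter (· ∉ I)) ((X.erase x).filter (· ∈ I)) =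
        pp (fun x y => g c x y / g c x (y - s)) (X.filter (· ∉ I)) (X.filter (· ∈ I)) *
          ∏ y ∈ X.erase x, g c (e y) (e x) := by
      rw [← Finset.prod_filter_mul_prod_filter_not (X.erase x) (· ∈ I) (fun y => g c y x),
        ← Finset.prod_filter_mul_prod_filter_not (X.erase x) (· ∈ I) (fun y => g c (e y) (e x))]
      by_cases hxI : x ∈ I
      · have f1 : (X.erase x).filter (· ∉ I) = X.filter (· ∉ I) := by
          ext y; simp only [Finset.mem_filter, Finset.mem_erase]; grind
        have f2 : X.filter (· ∈ I) = insert x ((X.erase x).filter (· ∈ I)) := by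
          ext y; simp only [Finset.mem_filter, Finset.mem_erase, Finset.mem_insert]; grind
        rw [f1, f2, pp_insert_right _ (by simp), pp_singleton_right]
        have g1 : ∏ y ∈ (X.erase x).filter (· ∈ I), g c (e y) (e x) =
            ∏ y ∈ (X.erase x).filter (· ∈ I), g c y x := by
          refine Finset.prod_congr rfl fun y hy => ?_
          simp [he, hxI, (Finset.mem_filter.1 hy).2, g]
        have g2 : (∏ y ∈ X.filter (· ∉ I), g c y x / g c y (x - s)) *
            ∏ y ∈ X.filter (· ∉ I), g c (e y) (e x) = ∏ y ∈ X.filter (· ∉ I), g c y x := by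
          rw [← Finset.prod_mul_distrib]
          refine Finset.prod_congr rfl fun y hy => ?_
          have hy' := Finset.mem_filter.1 hy
          simp only [he, hxI, hy'.2, if_true, if_false]
          exact div_mul_cancel₀ _ (g_ne_zero hc (hI y hy'.1 x hx hy'.2 hxI))
        rw [g1, ← g2]; ring
      · have f1 : (X.erase x).filter (· ∈ I) = X.filter (· ∈ I) := by
          ext y; simp only [Finset.mem_filter, Finset.mem_erase]; grind
        have f2 : X.filter (· ∉ I) = insert x ((X.erase x).filter (· ∉ I)) := by
          ext y; simp only [Finset.mem_filter, Finset.mem_erase, Finset.mem_insert]; grind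
        rw [f1, f2, pp_insert_left _ (by simp), pp_singleton_left]
        have g1 : ∏ y ∈ (X.erase x).filter (· ∉ I), g c (e y) (e x) =
            ∏ y ∈ (X.erase x).filter (· ∉ I), g c y x := by
          refine Finset.prod_congr rfl fun y hy => ?_
          simp [he, hxI, (Finset.mem_filter.1 hy).2]
        have g2 : (∏ y ∈ X.filter (· ∈ I), g c x y / g c x (y - s)) *
            ∏ y ∈ X.filter (· ∈ I), g c (e y) (e x) = ∏ y ∈ X.filter (· ∈ I), g c y x := by
          rw [← Finset.prod_mul_distrib]
          refine Finset.prod_congr rfl fun y hy => ?_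
          have hy' := Finset.mem_filter.1 hy
          simp only [he, hxI, hy'.2, if_true, if_false]
          rw [g_antisymm c (y - s) x, g_antisymm c y x, mul_neg,
            div_mul_cancel₀ _ (g_ne_zero hc (hI x hx y hy'.1 hxI hy'.2))]
        rw [g1, ← g2]; ring
    calc _ = φ v (e x) * ((∏ y ∈ X.erase x, g c y x) * pp (fun x y => g c x y / g c x (y - s))
            ((X.erase x).filter (· ∉ I)) ((X.erase x).filter (· ∈ I))) * pp (g c) {v} W *
            alt c φ W ((X.erase x).image e) := by ring
      _ = _ := by rw [key]; ring

/-- The alternant of the Lagrange basis. -/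
theorem alt_lagrange (hc : c ≠ 0) (h : W.card = X.card) :
    alt c (fun w x => ∏ v ∈ W.erase w, (g c x v)⁻¹) W X = 1 := by
  induction W using Finset.induction_on generalizing X with
  | empty =>
    have : X = ∅ := by simpa using h.symm
    subst this; simp
  | insert w W hw ih =>
    rw [alt_insert hw]
    have hX : ∀ x ∈ X, (∏ v ∈ (insert w W).erase w, (g c x v)⁻¹) * pp (g c) (X.erase x) {x} *
        pp (g c) {w} W * alt c (fun w' x => ∏ v ∈ (insert w W).erase w', (g c x v)⁻¹) W (X.erase x)
        = (pp (g c) {w} W * (c⁻¹) ^ W.card) *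
          ((nod W).eval x * ∏ y ∈ X.erase x, ((w - y) / (x - y))) := by
      intro x hx
      have hcard : W.card = (X.erase x).card := by
        rw [Finset.card_erase_of_mem hx, ← h, Finset.card_insert_of_notMem hw]; rfl
      -- Every remaining row contains the factor 1/g(·, w). Without it the minor is the Lagrange
      -- basis of W, to which the induction hypothesis applies.
      have h1 : alt c (fun w' x => ∏ v ∈ (insert w W).erase w', (g c x v)⁻¹) W (X.erase x)
          = ∏ y ∈ X.erase x, (g c y w)⁻¹ := by
        have := alt_mul_col (c := c) (φ := fun w' x => ∏ v ∈ W.erase w', (g c x v)⁻¹)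
          (fun x => (g c x w)⁻¹) W (X.erase x)
        rw [ih hcard, mul_one] at this
        rw [← this]
        refine alt_congr fun w' hw' y _ => ?_
        have hne : w ≠ w' := fun e => hw (e ▸ hw')
        rw [Finset.erase_insert_of_ne hne, Finset.prod_insert (by simp [hw])]
      rw [h1, Finset.erase_insert hw, eval_nod, pp_singleton_right]
      have h2 : ∏ v ∈ W, (g c x v)⁻¹ = (c⁻¹) ^ W.card * ∏ v ∈ W, (x - v) := by
        rw [← Finset.prod_const, ← Finset.prod_mul_distrib]
        refine Finset.prod_congr rfl fun v _ => ?_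
        rw [g, inv_div, div_eq_inv_mul]
      have h3 : (∏ y ∈ X.erase x, g c y x) * ∏ y ∈ X.erase x, (g c y w)⁻¹ =
          ∏ y ∈ X.erase x, ((w - y) / (x - y)) := by
        rw [← Finset.prod_mul_distrib]
        refine Finset.prod_congr rfl fun y hy => ?_
        have : x - y ≠ 0 := sub_ne_zero.2 (Finset.ne_of_mem_erase hy).symm
        have : y - x ≠ 0 := sub_ne_zero.2 (Finset.ne_of_mem_erase hy)
        rw [g, g, inv_div]; field_simp; ring
      rw [← h3, h2]; ring
    -- The sum over x is the interpolation of ∏_{v ∈ W} (z - v) at the nodes X, evaluated at z = w.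
    rw [Finset.sum_congr rfl hX, ← Finset.mul_sum, ← eval_eq_sum, eval_nod, pp_singleton_left]
    · rw [mul_assoc, ← Finset.prod_const, ← Finset.prod_mul_distrib, ← Finset.prod_mul_distrib]
      refine Finset.prod_eq_one fun v hv => ?_
      have : w - v ≠ 0 := sub_ne_zero.2 fun e => hw (e ▸ hv)
      rw [g]; field_simp
    · rw [degree_nod, ← h, Finset.card_insert_of_notMem hw]
      exact_mod_cast Nat.lt_succ_self _

/-- The Cauchy determinant: extracting g(x, W) from column x leaves the Lagrange basis of W. -/
theorem alt_g (hc : c ≠ 0) (hd : Disjoint W X) (h : W.card = X.card) :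
    alt c (fun w x => g c x w) W X = pp (g c) X W := by
  have := alt_mul_col (c := c) (φ := fun w x => ∏ v ∈ W.erase w, (g c x v)⁻¹)
          (fun x => ∏ v ∈ W, g c x v) W X
  rw [alt_lagrange hc h, mul_one] at this
  rw [pp, ← this]
  refine alt_congr fun w hw x hx => ?_
  rw [← Finset.mul_prod_erase _ _ hw, mul_assoc, ← Finset.prod_mul_distrib, Finset.prod_eq_one, mul_one]
  intro v hv
  exact mul_inv_cancel₀ (g_ne_zero hc fun e => Finset.disjoint_left.1 hd (Finset.mem_of_mem_erase hv) (e ▸ hx))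

/-- This is the expansion, along the additional copy, of a determinant in which column x occurs
twice. Expanding once more along the other copy gives a double sum that is antisymmetric in the two
rows. -/
theorem alt_repeated_col {x : ℂ} (hx : x ∈ X) (W : Finset ℂ) :
    ∑ w ∈ W, φ w x * pp (g c) (W.erase w) {w} * alt c φ (W.erase w) X = 0 := by
  have h1 : ∑ w ∈ W, φ w x * pp (g c) (W.erase w) {w} * alt c φ (W.erase w) X =
      ∑ w ∈ W, ∑ v ∈ W.erase w, φ w x * pp (g c) (W.erase w) {w} * (φ v x * pp (g c) (X.erase x) {x} *
        pp (g c) {v} ((W.erase w).erase v) * alt c φ ((W.erase w).erase v) (X.erase x)) := by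
    refine Finset.sum_congr rfl fun w _ => ?_
    rw [alt_col hx, Finset.mul_sum]
  set S := ∑ w ∈ W, φ w x * pp (g c) (W.erase w) {w} * alt c φ (W.erase w) X
  have h2 : S = -S := by
    conv_lhs => rw [h1, sum_erase_comm]
    rw [h1, ← Finset.sum_neg_distrib]
    refine Finset.sum_congr rfl fun w hw => ?_
    rw [← Finset.sum_neg_distrib]
    refine Finset.sum_congr rfl fun v hv => ?_
    have hw' : w ∈ W.erase v := by simp only [Finset.mem_erase, ne_eq] at *; grind
    rw [pp_erase_right_singleton hw', pp_erase_right_singleton hv, Finset.erase_right_comm (a := v),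
      g_antisymm c v w, pp_g_swap c _ {v}, pp_g_swap c _ {w}, Finset.card_singleton,
      Finset.card_singleton]
    ring
  have h3 : (2 : ℂ) * S = 0 := by linear_combination h2
  exact (mul_eq_zero.1 h3).resolve_left two_ne_zero

/-- The product of `g(x,y)` over the ordered pairs of distinct elements. -/
def discr (c : ℂ) (X : Finset ℂ) : ℂ := ∏ x ∈ X, ∏ y ∈ X.erase x, g c y x

theorem discr_ne_zero (hc : c ≠ 0) (X : Finset ℂ) : discr c X ≠ 0 :=
  Finset.prod_ne_zero_iff.2 fun _ _ => Finset.prod_ne_zero_iff.2 fun _ hy =>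
    g_ne_zero hc (Finset.ne_of_mem_erase hy)

theorem discr_insert {x : ℂ} (hx : x ∉ X) :
    discr c (insert x X) = pp (g c) X {x} * pp (g c) {x} X * discr c X := by
  have h : ∀ y ∈ X, ∏ z ∈ (insert x X).erase y, g c z y = g c x y * ∏ z ∈ X.erase y, g c z y := by
    intro y hy
    have hne : x ≠ y := fun e => hx (e ▸ hy)
    rw [Finset.erase_insert_of_ne hne, Finset.prod_insert (by simp [hx])]
  rw [discr, Finset.prod_insert hx, Finset.erase_insert hx, Finset.prod_congr rfl h,
    Finset.prod_mul_distrib, discr, pp_singleton_left, pp_singleton_right, mul_assoc]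

theorem prod_pp_erase (X Z : Finset ℂ) (hZ : Z ⊆ X) :
    ∏ x ∈ Z, pp (g c) (X.erase x) {x} = pp (g c) (X \ Z) Z * discr c Z := by
  have e0 : pp (g c) (X \ Z) Z = ∏ x ∈ Z, ∏ y ∈ X \ Z, g c y x := (pp_flip (g c)).symm
  rw [discr, e0, ← Finset.prod_mul_distrib]
  refine Finset.prod_congr rfl fun x hx => ?_
  have e : X.erase x = (X \ Z) ∪ Z.erase x := by
    ext y; simp only [Finset.mem_erase, Finset.mem_union, Finset.mem_sdiff]
    grind
  rw [pp_singleton_right, e, Finset.prod_union]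
  exact Finset.sdiff_disjoint.mono_right (Finset.erase_subset _ _)

/-- The Andréief (Cauchy–Binet) identity. -/
theorem alt_andreief (hc : c ≠ 0) (φ ψ : ℂ → ℂ → ℂ) (B A X : Finset ℂ) :
    alt c (fun b a => ∑ x ∈ X, φ b x * ψ a x) B A =
      ∑ Z ∈ X.powerset, (discr c Z)⁻¹ * alt c φ B Z * alt c ψ A Z := by
  induction B using Finset.induction_on generalizing A with
  | empty =>
    rw [Finset.sum_eq_single ∅]
    · by_cases hA : A = ∅
      · subst hA; simp [discr]
      · rw [alt_empty, if_neg hA, alt_eq_zero (W := A)]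
        · simp
        · simpa using hA
    · intro Z _ hZ; simp [alt_empty, hZ]
    · simp
  | insert b B hb ih =>
    rw [alt_insert hb]
    have h1 : ∀ a ∈ A, (∑ x ∈ X, φ b x * ψ a x) * pp (g c) (A.erase a) {a} * pp (g c) {b} B *
        alt c (fun b a => ∑ x ∈ X, φ b x * ψ a x) B (A.erase a) =
        ∑ x ∈ X, ∑ Z ∈ X.powerset, φ b x * pp (g c) {b} B * (discr c Z)⁻¹ * alt c φ B Z *
          (ψ a x * pp (g c) (A.erase a) {a} * alt c ψ (A.erase a) Z) := by
      intro a _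
      rw [ih, Finset.sum_mul, Finset.sum_mul, Finset.sum_mul]
      refine Finset.sum_congr rfl fun x _ => ?_
      rw [Finset.mul_sum]
      refine Finset.sum_congr rfl fun Z _ => ?_
      ring
    have h2 : ∀ Z ∈ X.powerset, (discr c Z)⁻¹ * alt c φ (insert b B) Z * alt c ψ A Z =
        ∑ x ∈ Z, φ b x * pp (g c) {b} B * (discr c (Z.erase x))⁻¹ * alt c φ B (Z.erase x) *
          ∑ a ∈ A, (ψ a x * pp (g c) (A.erase a) {a} * alt c ψ (A.erase a) (Z.erase x)) := by
      intro Z _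
      rw [alt_insert hb, Finset.mul_sum, Finset.sum_mul]
      refine Finset.sum_congr rfl fun x hx => ?_
      by_cases hcard : A.card = Z.card
      swap
      · rw [alt_eq_zero hcard, Finset.sum_eq_zero, mul_zero, mul_zero]
        intro a ha
        rw [alt_eq_zero (c := c) (φ := ψ), mul_zero]
        rw [Finset.card_erase_of_mem ha, Finset.card_erase_of_mem hx]
        have := Finset.card_pos.2 ⟨a, ha⟩; have := Finset.card_pos.2 ⟨x, hx⟩; omega
      -- The product of two alternants over Z carries the Vandermonde factor of Z twice; `discr` is
      -- that double factor up to the orientations, which the weights of the expansions account for.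
      have hd : discr c Z = pp (g c) (Z.erase x) {x} * pp (g c) {x} (Z.erase x) * discr c (Z.erase x) := by
        conv_lhs => rw [← Finset.insert_erase hx]
        exact discr_insert (Finset.notMem_erase x Z)
      have hn1 : pp (g c) (Z.erase x) {x} ≠ 0 := pp_g_ne_zero hc (by simp)
      have hn2 : discr c (Z.erase x) ≠ 0 := discr_ne_zero hc _
      rw [alt_col hx, hd, Finset.mul_sum, Finset.mul_sum]
      refine Finset.sum_congr rfl fun a ha => ?_
      have hcard' : (A.erase a).card = (Z.erase x).card := by
        rw [Finset.card_erase_of_mem ha, Finset.card_erase_of_mem hx, hcard]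
      have hn3 : (-1 : ℂ) ^ (Z.erase x).card ≠ 0 := pow_ne_zero _ (by norm_num)
      rw [pp_g_swap c {x}, pp_g_swap c {a}, hcard', Finset.card_singleton, one_mul,
        Finset.card_singleton, one_mul]
      field_simp
    rw [Finset.sum_congr rfl h1, Finset.sum_congr rfl h2,
      sum_powerset_mem X (fun x Z => φ b x * pp (g c) {b} B * (discr c Z)⁻¹ * alt c φ B Z *
          ∑ a ∈ A, (ψ a x * pp (g c) (A.erase a) {a} * alt c ψ (A.erase a) Z)), Finset.sum_comm]
    refine Finset.sum_congr rfl fun x hx => ?_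
    rw [Finset.sum_comm]
    have hsub : (X.erase x).powerset ⊆ X.powerset := Finset.powerset_mono.2 (Finset.erase_subset _ _)
    rw [← Finset.sum_subset hsub]
    · refine Finset.sum_congr rfl fun Z _ => ?_
      rw [Finset.mul_sum]
    -- Subsets that already contain x would use this column twice.
    · intro Z hZ hZ'
      have hxZ : x ∈ Z := by
        by_contra hxZ
        exact hZ' (Finset.mem_powerset.2 (Finset.subset_erase.2 ⟨Finset.mem_powerset.1 hZ, hxZ⟩))
      rw [← Finset.mul_sum, alt_repeated_col hxZ, mul_zero]

end alt

/-- No two distinct elements differ by `c`. -/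
def Gen (c : ℂ) (S : Finset ℂ) : Prop := ∀ x ∈ S, ∀ y ∈ S, x ≠ y → x - y ≠ c

theorem Gen.mono {c : ℂ} {S T : Finset ℂ} (h : Gen c T) (hST : S ⊆ T) : Gen c S :=
  fun x hx y hy => h x (hST hx) y (hST hy)

section alt
variable {c : ℂ} {φ ψ : ℂ → ℂ → ℂ} {W X : Finset ℂ}

theorem alt_g' (hc : c ≠ 0) (hd : Disjoint W X) (h : W.card = X.card) :
    alt c (g c) W X = pp (g c) W X := by
  rw [alt_transpose, alt_g hc hd.symm h.symm]

theorem alt_repeated_row {w : ℂ} (hw : w ∈ W) (X : Finset ℂ) :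
    ∑ x ∈ X, φ w x * pp (g c) (X.erase x) {x} * alt c φ W (X.erase x) = 0 := by
  rw [← alt_repeated_col (c := c) (φ := fun x w => φ w x) hw X]
  refine Finset.sum_congr rfl fun x _ => ?_
  rw [alt_transpose]

/-- The dependence expresses row v through the other rows, and each replacement produces a repeated
row. Only the coefficient at v has to be nonzero. -/
theorem alt_dependent_rows {v : ℂ} (hv : v ∈ W) (γ : ℂ → ℂ) (hγ : γ v ≠ 0)
    (h : ∀ x ∈ X, ∑ w ∈ W, γ w * φ w x = 0) : alt c φ W X = 0 := by
  refine (mul_eq_zero.1 ?_).resolve_left hγ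
  rw [alt_row hv, Finset.mul_sum]
  have h1 : ∀ x ∈ X, γ v * (φ v x * pp (g c) (X.erase x) {x} * pp (g c) {v} (W.erase v) *
      alt c φ (W.erase v) (X.erase x)) = ∑ w ∈ W.erase v, (- γ w * pp (g c) {v} (W.erase v)) *
        (φ w x * pp (g c) (X.erase x) {x} * alt c φ (W.erase v) (X.erase x)) := by
    intro x hx
    have h2 := h x hx
    rw [← Finset.add_sum_erase _ _ hv] at h2
    have h3 : γ v * φ v x = - ∑ w ∈ W.erase v, γ w * φ w x := eq_neg_of_add_eq_zero_left h2
    calc _ = (γ v * φ v x) * (pp (g c) (X.erase x) {x} * pp (g c) {v} (W.erase v) *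
      alt c φ (W.erase v) (X.erase x)) := by ring
      _ = _ := by
        rw [h3, ← Finset.sum_neg_distrib, Finset.sum_mul]
        exact Finset.sum_congr rfl fun w _ => by ring
  rw [Finset.sum_congr rfl h1, Finset.sum_comm]
  refine Finset.sum_eq_zero fun w hw => ?_
  rw [← Finset.mul_sum, alt_repeated_row hw, mul_zero]

/-- The alternant of a difference `φ(w, x) - φ(w, x - c)`. -/
theorem alt_sub_shift (hc : c ≠ 0) (hX : Gen c X) (φ : ℂ → ℂ → ℂ) (W : Finset ℂ) :
    alt c (fun w x => φ w x - φ w (x - c)) W X = ∑ I ∈ X.powerset, (-1) ^ I.card *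
      pp (f c) (X \ I) I * alt c φ W (X \ I ∪ I.image (· - c)) := by
  simp only [sub_eq_add_neg (φ _ _)]
  rw [alt_add_col]
  refine Finset.sum_congr rfl fun I hI => ?_
  have hI' := Finset.mem_powerset.1 hI
  have h1 : alt c (fun w x => if x ∈ I then - φ w (x - c) else φ w x) W X =
      alt c (fun w x => (if x ∈ I then -1 else 1) * φ w (if x ∈ I then x - c else x)) W X := by
    refine alt_congr fun w _ x _ => ?_
    split_ifs <;> ring
  have hne : ∀ x ∈ X, ∀ y ∈ X, x ∉ I → y ∈ I → x ≠ y - c := by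
    intro x hx y hy hxI hyI e
    refine hX y hy x hx (fun e' => hxI (e' ▸ hyI)) ?_
    rw [e]; ring
  rw [h1, alt_mul_col (c := c) (φ := fun w x => φ w (if x ∈ I then x - c else x))
    (fun x => if x ∈ I then -1 else 1), alt_shift c I hne hc]
  have e1 : X.filter (· ∈ I) = I := by
    ext x; simp only [Finset.mem_filter]; exact ⟨fun h => h.2, fun h => ⟨hI' h, h⟩⟩
  have e2 : X.filter (· ∉ I) = X \ I := by
    ext x; simp only [Finset.mem_filter, Finset.mem_sdiff]
  have e3 : X.image (fun x => if x ∈ I then x - c else x) = X \ I ∪ I.image (· - c) := by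
    ext y; simp only [Finset.mem_image, Finset.mem_union, Finset.mem_sdiff]
    constructor
    · rintro ⟨x, hx, rfl⟩
      by_cases hxI : x ∈ I
      · right; exact ⟨x, hxI, by simp [hxI]⟩
      · left; simp [hxI, hx]
    · rintro (⟨hy, hyI⟩ | ⟨x, hx, rfl⟩)
      · exact ⟨y, hy, by simp [hyI]⟩
      · exact ⟨x, hI' hx, by simp [hx]⟩
  have e4 : ∏ x ∈ X, (if x ∈ I then (-1 : ℂ) else 1) = (-1) ^ I.card := by
    rw [← Finset.prod_filter, e1, Finset.prod_const]
  -- The Vandermonde ratio of a mixed pair is g(x, y) / g(x, y - c) = f(x, y); this is where the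
  -- factors f(X \ I, I) of all later sums come from.
  have e5 : pp (fun x y => g c x y / g c x (y - c)) (X \ I) I = pp (f c) (X \ I) I := by
    refine pp_congr fun x hx y hy => ?_
    have hx' := Finset.mem_sdiff.1 hx
    have n1 : x - (y - c) ≠ 0 := sub_ne_zero.2 (hne x hx'.1 y (hI' hy) hx'.2 hy)
    have n2 : x - y ≠ 0 := sub_ne_zero.2 fun e => hx'.2 (e ▸ hy)
    rw [g, g, f]; field_simp; ring
  rw [e1, e2, e3, e4, e5]; ring

end alt

/-! ### The domain wall partition function -/

section dw
variable {c : ℂ}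

/-- The domain wall partition function, as a sum over partitions. -/
def dw (c : ℂ) (A Z : Finset ℂ) : ℂ :=
  ∑ α ∈ A.powerset, (-1) ^ (A \ α).card * pp (f c) Z α * pp (f c) α (A \ α)

/-- Apply `alt_sub_shift` to the Lagrange basis of A. On the right all alternants equal 1. On the
left the rows are linearly dependent: the suitably weighted basis functions add up to the constant
1, which the difference operator annihilates. -/
theorem sum_neg_one_pow_pp_f (hc : c ≠ 0) {A : Finset ℂ} (hA : Gen c A) (hne : A.Nonempty) :
    ∑ I ∈ A.powerset, (-1) ^ I.card * pp (f c) (A \ I) I = 0 := by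
  set p : ℂ → ℂ → ℂ := fun w x => ∏ v ∈ A.erase w, (g c x v)⁻¹
  have h := alt_sub_shift hc hA p A
  obtain ⟨v, hv⟩ := hne
  rw [alt_dependent_rows hv (fun w => ∏ u ∈ A.erase w, g c w u)] at h
  · rw [h]
    refine Finset.sum_congr rfl fun I hI => ?_
    rw [alt_lagrange hc, mul_one]
    have hI' := Finset.mem_powerset.1 hI
    rw [Finset.card_union_of_disjoint, Finset.card_image_of_injective _ (sub_left_injective),
      Finset.card_sdiff_add_card_eq_card hI']
    rw [Finset.disjoint_left]
    intro x hx hx'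
    obtain ⟨y, hy, rfl⟩ := Finset.mem_image.1 hx'
    have hx := Finset.mem_sdiff.1 hx
    refine hA y (hI' hy) _ hx.1 (fun e => hx.2 (e ▸ hy)) (by ring)
  · exact Finset.prod_ne_zero_iff.2 fun u hu => g_ne_zero hc (Finset.ne_of_mem_erase hu).symm
  · have key : ∀ x : ℂ, ∑ w ∈ A, (∏ u ∈ A.erase w, g c w u) * p w x = 1 := by
      intro x
      have := eval_eq_sum A 1 (by
        rw [Polynomial.degree_one]; exact_mod_cast Finset.card_pos.2 ⟨v, hv⟩) x
      rw [Polynomial.eval_one] at this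
      rw [this]
      refine Finset.sum_congr rfl fun w _ => ?_
      rw [← Finset.prod_mul_distrib, Polynomial.eval_one, one_mul]
      refine Finset.prod_congr rfl fun u hu => ?_
      have : w - u ≠ 0 := sub_ne_zero.2 (Finset.ne_of_mem_erase hu).symm
      rw [g, g]; field_simp
    intro x _
    simp only [mul_sub, Finset.sum_sub_distrib, key, sub_self]

theorem dw_empty (hc : c ≠ 0) {A : Finset ℂ} (hA : Gen c A) :
    dw c A ∅ = if A = ∅ then 1 else 0 := by
  split_ifs with h
  · subst h; simp [dw]
  · rw [dw, ← sum_neg_one_pow_pp_f hc hA (Finset.nonempty_iff_ne_empty.2 h),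
      ← sum_powerset_compl A (fun S T => (-1) ^ T.card * pp (f c) S T)]
    simp

/-- Residues of ∏ (X - a - c) over the nodes S ∪ {z + c}: the polynomial is monic of degree one less
than the number of nodes, so the residues sum to 1, and the node z + c contributes 1 / f(z, S). -/
theorem sum_g_mul_pp_f {z : ℂ} {S : Finset ℂ} (h : ∀ a ∈ S, z ≠ a ∧ a - z ≠ c) :
    ∑ a ∈ S, g c z a * pp (f c) (S.erase a) {a} * pp (f c) {z} (S.erase a) = pp (f c) {z} S - 1 := by
  have hz : z + c ∉ S := fun hm => (h _ hm).2 (by ring)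
  have hdeg : (nod (S.image (· + c))).degree < (insert (z + c) S).card := by
    rw [degree_nod, Finset.card_image_of_injective _ (add_left_injective c),
      Finset.card_insert_of_notMem hz]
    exact_mod_cast Nat.lt_succ_self _
  have hev : ∀ x, (nod (S.image (· + c))).eval x = ∏ a ∈ S, (x - (a + c)) := by
    intro x
    rw [eval_nod, Finset.prod_image fun _ _ _ _ e => add_left_injective c e]
  have h1 := sum_eval_div _ _ hdeg
  have hco : (nod (S.image (· + c))).coeff ((insert (z + c) S).card - 1) = 1 := by
    have : (insert (z + c) S).card - 1 = (nod (S.image (· + c))).natDegree := by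
      rw [natDegree_nod, Finset.card_image_of_injective _ (add_left_injective c),
        Finset.card_insert_of_notMem hz]; rfl
    rw [this]; exact monic_nod _
  rw [hco, Finset.sum_insert hz, Finset.erase_insert hz, hev] at h1
  have hf : ∀ a ∈ S, f c z a ≠ 0 := by
    intro a ha
    rw [f]
    refine div_ne_zero (fun e => (h a ha).2 ?_) (sub_ne_zero.2 (h a ha).1)
    linear_combination -e
  have hF : pp (f c) {z} S ≠ 0 := pp_ne_zero (by simpa using hf)
  have t1 : (∏ a ∈ S, (z + c - (a + c))) / ∏ y ∈ S, (z + c - y) = (pp (f c) {z} S)⁻¹ := by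
    rw [← Finset.prod_div_distrib, pp_singleton_left, ← Finset.prod_inv_distrib]
    refine Finset.prod_congr rfl fun a _ => ?_
    rw [f, inv_div]; congr 1 <;> ring
  have t2 : ∀ a ∈ S, (nod (S.image (· + c))).eval a / ∏ y ∈ (insert (z + c) S).erase a, (a - y) =
      (pp (f c) {z} S)⁻¹ * (g c z a * pp (f c) (S.erase a) {a} * pp (f c) {z} (S.erase a)) := by
    intro a ha
    have hne : z + c ≠ a := fun e => hz (e ▸ ha)
    rw [hev, Finset.erase_insert_of_ne hne, Finset.prod_insert (by simp [hz]),
      ← Finset.mul_prod_erase _ _ ha, ← pp_erase_right (f c) ha, pp_pair]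
    have hF' : pp (f c) {z} (S.erase a) ≠ 0 := by
      refine pp_ne_zero fun x hx y hy => ?_
      rw [Finset.mem_singleton.1 hx]; exact hf y (Finset.mem_of_mem_erase hy)
    have e1 : pp (f c) (S.erase a) {a} = (∏ y ∈ S.erase a, (a - (y + c))) / ∏ y ∈ S.erase a, (a - y) := by
      rw [← Finset.prod_div_distrib, pp_singleton_right]
      refine Finset.prod_congr rfl fun y hy => ?_
      have : a - y ≠ 0 := sub_ne_zero.2 (Finset.ne_of_mem_erase hy).symm
      have : y - a ≠ 0 := sub_ne_zero.2 (Finset.ne_of_mem_erase hy)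
      rw [f]; field_simp; ring
    have n1 : ∏ y ∈ S.erase a, (a - y) ≠ 0 :=
      Finset.prod_ne_zero_iff.2 fun y hy => sub_ne_zero.2 (Finset.ne_of_mem_erase hy).symm
    have n2 := sub_ne_zero.2 (h a ha).1
    have n3 : z - a + c ≠ 0 := fun e => (h a ha).2 (by linear_combination -e)
    have n4 : a - (z + c) ≠ 0 := fun e => (h a ha).2 (by linear_combination e)
    rw [e1, f, g]
    field_simp
    ring
  rw [t1, Finset.sum_congr rfl t2, ← Finset.mul_sum] at h1
  field_simp at h1
  linear_combination h1

/-- The summand of α acquires the factor f(z, α). By `sum_g_mul_pp_f` for A \ α, it is f(z, A) minus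
f(z, α) times a sum over a in A \ α; exchanging the sums over α and a gives the recursion. No
relation between the cardinalities is needed. -/
theorem dw_insert {z : ℂ} {A Z : Finset ℂ} (hz : z ∉ Z) (h : ∀ a ∈ A, z ≠ a ∧ a - z ≠ c) :
    dw c A (insert z Z) = pp (f c) {z} A * dw c A Z +
      ∑ a ∈ A, g c z a * pp (f c) (A.erase a) {a} * pp (f c) {z} (A.erase a) * dw c (A.erase a) Z := by
  have h1 : ∀ a ∈ A, g c z a * pp (f c) (A.erase a) {a} * pp (f c) {z} (A.erase a) * dw c (A.erase a) Z
      = ∑ α ∈ (A.erase a).powerset, g c z a * pp (f c) (A.erase a) {a} * pp (f c) {z} (A.erase a) *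
        ((-1) ^ (A.erase a \ α).card * pp (f c) Z α * pp (f c) α (A.erase a \ α)) := by
    intro a _; rw [dw, Finset.mul_sum]
  rw [Finset.sum_congr rfl h1, ← sum_powerset_sdiff, dw, dw, Finset.mul_sum, ← Finset.sum_add_distrib]
  refine Finset.sum_congr rfl fun α hα => ?_
  have hα' := Finset.mem_powerset.1 hα
  have h2 : ∀ a ∈ A \ α, g c z a * pp (f c) (A.erase a) {a} * pp (f c) {z} (A.erase a) *
        ((-1) ^ (A.erase a \ α).card * pp (f c) Z α * pp (f c) α (A.erase a \ α)) =
      (- (-1) ^ (A \ α).card * pp (f c) Z α * pp (f c) {z} α * pp (f c) α (A \ α)) *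
        (g c z a * pp (f c) ((A \ α).erase a) {a} * pp (f c) {z} ((A \ α).erase a)) := by
    intro a ha
    have ha' := Finset.mem_sdiff.1 ha
    have e1 : A.erase a \ α = (A \ α).erase a := by
      ext y; simp only [Finset.mem_erase, Finset.mem_sdiff]; tauto
    have e2 : A.erase a = α ∪ (A \ α).erase a := by
      ext y; simp only [Finset.mem_erase, Finset.mem_union, Finset.mem_sdiff]; grind
    have hd : Disjoint α ((A \ α).erase a) :=
      Finset.disjoint_sdiff.mono_right (Finset.erase_subset _ _)
    rw [e1, e2, pp_union_left _ hd, pp_union_right _ hd, ← pp_erase_right (f c) (S := α) ha,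
      ← Finset.card_erase_add_one ha, pow_succ]
    ring
  rw [Finset.sum_congr rfl h2, ← Finset.mul_sum,
    sum_g_mul_pp_f fun a ha => h a (Finset.mem_sdiff.1 ha).1, pp_insert_left _ hz,
    ← pp_sdiff_right (f c) (S := {z}) hα']
  ring

/-- The recursion lowers |Z| by one and |A| by at most one, so it ends at Z empty and A nonempty,
where `dw_empty` gives zero. -/
theorem dw_eq_zero (hc : c ≠ 0) {A Z : Finset ℂ} (hA : Gen c A) (h : ∀ z ∈ Z, ∀ a ∈ A, z ≠ a ∧ a - z ≠ c)
    (hcard : Z.card < A.card) : dw c A Z = 0 := by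
  induction Z using Finset.induction_on generalizing A with
  | empty => rw [dw_empty hc hA, if_neg]; rintro rfl; simp at hcard
  | insert z Z hz ih =>
    rw [Finset.card_insert_of_notMem hz] at hcard
    have h' : ∀ w ∈ Z, ∀ a ∈ A, w ≠ a ∧ a - w ≠ c := fun w hw => h w (Finset.mem_insert_of_mem hw)
    rw [dw_insert hz (h z (Finset.mem_insert_self _ _)), ih hA h' (by omega), mul_zero, zero_add]
    refine Finset.sum_eq_zero fun a ha => ?_
    rw [ih (hA.mono (Finset.erase_subset _ _)) (fun w hw b hb => h' w hw b (Finset.mem_of_mem_erase hb)),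
      mul_zero]
    rw [Finset.card_erase_of_mem ha]; omega

theorem dw_rec (hc : c ≠ 0) {z : ℂ} {A Z : Finset ℂ} (hz : z ∉ Z) (hA : Gen c A)
    (h : ∀ w ∈ insert z Z, ∀ a ∈ A, w ≠ a ∧ a - w ≠ c) (hcard : A.card = Z.card + 1) :
    dw c A (insert z Z) = ∑ a ∈ A,
      g c z a * pp (f c) (A.erase a) {a} * pp (f c) {z} (A.erase a) * dw c (A.erase a) Z := by
  rw [dw_insert hz (h z (Finset.mem_insert_self _ _)),
    dw_eq_zero hc hA (fun w hw => h w (Finset.mem_insert_of_mem hw)) (by omega), mul_zero, zero_add]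

/-- As functions of Z₁ both sides satisfy the recursion `dw_insert`. For empty Z₁ only R = A
survives. This performs the sum over the partitions of u^C. -/
theorem dw_convolution (hc : c ≠ 0) {A : Finset ℂ} (hA : Gen c A) {Z₀ Z₁ : Finset ℂ} (hZ : Disjoint Z₀ Z₁)
    (h : ∀ z ∈ Z₁, ∀ a ∈ A, z ≠ a ∧ a - z ≠ c) :
    ∑ R ∈ A.powerset, pp (f c) R (A \ R) * pp (f c) Z₁ R * dw c R Z₀ * dw c (A \ R) Z₁ =
      dw c A (Z₀ ∪ Z₁) := by
  induction Z₁ using Finset.induction_on generalizing A with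
  | empty =>
    rw [Finset.sum_eq_single A]
    · simp [dw_empty hc (hA.mono (Finset.empty_subset A))]
    · intro R hR hRA
      rw [dw_empty hc (hA.mono Finset.sdiff_subset), if_neg, mul_zero]
      rw [Finset.sdiff_eq_empty_iff_subset]
      exact fun h => hRA (Finset.Subset.antisymm (Finset.mem_powerset.1 hR) h)
    · simp
  | insert z Z₁ hz ih =>
    have hz₀ : z ∉ Z₀ := Finset.disjoint_right.1 hZ (Finset.mem_insert_self _ _)
    have hZ' : Disjoint Z₀ Z₁ := hZ.mono_right (Finset.subset_insert _ _)
    have h' : ∀ w ∈ Z₁, ∀ a ∈ A, w ≠ a ∧ a - w ≠ c := fun w hw => h w (Finset.mem_insert_of_mem hw)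
    have hzA := h z (Finset.mem_insert_self _ _)
    have h1 : ∀ R ∈ A.powerset, pp (f c) R (A \ R) * pp (f c) (insert z Z₁) R * dw c R Z₀ *
        dw c (A \ R) (insert z Z₁) = pp (f c) {z} A *
          (pp (f c) R (A \ R) * pp (f c) Z₁ R * dw c R Z₀ * dw c (A \ R) Z₁) +
        ∑ a ∈ A \ R, g c z a * pp (f c) (A.erase a) {a} * pp (f c) {z} (A.erase a) *
          (pp (f c) R (A.erase a \ R) * pp (f c) Z₁ R * dw c R Z₀ * dw c (A.erase a \ R) Z₁) := by
      intro R hR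
      have hR' := Finset.mem_powerset.1 hR
      rw [dw_insert hz fun a ha => hzA a (Finset.mem_sdiff.1 ha).1, pp_insert_left _ hz, mul_add,
        Finset.mul_sum, ← pp_sdiff_right (f c) (S := {z}) hR']
      congr 1
      · ring
      · refine Finset.sum_congr rfl fun a ha => ?_
        have ha' := Finset.mem_sdiff.1 ha
        have e1 : A.erase a \ R = (A \ R).erase a := by
          ext y; simp only [Finset.mem_erase, Finset.mem_sdiff]; tauto
        have e2 : A.erase a = R ∪ (A \ R).erase a := by
          ext y; simp only [Finset.mem_erase, Finset.mem_union, Finset.mem_sdiff]; grind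
        have hd : Disjoint R ((A \ R).erase a) :=
          Finset.disjoint_sdiff.mono_right (Finset.erase_subset _ _)
        rw [e1, e2, pp_union_left _ hd, pp_union_right _ hd, ← pp_erase_right (f c) (S := R) ha]
        ring
    rw [Finset.sum_congr rfl h1, Finset.sum_add_distrib, ← Finset.mul_sum, ih hA hZ' h',
      sum_powerset_sdiff, Finset.union_insert, dw_insert (by simp [hz, hz₀]) hzA]
    congr 1
    refine Finset.sum_congr rfl fun a _ => ?_
    rw [← Finset.mul_sum, ih (hA.mono (Finset.erase_subset _ _)) hZ'
      fun w hw b hb => h' w hw b (Finset.mem_of_mem_erase hb)]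

/-- Izergin's determinant. Since t(z, a) = g(z, a) - g(z, a - c), `alt_sub_shift` in the variables A
gives a sum of Cauchy determinants at the points (A \ β) ∪ (β - c). The factors h(Z, β) and g(Z, β -
c) are inverse to each other, and what is left is the defining sum of `dw`. -/
theorem dw_eq_alt (hc : c ≠ 0) {A Z : Finset ℂ} (hA : Gen c A) (hZA : ∀ z ∈ Z, ∀ a ∈ A, z ≠ a ∧ a - z ≠ c)
    (hcard : A.card = Z.card) :
    dw c A Z = alt c (fun a z => t c z a * pp (h c) {z} A) A Z := by
  have e0 : ∀ z ∈ Z, ∀ a ∈ A, t c z a = g c z a - g c z (a - c) := by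
    intro z hz a ha
    have n2 := sub_ne_zero.2 (hZA z hz a ha).1
    have n3 : z - a + c ≠ 0 := fun e => (hZA z hz a ha).2 (by linear_combination -e)
    have n4 : z - (a - c) ≠ 0 := fun e => (hZA z hz a ha).2 (by linear_combination -e)
    rw [t, g, g]; field_simp; ring
  have e1 : alt c (fun a z => t c z a * pp (h c) {z} A) A Z =
      pp (h c) Z A * alt c (fun z a => g c z a - g c z (a - c)) Z A := by
    rw [alt_transpose c (fun z a => g c z a - g c z (a - c)), pp]
    simp only [pp_singleton_left]
    rw [← alt_mul_col]
    exact alt_congr fun a ha z hz => by rw [e0 z hz a ha]; ring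
  rw [e1, alt_sub_shift hc hA, Finset.mul_sum, dw,
    sum_powerset_compl A (fun α β => (-1) ^ β.card * pp (f c) Z α * pp (f c) α β)]
  refine Finset.sum_congr rfl fun β hβ => ?_
  have hβ' := Finset.mem_powerset.1 hβ
  have hd : Disjoint (A \ β) (β.image (· - c)) := by
    rw [Finset.disjoint_left]
    intro x hx hx'
    obtain ⟨y, hy, rfl⟩ := Finset.mem_image.1 hx'
    have hx := Finset.mem_sdiff.1 hx
    refine hA y (hβ' hy) _ hx.1 (fun e => hx.2 (e ▸ hy)) (by ring)
  have hdZ : Disjoint Z (A \ β ∪ β.image (· - c)) := by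
    rw [Finset.disjoint_left]
    intro z hz hz'
    rcases Finset.mem_union.1 hz' with h1 | h1
    · exact (hZA z hz z (Finset.mem_sdiff.1 h1).1).1 rfl
    · obtain ⟨y, hy, rfl⟩ := Finset.mem_image.1 h1
      exact (hZA _ hz y (hβ' hy)).2 (by ring)
  have hcard' : Z.card = (A \ β ∪ β.image (· - c)).card := by
    rw [Finset.card_union_of_disjoint hd, Finset.card_image_of_injective _ (sub_left_injective),
      Finset.card_sdiff_add_card_eq_card hβ', hcard]
  rw [alt_g' hc hdZ hcard', pp_union_right _ hd, pp_f_eq hc Z, ← pp_sdiff_right (h c) (S := Z) hβ']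
  have e2 : pp (h c) Z β * pp (g c) Z (β.image (· - c)) = 1 := by
    have : pp (g c) Z (β.image (· - c)) = pp (fun z b => g c z (b - c)) Z β := by
      rw [pp, pp]
      refine Finset.prod_congr rfl fun z _ => ?_
      rw [Finset.prod_image fun _ _ _ _ e => sub_left_injective e]
    rw [this, ← pp_mul]
    refine Finset.prod_eq_one fun z hz => Finset.prod_eq_one fun b hb => ?_
    have n3 : z - b + c ≠ 0 := fun e => (hZA z hz b (hβ' hb)).2 (by linear_combination -e)
    have n4 : z - (b - c) ≠ 0 := fun e => (hZA z hz b (hβ' hb)).2 (by linear_combination -e)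
    change h c z b * g c z (b - c) = 1
    rw [h, g]; field_simp; ring
  linear_combination (-(-1) ^ β.card * pp (g c) Z (A \ β) * pp (h c) Z (A \ β) *
    pp (f c) (A \ β) β) * e2

end dw

/-! ### The highest coefficient and its dual representation -/

section powersetCard
variable {M : Type*} [AddCommMonoid M]

theorem sum_powersetCard_compl {X : Finset ℂ} {m n : ℕ} (h : m + n = X.card)
    (F : Finset ℂ → Finset ℂ → M) :
    ∑ Z ∈ X.powersetCard m, F Z (X \ Z) = ∑ Z ∈ X.powersetCard n, F (X \ Z) Z := by
  refine Finset.sum_nbij' (fun Z => X \ Z) (fun Z => X \ Z) ?_ ?_ ?_ ?_ ?_ <;> intro Z hZ <;>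
    rw [Finset.mem_powersetCard] at hZ
  · rw [Finset.mem_powersetCard]
    refine ⟨Finset.sdiff_subset, ?_⟩
    rw [Finset.card_sdiff_of_subset hZ.1]; omega
  · rw [Finset.mem_powersetCard]
    refine ⟨Finset.sdiff_subset, ?_⟩
    rw [Finset.card_sdiff_of_subset hZ.1]; omega
  · exact Finset.sdiff_sdiff_eq_self hZ.1
  · exact Finset.sdiff_sdiff_eq_self hZ.1
  · rw [Finset.sdiff_sdiff_eq_self hZ.1]

theorem sum_powerset_eq_powersetCard {X : Finset ℂ} {n : ℕ} {F : Finset ℂ → M}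
    (h : ∀ Z ⊆ X, Z.card ≠ n → F Z = 0) : ∑ Z ∈ X.powerset, F Z = ∑ Z ∈ X.powersetCard n, F Z := by
  symm
  refine Finset.sum_subset (fun Z hZ => ?_) fun Z hZ hZ' => ?_
  · exact Finset.mem_powerset.2 (Finset.mem_powersetCard.1 hZ).1
  · rw [Finset.mem_powersetCard] at hZ'
    exact h Z (Finset.mem_powerset.1 hZ) fun e => hZ' ⟨Finset.mem_powerset.1 hZ, e⟩

end powersetCard

variable {c : ℂ}

/-- The residues of ∏_V (z - v) / ∏_N (z - x), which decays like z^{-2} or faster at infinity. -/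
theorem sum_pp_g_erase_eq_zero {N V : Finset ℂ} (h : V.card + 2 ≤ N.card) :
    ∑ x ∈ N, pp (g c) (N.erase x) {x} * ∏ v ∈ V, (g c x v)⁻¹ = 0 := by
  have hdeg : (nod V).degree < N.card := by
    rw [degree_nod]; exact_mod_cast (by omega : V.card < N.card)
  have h1 := sum_eval_div N (nod V) hdeg
  rw [Polynomial.coeff_eq_zero_of_natDegree_lt (by rw [natDegree_nod]; omega)] at h1
  have h2 : ∀ x ∈ N, pp (g c) (N.erase x) {x} * ∏ v ∈ V, (g c x v)⁻¹ =
      ((-c) ^ (N.card - 1) * (c⁻¹) ^ V.card) * ((nod V).eval x / ∏ y ∈ N.erase x, (x - y)) := by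
    intro x hx
    have e1 : ∏ v ∈ V, (g c x v)⁻¹ = (c⁻¹) ^ V.card * ∏ v ∈ V, (x - v) := by
      rw [← Finset.prod_const, ← Finset.prod_mul_distrib]
      refine Finset.prod_congr rfl fun v _ => ?_
      rw [g, inv_div, div_eq_inv_mul]
    have e2 : pp (g c) (N.erase x) {x} = (-c) ^ (N.card - 1) / ∏ y ∈ N.erase x, (x - y) := by
      rw [pp_singleton_right, ← Finset.card_erase_of_mem hx, ← Finset.prod_const, ← Finset.prod_div_distrib]
      refine Finset.prod_congr rfl fun y _ => ?_
      rw [g, ← neg_sub x y, div_neg, neg_div]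
    rw [e1, e2, eval_nod]; ring
  rw [Finset.sum_congr rfl h2, ← Finset.mul_sum, h1, mul_zero]

/-- The residues at X, expressed through those at the two additional simple poles q and r. -/
theorem sum_pp_g_erase_mul_g {X V : Finset ℂ} {p q r : ℂ} (hp : p ∈ V) (h : V.card = X.card)
    (hq : q ∉ X) (hr : r ∉ X) (hqr : q ≠ r) :
    ∑ x ∈ X, pp (g c) (X.erase x) {x} * (∏ v ∈ V.erase p, (g c x v)⁻¹) * g c x q * g c x r =
      - (g c r q * pp (g c) X {q} * ∏ v ∈ V.erase p, (g c q v)⁻¹)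
      - (g c q r * pp (g c) X {r} * ∏ v ∈ V.erase p, (g c r v)⁻¹) := by
  have hq' : q ∉ insert r X := by simp [hq, hqr]
  have hcard : (V.erase p).card + 2 ≤ (insert q (insert r X)).card := by
    rw [Finset.card_insert_of_notMem hq', Finset.card_insert_of_notMem hr, Finset.card_erase_of_mem hp, h]
    omega
  have h1 := sum_pp_g_erase_eq_zero (c := c) hcard
  rw [Finset.sum_insert hq', Finset.sum_insert hr, Finset.erase_insert hq', pp_insert_left _ hr,
    Finset.erase_insert_of_ne hqr, Finset.erase_insert hr, pp_insert_left _ hq, pp_pair, pp_pair] at h1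
  have h2 : ∀ x ∈ X, pp (g c) ((insert q (insert r X)).erase x) {x} * ∏ v ∈ V.erase p, (g c x v)⁻¹ =
      pp (g c) (X.erase x) {x} * (∏ v ∈ V.erase p, (g c x v)⁻¹) * g c x q * g c x r := by
    intro x hx
    have n1 : q ≠ x := fun e => hq (e ▸ hx)
    have n2 : r ≠ x := fun e => hr (e ▸ hx)
    rw [Finset.erase_insert_of_ne n1, Finset.erase_insert_of_ne n2, pp_insert_left _ (by simp [hq, hqr]),
      pp_insert_left _ (by simp [hr]), pp_pair, pp_pair, g_antisymm c q x, g_antisymm c r x]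
    ring
  rw [Finset.sum_congr rfl h2] at h1
  linear_combination h1

/-- The highest coefficient, as a sum over partitions of `x ∪ s`. -/
def zf (c : ℂ) (t x s y : Finset ℂ) : ℂ :=
  ∑ η ∈ (x ∪ s).powersetCard y.card,
    pp (g c) η ((x ∪ s) \ η) * pp (h c) η x * pp (g c) η y * dw c t ((x ∪ s) \ η)

/-- Since 1/h(z, a) = g(z + c, a), this is a Cauchy determinant with all columns moved by c, which
leaves the Vandermonde product unchanged. -/
theorem alt_inv_h (hc : c ≠ 0) {A Z : Finset ℂ} (hd : ∀ z ∈ Z, ∀ a ∈ A, z - a + c ≠ 0)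
    (hcard : A.card = Z.card) : alt c (fun a z => (h c z a)⁻¹) A Z = (pp (h c) Z A)⁻¹ := by
  have h1 := alt_shift (c := c) (φ := fun a z => g c z a) (X := Z) (-c) Z
    (fun x hx y _ hx' => absurd hx hx') hc A
  have e0 : Z.filter (· ∉ Z) = ∅ := Finset.filter_false_of_mem fun x hx => by simp [hx]
  have e1 : Z.image (fun x => if x ∈ Z then x - -c else x) = Z.image (· + c) :=
    Finset.image_congr fun x hx => by simp [Finset.mem_coe.1 hx]
  rw [e0, pp_empty_left, one_mul, e1, alt_g hc] at h1
  · have e2 : alt c (fun a z => (h c z a)⁻¹) A Z =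
        alt c (fun w x => g c (if x ∈ Z then x - -c else x) w) A Z := by
      refine alt_congr fun a _ z hz => ?_
      simp only [hz, if_true, h, g, inv_div]
      congr 1; ring
    rw [e2, h1, ← pp_inv, pp, Finset.prod_image fun _ _ _ _ e => add_left_injective c e, pp]
    refine Finset.prod_congr rfl fun z _ => Finset.prod_congr rfl fun a _ => ?_
    rw [h, g, inv_div]; congr 1; ring
  · rw [Finset.disjoint_right]
    intro x hx hxA
    obtain ⟨z, hz, rfl⟩ := Finset.mem_image.1 hx
    exact hd z hz _ hxA (by ring)
  · rw [Finset.card_image_of_injective _ (add_left_injective c), hcard]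

/-- The sum over partitions of `(B - c) ∪ W` dual to `zf`. -/
def zfDual (c : ℂ) (B A Y W : Finset ℂ) : ℂ :=
  ∑ ζ ∈ (B.image (· - c) ∪ W).powersetCard Y.card,
    pp (g c) ζ ((B.image (· - c) ∪ W) \ ζ) * (pp (g c) ζ B)⁻¹ * pp (g c) ζ Y *
      dw c A ((B.image (· - c) ∪ W) \ ζ) * (pp (f c) ((B.image (· - c) ∪ W) \ ζ) A)⁻¹

/-- In terms of the complement Θ of η, the summand contains dw(B, Θ), an alternant over B × Θ, and
1/h(Θ, A), an alternant over A × Θ. The sum over Θ is therefore a Cauchy–Binet sum. -/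
theorem zf_eq_alt (hc : c ≠ 0) {B A Y W : Finset ℂ} (hn : A.card = B.card) (hm : W.card = Y.card)
    (hAY : Disjoint A Y) (hX : ∀ x ∈ A ∪ Y, ∀ b ∈ B, x ≠ b ∧ b - x ≠ c)
    (hXW : Disjoint (A ∪ Y) W)
    (hXA : ∀ x ∈ A ∪ Y, ∀ a ∈ A, x - a + c ≠ 0) (hB : Gen c B) :
    zf c B A Y W = pp (h c) (A ∪ Y) A * pp (g c) (A ∪ Y) W *
      alt c (fun b a => ∑ x ∈ A ∪ Y, pp (g c) ((A ∪ Y).erase x) {x} * (pp (g c) {x} W)⁻¹ *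
        (t c x b * pp (h c) {x} B) * (h c x a)⁻¹) B A := by
  set X := A ∪ Y with hXdef
  have hXcard : W.card + B.card = X.card := by
    rw [hXdef, Finset.card_union_of_disjoint hAY, hm, hn, add_comm]
  rw [alt_andreief hc (fun b x => pp (g c) (X.erase x) {x} * (pp (g c) {x} W)⁻¹ *
        (t c x b * pp (h c) {x} B)) (fun a x => (h c x a)⁻¹),
    sum_powerset_eq_powersetCard (n := B.card), zf,
    sum_powersetCard_compl (n := B.card) (by rw [← hXcard]) (fun η Θ =>
      pp (g c) η Θ * pp (h c) η A * pp (g c) η W * dw c B Θ), Finset.mul_sum]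
  · refine Finset.sum_congr rfl fun Θ hΘ => ?_
    obtain ⟨hΘ, hcard⟩ := Finset.mem_powersetCard.1 hΘ
    rw [alt_inv_h hc (fun z hz => hXA z (hΘ hz)) (hn.trans hcard.symm),
      dw_eq_alt hc hB (fun z hz => hX z (hΘ hz)) hcard.symm]
    rw [alt_mul_col (c := c) (φ := fun b x => t c x b * pp (h c) {x} B)
      (fun x => pp (g c) (X.erase x) {x} * (pp (g c) {x} W)⁻¹), Finset.prod_mul_distrib,
      prod_pp_erase X Θ hΘ, ← pp_sdiff_left (h c) (T := A) hΘ, ← pp_sdiff_left (g c) (T := W) hΘ]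
    have e1 : ∏ x ∈ Θ, (pp (g c) {x} W)⁻¹ = (pp (g c) Θ W)⁻¹ := by
      simp only [pp_singleton_left]; rw [Finset.prod_inv_distrib, pp]
    rw [e1]
    have n1 : pp (g c) Θ W ≠ 0 := pp_g_ne_zero hc (hXW.mono_left hΘ)
    have n2 : pp (h c) Θ A ≠ 0 := pp_ne_zero fun z hz a ha => div_ne_zero (hXA z (hΘ hz) a ha) hc
    have n3 := discr_ne_zero hc Θ
    rw [← hXdef]
    field_simp
  · intro Z _ hZ
    rw [alt_eq_zero (W := B) hZ.symm]; ring

/-- As in `zf_eq_alt`, with the Cauchy determinant g(Θ, B) in place of 1/h(Θ, A). -/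
theorem zfDual_eq_alt (hc : c ≠ 0) {B A Y W X : Finset ℂ} (hXdef : B.image (· - c) ∪ W = X)
    (hXcard : Y.card + A.card = X.card) (hn : A.card = B.card) (hX : ∀ x ∈ X, ∀ a ∈ A, x ≠ a ∧ a - x ≠ c)
    (hXY : Disjoint X Y) (hXB : Disjoint X B) (hA : Gen c A) :
    pp (g c) X B * zfDual c B A Y W = pp (g c) X Y *
      alt c (fun a b => ∑ x ∈ X, pp (g c) (X.erase x) {x} * (pp (g c) {x} Y)⁻¹ *
        (t c x a * (pp (g c) {x} A)⁻¹) * g c x b) A B := by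
  rw [alt_andreief hc (fun a x => pp (g c) (X.erase x) {x} * (pp (g c) {x} Y)⁻¹ *
        (t c x a * (pp (g c) {x} A)⁻¹)) (fun b x => g c x b),
    sum_powerset_eq_powersetCard (n := A.card), zfDual, hXdef,
    sum_powersetCard_compl (n := A.card) (by rw [← hXcard]) (fun η Θ =>
      pp (g c) η Θ * (pp (g c) η B)⁻¹ * pp (g c) η Y * dw c A Θ * (pp (f c) Θ A)⁻¹),
    Finset.mul_sum, Finset.mul_sum]
  · refine Finset.sum_congr rfl fun Θ hΘ => ?_
    obtain ⟨hΘ, hcard⟩ := Finset.mem_powersetCard.1 hΘ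
    rw [alt_g hc (hXB.mono_left hΘ).symm (hn.symm.trans hcard.symm),
      dw_eq_alt hc hA (fun z hz => hX z (hΘ hz)) hcard.symm]
    have n4 : ∀ z ∈ Θ, pp (h c) {z} A ≠ 0 := by
      intro z hz
      refine pp_ne_zero fun z' hz' a ha => div_ne_zero (fun e => ?_) hc
      rw [Finset.mem_singleton.1 hz'] at e
      exact (hX z (hΘ hz) a ha).2 (by linear_combination -e)
    have a1 : alt c (fun a x => t c x a * pp (h c) {x} A) A Θ =
        (∏ x ∈ Θ, pp (h c) {x} A) * alt c (fun a x => t c x a) A Θ := by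
      rw [← alt_mul_col]; exact alt_congr fun a _ x _ => mul_comm _ _
    have a2 : alt c (fun a x => pp (g c) (X.erase x) {x} * (pp (g c) {x} Y)⁻¹ *
        (t c x a * (pp (g c) {x} A)⁻¹)) A Θ = (∏ x ∈ Θ, pp (g c) (X.erase x) {x} * (pp (g c) {x} Y)⁻¹ *
          (pp (g c) {x} A)⁻¹) * alt c (fun a x => t c x a) A Θ := by
      rw [← alt_mul_col]; exact alt_congr fun a _ x _ => by ring
    rw [a1, a2,
      Finset.prod_mul_distrib, Finset.prod_mul_distrib,
      prod_pp_erase X Θ hΘ, ← pp_sdiff_left (g c) (T := B) hΘ, ← pp_sdiff_left (g c) (T := Y) hΘ,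
      pp_f_eq hc]
    have e1 : ∏ x ∈ Θ, (pp (g c) {x} Y)⁻¹ = (pp (g c) Θ Y)⁻¹ := by
      simp only [pp_singleton_left]; rw [Finset.prod_inv_distrib, pp]
    have e2 : ∏ x ∈ Θ, (pp (g c) {x} A)⁻¹ = (pp (g c) Θ A)⁻¹ := by
      simp only [pp_singleton_left]; rw [Finset.prod_inv_distrib, pp]
    have e3 : ∏ x ∈ Θ, pp (h c) {x} A = pp (h c) Θ A := by
      simp only [pp_singleton_left]; rw [pp]
    rw [e1, e2, e3]
    have n1 : pp (g c) Θ Y ≠ 0 := pp_g_ne_zero hc (hXY.mono_left hΘ)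
    have n2 : pp (h c) Θ A ≠ 0 := e3 ▸ Finset.prod_ne_zero_iff.2 n4
    have n3 := discr_ne_zero hc Θ
    have n5 : pp (g c) (X \ Θ) B ≠ 0 := pp_g_ne_zero hc (hXB.mono_left Finset.sdiff_subset)
    have n6 : pp (g c) Θ A ≠ 0 := pp_ne_zero fun x hx a ha => g_ne_zero hc (hX x (hΘ hx) a ha).1
    field_simp
  · intro Z _ hZ
    rw [alt_eq_zero (W := A) hZ.symm]; ring

theorem pp_image_sub_left (k : ℂ → ℂ → ℂ) (S T : Finset ℂ) :
    pp k (S.image (· - c)) T = pp (fun x y => k (x - c) y) S T := by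
  rw [pp, pp, Finset.prod_image fun _ _ _ _ e => sub_left_injective e]

/-- The two representations of the highest coefficient agree. -/
theorem zf_eq_zfDual (hc : c ≠ 0) {B A Y W : Finset ℂ} (hn : A.card = B.card) (hm : W.card = Y.card)
    (hAB : Disjoint A B) (hAY : Disjoint A Y) (hAW : Disjoint A W) (hBY : Disjoint B Y)
    (hBW : Disjoint B W) (hYW : Disjoint Y W) (hG : Gen c (A ∪ B ∪ (Y ∪ W))) :
    zf c B A Y W = (-1) ^ (B.card + W.card) * pp (f c) W A * pp (f c) Y B * zfDual c B A Y W := by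
  obtain ⟨X, hXdef⟩ : ∃ X, A ∪ Y = X := ⟨_, rfl⟩
  obtain ⟨V, hVdef⟩ : ∃ V, B.image (· - c) ∪ W = V := ⟨_, rfl⟩
  have mA : ∀ x ∈ A, x ∈ A ∪ B ∪ (Y ∪ W) := fun x hx => by simp [hx]
  have mB : ∀ x ∈ B, x ∈ A ∪ B ∪ (Y ∪ W) := fun x hx => by simp [hx]
  have mY : ∀ x ∈ Y, x ∈ A ∪ B ∪ (Y ∪ W) := fun x hx => by simp [hx]
  have mW : ∀ x ∈ W, x ∈ A ∪ B ∪ (Y ∪ W) := fun x hx => by simp [hx]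
  have mX : ∀ x ∈ X, x ∈ A ∪ B ∪ (Y ∪ W) := by
    intro x hx; rw [← hXdef] at hx
    rcases Finset.mem_union.1 hx with h | h
    exacts [mA x h, mY x h]
  have hXB : Disjoint X B := hXdef ▸ Finset.disjoint_union_left.2 ⟨hAB, hBY.symm⟩
  have hXW : Disjoint X W := hXdef ▸ Finset.disjoint_union_left.2 ⟨hAW, hYW⟩
  have ne : ∀ {S T : Finset ℂ}, Disjoint S T → ∀ {x y : ℂ}, x ∈ S → y ∈ T → x ≠ y :=
    fun {S T} hd {x y} hx hy e => Finset.disjoint_left.1 hd hx (e ▸ hy)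
  have gen : ∀ {x y : ℂ}, x ∈ A ∪ B ∪ (Y ∪ W) → y ∈ A ∪ B ∪ (Y ∪ W) → x - y + c ≠ 0 := by
    intro x y hx hy e
    by_cases hxy : x = y
    · rw [hxy] at e; simp at e; exact hc e
    · exact hG y hy x hx (Ne.symm hxy) (by linear_combination -e)
  have hdBW : Disjoint (B.image (· - c)) W := by
    rw [Finset.disjoint_left]
    intro x hx hxW
    obtain ⟨b, hb, rfl⟩ := Finset.mem_image.1 hx
    exact gen (mW _ hxW) (mB b hb) (by ring)
  have hVcard : V.card = X.card := by
    rw [← hVdef, ← hXdef, Finset.card_union_of_disjoint hdBW, Finset.card_union_of_disjoint hAY,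
      Finset.card_image_of_injective _ sub_left_injective, hn, hm]
  have hcard1 : Y.card + A.card = X.card := by
    rw [← hXdef, Finset.card_union_of_disjoint hAY, add_comm]
  -- membership in `V` and avoidance
  have hVcases : ∀ v ∈ V, (∃ b ∈ B, v = b - c) ∨ v ∈ W := by
    intro v hv; rw [← hVdef] at hv
    rcases Finset.mem_union.1 hv with h | h
    · obtain ⟨b, hb, rfl⟩ := Finset.mem_image.1 h; exact Or.inl ⟨b, hb, rfl⟩
    · exact Or.inr h
  have hVA : ∀ x ∈ V, ∀ a ∈ A, x ≠ a ∧ a - x ≠ c := by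
    intro x hx a ha
    rcases hVcases x hx with ⟨b, hb, rfl⟩ | h
    · refine ⟨fun e => gen (mA a ha) (mB b hb) (by rw [← e]; ring), fun e => ne hAB ha hb ?_⟩
      linear_combination e
    · exact ⟨(ne hAW ha h).symm, fun e => gen (mW x h) (mA a ha) (by linear_combination -e)⟩
  have hVY : Disjoint V Y := by
    rw [Finset.disjoint_left]
    intro x hx hxY
    rcases hVcases x hx with ⟨b, hb, rfl⟩ | h
    · exact gen (mY _ hxY) (mB b hb) (by ring)
    · exact ne hYW hxY h rfl
  have hVB : Disjoint V B := by
    rw [Finset.disjoint_left]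
    intro x hx hxB
    rcases hVcases x hx with ⟨b, hb, rfl⟩ | h
    · exact gen (mB _ hxB) (mB b hb) (by ring)
    · exact ne hBW hxB h rfl
  have hVac : ∀ a ∈ A, a - c ∉ V := fun a ha hm => (hVA _ hm a ha).2 (by ring)
  have hXac : ∀ a ∈ A, a - c ∉ X := fun a ha hm => gen (mX _ hm) (mA a ha) (by ring)
  have hX : ∀ x ∈ A ∪ Y, ∀ b ∈ B, x ≠ b ∧ b - x ≠ c := by
    intro x hx b hb; rw [hXdef] at hx
    exact ⟨ne hXB hx hb, fun e => gen (mX x hx) (mB b hb) (by linear_combination -e)⟩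
  have hz := zf_eq_alt hc hn hm hAY hX (by rw [hXdef]; exact hXW)
    (fun x hx a ha => gen (mX x (hXdef ▸ hx)) (mA a ha)) (hG.mono mB)
  have hd := zfDual_eq_alt hc hVdef (by rw [hVcard, hcard1]) hn hVA hVY hVB (hG.mono mA)
  rw [hXdef] at hz
  -- The function ∏_V (z - v) / ∏_X (z - x), normalized, at the two extra poles b and a - c of the
  -- entry (b, a). The dual entry involves its reciprocal, with the same two extra poles.
  set u₁ : ℂ → ℂ := fun b => pp (g c) X {b} * ∏ v ∈ V, (g c b v)⁻¹ with hu₁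
  set u₂ : ℂ → ℂ := fun a => pp (g c) X {a - c} * ∏ v ∈ V, (g c (a - c) v)⁻¹ with hu₂
  -- Both sums are residue sums. Replaced by the residues at b and a - c, they become two-term
  -- combinations of u₁(b), u₂(a) and of their inverses; multiplying the second by u₁(b) u₂(a) turns
  -- it into the first. So the two matrices differ only by row and column factors.
  have hE : ∀ b ∈ B, ∀ a ∈ A,
      ∑ x ∈ X, pp (g c) (X.erase x) {x} * (pp (g c) {x} W)⁻¹ * (t c x b * pp (h c) {x} B) * (h c x a)⁻¹ =
      u₁ b * (u₂ a * ∑ x ∈ V, pp (g c) (V.erase x) {x} * (pp (g c) {x} Y)⁻¹ *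
        (t c x a * (pp (g c) {x} A)⁻¹) * g c x b) := by
    intro b hb a ha
    have ht : ∀ x y : ℂ, t c x y = g c x y * g c x (y - c) := by
      intro x y; rw [t, g, g, div_mul_div_comm, ← pow_two]; congr 2; ring
    have hbV : b - c ∈ V := by
      rw [← hVdef]; exact Finset.mem_union_left _ (Finset.mem_image_of_mem _ hb)
    have haX : a ∈ X := by rw [← hXdef]; exact Finset.mem_union_left _ ha
    have hbX : b ∉ X := Finset.disjoint_right.1 hXB hb
    have hbV' : b ∉ V := Finset.disjoint_right.1 hVB hb
    have hbac : b ≠ a - c := fun e => gen (mB b hb) (mA a ha) (by rw [e]; ring)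
    have hVX : ∀ x ∈ X, x ∉ V := by
      intro x hx hxV; rw [← hXdef] at hx
      rcases Finset.mem_union.1 hx with h | h
      · exact (hVA x hxV x h).1 rfl
      · exact ne hVY hxV h rfl
    have pV : ∀ x, ∏ v ∈ V, (g c x v)⁻¹ = pp (h c) {x} B * (pp (g c) {x} W)⁻¹ := by
      intro x
      rw [← hVdef, Finset.prod_union hdBW, Finset.prod_image fun _ _ _ _ e => sub_left_injective e,
        pp_singleton_left, pp_singleton_left, Finset.prod_inv_distrib (f := fun w => g c x w)]
      congr 1
      refine Finset.prod_congr rfl fun b' _ => ?_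
      rw [g, h, inv_div]; congr 1; ring
    have pX : ∀ x, ∏ v ∈ X, (g c x v)⁻¹ = (pp (g c) {x} A)⁻¹ * (pp (g c) {x} Y)⁻¹ := by
      intro x
      rw [← hXdef, Finset.prod_union hAY, pp_singleton_left, pp_singleton_left, Finset.prod_inv_distrib,
        Finset.prod_inv_distrib]
    have er : ∀ (S : Finset ℂ) (x p : ℂ), p ∈ S → x ≠ p →
        ∏ v ∈ S.erase p, (g c x v)⁻¹ = g c x p * ∏ v ∈ S, (g c x v)⁻¹ := by
      intro S x p hp hxp
      rw [← Finset.mul_prod_erase S _ hp, mul_inv_cancel_left₀ (g_ne_zero hc hxp)]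
    have s1 : ∀ x ∈ X, pp (g c) (X.erase x) {x} * (pp (g c) {x} W)⁻¹ * (t c x b * pp (h c) {x} B) *
        (h c x a)⁻¹ = pp (g c) (X.erase x) {x} * (∏ v ∈ V.erase (b - c), (g c x v)⁻¹) * g c x b *
          g c x (a - c) := by
      intro x hx
      have : (h c x a)⁻¹ = g c x (a - c) := by rw [h, g, inv_div]; congr 1; ring
      rw [er V x _ hbV (fun e => hVX x hx (e ▸ hbV)), pV, ht, this]; ring
    have s2 : ∀ x ∈ V, pp (g c) (V.erase x) {x} * (pp (g c) {x} Y)⁻¹ * (t c x a * (pp (g c) {x} A)⁻¹) *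
        g c x b = pp (g c) (V.erase x) {x} * (∏ v ∈ X.erase a, (g c x v)⁻¹) * g c x b *
          g c x (a - c) := by
      intro x hx
      rw [er X x a haX (hVA x hx a ha).1, pX, ht]; ring
    rw [Finset.sum_congr rfl s1, Finset.sum_congr rfl s2,
      sum_pp_g_erase_mul_g hbV hVcard hbX (hXac a ha) hbac,
      sum_pp_g_erase_mul_g haX hVcard.symm hbV' (hVac a ha) hbac,
      er V b _ hbV (fun e => hc (by linear_combination e)),
      er V (a - c) _ hbV (fun e => ne hAB ha hb (by linear_combination e)),
      er X b a haX (fun e => ne hAB ha hb e.symm),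
      er X (a - c) a haX (fun e => hc (by linear_combination -e))]
    -- Interchanging X and V inverts the value; the signs agree because |X| = |V|.
    have i1 : ∀ q, q ∉ X → q ∉ V → (pp (g c) X {q} * ∏ v ∈ V, (g c q v)⁻¹) *
        (pp (g c) V {q} * ∏ v ∈ X, (g c q v)⁻¹) = 1 := by
      intro q hq hq'
      have nX : pp (g c) {q} X ≠ 0 := pp_g_ne_zero hc (by simpa using hq)
      have nV : pp (g c) {q} V ≠ 0 := pp_g_ne_zero hc (by simpa using hq')
      rw [Finset.prod_inv_distrib, Finset.prod_inv_distrib, ← pp_singleton_left, ← pp_singleton_left,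
        pp_g_swap c X {q}, pp_g_swap c V {q}, hVcard]
      rcases neg_one_pow_eq_or ℂ (X.card * ({q} : Finset ℂ).card) with e | e <;>
        (rw [e]; field_simp)
    have j1 := i1 b hbX hbV'
    have j2 := i1 (a - c) (hXac a ha) (hVac a ha)
    have k1 : g c b (b - c) = 1 := by rw [g]; simp [hc]
    have k2 : g c (a - c) a = -1 := by rw [g]; simp [hc]
    have k3 : g c (a - c) (b - c) = g c a b := by rw [g, g]; congr 1; ring
    rw [k1, k2, k3, g_antisymm c b (a - c), g_antisymm c b a]
    simp only [hu₁, hu₂]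
    linear_combination -(g c (a - c) b * g c a b * (pp (g c) X {a - c} * ∏ v ∈ V, (g c (a - c) v)⁻¹)) * j1 +
      (g c (a - c) b * (pp (g c) X {b} * ∏ v ∈ V, (g c b v)⁻¹)) * j2
  have hpre : pp (h c) X A * pp (g c) X W * (∏ b ∈ B, u₁ b) * (∏ a ∈ A, u₂ a) * pp (g c) V B =
      (-1) ^ (B.card + W.card) * pp (f c) W A * pp (f c) Y B * pp (g c) V Y := by
    have nVB : pp (g c) V B ≠ 0 := pp_g_ne_zero hc hVB
    have p1 : (∏ b ∈ B, u₁ b) * pp (g c) V B = (-1) ^ (A.card * V.card) * pp (g c) X B := by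
      have : ∏ b ∈ B, u₁ b = pp (g c) X B * (pp (g c) B V)⁻¹ := by
        simp only [hu₁, Finset.prod_mul_distrib, pp_singleton_right]
        rw [← pp_inv, pp, pp, Finset.prod_comm]
      rw [this, pp_g_swap c B V, hn]
      rcases neg_one_pow_eq_or ℂ (B.card * V.card) with e | e <;> (rw [e]; field_simp)
    have p2 : pp (h c) X A * ∏ a ∈ A, u₂ a = (-1) ^ (A.card * V.card) * pp (h c) V A := by
      have : ∏ a ∈ A, u₂ a = (pp (h c) X A)⁻¹ * ((-1) ^ (A.card * V.card) * pp (h c) V A) := by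
        rw [← pp_flip (h c) (S := A), ← pp_flip (h c) (S := A), ← pp_inv, ← pp_neg]
        simp only [hu₂, pp_singleton_right, Finset.prod_mul_distrib]
        rw [pp, pp]
        congr 1 <;> refine Finset.prod_congr rfl fun a _ => Finset.prod_congr rfl fun v _ => ?_
        · rw [h, g, inv_div]; congr 1; ring
        · rw [h, g, inv_div, ← neg_div]; congr 1; ring
      rw [this, mul_inv_cancel_left₀]
      exact pp_ne_zero fun x hx a ha => div_ne_zero (gen (mX x hx) (mA a ha)) hc
    have p3 : pp (h c) V A = pp (h c) W A * (pp (g c) B A)⁻¹ := by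
      rw [← hVdef, pp_union_left _ hdBW, pp_image_sub_left, ← pp_inv, mul_comm]
      congr 1
      refine pp_congr fun b hb a ha => ?_
      rw [h, g, inv_div]; congr 1; ring
    have p4 : pp (g c) V Y = pp (g c) W Y * ((-1) ^ (B.card * Y.card) * (pp (h c) Y B)⁻¹) := by
      rw [← hVdef, pp_union_left _ hdBW, pp_image_sub_left, mul_comm, ← pp_flip (h c) (S := B), ← pp_inv,
        ← pp_neg]
      congr 1
      refine pp_congr fun b hb y hy => ?_
      rw [h, g, inv_div, ← div_neg]; congr 1; ring
    have nWY : pp (g c) W Y ≠ 0 := pp_g_ne_zero hc hYW.symm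
    have nBA : pp (g c) B A ≠ 0 := pp_g_ne_zero hc hAB.symm
    have nYB : pp (h c) Y B ≠ 0 := pp_ne_zero fun x hx a ha => div_ne_zero (gen (mY x hx) (mB a ha)) hc
    calc _ = (pp (h c) X A * ∏ a ∈ A, u₂ a) * pp (g c) X W * ((∏ b ∈ B, u₁ b) * pp (g c) V B) := by ring
      _ = _ := by
        rw [p1, p2, p3, p4, ← hXdef, pp_union_left _ hAY, pp_union_left _ hAY, pp_f_eq hc, pp_f_eq hc,
          pp_g_swap c A W, pp_g_swap c A B, pp_g_swap c Y W, hVcard, ← hcard1, hn, hm]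
        have e1 : ∀ k : ℕ, ((-1 : ℂ) ^ k) * (-1) ^ k = 1 := fun k => by
          rw [← pow_add, ← two_mul, pow_mul]; simp
        have e2 : ∀ k : ℕ, ((-1 : ℂ) ^ (k * k)) = (-1) ^ k := fun k => by
          rcases Nat.even_or_odd k with hk | hk
          · rw [hk.neg_one_pow, (hk.mul_left k).neg_one_pow]
          · rw [hk.neg_one_pow, (hk.mul hk).neg_one_pow]
        have e3 := e1 (B.card * (Y.card + B.card))
        rw [e2, e2, pow_add (-1 : ℂ) B.card]
        generalize (-1 : ℂ) ^ (B.card * (Y.card + B.card)) = ε at e3 ⊢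
        field_simp
        linear_combination (pp (h c) W A * pp (g c) W A * pp (g c) Y B) * e3
  have hflip : alt c (fun b a => ∑ x ∈ X, pp (g c) (X.erase x) {x} * (pp (g c) {x} W)⁻¹ *
      (t c x b * pp (h c) {x} B) * (h c x a)⁻¹) B A = (∏ b ∈ B, u₁ b) * ((∏ a ∈ A, u₂ a) *
      alt c (fun a b => ∑ x ∈ V, pp (g c) (V.erase x) {x} * (pp (g c) {x} Y)⁻¹ *
        (t c x a * (pp (g c) {x} A)⁻¹) * g c x b) A B) := by
    rw [alt_congr hE, alt_mul_row (c := c), alt_mul_col (c := c), ← alt_transpose]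
  have nVY : pp (g c) V Y ≠ 0 := pp_g_ne_zero hc hVY
  have nVB : pp (g c) V B ≠ 0 := pp_g_ne_zero hc hVB
  rw [hz, hflip]
  apply mul_left_cancel₀ nVY
  linear_combination (-(pp (h c) X A * pp (g c) X W * (∏ b ∈ B, u₁ b) * (∏ a ∈ A, u₂ a))) * hd +
    zfDual c B A Y W * hpre

/-! ### Summation over the partitions of A and Y -/

section scalar
variable {c : ℂ}

/-- The Laplace expansion, along the rows η and ζ, of the Cauchy determinant with rows η ∪ ζ and
columns Y; its minors are again Cauchy determinants. -/
theorem sum_pp_g_powersetCard (hc : c ≠ 0) {η ζ Y : Finset ℂ} (hd : Disjoint η ζ) (hY : Disjoint (η ∪ ζ) Y)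
    (hcard : η.card + ζ.card = Y.card) :
    ∑ K ∈ Y.powersetCard η.card, pp (g c) K (Y \ K) * pp (g c) η K * pp (g c) ζ (Y \ K) =
      pp (g c) (η ∪ ζ) Y * (pp (g c) ζ η)⁻¹ := by
  have h1 := alt_union (c := c) (g c) hd Y
  rw [alt_g' hc hY (by rw [Finset.card_union_of_disjoint hd, hcard]),
    sum_powerset_eq_powersetCard (n := ζ.card)] at h1
  · rw [h1, sum_powersetCard_compl hcard (fun K K' => pp (g c) K K' * pp (g c) η K * pp (g c) ζ K'),
      Finset.sum_mul]
    refine Finset.sum_congr rfl fun Z hZ => ?_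
    obtain ⟨hZY, hZc⟩ := Finset.mem_powersetCard.1 hZ
    have hc' : (Y \ Z).card = η.card := by rw [Finset.card_sdiff_of_subset hZY]; omega
    rw [alt_g' hc ((Finset.disjoint_union_left.1 hY).1.mono_right Finset.sdiff_subset) hc'.symm,
      alt_g' hc ((Finset.disjoint_union_left.1 hY).2.mono_right hZY) hZc.symm,
      pp_g_swap c (Y \ Z) Z, pp_g_swap c η ζ, hc', hZc]
    have : pp (g c) ζ η ≠ 0 := pp_g_ne_zero hc hd.symm
    rw [mul_comm η.card ζ.card] 
    field_simp
  · intro Z hZ hne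
    rw [alt_eq_zero (W := ζ) (Ne.symm hne), mul_zero]

/-- This is `dw_convolution` divided by f(Ξ, A). Partitions with |R| different from |Θ| drop out
because one of the two partition functions then has fewer points in its second set than in its
first. -/
theorem sum_dw_mul_dw (hc : c ≠ 0) {A Θ Ξ : Finset ℂ} (hA : Gen c A) (hd : Disjoint Θ Ξ)
    (hZ : ∀ z ∈ Θ ∪ Ξ, ∀ a ∈ A, z ≠ a ∧ a - z ≠ c) (hcard : Θ.card + Ξ.card = A.card) :
    ∑ R ∈ A.powersetCard Θ.card, pp (f c) R (A \ R) * dw c R Θ * (dw c (A \ R) Ξ * (pp (f c) Ξ (A \ R))⁻¹) =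
      dw c A (Θ ∪ Ξ) * (pp (f c) Ξ A)⁻¹ := by
  have hΞ : ∀ z ∈ Ξ, ∀ a ∈ A, z ≠ a ∧ a - z ≠ c := fun z hz => hZ z (Finset.mem_union_right _ hz)
  have hΘ : ∀ z ∈ Θ, ∀ a ∈ A, z ≠ a ∧ a - z ≠ c := fun z hz => hZ z (Finset.mem_union_left _ hz)
  have hf : ∀ S ⊆ A, pp (f c) Ξ S ≠ 0 := fun S hS => pp_ne_zero fun x hx y hy => by
    have := hΞ x hx y (hS hy)
    exact div_ne_zero (fun e => this.2 (by linear_combination -e)) (sub_ne_zero.2 this.1)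
  rw [← dw_convolution hc hA hd hΞ, sum_powerset_eq_powersetCard (n := Θ.card), Finset.sum_mul]
  · refine Finset.sum_congr rfl fun R hR => ?_
    have hRA := (Finset.mem_powersetCard.1 hR).1
    rw [← pp_sdiff_right (k := f c) (S := Ξ) hRA]
    have := hf R hRA
    have := hf (A \ R) Finset.sdiff_subset
    field_simp
  · intro R hR hne
    rcases lt_or_gt_of_ne hne with hlt | hgt
    · rw [dw_eq_zero (A := A \ R) hc (hA.mono Finset.sdiff_subset)
        (fun z hz a ha => hΞ z hz a (Finset.sdiff_subset ha)), mul_zero]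
      rw [Finset.card_sdiff_of_subset hR]; have := Finset.card_le_card hR; omega
    · rw [dw_eq_zero (A := R) hc (hA.mono hR) (fun z hz a ha => hΘ z hz a (hR ha)) hgt, mul_zero, zero_mul]

/-- Sums over nested subsets `ζ ⊆ Z ⊆ X₀ ∪ X₁`, when only `Z \ ζ ⊆ X₀`, `ζ ⊆ X₁` contribute. -/
theorem sum_powerset_powerset_eq {X₀ X₁ : Finset ℂ} (hd : Disjoint X₀ X₁) (F : Finset ℂ → Finset ℂ → ℂ)
    (h₀ : ∀ η ζ, η ⊆ X₀ ∪ X₁ → ¬ η ⊆ X₀ → F η ζ = 0) (h₁ : ∀ η ζ, ζ ⊆ X₀ ∪ X₁ → ¬ ζ ⊆ X₁ → F η ζ = 0) :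
    ∑ Z ∈ (X₀ ∪ X₁).powerset, ∑ ζ ∈ Z.powerset, F (Z \ ζ) ζ =
      ∑ η ∈ X₀.powerset, ∑ ζ ∈ X₁.powerset, F η ζ := by
  rw [← Finset.sum_product', Finset.sum_sigma']
  symm
  refine Finset.sum_bij_ne_zero (fun p _ _ => ⟨p.1 ∪ p.2, p.2⟩) ?_ ?_ ?_ ?_
  · rintro ⟨η, ζ⟩ hp _
    simp only [Finset.mem_product, Finset.mem_powerset] at hp
    simp only [Finset.mem_sigma, Finset.mem_powerset]
    exact ⟨Finset.union_subset_union hp.1 hp.2, Finset.subset_union_right⟩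
  · rintro ⟨η, ζ⟩ hp _ ⟨η', ζ'⟩ hp' _ e
    simp only [Finset.mem_product, Finset.mem_powerset, Sigma.mk.injEq, heq_eq_eq] at hp hp' e
    obtain ⟨e1, rfl⟩ := e
    have d1 : Disjoint η ζ := hd.mono hp.1 hp.2
    have d2 : Disjoint η' ζ := hd.mono hp'.1 hp.2
    congr 1
    rw [← Finset.union_sdiff_cancel_right d1, e1, Finset.union_sdiff_cancel_right d2]
  · rintro ⟨Z, ζ⟩ hp hne
    simp only [Finset.mem_sigma, Finset.mem_powerset] at hp
    have a1 : Z \ ζ ⊆ X₀ := by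
      by_contra hcon; exact hne (h₀ _ _ (Finset.sdiff_subset.trans hp.1) hcon)
    have a2 : ζ ⊆ X₁ := by
      by_contra hcon; exact hne (h₁ _ _ (hp.2.trans hp.1) hcon)
    exact ⟨⟨Z \ ζ, ζ⟩, by simp [a1, a2], hne, by simp [Finset.sdiff_union_of_subset hp.2]⟩
  · rintro ⟨η, ζ⟩ hp _
    simp only [Finset.mem_product, Finset.mem_powerset] at hp
    simp only [Finset.union_sdiff_cancel_right (hd.mono hp.1 hp.2)]

/-- The common form of both sides: the sum over `I ⊆ B`, `J ⊆ W` and over the splittings of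
`(B \ I) ∪ (W \ J)` and `(I - c) ∪ J`. -/
def mixedSum (c ϰ : ℂ) (r₁ r₃ : ℂ → ℂ) (A B W Y : Finset ℂ) : ℂ :=
  ∑ I ∈ B.powerset, ∑ J ∈ W.powerset, (∏ x ∈ I, r₁ x) * (∏ x ∈ J, r₃ x) * (-1) ^ (I.card + J.card) *
    pp (f c) (B \ I) I * pp (g c) J (W \ J) * (ϰ ^ (B \ I).card *
    ∑ η ∈ (B \ I ∪ W \ J).powersetCard (W \ J).card, ∑ ζ ∈ (I.image (· - c) ∪ J).powersetCard J.card,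
      pp (g c) η ((B \ I ∪ W \ J) \ η) * pp (h c) η (B \ I) *
      (pp (g c) ζ ((I.image (· - c) ∪ J) \ ζ) * (pp (g c) ζ I)⁻¹) *
      (pp (g c) (η ∪ ζ) Y * (pp (g c) ζ η)⁻¹) *
      (dw c A ((B \ I ∪ W \ J) \ η ∪ (I.image (· - c) ∪ J) \ ζ) *
        (pp (f c) ((I.image (· - c) ∪ J) \ ζ) A)⁻¹))

/-- Parameters in general position. -/
structure General (c : ℂ) (A B W Y : Finset ℂ) : Prop where
  gen : Gen c (A ∪ B ∪ (W ∪ Y))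
  AB : Disjoint A B
  AW : Disjoint A W
  AY : Disjoint A Y
  BW : Disjoint B W
  BY : Disjoint B Y
  WY : Disjoint W Y
  cardAB : A.card = B.card
  cardWY : W.card = Y.card

theorem General.add_ne {A B W Y : Finset ℂ} (H : General c A B W Y) (hc : c ≠ 0) {x y : ℂ}
    (hx : x ∈ A ∪ B ∪ (W ∪ Y)) (hy : y ∈ A ∪ B ∪ (W ∪ Y)) : x - y + c ≠ 0 := by
  intro e
  by_cases hxy : x = y
  · rw [hxy] at e; simp at e; exact hc e
  · exact H.gen y hy x hx (Ne.symm hxy) (by linear_combination -e)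

end scalar

section scalar
variable {c : ℂ} {A B W Y : Finset ℂ}

theorem General.disjoint_shift (H : General c A B W Y) (hc : c ≠ 0) {I S : Finset ℂ} (hI : I ⊆ B)
    (hS : S ⊆ A ∪ B ∪ (W ∪ Y)) : Disjoint (I.image (· - c)) S := by
  rw [Finset.disjoint_left]
  intro x hx hxW
  obtain ⟨b, hb, rfl⟩ := Finset.mem_image.1 hx
  exact H.add_ne hc (hS hxW) (by simp [hI hb] : b ∈ _) (by ring)

theorem card_image_sub (c : ℂ) (I : Finset ℂ) : (I.image (· - c)).card = I.card :=
  Finset.card_image_of_injective _ sub_left_injective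

theorem General.avoid (H : General c A B W Y) (hc : c ≠ 0) {z a : ℂ}
    (hz : z ∈ B.image (· - c) ∪ B ∪ W) (ha : a ∈ A) : z ≠ a ∧ a - z ≠ c := by
  have ha' : a ∈ A ∪ B ∪ (W ∪ Y) := by simp [ha]
  rcases Finset.mem_union.1 hz with hz | hz
  · rcases Finset.mem_union.1 hz with hz | hz
    · obtain ⟨b, hb, rfl⟩ := Finset.mem_image.1 hz
      refine ⟨fun e => H.add_ne hc ha' (by simp [hb] : b ∈ _) (by rw [← e]; ring), fun e => ?_⟩
      exact Finset.disjoint_left.1 H.AB ha (by rwa [show a = b by linear_combination e])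
    · refine ⟨fun e => Finset.disjoint_left.1 H.AB ha (e ▸ hz), fun e => ?_⟩
      exact H.add_ne hc (by simp [hz] : z ∈ _) ha' (by linear_combination -e)
  · refine ⟨fun e => Finset.disjoint_left.1 H.AW ha (e ▸ hz), fun e => ?_⟩
    exact H.add_ne hc (by simp [hz] : z ∈ _) ha' (by linear_combination -e)

/-- After both highest coefficients are written out and η, ζ are fixed, the dependence on R and the
dependence on K separate. The sum over R is `sum_dw_mul_dw`, the sum over K is
`sum_pp_g_powersetCard`. It is the mixture of the two representations that gives both sums a
summable form. -/
theorem zf_mul_zfDual_sum (hc : c ≠ 0) (H : General c A B W Y) {I J : Finset ℂ} (hI : I ⊆ B) (hJ : J ⊆ W)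
    (ϰ : ℂ) :
    ∑ R ∈ A.powersetCard (B \ I).card, ∑ K ∈ Y.powersetCard (W \ J).card,
      ϰ ^ R.card * pp (f c) R (A \ R) * pp (g c) K (Y \ K) * zf c R (B \ I) (W \ J) K *
        zfDual c I (A \ R) (Y \ K) J =
    ϰ ^ (B \ I).card *
    ∑ η ∈ (B \ I ∪ W \ J).powersetCard (W \ J).card, ∑ ζ ∈ (I.image (· - c) ∪ J).powersetCard J.card,
      pp (g c) η ((B \ I ∪ W \ J) \ η) * pp (h c) η (B \ I) *
      (pp (g c) ζ ((I.image (· - c) ∪ J) \ ζ) * (pp (g c) ζ I)⁻¹) *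
      (pp (g c) (η ∪ ζ) Y * (pp (g c) ζ η)⁻¹) *
      (dw c A ((B \ I ∪ W \ J) \ η ∪ (I.image (· - c) ∪ J) \ ζ) *
        (pp (f c) ((I.image (· - c) ∪ J) \ ζ) A)⁻¹) := by
  have cI := Finset.card_sdiff_add_card_eq_card hI
  have cJ := Finset.card_sdiff_add_card_eq_card hJ
  have hAB := H.cardAB
  have hWY := H.cardWY
  have d0 : Disjoint (B \ I) (W \ J) := H.BW.mono Finset.sdiff_subset Finset.sdiff_subset
  have d1 : Disjoint (I.image (· - c)) J := H.disjoint_shift hc hI (hJ.trans (by intro x; simp; tauto))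
  have d01 : Disjoint (B \ I ∪ W \ J) (I.image (· - c) ∪ J) := by
    refine Finset.disjoint_union_right.2 ⟨(H.disjoint_shift hc hI ?_).symm, ?_⟩
    · intro x; simp; tauto
    · exact Finset.disjoint_union_left.2 ⟨H.BW.mono Finset.sdiff_subset hJ, Finset.sdiff_disjoint⟩
  have dY : Disjoint ((B \ I ∪ W \ J) ∪ (I.image (· - c) ∪ J)) Y := by
    refine Finset.disjoint_union_left.2 ⟨Finset.disjoint_union_left.2
      ⟨H.BY.mono_left Finset.sdiff_subset, H.WY.mono_left Finset.sdiff_subset⟩,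
      Finset.disjoint_union_left.2 ⟨H.disjoint_shift hc hI ?_, H.WY.mono_left hJ⟩⟩
    intro x; simp; tauto
  have hsub : (B \ I ∪ W \ J) ∪ (I.image (· - c) ∪ J) ⊆ B.image (· - c) ∪ B ∪ W := by
    refine Finset.union_subset (Finset.union_subset ?_ ?_) (Finset.union_subset ?_ ?_)
    · exact fun x hx => by simp [(Finset.mem_sdiff.1 hx).1]
    · exact fun x hx => by simp [(Finset.mem_sdiff.1 hx).1]
    · exact (Finset.image_subset_image hI).trans (by rw [Finset.union_assoc]; exact Finset.subset_union_left)
    · exact fun x hx => by simp [hJ hx]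
  have c0 : (B \ I ∪ W \ J).card = (B \ I).card + (W \ J).card := Finset.card_union_of_disjoint d0
  have c1 : (I.image (· - c) ∪ J).card = I.card + J.card := by
    rw [Finset.card_union_of_disjoint d1, card_image_sub]
  obtain ⟨X₀, hX₀⟩ : ∃ X, B \ I ∪ W \ J = X := ⟨_, rfl⟩
  obtain ⟨X₁, hX₁⟩ : ∃ X, I.image (· - c) ∪ J = X := ⟨_, rfl⟩
  simp only [zf, zfDual, hX₀, hX₁] at *
  have e1 : ∀ R ∈ A.powersetCard (B \ I).card, ∀ K ∈ Y.powersetCard (W \ J).card,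
      ϰ ^ R.card * pp (f c) R (A \ R) * pp (g c) K (Y \ K) *
        (∑ η ∈ X₀.powersetCard K.card, pp (g c) η (X₀ \ η) * pp (h c) η (B \ I) * pp (g c) η K * dw c R (X₀ \ η)) *
        (∑ ζ ∈ X₁.powersetCard (Y \ K).card, pp (g c) ζ (X₁ \ ζ) * (pp (g c) ζ I)⁻¹ * pp (g c) ζ (Y \ K) *
          dw c (A \ R) (X₁ \ ζ) * (pp (f c) (X₁ \ ζ) (A \ R))⁻¹) =
      ∑ η ∈ X₀.powersetCard (W \ J).card, ∑ ζ ∈ X₁.powersetCard J.card,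
        (ϰ ^ (B \ I).card * (pp (g c) η (X₀ \ η) * pp (h c) η (B \ I)) * (pp (g c) ζ (X₁ \ ζ) * (pp (g c) ζ I)⁻¹)) *
        (pp (f c) R (A \ R) * dw c R (X₀ \ η) * (dw c (A \ R) (X₁ \ ζ) * (pp (f c) (X₁ \ ζ) (A \ R))⁻¹)) *
        (pp (g c) K (Y \ K) * pp (g c) η K * pp (g c) ζ (Y \ K)) := by
    intro R hR K hK
    obtain ⟨-, hRc⟩ := Finset.mem_powersetCard.1 hR
    obtain ⟨hKY, hKc⟩ := Finset.mem_powersetCard.1 hK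
    have : (Y \ K).card = J.card := by rw [Finset.card_sdiff_of_subset hKY]; omega
    rw [this, hKc, hRc, mul_assoc, Finset.sum_mul_sum, Finset.mul_sum]
    refine Finset.sum_congr rfl fun η _ => ?_
    rw [Finset.mul_sum]
    exact Finset.sum_congr rfl fun ζ _ => by ring
  rw [Finset.sum_congr rfl fun R hR => Finset.sum_congr rfl fun K hK => e1 R hR K hK]
  rw [Finset.mul_sum]
  have comm : ∀ F : Finset ℂ → Finset ℂ → Finset ℂ → Finset ℂ → ℂ,
      ∑ R ∈ A.powersetCard (B \ I).card, ∑ K ∈ Y.powersetCard (W \ J).card,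
        ∑ η ∈ X₀.powersetCard (W \ J).card, ∑ ζ ∈ X₁.powersetCard J.card, F R K η ζ =
      ∑ η ∈ X₀.powersetCard (W \ J).card, ∑ ζ ∈ X₁.powersetCard J.card,
        ∑ R ∈ A.powersetCard (B \ I).card, ∑ K ∈ Y.powersetCard (W \ J).card, F R K η ζ := by
    intro F
    rw [Finset.sum_congr rfl fun R _ => Finset.sum_comm, Finset.sum_comm]
    refine Finset.sum_congr rfl fun η _ => ?_
    rw [Finset.sum_congr rfl fun R _ => Finset.sum_comm, Finset.sum_comm]
  rw [comm]
  refine Finset.sum_congr rfl fun η hη => ?_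
  rw [Finset.mul_sum]
  refine Finset.sum_congr rfl fun ζ hζ => ?_
  obtain ⟨hηX, hηc⟩ := Finset.mem_powersetCard.1 hη
  obtain ⟨hζX, hζc⟩ := Finset.mem_powersetCard.1 hζ
  have k1 := sum_pp_g_powersetCard hc (d01.mono hηX hζX)
    (dY.mono_left (Finset.union_subset_union hηX hζX)) (by omega)
  have k2 := sum_dw_mul_dw hc (A := A) (Θ := X₀ \ η) (Ξ := X₁ \ ζ) (H.gen.mono (by intro x; simp; tauto))
    (d01.mono Finset.sdiff_subset Finset.sdiff_subset)
    (fun z hz a ha => H.avoid hc (hsub (Finset.union_subset_union Finset.sdiff_subset Finset.sdiff_subset hz)) ha)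
    (by rw [Finset.card_sdiff_of_subset hηX, Finset.card_sdiff_of_subset hζX]; omega)
  rw [show (X₀ \ η).card = (B \ I).card by rw [Finset.card_sdiff_of_subset hηX]; omega] at k2
  rw [hηc] at k1
  rw [← k1, ← k2]
  simp only [Finset.mul_sum, Finset.sum_mul]
  exact Finset.sum_congr rfl fun R _ => Finset.sum_congr rfl fun K _ => by ring

end scalar

section scalar
variable {c : ℂ} {A B W Y : Finset ℂ}

/-- The sum over partitions of both pairs of sets of Bethe parameters that represents the scalar product of
generic Bethe vectors, multiplied by `f(W, A) f(Y, B)`. -/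
def sumFormula (c : ℂ) (r₁ r₃ : ℂ → ℂ) (A B W Y : Finset ℂ) : ℂ :=
  ∑ I ∈ B.powerset, ∑ J ∈ W.powerset, ∑ R ∈ A.powersetCard (B \ I).card, ∑ K ∈ Y.powersetCard (W \ J).card,
    (∏ x ∈ R, r₁ x) * (∏ x ∈ I, r₁ x) * (∏ x ∈ J, r₃ x) * (∏ x ∈ K, r₃ x) *
      (pp (f c) (A \ R) R * pp (f c) (B \ I) I * pp (f c) (W \ J) (A \ R) * pp (f c) (Y \ K) (B \ I) *
        pp (g c) J (W \ J) * pp (g c) K (Y \ K)) *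
      zf c R (B \ I) (W \ J) K * zf c I (A \ R) (Y \ K) J

theorem prod_prod_erase_div (R : Finset ℂ) (u : ℂ → ℂ → ℂ) (hu : ∀ x ∈ R, ∀ y ∈ R, x ≠ y → u x y ≠ 0) :
    ∏ x ∈ R, ∏ y ∈ R.erase x, u x y / u y x = 1 := by
  simp only [Finset.prod_div_distrib]
  rw [div_eq_one_iff_eq]
  · refine Finset.prod_comm' fun x y => ?_
    simp only [Finset.mem_erase, ne_eq]; grind
  · refine Finset.prod_ne_zero_iff.2 fun x hx => Finset.prod_ne_zero_iff.2 fun y hy => ?_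
    exact hu y (Finset.mem_of_mem_erase hy) x hx (Finset.ne_of_mem_erase hy)

/-- Pairs inside R cancel against each other, so only the interaction between R and A \ R remains.
-/
theorem prod_onShell {A R : Finset ℂ} (hR : R ⊆ A) (u : ℂ → ℂ → ℂ)
    (hu : ∀ x ∈ A, ∀ y ∈ A, x ≠ y → u x y ≠ 0) :
    ∏ x ∈ R, ∏ y ∈ A.erase x, u x y / u y x = pp u R (A \ R) / pp u (A \ R) R := by
  have h1 : ∀ x ∈ R, ∏ y ∈ A.erase x, u x y / u y x =
      (∏ y ∈ R.erase x, u x y / u y x) * ∏ y ∈ A \ R, u x y / u y x := by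
    intro x hx
    rw [← Finset.prod_union]
    · refine Finset.prod_congr ?_ fun _ _ => rfl
      ext y; simp only [Finset.mem_erase, Finset.mem_union, Finset.mem_sdiff, ne_eq]
      by_cases hy : y = x
      · subst hy; simp [hx]
      · by_cases hyR : y ∈ R
        · simp [hy, hyR, hR hyR]
        · simp [hy, hyR]
    · exact Finset.disjoint_of_subset_left (Finset.erase_subset _ _) Finset.disjoint_sdiff
  rw [Finset.prod_congr rfl h1, Finset.prod_mul_distrib,
    prod_prod_erase_div R u fun x hx y hy => hu x (hR hx) y (hR hy), one_mul]
  simp only [Finset.prod_div_distrib]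
  rw [pp, pp, Finset.prod_comm (s := A \ R)]

theorem General.f_ne (H : General c A B W Y) (hc : c ≠ 0) {x y : ℂ}
    (hx : x ∈ A ∪ B ∪ (W ∪ Y)) (hy : y ∈ A ∪ B ∪ (W ∪ Y)) (hxy : x ≠ y) : f c x y ≠ 0 :=
  div_ne_zero (H.add_ne hc hx hy) (sub_ne_zero.2 hxy)

theorem General.pp_f_ne (H : General c A B W Y) (hc : c ≠ 0) {S T : Finset ℂ}
    (hS : S ⊆ A ∪ B ∪ (W ∪ Y)) (hT : T ⊆ A ∪ B ∪ (W ∪ Y)) (hd : Disjoint S T) : pp (f c) S T ≠ 0 :=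
  pp_ne_zero fun _ hx _ hy => H.f_ne hc (hS hx) (hT hy) fun e => Finset.disjoint_left.1 hd hx (e ▸ hy)

/-- The Bethe equation for R replaces f(A \ R, R) by ϰ^|R| f(R, A \ R) f(W, R), the one for K gives
f(K, B), and passing to `zfDual` in the second highest coefficient supplies f(J, A \ R) f(Y \ K, I).
With the factors already present these complete f(W, A) f(Y, B), which is independent of the
partition; `zf_mul_zfDual_sum` does the rest. -/
theorem sumFormula_eq_mixedSum (hc : c ≠ 0) (H : General c A B W Y) {ϰ : ℂ} {r₁ r₃ : ℂ → ℂ}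
    (h₁ : ∀ x ∈ A, r₁ x = ϰ * (∏ y ∈ A.erase x, f c x y / f c y x) * pp (f c) W {x})
    (h₃ : ∀ y ∈ Y, r₃ y = pp (f c) {y} B) :
    sumFormula c r₁ r₃ A B W Y = pp (f c) W A * pp (f c) Y B * mixedSum c ϰ r₁ r₃ A B W Y := by
  have sA : A ⊆ A ∪ B ∪ (W ∪ Y) := by intro x; simp; tauto
  have sB : B ⊆ A ∪ B ∪ (W ∪ Y) := by intro x; simp; tauto
  have sW : W ⊆ A ∪ B ∪ (W ∪ Y) := by intro x; simp; tauto
  have sY : Y ⊆ A ∪ B ∪ (W ∪ Y) := by intro x; simp; tauto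
  simp only [sumFormula, mixedSum, Finset.mul_sum (s := B.powerset), Finset.mul_sum (s := W.powerset)]
  refine Finset.sum_congr rfl fun I hI => Finset.sum_congr rfl fun J hJ => ?_
  rw [Finset.mem_powerset] at hI hJ
  have e1 := zf_mul_zfDual_sum hc H hI hJ ϰ
  have cI := Finset.card_sdiff_add_card_eq_card hI
  have cJ := Finset.card_sdiff_add_card_eq_card hJ
  have hAB := H.cardAB
  have hWY := H.cardWY
  rw [← e1, ← mul_assoc, Finset.mul_sum]
  refine Finset.sum_congr rfl fun R hR => ?_
  rw [Finset.mul_sum]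
  refine Finset.sum_congr rfl fun K hK => ?_
  obtain ⟨hRA, hRc⟩ := Finset.mem_powersetCard.1 hR
  obtain ⟨hKY, hKc⟩ := Finset.mem_powersetCard.1 hK
  have sR : A \ R ⊆ A := Finset.sdiff_subset
  have sK : Y \ K ⊆ Y := Finset.sdiff_subset
  have cR := Finset.card_sdiff_add_card_eq_card hRA
  have cK := Finset.card_sdiff_add_card_eq_card hKY
  rw [zf_eq_zfDual (B := I) hc (by omega) (by omega) (H.AB.mono sR hI) (H.AY.mono sR sK) (H.AW.mono sR hJ)
    (H.BY.mono hI sK) (H.BW.mono hI hJ) (H.WY.symm.mono sK hJ) (H.gen.mono (by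
      refine Finset.union_subset (Finset.union_subset (sR.trans sA) (hI.trans sB))
        (Finset.union_subset (sK.trans sY) (hJ.trans sW))))]
  have q1 : ∏ x ∈ R, r₁ x = ϰ ^ R.card * (pp (f c) R (A \ R) / pp (f c) (A \ R) R) * pp (f c) W R := by
    rw [Finset.prod_congr rfl fun x hx => h₁ x (hRA hx), Finset.prod_mul_distrib, Finset.prod_mul_distrib,
      Finset.prod_const, prod_onShell hRA _ fun x hx y hy hxy => H.f_ne hc (sA hx) (sA hy) hxy]
    congr 1
    simp only [pp_singleton_right]
    rw [pp, Finset.prod_comm]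
  have q3 : ∏ x ∈ K, r₃ x = pp (f c) K B := by
    rw [Finset.prod_congr rfl fun x hx => h₃ x (hKY hx)]
    simp only [pp_singleton_left]; rfl
  have n1 : pp (f c) (A \ R) R ≠ 0 := H.pp_f_ne hc (sR.trans sA) (hRA.trans sA) Finset.sdiff_disjoint
  rw [q1, q3, ← pp_sdiff_right (k := f c) (S := W) hRA, ← pp_sdiff_left (k := f c) (T := B) hKY,
    ← pp_sdiff_left (k := f c) (T := A \ R) hJ, ← pp_sdiff_right (k := f c) (S := Y \ K) hI]
  generalize (-1 : ℂ) ^ (I.card + J.card) = ε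
  generalize ϰ ^ R.card = κ
  generalize zf c R (B \ I) (W \ J) K = z₁
  generalize zfDual c I (A \ R) (Y \ K) J = z₂
  generalize pp (f c) (A \ R) R = p at n1 ⊢
  rw [show ∀ x : ℂ, κ * (x / p) = κ * x * p⁻¹ from fun x => by ring]
  have n2 := mul_inv_cancel₀ n1
  generalize p⁻¹ = q at n2 ⊢
  generalize ∏ x ∈ I, r₁ x = o₁
  generalize ∏ x ∈ J, r₃ x = o₂
  linear_combination (κ * pp (f c) R (A \ R) * pp (f c) W R * o₁ * o₂ * pp (f c) K B *
      (pp (f c) (B \ I) I * pp (f c) (W \ J) (A \ R) * pp (f c) (Y \ K) (B \ I) *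
        pp (g c) J (W \ J) * pp (g c) K (Y \ K)) *
      z₁ * (ε * pp (f c) J (A \ R) * pp (f c) (Y \ K) I * z₂)) * n2

end scalar

/-! ### Minors of the matrix with shifted columns -/

section scalar
variable {c : ℂ} {A B W Y : Finset ℂ}

theorem prod_pp_singleton_left (k : ℂ → ℂ → ℂ) (S T : Finset ℂ) : ∏ z ∈ S, pp k {z} T = pp k S T := by
  simp only [pp_singleton_left]; rfl

/-- On the rows J the Lagrange basis of W is the Lagrange basis of J times a factor 1/g(z, W \ J)
that depends on the column only. -/
theorem alt_lagrange_subset (hc : c ≠ 0) {J : Finset ℂ} (hJ : J ⊆ W) (k : ℂ → ℂ) (η : Finset ℂ) :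
    alt c (fun w z => k z * ∏ v ∈ W.erase w, (g c z v)⁻¹) J η =
      if J.card = η.card then (∏ z ∈ η, k z) * (pp (g c) η (W \ J))⁻¹ else 0 := by
  have h1 : alt c (fun w z => k z * ∏ v ∈ W.erase w, (g c z v)⁻¹) J η =
      alt c (fun w z => (k z * (pp (g c) {z} (W \ J))⁻¹) * ∏ v ∈ J.erase w, (g c z v)⁻¹) J η := by
    refine alt_congr fun w hw z _ => ?_
    have : W.erase w = (W \ J) ∪ J.erase w := by
      ext v; simp only [Finset.mem_erase, Finset.mem_union, Finset.mem_sdiff, ne_eq]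
      by_cases hv : v ∈ J
      · simp [hv, hJ hv]
      · have : v ≠ w := fun e => hv (e ▸ hw)
        simp [hv, this]
    rw [this, Finset.prod_union (Finset.disjoint_of_subset_right (Finset.erase_subset _ _) Finset.sdiff_disjoint),
      pp_singleton_left, Finset.prod_inv_distrib (s := W \ J)]
    ring
  rw [h1, alt_mul_col (c := c)]
  split_ifs with hcard
  · rw [alt_lagrange hc hcard, mul_one, Finset.prod_mul_distrib, Finset.prod_inv_distrib,
      prod_pp_singleton_left]
  · rw [alt_eq_zero hcard, mul_zero]

/-- The columns of the matrix after the part of the columns `I` that contains `r₁` has been selected and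
moved to `I - c`. -/
def shiftedEntry (c ϰ : ℂ) (r₃ : ℂ → ℂ) (A B W Y I : Finset ℂ) (w z : ℂ) : ℂ :=
  if w ∈ A then (if z ∈ I.image (· - c) then -(pp (f c) {z} A)⁻¹ else ϰ) * (t c z w * pp (h c) {z} A)
  else (pp (g c) {z} Y * pp (h c) {z} B) * (∏ v ∈ W.erase w, (g c z v)⁻¹) +
    r₃ w * (ϰ * pp (f c) {w} A)⁻¹ *
      ((-pp (f c) {z} A * (if z ∈ I.image (· - c) then -(pp (f c) {z} A)⁻¹ else ϰ) *
        (pp (g c) {z} Y * (pp (g c) {z} B)⁻¹)) * ∏ v ∈ W.erase w, (g c z v)⁻¹)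

/-- The inner sum of `mixedSum`. -/
def mixedTerm (c ϰ : ℂ) (A B W Y I J : Finset ℂ) : ℂ :=
  ϰ ^ (B \ I).card *
    ∑ η ∈ (B \ I ∪ W \ J).powersetCard (W \ J).card, ∑ ζ ∈ (I.image (· - c) ∪ J).powersetCard J.card,
      pp (g c) η ((B \ I ∪ W \ J) \ η) * pp (h c) η (B \ I) *
      (pp (g c) ζ ((I.image (· - c) ∪ J) \ ζ) * (pp (g c) ζ I)⁻¹) *
      (pp (g c) (η ∪ ζ) Y * (pp (g c) ζ η)⁻¹) *
      (dw c A ((B \ I ∪ W \ J) \ η ∪ (I.image (· - c) ∪ J) \ ζ) *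
        (pp (f c) ((I.image (· - c) ∪ J) \ ζ) A)⁻¹)

/-- The comparison of scalar prefactors for fixed η and ζ. The union η ∪ Θ is (B \ I) ∪ (W \ J), and
ζ ∪ Ξ is (I - c) ∪ J. Products over these unions regroup, h(η, I) cancels g(η, I - c), and powers of
ϰ on J cancel. -/
theorem mixed_term_eq (hc : c ≠ 0) (H : General c A B W Y) {ϰ : ℂ} (hϰ : ϰ ≠ 0) {I J η ζ : Finset ℂ}
    (hI : I ⊆ B) (hJ : J ⊆ W)
    (hη : η ⊆ B \ I ∪ W \ J) (hηc : η.card = (W \ J).card) (hζ : ζ ⊆ I.image (· - c) ∪ J)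
    (hζc : ζ.card = J.card) :
    pp (g c) (W \ J) J * pp (g c) (η ∪ ζ) ((B \ I ∪ W \ J ∪ (I.image (· - c) ∪ J)) \ (η ∪ ζ)) *
      (∏ z ∈ (B \ I ∪ W \ J ∪ (I.image (· - c) ∪ J)) \ (η ∪ ζ),
        if z ∈ I.image (· - c) then -(pp (f c) {z} A)⁻¹ else ϰ) * pp (g c) ζ η *
      ((pp (g c) η Y * pp (h c) η B) * (pp (g c) η J)⁻¹) *
      ((∏ w ∈ J, (ϰ * pp (f c) {w} A)⁻¹) *
        ((∏ z ∈ ζ, (-pp (f c) {z} A * (if z ∈ I.image (· - c) then -(pp (f c) {z} A)⁻¹ else ϰ) *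
          (pp (g c) {z} Y * (pp (g c) {z} B)⁻¹))) * (pp (g c) ζ (W \ J))⁻¹)) =
    (-1) ^ (I.card + J.card) * pp (g c) J (W \ J) * ϰ ^ (B \ I).card *
      (pp (g c) η ((B \ I ∪ W \ J) \ η) * pp (h c) η (B \ I) *
      (pp (g c) ζ ((I.image (· - c) ∪ J) \ ζ) * (pp (g c) ζ I)⁻¹) *
      (pp (g c) (η ∪ ζ) Y * (pp (g c) ζ η)⁻¹) * (pp (f c) ((I.image (· - c) ∪ J) \ ζ) A)⁻¹) := by
  have sJ : J ⊆ A ∪ B ∪ (W ∪ Y) := hJ.trans (by intro x; simp; tauto)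
  have d0 : Disjoint (B \ I) (W \ J) := H.BW.mono Finset.sdiff_subset Finset.sdiff_subset
  have d1 : Disjoint (I.image (· - c)) J := H.disjoint_shift hc hI sJ
  have d2 : Disjoint (I.image (· - c)) (B \ I ∪ W \ J) := H.disjoint_shift hc hI (by intro x; simp; tauto)
  have d01 : Disjoint (B \ I ∪ W \ J) (I.image (· - c) ∪ J) :=
    Finset.disjoint_union_right.2 ⟨d2.symm,
      Finset.disjoint_union_left.2 ⟨H.BW.mono Finset.sdiff_subset hJ, Finset.sdiff_disjoint⟩⟩
  have fne : ∀ z ∈ I.image (· - c) ∪ J, ∀ a ∈ A, f c z a ≠ 0 := by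
    intro z hz a ha
    have := H.avoid hc (z := z) (a := a) (by
      rcases Finset.mem_union.1 hz with h | h
      · exact Finset.mem_union_left _ (Finset.mem_union_left _ (Finset.image_subset_image hI h))
      · exact Finset.mem_union_right _ (hJ h)) ha
    exact div_ne_zero (fun e => this.2 (by linear_combination -e)) (sub_ne_zero.2 this.1)
  have ppne : ∀ S ⊆ I.image (· - c) ∪ J, pp (f c) S A ≠ 0 := fun S hS =>
    pp_ne_zero fun z hz a ha => fne z (hS hz) a ha
  have gI : ∀ x, g c x (x - c + c) = 0 := fun x => by simp [g]
  obtain ⟨D, hD⟩ : ∃ D : ℂ → ℂ, D = fun z => if z ∈ I.image (· - c) then -(pp (f c) {z} A)⁻¹ else ϰ :=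
    ⟨_, rfl⟩
  obtain ⟨Θ, hΘ⟩ : ∃ Θ, (B \ I ∪ W \ J) \ η = Θ := ⟨_, rfl⟩
  obtain ⟨Ξ, hΞ⟩ : ∃ Ξ, (I.image (· - c) ∪ J) \ ζ = Ξ := ⟨_, rfl⟩
  have eΘ : η ∪ Θ = B \ I ∪ W \ J := hΘ ▸ Finset.union_sdiff_of_subset hη
  have eΞ : ζ ∪ Ξ = I.image (· - c) ∪ J := hΞ ▸ Finset.union_sdiff_of_subset hζ
  have dηΘ : Disjoint η Θ := hΘ ▸ Finset.disjoint_sdiff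
  have dζΞ : Disjoint ζ Ξ := hΞ ▸ Finset.disjoint_sdiff
  have sΘ : Θ ⊆ B \ I ∪ W \ J := hΘ ▸ Finset.sdiff_subset
  have sΞ : Ξ ⊆ I.image (· - c) ∪ J := hΞ ▸ Finset.sdiff_subset
  have eQ : (B \ I ∪ W \ J ∪ (I.image (· - c) ∪ J)) \ (η ∪ ζ) = Θ ∪ Ξ := by
    rw [← eΘ, ← eΞ]
    have d3 : Disjoint Θ ζ := d01.mono sΘ hζ
    have d4 : Disjoint η Ξ := d01.mono hη sΞ
    rw [Finset.disjoint_left] at d3 d4 dηΘ dζΞ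
    ext x
    simp only [Finset.mem_sdiff, Finset.mem_union]
    have a1 := @d3 x; have a2 := @d4 x; have a3 := @dηΘ x; have a4 := @dζΞ x
    tauto
  have dΘΞ : Disjoint Θ Ξ := d01.mono sΘ sΞ
  have dηζ : Disjoint η ζ := d01.mono hη hζ
  -- products of the diagonal factors
  have D1 : ∏ z ∈ Θ, D z = ϰ ^ (B \ I).card := by
    rw [Finset.prod_congr rfl (g := fun _ => ϰ), Finset.prod_const]
    · congr 1
      have h1 := congrArg Finset.card eΘ
      rw [Finset.card_union_of_disjoint dηΘ, Finset.card_union_of_disjoint d0] at h1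
      omega
    · intro z hz
      rw [hD]; exact if_neg fun hz' => Finset.disjoint_left.1 d2 hz' (sΘ hz)
  have D2 : (∏ z ∈ ζ, D z) * ∏ z ∈ Ξ, D z = (-1) ^ I.card * (pp (f c) (I.image (· - c)) A)⁻¹ * ϰ ^ J.card := by
    rw [← Finset.prod_union dζΞ, eΞ, Finset.prod_union d1, Finset.prod_congr rfl (s₁ := J) (g := fun _ => ϰ),
      Finset.prod_const, Finset.prod_congr rfl (g := fun z => -(pp (f c) {z} A)⁻¹)]
    · congr 1
      rw [Finset.prod_neg, card_image_sub, Finset.prod_inv_distrib, prod_pp_singleton_left]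
    · intro z hz; rw [hD]; exact if_pos hz
    · intro z hz; rw [hD]; exact if_neg fun hz' => Finset.disjoint_left.1 d1 hz' hz
  have F1 : pp (f c) ζ A * pp (f c) Ξ A = pp (f c) (I.image (· - c)) A * pp (f c) J A := by
    rw [← pp_union_left _ dζΞ, eΞ, pp_union_left _ d1]
  have G1 : pp (g c) ζ Θ * pp (g c) ζ η = pp (g c) ζ (B \ I) * pp (g c) ζ (W \ J) := by
    rw [mul_comm, ← pp_union_right _ dηΘ, eΘ, pp_union_right _ d0]
  have G2 : pp (g c) η ζ * pp (g c) η Ξ = pp (g c) η (I.image (· - c)) * pp (g c) η J := by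
    rw [← pp_union_right _ dζΞ, eΞ, pp_union_right _ d1]
  have G3 : pp (h c) η I * pp (g c) η (I.image (· - c)) = 1 := by
    have : pp (g c) η (I.image (· - c)) = pp (fun x y => g c x (y - c)) η I := by
      rw [pp, pp]
      exact Finset.prod_congr rfl fun x _ => Finset.prod_image fun _ _ _ _ e => sub_left_injective e
    rw [this, ← pp_mul]
    rw [pp_congr (l := fun _ _ => 1)]
    · simp [pp]
    · intro x hx y hy
      have : x - y + c ≠ 0 := by
        refine H.add_ne hc ?_ (by simp [hI hy] : y ∈ _)
        have := hη hx
        simp only [Finset.mem_union, Finset.mem_sdiff] at this ⊢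
        tauto
      rw [h, g, show x - (y - c) = x - y + c by ring]
      field_simp
  have n1 : pp (g c) ζ (B \ I) ≠ 0 := pp_g_ne_zero hc ((d01.mono_right hζ).symm.mono_right Finset.subset_union_left)
  have n2 : pp (g c) ζ (W \ J) ≠ 0 := pp_g_ne_zero hc ((d01.mono_right hζ).symm.mono_right Finset.subset_union_right)
  have n3 : pp (g c) η J ≠ 0 := pp_g_ne_zero hc ((d01.mono_left hη).mono_right Finset.subset_union_right)
  have n4 : pp (g c) ζ η ≠ 0 := pp_g_ne_zero hc dηζ.symm
  have n5 := ppne _ sΞ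
  have n6 := ppne _ (Finset.subset_union_left : I.image (· - c) ⊆ I.image (· - c) ∪ J)
  have n7 := ppne _ (Finset.subset_union_right : J ⊆ I.image (· - c) ∪ J)
  -- Both reorderings cost the same sign, since η and ζ have the sizes of W \ J and J.
  have hsw : pp (g c) (W \ J) J * pp (g c) ζ η = pp (g c) J (W \ J) * pp (g c) η ζ := by
    rw [pp_g_swap c (W \ J) J, pp_g_swap c η ζ, hηc, hζc]; ring
  have P1 : ∏ w ∈ J, (ϰ * pp (f c) {w} A)⁻¹ = (ϰ ^ J.card)⁻¹ * (pp (f c) J A)⁻¹ := by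
    rw [Finset.prod_inv_distrib, Finset.prod_mul_distrib, Finset.prod_const, prod_pp_singleton_left, mul_inv]
  have P2 : ∏ z ∈ ζ, (-pp (f c) {z} A * D z * (pp (g c) {z} Y * (pp (g c) {z} B)⁻¹)) =
      (-1) ^ J.card * pp (f c) ζ A * (∏ z ∈ ζ, D z) * (pp (g c) ζ Y * (pp (g c) ζ B)⁻¹) := by
    rw [Finset.prod_mul_distrib, Finset.prod_mul_distrib, Finset.prod_neg, Finset.prod_mul_distrib,
      Finset.prod_inv_distrib, prod_pp_singleton_left, prod_pp_singleton_left, prod_pp_singleton_left, hζc]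
  have hDz : ∀ z, (if z ∈ I.image (· - c) then -(pp (f c) {z} A)⁻¹ else ϰ) = D z := fun z => by rw [hD]
  simp only [hDz]
  rw [P1, P2, eQ, hΘ, hΞ, Finset.prod_union dΘΞ, D1, pp_union_right _ dΘΞ, pp_union_left _ dηζ,
    pp_union_left _ dηζ, pp_union_left _ dηζ, ← pp_sdiff_right (k := g c) (S := ζ) hI,
    ← pp_sdiff_right (k := h c) (S := η) hI, pow_add]
  have nϰ : ϰ ^ J.card ≠ 0 := pow_ne_zero _ hϰ
  have n8 : pp (g c) η ζ ≠ 0 := pp_g_ne_zero hc dηζ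
  have q1 : pp (g c) ζ Θ * pp (g c) ζ η * (pp (g c) ζ (B \ I))⁻¹ * (pp (g c) ζ (W \ J))⁻¹ = 1 := by
    rw [G1]; field_simp
  have q2 : pp (f c) ζ A * (pp (f c) J A)⁻¹ * (pp (f c) (I.image (· - c)) A)⁻¹ = (pp (f c) Ξ A)⁻¹ := by
    field_simp; linear_combination F1
  have q3 : pp (h c) η I * pp (g c) η Ξ * (pp (g c) η J)⁻¹ = (pp (g c) η ζ)⁻¹ := by
    field_simp; linear_combination pp (h c) η I * G2 + pp (g c) η J * G3
  have q4 : pp (g c) (W \ J) J * (pp (g c) η ζ)⁻¹ = pp (g c) J (W \ J) * (pp (g c) ζ η)⁻¹ := by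
    field_simp; linear_combination hsw
  have q5 : ϰ ^ J.card * (ϰ ^ J.card)⁻¹ = 1 := mul_inv_cancel₀ nϰ
  simp only [mul_inv]
  calc _ = (pp (g c) (W \ J) J * (pp (h c) η I * pp (g c) η Ξ * (pp (g c) η J)⁻¹)) *
        (pp (g c) ζ Θ * pp (g c) ζ η * (pp (g c) ζ (B \ I))⁻¹ * (pp (g c) ζ (W \ J))⁻¹) *
        (pp (f c) ζ A * (pp (f c) J A)⁻¹ * ((∏ z ∈ ζ, D z) * ∏ z ∈ Ξ, D z)) * (ϰ ^ J.card)⁻¹ *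
        (pp (g c) η Θ * pp (g c) ζ Ξ * ϰ ^ (B \ I).card * pp (g c) η Y * pp (h c) η (B \ I) * (-1) ^ J.card *
          pp (g c) ζ Y * (pp (g c) ζ I)⁻¹) := by ring
    _ = (pp (g c) (W \ J) J * (pp (g c) η ζ)⁻¹) * 1 *
        (pp (f c) ζ A * (pp (f c) J A)⁻¹ * (pp (f c) (I.image (· - c)) A)⁻¹) *
        (ϰ ^ J.card * (ϰ ^ J.card)⁻¹) * (-1) ^ I.card *
        (pp (g c) η Θ * pp (g c) ζ Ξ * ϰ ^ (B \ I).card * pp (g c) η Y * pp (h c) η (B \ I) * (-1) ^ J.card *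
          pp (g c) ζ Y * (pp (g c) ζ I)⁻¹) := by rw [q1, q3, D2]; ring
    _ = _ := by rw [q2, q4, q5]; ring

end scalar

section scalar
variable {c : ℂ} {A B W Y : Finset ℂ}

theorem union_sdiff_union {X₀ X₁ η ζ : Finset ℂ} (hd : Disjoint X₀ X₁) (hη : η ⊆ X₀) (hζ : ζ ⊆ X₁) :
    (X₀ ∪ X₁) \ (η ∪ ζ) = X₀ \ η ∪ X₁ \ ζ := by
  ext x
  have b1 := @Finset.disjoint_left.1 hd x
  have b2 := @hη x
  have b3 := @hζ x
  simp only [Finset.mem_sdiff, Finset.mem_union]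
  tauto

theorem mixedSum_eq (c ϰ : ℂ) (r₁ r₃ : ℂ → ℂ) (A B W Y : Finset ℂ) :
    mixedSum c ϰ r₁ r₃ A B W Y = ∑ I ∈ B.powerset, ∑ J ∈ W.powerset,
      (∏ x ∈ I, r₁ x) * (∏ x ∈ J, r₃ x) * (-1) ^ (I.card + J.card) *
        pp (f c) (B \ I) I * pp (g c) J (W \ J) * mixedTerm c ϰ A B W Y I J := rfl

/-- Laplace expansion between the rows A and W. The rows A give `dw` times diagonal factors. Each
row of W is a sum of two multiples of its Lagrange function; J collects the rows that take the r₃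
multiple, with minor columns ζ, while η are the columns of the other rows. Zeros of the entries
confine η to (B \ I) ∪ (W \ J) and ζ to (I - c) ∪ J. -/
theorem alt_shiftedEntry (hc : c ≠ 0) (H : General c A B W Y) {ϰ : ℂ} (hϰ : ϰ ≠ 0) (r₃ : ℂ → ℂ) {I : Finset ℂ}
    (hI : I ⊆ B) :
    alt c (shiftedEntry c ϰ r₃ A B W Y I) (A ∪ W) (I.image (· - c) ∪ (B \ I ∪ W)) =
      pp (g c) A W * ∑ J ∈ W.powerset, (∏ x ∈ J, r₃ x) * ((-1) ^ (I.card + J.card) *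
        pp (g c) J (W \ J) * mixedTerm c ϰ A B W Y I J) := by
  obtain ⟨X, hX⟩ : ∃ X, I.image (· - c) ∪ (B \ I ∪ W) = X := ⟨_, rfl⟩
  rw [hX]
  obtain ⟨D, hD⟩ : ∃ D : ℂ → ℂ, D = fun z => if z ∈ I.image (· - c) then -(pp (f c) {z} A)⁻¹ else ϰ :=
    ⟨_, rfl⟩
  have hDz : ∀ z, (if z ∈ I.image (· - c) then -(pp (f c) {z} A)⁻¹ else ϰ) = D z := fun z => by rw [hD]
  have up : ∀ Q, alt c (shiftedEntry c ϰ r₃ A B W Y I) A Q =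
      (∏ z ∈ Q, D z) * alt c (fun a z => t c z a * pp (h c) {z} A) A Q := by
    intro Q
    rw [← alt_mul_col (c := c)]
    refine alt_congr fun a ha z _ => ?_
    rw [shiftedEntry, if_pos ha, hDz]
  have low : ∀ Z, alt c (shiftedEntry c ϰ r₃ A B W Y I) W Z = ∑ J ∈ W.powerset, ∑ ζ ∈ Z.powerset,
      pp (g c) (W \ J) J * pp (g c) ζ (Z \ ζ) *
      alt c (fun w z => (pp (g c) {z} Y * pp (h c) {z} B) * ∏ v ∈ W.erase w, (g c z v)⁻¹) (W \ J) (Z \ ζ) *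
      ((∏ w ∈ J, r₃ w * (ϰ * pp (f c) {w} A)⁻¹) *
        alt c (fun w z => (-pp (f c) {z} A * D z * (pp (g c) {z} Y * (pp (g c) {z} B)⁻¹)) *
          ∏ v ∈ W.erase w, (g c z v)⁻¹) J ζ) := by
    intro Z
    simp only [← alt_mul_row (c := c)]
    rw [← alt_add]
    refine alt_congr fun w hw z _ => ?_
    rw [shiftedEntry, if_neg (Finset.disjoint_right.1 H.AW hw), hDz]
  rw [alt_union _ H.AW]
  simp only [up, low, Finset.mul_sum]
  rw [Finset.sum_comm]
  refine Finset.sum_congr rfl fun J hJ => ?_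
  rw [Finset.mem_powerset] at hJ
  have sJ : J ⊆ A ∪ B ∪ (W ∪ Y) := hJ.trans (by intro x; simp; tauto)
  have d0 : Disjoint (B \ I) (W \ J) := H.BW.mono Finset.sdiff_subset Finset.sdiff_subset
  have d1 : Disjoint (I.image (· - c)) J := H.disjoint_shift hc hI sJ
  have d2 : Disjoint (I.image (· - c)) (B \ I ∪ W \ J) := H.disjoint_shift hc hI (by intro x; simp; tauto)
  have d01 : Disjoint (B \ I ∪ W \ J) (I.image (· - c) ∪ J) :=
    Finset.disjoint_union_right.2 ⟨d2.symm,
      Finset.disjoint_union_left.2 ⟨H.BW.mono Finset.sdiff_subset hJ, Finset.sdiff_disjoint⟩⟩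
  have hX' : X = (B \ I ∪ W \ J) ∪ (I.image (· - c) ∪ J) := by
    rw [← hX]
    ext x; simp only [Finset.mem_union, Finset.mem_sdiff]
    have := @hJ x; tauto
  simp only [alt_lagrange_subset hc hJ, alt_lagrange_subset hc (Finset.sdiff_subset : W \ J ⊆ W),
    Finset.sdiff_sdiff_eq_self hJ]
  let F : Finset ℂ → Finset ℂ → ℂ := fun η ζ =>
    pp (g c) A W * pp (g c) (η ∪ ζ) (X \ (η ∪ ζ)) *
      ((∏ z ∈ X \ (η ∪ ζ), D z) * alt c (fun a z => t c z a * pp (h c) {z} A) A (X \ (η ∪ ζ))) *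
      (pp (g c) (W \ J) J * pp (g c) ζ η *
        (if (W \ J).card = η.card then
          (∏ z ∈ η, pp (g c) {z} Y * pp (h c) {z} B) * (pp (g c) η J)⁻¹ else 0) *
        ((∏ w ∈ J, r₃ w * (ϰ * pp (f c) {w} A)⁻¹) *
          if J.card = ζ.card then
            (∏ z ∈ ζ, -pp (f c) {z} A * D z * (pp (g c) {z} Y * (pp (g c) {z} B)⁻¹)) *
              (pp (g c) ζ (W \ J))⁻¹ else 0))
  have hF : ∀ Z ∈ X.powerset, ∀ ζ ∈ Z.powerset, pp (g c) A W * pp (g c) Z (X \ Z) *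
      ((∏ z ∈ X \ Z, D z) * alt c (fun a z => t c z a * pp (h c) {z} A) A (X \ Z)) *
      (pp (g c) (W \ J) J * pp (g c) ζ (Z \ ζ) *
        (if (W \ J).card = (Z \ ζ).card then
          (∏ z ∈ Z \ ζ, pp (g c) {z} Y * pp (h c) {z} B) * (pp (g c) (Z \ ζ) J)⁻¹ else 0) *
        ((∏ w ∈ J, r₃ w * (ϰ * pp (f c) {w} A)⁻¹) *
          if J.card = ζ.card then
            (∏ z ∈ ζ, -pp (f c) {z} A * D z * (pp (g c) {z} Y * (pp (g c) {z} B)⁻¹)) *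
              (pp (g c) ζ (W \ J))⁻¹ else 0)) = F (Z \ ζ) ζ := by
    intro Z _ ζ hζ
    simp only [F]
    rw [Finset.sdiff_union_of_subset (Finset.mem_powerset.1 hζ)]
  rw [Finset.sum_congr rfl fun Z hZ => Finset.sum_congr rfl fun ζ hζ => hF Z hZ ζ hζ, hX',
    sum_powerset_powerset_eq d01 F]
  · rw [sum_powerset_eq_powersetCard (n := (W \ J).card)]
    · rw [mixedTerm]
      simp only [Finset.mul_sum]
      refine Finset.sum_congr rfl fun η hη => ?_
      rw [sum_powerset_eq_powersetCard (n := J.card)]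
      · refine Finset.sum_congr rfl fun ζ hζ => ?_
        obtain ⟨hηX, hηc⟩ := Finset.mem_powersetCard.1 hη
        obtain ⟨hζX, hζc⟩ := Finset.mem_powersetCard.1 hζ
        have key := mixed_term_eq hc H hϰ hI hJ hηX hηc hζX hζc
        have eQ : X \ (η ∪ ζ) = (B \ I ∪ W \ J) \ η ∪ (I.image (· - c) ∪ J) \ ζ := by
          rw [hX', union_sdiff_union d01 hηX hζX]
        have hcQ : A.card = (X \ (η ∪ ζ)).card := by
          rw [eQ, Finset.card_union_of_disjoint (d01.mono Finset.sdiff_subset Finset.sdiff_subset),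
            Finset.card_sdiff_of_subset hηX, Finset.card_sdiff_of_subset hζX,
            Finset.card_union_of_disjoint d0, Finset.card_union_of_disjoint d1, card_image_sub]
          have := Finset.card_sdiff_add_card_eq_card hI
          have := H.cardAB
          omega
        have hdw : alt c (fun a z => t c z a * pp (h c) {z} A) A (X \ (η ∪ ζ)) =
            dw c A ((B \ I ∪ W \ J) \ η ∪ (I.image (· - c) ∪ J) \ ζ) := by
          rw [← eQ, dw_eq_alt hc (H.gen.mono (by intro x; simp; tauto)) _ hcQ]
          intro z hz a ha
          refine H.avoid hc ?_ ha
          have hzX := Finset.mem_of_subset Finset.sdiff_subset hz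
          rw [← hX] at hzX
          rcases Finset.mem_union.1 hzX with hz' | hz'
          · exact Finset.mem_union_left _ (Finset.mem_union_left _ (Finset.image_subset_image hI hz'))
          · simp only [Finset.mem_union, Finset.mem_sdiff] at hz' ⊢; tauto
        simp only [F]
        rw [if_pos hηc.symm, if_pos hζc.symm, hdw]
        simp only [hDz] at key
        rw [← hX'] at key
        rw [Finset.prod_mul_distrib (s := J), Finset.prod_mul_distrib (s := η), prod_pp_singleton_left,
          prod_pp_singleton_left]
        linear_combination (pp (g c) A W * (∏ w ∈ J, r₃ w) *
          dw c A ((B \ I ∪ W \ J) \ η ∪ (I.image (· - c) ∪ J) \ ζ)) * key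
      · intro ζ _ hne
        simp only [F]
        rw [if_neg (Ne.symm hne)]; simp
    · intro η _ hne
      refine Finset.sum_eq_zero fun ζ _ => ?_
      simp only [F]
      rw [if_neg (Ne.symm hne)]; simp
  -- A point b - c of I - c is excluded from η by h(b - c, b) = 0, and a point of J by 1/g(z, z) =
  -- 0.
  · intro η ζ hη hn
    obtain ⟨z, hz, hz'⟩ := Finset.not_subset.1 hn
    have hz1 : z ∈ I.image (· - c) ∪ J := by
      rcases Finset.mem_union.1 (hη hz) with h | h
      exacts [absurd h hz', h]
    simp only [F]
    have : (∏ z ∈ η, pp (g c) {z} Y * pp (h c) {z} B) * (pp (g c) η J)⁻¹ = 0 := by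
      rcases Finset.mem_union.1 hz1 with h1 | h1
      · obtain ⟨b, hb, rfl⟩ := Finset.mem_image.1 h1
        rw [Finset.prod_eq_zero hz, zero_mul]
        rw [pp_eq_zero (k := h c) (Finset.mem_singleton_self _) (hI hb), mul_zero]
        simp [h]
      · rw [pp_eq_zero (k := g c) hz h1 (by simp [g])]; simp
    rw [this]; simp
  -- Here 1/g(z, z) = 0 excludes both B \ I, through 1/g(z, B), and W \ J, through 1/g(ζ, W \ J).
  · intro η ζ hζ hn
    obtain ⟨z, hz, hz'⟩ := Finset.not_subset.1 hn
    have hz1 : z ∈ B \ I ∪ W \ J := by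
      rcases Finset.mem_union.1 (hζ hz) with h | h
      exacts [h, absurd h hz']
    simp only [F]
    have : (∏ z ∈ ζ, -pp (f c) {z} A * D z * (pp (g c) {z} Y * (pp (g c) {z} B)⁻¹)) *
              (pp (g c) ζ (W \ J))⁻¹ = 0 := by
      rcases Finset.mem_union.1 hz1 with h1 | h1
      · rw [Finset.prod_eq_zero hz, zero_mul]
        rw [pp_eq_zero (k := g c) (Finset.mem_singleton_self _) (Finset.mem_sdiff.1 h1).1 (by simp [g])]
        simp
      · rw [pp_eq_zero (k := g c) hz h1 (by simp [g])]; simp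
    rw [this]; simp

end scalar

/-! ### The matrix of the theorem as a sum of shifted columns -/

section scalar
variable {c : ℂ} {A B W Y : Finset ℂ}

/-- The entries of the matrix of the determinant representation: rows `A ∪ W`, columns `B ∪ W`. -/
def entry (c ϰ : ℂ) (r₁ r₃ : ℂ → ℂ) (A B W Y : Finset ℂ) (w x : ℂ) : ℂ :=
  if w ∈ A then
    (-1) ^ (A.card + 1) * r₁ x * (∏ v ∈ W, (f c v x)⁻¹) * t c w x * pp (h c) A {x} + ϰ * t c x w * pp (h c) {x} A
  else pp (g c) {x} Y * (1 - r₃ x * ∏ b ∈ B, (f c x b)⁻¹) *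
    ((∏ v ∈ W.erase w, (g c x v)⁻¹) * pp (h c) {x} B + (∏ v ∈ W, (g c x v)⁻¹) *
      ((-1) ^ (A.card + 1) * r₁ x * r₃ w * pp (h c) B {x} /
        (ϰ * pp (f c) {w} A * pp (f c) Y {x} * h c w x)))

/-- The part of `entry` that contains `r₁`. -/
def entryShifted (c ϰ : ℂ) (r₁ r₃ : ℂ → ℂ) (A B W Y : Finset ℂ) (w x : ℂ) : ℂ :=
  if x ∈ B then (r₁ x * ∏ v ∈ W, (f c v x)⁻¹) *
    (if w ∈ A then -(pp (f c) {x - c} A)⁻¹ * (t c (x - c) w * pp (h c) {x - c} A)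
      else r₃ w * (ϰ * pp (f c) {w} A)⁻¹ * (pp (g c) {x - c} Y * (pp (g c) {x - c} B)⁻¹ *
        ∏ v ∈ W.erase w, (g c (x - c) v)⁻¹))
  else 0

theorem pp_h_shift (c : ℂ) (S : Finset ℂ) (x : ℂ) :
    pp (h c) S {x} = (-1) ^ S.card * (pp (g c) {x - c} S)⁻¹ := by
  rw [pp_singleton_right, pp_singleton_left, ← Finset.prod_inv_distrib, ← Finset.prod_const,
    ← Finset.prod_mul_distrib]
  refine Finset.prod_congr rfl fun a _ => ?_
  rw [h, g, inv_div]; ring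

/-- For x in B the r₁ part is a function of x - c, because t(w, x) = t(x - c, w) and h(A, x) is, up
to sign, h(x - c, A) / f(x - c, A). For x in W it vanishes, as 1/f(x, x) = 0. -/
theorem entry_eq_of_mem_A (hc : c ≠ 0) (H : General c A B W Y) (ϰ : ℂ) (r₁ r₃ : ℂ → ℂ) {w x : ℂ}
    (hw : w ∈ A) (hx : x ∈ B ∪ W) :
    entry c ϰ r₁ r₃ A B W Y w x = shiftedEntry c ϰ r₃ A B W Y ∅ w x + entryShifted c ϰ r₁ r₃ A B W Y w x := by
  rw [entry, shiftedEntry, entryShifted, if_pos hw, if_pos hw, if_pos hw]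
  rw [Finset.image_empty, if_neg (by simp)]
  rcases Finset.mem_union.1 hx with hxB | hxW
  · rw [if_pos hxB]
    have hav : ∀ a ∈ A, x - c ≠ a ∧ a - (x - c) ≠ c := fun a ha =>
      H.avoid hc (Finset.mem_union_left _ (Finset.mem_union_left _ (Finset.mem_image_of_mem _ hxB))) ha
    have e1 : t c w x = t c (x - c) w := by
      rw [t, t]; congr 1; ring
    have e2 : pp (h c) A {x} = (-1) ^ A.card * ((pp (f c) {x - c} A)⁻¹ * pp (h c) {x - c} A) := by
      rw [pp_h_shift, pp_f_eq hc, mul_inv]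
      have : pp (h c) {x - c} A ≠ 0 := pp_ne_zero fun z hz a ha => by
        rw [Finset.mem_singleton.1 hz]
        exact div_ne_zero (fun e => (hav a ha).2 (by linear_combination -e)) hc
      field_simp
    rw [e1, e2, pow_succ]
    have : ((-1 : ℂ) ^ A.card) * (-1) ^ A.card = 1 := by rw [← mul_pow]; simp
    linear_combination (-(r₁ x * (∏ v ∈ W, (f c v x)⁻¹) * t c (x - c) w * ((pp (f c) {x - c} A)⁻¹ * pp (h c) {x - c} A))) * this
  · rw [if_neg (Finset.disjoint_right.1 H.BW hxW), Finset.prod_eq_zero hxW (by simp [f])]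
    ring

/-- For x in B the bracket with r₃(x) is 1 because 1/f(x, x) = 0, and the r₁ part is rewritten at x
- c. For x in W the r₁ part vanishes, and the r₃ terms have to be compared only at x = w. -/
theorem entry_eq_of_mem_W (hc : c ≠ 0) (H : General c A B W Y) {ϰ : ℂ} (hϰ : ϰ ≠ 0) (r₁ r₃ : ℂ → ℂ) {w x : ℂ}
    (hw : w ∈ W) (hx : x ∈ B ∪ W) :
    entry c ϰ r₁ r₃ A B W Y w x = shiftedEntry c ϰ r₃ A B W Y ∅ w x + entryShifted c ϰ r₁ r₃ A B W Y w x := by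
  have hwA : w ∉ A := Finset.disjoint_right.1 H.AW hw
  rw [entry, shiftedEntry, entryShifted, if_neg hwA, if_neg hwA, if_neg hwA]
  rw [Finset.image_empty, if_neg (by simp)]
  rcases Finset.mem_union.1 hx with hxB | hxW
  · rw [if_pos hxB, Finset.prod_eq_zero hxB (by simp [f]),
      pp_eq_zero (k := g c) (Finset.mem_singleton_self x) hxB (by simp [g])]
    have mx : x ∈ A ∪ B ∪ (W ∪ Y) := by simp [hxB]
    have e1 : pp (h c) B {x} = (-1) ^ A.card * (pp (g c) {x - c} B)⁻¹ := by
      rw [pp_h_shift, H.cardAB]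
    have e2 : pp (g c) {x} Y * (pp (f c) Y {x})⁻¹ = pp (g c) {x - c} Y := by
      rw [pp_singleton_left, pp_singleton_left, pp_singleton_right, ← Finset.prod_inv_distrib,
        ← Finset.prod_mul_distrib]
      refine Finset.prod_congr rfl fun y hy => ?_
      have h1 : x - y ≠ 0 := sub_ne_zero.2 fun e => Finset.disjoint_left.1 H.BY hxB (e ▸ hy)
      have h2 : y - x + c ≠ 0 := H.add_ne hc (by simp [hy] : y ∈ _) mx
      have h3 : x - c - y ≠ 0 := fun e => h2 (by linear_combination -e)
      have h4 : y - x ≠ 0 := fun e => h1 (by linear_combination -e)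
      rw [g, g, f]; field_simp; ring
    have e3 : ∏ v ∈ W, (g c x v)⁻¹ = (∏ v ∈ W, (f c v x)⁻¹) * ((g c (x - c) w)⁻¹ *
        ∏ v ∈ W.erase w, (g c (x - c) v)⁻¹) := by
      rw [Finset.mul_prod_erase W (fun v => (g c (x - c) v)⁻¹) hw, ← Finset.prod_mul_distrib]
      refine Finset.prod_congr rfl fun v hv => ?_
      have h1 : x - v ≠ 0 := sub_ne_zero.2 fun e => Finset.disjoint_left.1 H.BW hxB (e ▸ hv)
      have h2 : v - x + c ≠ 0 := H.add_ne hc (by simp [hv] : v ∈ _) mx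
      have h4 : v - x ≠ 0 := fun e => h1 (by linear_combination -e)
      rw [g, g, f, inv_div, inv_div, inv_div]; field_simp; ring
    have e4 : (g c (x - c) w)⁻¹ * (h c w x)⁻¹ = -1 := by
      have h2 : w - x + c ≠ 0 := H.add_ne hc (by simp [hw] : w ∈ _) mx
      rw [g, h, inv_div, inv_div]; field_simp; ring
    have e5 : ((-1 : ℂ) ^ A.card) * (-1) ^ A.card = 1 := by rw [← mul_pow]; simp
    rw [e3, e1, pow_succ, ← e2]
    simp only [div_eq_mul_inv, mul_inv]
    linear_combination (-(pp (g c) {x} Y * (∏ v ∈ W, (f c v x)⁻¹) * (∏ v ∈ W.erase w, (g c (x - c) v)⁻¹) *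
      (-1) ^ A.card * (-1) ^ A.card * r₁ x * r₃ w * (pp (g c) {x - c} B)⁻¹ * ϰ⁻¹ * (pp (f c) {w} A)⁻¹ *
      (pp (f c) Y {x})⁻¹)) * e4 + (pp (g c) {x} Y * (∏ v ∈ W, (f c v x)⁻¹) *
      (∏ v ∈ W.erase w, (g c (x - c) v)⁻¹) * r₁ x * r₃ w * (pp (g c) {x - c} B)⁻¹ * ϰ⁻¹ * (pp (f c) {w} A)⁻¹ *
      (pp (f c) Y {x})⁻¹) * e5
  · have hxB : x ∉ B := Finset.disjoint_right.1 H.BW hxW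
    rw [if_neg hxB, Finset.prod_eq_zero (s := W) hxW (by simp [g])]
    -- At a point of W other than w the Lagrange factor is zero on both sides. At x = w the identity
    -- is h/f = 1/g for the products over B, the factors f(w, A) and ϰ cancelling.
    by_cases hxw : x = w
    · subst hxw
      have n1 : pp (f c) {x} A ≠ 0 := H.pp_f_ne hc (by simp [hw]) (by intro x; simp; tauto) (by simpa using hwA)
      have n2 : pp (f c) {x} B ≠ 0 := H.pp_f_ne hc (by simp [hw]) (by intro x; simp; tauto) (by simpa using hxB)
      have e1 : ∏ b ∈ B, (f c x b)⁻¹ = (pp (f c) {x} B)⁻¹ := by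
        rw [pp_singleton_left, Finset.prod_inv_distrib]
      rw [pp_f_eq hc] at n2
      rw [e1, pp_f_eq hc {x} B]
      have n3 := left_ne_zero_of_mul n2
      have n4 := right_ne_zero_of_mul n2
      field_simp
      ring
    · rw [Finset.prod_eq_zero (s := W.erase w) (Finset.mem_erase.2 ⟨hxw, hxW⟩) (by simp [g])]
      ring

/-- Split every column into its two parts, let I be the columns that take the r₁ part, and move
these to I - c. The Vandermonde ratio f(B \ I, I) f(W, I) loses its second factor to the products of
1/f(v, x) in the entries, and `alt_shiftedEntry` evaluates the rest. Columns of W have no r₁ part,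
so I lies in B. -/
theorem alt_entry (hc : c ≠ 0) (H : General c A B W Y) {ϰ : ℂ} (hϰ : ϰ ≠ 0) (r₁ r₃ : ℂ → ℂ) :
    alt c (entry c ϰ r₁ r₃ A B W Y) (A ∪ W) (B ∪ W) = pp (g c) A W * mixedSum c ϰ r₁ r₃ A B W Y := by
  have h1 : alt c (entry c ϰ r₁ r₃ A B W Y) (A ∪ W) (B ∪ W) = alt c (fun w x =>
      shiftedEntry c ϰ r₃ A B W Y ∅ w x + entryShifted c ϰ r₁ r₃ A B W Y w x) (A ∪ W) (B ∪ W) := by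
    refine alt_congr fun w hw x hx => ?_
    rcases Finset.mem_union.1 hw with hw | hw
    exacts [entry_eq_of_mem_A hc H ϰ r₁ r₃ hw hx, entry_eq_of_mem_W hc H hϰ r₁ r₃ hw hx]
  rw [h1, alt_add_col, mixedSum_eq, Finset.mul_sum]
  symm
  refine Finset.sum_subset_zero_on_sdiff (Finset.powerset_mono.2 Finset.subset_union_left) ?_ ?_
  · intro I hI
    simp only [Finset.mem_sdiff, Finset.mem_powerset] at hI
    obtain ⟨x, hxI, hxB⟩ := Finset.not_subset.1 hI.2
    rw [alt_col (hI.1 hxI)]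
    refine Finset.sum_eq_zero fun w _ => ?_
    rw [if_pos hxI, entryShifted, if_neg hxB]
    ring
  · intro I hI
    rw [Finset.mem_powerset] at hI
    have hIx : ∀ x, x ∈ I → x - c ∈ I.image (· - c) := fun x hx => Finset.mem_image_of_mem _ hx
    have h2 : alt c (fun w x => if x ∈ I then entryShifted c ϰ r₁ r₃ A B W Y w x else
        shiftedEntry c ϰ r₃ A B W Y ∅ w x) (A ∪ W) (B ∪ W) =
        alt c (fun w x => (if x ∈ I then r₁ x * ∏ v ∈ W, (f c v x)⁻¹ else 1) *
          shiftedEntry c ϰ r₃ A B W Y I w (if x ∈ I then x - c else x)) (A ∪ W) (B ∪ W) := by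
      refine alt_congr fun w hw x hx => ?_
      by_cases hxI : x ∈ I
      · simp only [if_pos hxI]
        rw [entryShifted, if_pos (hI hxI), shiftedEntry, if_pos (hIx x hxI)]
        congr 1
        split_ifs with hwA
        · rfl
        · have n1 : pp (f c) {x - c} A ≠ 0 := pp_ne_zero fun z hz a ha => by
            rw [Finset.mem_singleton.1 hz]
            have := H.avoid hc (z := x - c) (Finset.mem_union_left _ (Finset.mem_union_left _
              (Finset.mem_image_of_mem _ (hI hxI)))) ha
            exact div_ne_zero (fun e => this.2 (by linear_combination -e)) (sub_ne_zero.2 this.1)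
          -- At a moved column the first term of a lower entry disappears because h(x - c, x) = 0,
          -- and the diagonal factor -1/f(x - c, A) cancels the prefactor -f(x - c, A).
          rw [pp_eq_zero (k := h c) (S := {x - c}) (T := B) (Finset.mem_singleton_self _) (hI hxI)
            (by simp [h]), neg_mul_neg, mul_inv_cancel₀ n1]
          ring
      · simp only [if_neg hxI]
        have hx' : x ∉ I.image (· - c) := by
          refine Finset.disjoint_right.1 (H.disjoint_shift hc hI (S := B ∪ W) ?_) hx
          intro y; simp; tauto
        simp only [shiftedEntry, if_neg hx', Finset.image_empty, Finset.notMem_empty, if_false, one_mul]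
    rw [h2, alt_mul_col (c := c), alt_shift c I]
    · have e1 : (B ∪ W).filter (· ∉ I) = B \ I ∪ W := by
        ext x
        have := @Finset.disjoint_left.1 (H.BW.mono_left hI) x
        simp only [Finset.mem_filter, Finset.mem_union, Finset.mem_sdiff]; tauto
      have e2 : (B ∪ W).filter (· ∈ I) = I := by
        ext x
        have := @hI x
        simp only [Finset.mem_filter, Finset.mem_union]; tauto
      have e3 : (B ∪ W).image (fun x => if x ∈ I then x - c else x) = I.image (· - c) ∪ (B \ I ∪ W) := by
        conv_lhs => rw [← Finset.filter_union_filter_not_eq (· ∈ I) (B ∪ W), Finset.image_union, e2]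
        rw [e1]
        congr 1
        · exact Finset.image_congr fun x hx => if_pos hx
        · rw [Finset.image_congr (g := id), Finset.image_id]
          intro x hx
          rw [← e1] at hx
          exact if_neg (Finset.mem_filter.1 hx).2
      have e4 : ∏ x ∈ B ∪ W, (if x ∈ I then r₁ x * ∏ v ∈ W, (f c v x)⁻¹ else 1) =
          (∏ x ∈ I, r₁ x) * (pp (f c) W I)⁻¹ := by
        rw [Finset.prod_ite, e2, Finset.prod_const_one, mul_one, Finset.prod_mul_distrib]
        congr 1
        rw [← pp_inv, pp, Finset.prod_comm]
      have e5 : pp (fun x y => g c x y / g c x (y - c)) (B \ I ∪ W) I = pp (f c) (B \ I) I * pp (f c) W I := by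
        rw [← pp_union_left _ (H.BW.mono_left Finset.sdiff_subset)]
        refine pp_congr fun x hx y hy => ?_
        have : x - y + c ≠ 0 := by
          refine H.add_ne hc ?_ (by simp [hI hy] : y ∈ _)
          simp only [Finset.mem_union, Finset.mem_sdiff] at hx ⊢; tauto
        rw [g, g, f, show x - (y - c) = x - y + c by ring]
        field_simp
      rw [e1, e2, e3, e4, e5, alt_shiftedEntry hc H hϰ r₃ hI, Finset.mul_sum, Finset.mul_sum, Finset.mul_sum,
        Finset.mul_sum]
      refine Finset.sum_congr rfl fun J hJ => ?_
      have n1 : pp (f c) W I ≠ 0 :=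
        H.pp_f_ne hc (by intro x; simp; tauto) (hI.trans (by intro x; simp; tauto)) (H.BW.mono_left hI).symm
      have n2 := mul_inv_cancel₀ n1
      linear_combination (-((∏ x ∈ I, r₁ x) * (∏ x ∈ J, r₃ x) * (-1) ^ (I.card + J.card) *
        pp (f c) (B \ I) I * pp (g c) J (W \ J) * mixedTerm c ϰ A B W Y I J * pp (g c) A W)) * n2
    · intro x hx y _ _ hy e
      refine H.add_ne hc (x := x) (y := y) ?_ (by simp [hI hy] : y ∈ _) (by rw [e]; ring)
      simp only [Finset.mem_union] at hx ⊢; tauto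
    · exact hc

end scalar

/-! ### Alternants as determinants of indexed matrices -/

section det
variable {c : ℂ}

theorem Delta_eq (c : ℂ) {n : ℕ} (x : Fin n → ℂ) :
    Delta c x = ∏ j, ∏ k, if k < j then g c (x j) (x k) else 1 := by
  refine Finset.prod_congr rfl fun j _ => ?_
  rw [← Finset.prod_filter]
  exact Finset.prod_congr (by ext; simp) fun _ _ => rfl

theorem DeltaPrime_eq (c : ℂ) {n : ℕ} (x : Fin n → ℂ) :
    DeltaPrime c x = ∏ j, ∏ k, if j < k then g c (x j) (x k) else 1 := by
  refine Finset.prod_congr rfl fun j _ => ?_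
  rw [← Finset.prod_filter]
  exact Finset.prod_congr (by ext; simp) fun _ _ => rfl

theorem prod_succAbove_neg_one {n : ℕ} (p : Fin (n + 1)) :
    ∏ k : Fin n, (if p.succAbove k < p then (-1 : ℂ) else 1) = (-1) ^ (p : ℕ) := by
  rw [Finset.prod_ite, Finset.prod_const_one, mul_one, Finset.prod_const]
  congr 1
  simp only [Fin.succAbove_lt_iff_castSucc_lt]
  simp only [Fin.lt_def, Fin.val_castSucc]
  rw [Fin.card_filter_val_lt]
  omega

/-- The sign counts the indices below p, for which the factor g has to be reversed. It is the sign
that cancels the cofactor sign in `alt_image_image`. -/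
theorem Delta_succAbove (c : ℂ) {n : ℕ} (x : Fin (n + 1) → ℂ) (p : Fin (n + 1)) :
    Delta c x = (-1) ^ (p : ℕ) * (∏ k, g c (x (p.succAbove k)) (x p)) * Delta c (x ∘ p.succAbove) := by
  have h1 : Delta c x = (∏ k, if p.succAbove k < p then g c (x p) (x (p.succAbove k)) else 1) *
      ∏ j, ((if p < p.succAbove j then g c (x (p.succAbove j)) (x p) else 1) *
        ∏ k, if p.succAbove k < p.succAbove j then g c (x (p.succAbove j)) (x (p.succAbove k)) else 1) := by
    rw [Delta_eq, Fin.prod_univ_succAbove _ p, Fin.prod_univ_succAbove _ p, if_neg (lt_irrefl p), one_mul]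
    congr 1
    exact Finset.prod_congr rfl fun j _ => Fin.prod_univ_succAbove _ p
  rw [h1, Delta_eq, Finset.prod_mul_distrib, ← mul_assoc, ← prod_succAbove_neg_one p]
  congr 1
  · rw [← Finset.prod_mul_distrib, ← Finset.prod_mul_distrib]
    refine Finset.prod_congr rfl fun k _ => ?_
    rcases lt_or_gt_of_ne (Fin.succAbove_ne p k) with hk | hk
    · rw [if_pos hk, if_neg hk.not_gt, if_pos hk, g_antisymm]; ring
    · rw [if_neg hk.not_gt, if_pos hk, if_neg hk.not_gt]
  · refine Finset.prod_congr rfl fun j _ => Finset.prod_congr rfl fun k _ => ?_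
    simp only [Fin.succAbove_lt_succAbove_iff, Function.comp]

theorem DeltaPrime_succ (c : ℂ) {n : ℕ} (x : Fin (n + 1) → ℂ) :
    DeltaPrime c x = (∏ k : Fin n, g c (x 0) (x k.succ)) * DeltaPrime c (x ∘ Fin.succ) := by
  have h1 : DeltaPrime c x = (∏ k : Fin n, if 0 < k.succ then g c (x 0) (x k.succ) else 1) *
      ∏ j : Fin n, ∏ k : Fin n, if j.succ < k.succ then g c (x j.succ) (x k.succ) else 1 := by
    rw [DeltaPrime_eq, Fin.prod_univ_succ, Fin.prod_univ_succ, if_neg (lt_irrefl _), one_mul]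
    congr 1
    refine Finset.prod_congr rfl fun j _ => ?_
    rw [Fin.prod_univ_succ, if_neg (by simp), one_mul]
  rw [h1, DeltaPrime_eq]
  simp only [Fin.succ_pos, if_true, Fin.succ_lt_succ_iff, Function.comp]

theorem DeltaPrime_append (c : ℂ) {m n : ℕ} (x : Fin m → ℂ) (y : Fin n → ℂ) :
    DeltaPrime c (Fin.append x y) = DeltaPrime c x * DeltaPrime c y * ∏ i, ∏ j, g c (x i) (y j) := by
  rw [DeltaPrime_eq, DeltaPrime_eq, DeltaPrime_eq, Fin.prod_univ_add,
    Finset.prod_congr rfl fun j _ => Fin.prod_univ_add _,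
    Finset.prod_congr (s₁ := (Finset.univ : Finset (Fin n))) rfl fun j _ => Fin.prod_univ_add _,
    Finset.prod_mul_distrib, Finset.prod_mul_distrib]
  have h1 : ∀ (i : Fin m) (j : Fin n), Fin.castAdd n i < Fin.natAdd m j := fun i j => by
    simp [Fin.lt_def]; omega
  simp only [Fin.append_left, Fin.append_right, h1, if_true, (h1 _ _).not_gt, if_false, Finset.prod_const_one,
    one_mul]
  have h2 : ∀ i j : Fin m, Fin.castAdd n i < Fin.castAdd n j ↔ i < j := fun i j => by simp only [Fin.lt_def, Fin.val_castAdd]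
  have h3 : ∀ i j : Fin n, Fin.natAdd m i < Fin.natAdd m j ↔ i < j := fun i j => by simp only [Fin.lt_def, Fin.val_natAdd, add_lt_add_iff_left]
  simp only [h2, h3]
  ring

theorem alt_image_image (c : ℂ) (φ : ℂ → ℂ → ℂ) {n : ℕ} {w x : Fin n → ℂ} (hw : Function.Injective w)
    (hx : Function.Injective x) :
    alt c φ (Finset.univ.image w) (Finset.univ.image x) =
      DeltaPrime c w * Delta c x * (Matrix.of fun i j => φ (w i) (x j)).det := by
  induction n with
  | zero => simp [DeltaPrime, Delta]
  | succ n ih =>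
    have e1 : Finset.univ.image w = insert (w 0) (Finset.univ.image (w ∘ Fin.succ)) := by
      ext z; simp [Fin.exists_fin_succ, eq_comm]
    have e2 : w 0 ∉ Finset.univ.image (w ∘ Fin.succ) := by
      simp only [Finset.mem_image, Finset.mem_univ, true_and, Function.comp, not_exists]
      exact fun k e => Fin.succ_ne_zero k (hw e)
    rw [e1, alt_insert e2, Finset.sum_image hx.injOn, Matrix.det_succ_row_zero, Finset.mul_sum]
    refine Finset.sum_congr rfl fun p _ => ?_
    have e3 : (Finset.univ.image x).erase (x p) = Finset.univ.image (x ∘ p.succAbove) := by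
      rw [← Finset.image_erase hx]
      ext z
      simp only [Finset.mem_image, Finset.mem_erase, Finset.mem_univ, and_true, true_and, Function.comp]
      constructor
      · rintro ⟨q, hq, rfl⟩
        obtain ⟨k, rfl⟩ := Fin.exists_succAbove_eq hq
        exact ⟨k, rfl⟩
      · rintro ⟨k, rfl⟩
        exact ⟨_, Fin.succAbove_ne p k, rfl⟩
    rw [e3, ih (hw.comp (Fin.succ_injective n)) (hx.comp Fin.succAbove_right_injective),
      Delta_succAbove c x p, DeltaPrime_succ, pp_singleton_left, pp_singleton_right,
      Finset.prod_image (hx.comp Fin.succAbove_right_injective).injOn,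
      Finset.prod_image (hw.comp (Fin.succ_injective n)).injOn]
    have e4 : ((-1 : ℂ) ^ (p : ℕ)) * (-1) ^ (p : ℕ) = 1 := by rw [← mul_pow]; simp
    have e5 : (Matrix.of fun i j => φ ((w ∘ Fin.succ) i) ((x ∘ p.succAbove) j)) =
      (Matrix.of fun i j => φ (w i) (x j)).submatrix Fin.succ p.succAbove := rfl
    rw [e5]
    simp only [Function.comp, Matrix.of_apply]
    linear_combination (-(φ (w 0) (x p) * (∏ i, g c (x (p.succAbove i)) (x p)) * (∏ i : Fin n, g c (w 0) (w i.succ)) *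
      (DeltaPrime c (w ∘ Fin.succ) * Delta c (x ∘ p.succAbove) *
      ((Matrix.of fun i j => φ (w i) (x j)).submatrix Fin.succ p.succAbove).det))) * e4

end det

/-! ### Universality of vacuum expectation values -/

/-- A model together with the space on which it acts. -/
structure BModel (c : ℂ) where
  V : Type u
  [addCommGroup : AddCommGroup V]
  [module : Module ℂ V]
  M : Model c V

attribute [instance] BModel.addCommGroup BModel.module

section universality
variable {c : ℂ}

/-- The monomial in the vacuum eigenvalues described by a multiset of pairs (index, point). -/
def lamMono (s : Multiset (Fin 3 × ℂ)) (X : BModel.{u} c) : ℂ := (s.map fun p => X.M.lam p.1 p.2).prod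

/-- The span of the monomials with prescribed indices and points, as functions of the model. -/
def lamSpan (c : ℂ) (r : Multiset (Fin 3)) (z : Multiset ℂ) : Submodule ℂ (BModel.{u} c → ℂ) :=
  Submodule.span ℂ (lamMono '' {s | s.map Prod.fst = r ∧ s.map Prod.snd = z})

theorem lamMono_mem (s : Multiset (Fin 3 × ℂ)) :
    (lamMono s : BModel.{u} c → ℂ) ∈ lamSpan c (s.map Prod.fst) (s.map Prod.snd) :=
  Submodule.subset_span ⟨s, ⟨rfl, rfl⟩, rfl⟩

theorem lamMono_mul_mem (s : Multiset (Fin 3 × ℂ)) {r : Multiset (Fin 3)} {z : Multiset ℂ}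
    {F : BModel.{u} c → ℂ} (hF : F ∈ lamSpan c r z) :
    (lamMono s * F) ∈ lamSpan c (s.map Prod.fst + r) (s.map Prod.snd + z) := by
  induction hF using Submodule.span_induction with
  | mem F hF =>
    obtain ⟨s', ⟨rfl, rfl⟩, rfl⟩ := hF
    refine Submodule.subset_span ⟨s + s', ⟨by simp, by simp⟩, ?_⟩
    funext X; simp [lamMono]
  | zero => rw [mul_zero]; exact Submodule.zero_mem _
  | add F G _ _ hF hG => rw [mul_add]; exact Submodule.add_mem _ hF hG
  | smul a F _ hF => rw [mul_smul_comm]; exact Submodule.smul_mem _ _ hF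

/-- The product of the operators `T_{ij}(z)` along a list of triples `(i, j, z)`. -/
def Model.wordOp {V : Type*} [AddCommGroup V] [Module ℂ V] (M : Model c V) (w : List (Fin 3 × Fin 3 × ℂ)) :
    Module.End ℂ V :=
  (w.map fun p => M.T p.1 p.2.1 p.2.2).prod

/-- The vacuum expectation value of a word. -/
def Model.vev {V : Type*} [AddCommGroup V] [Module ℂ V] (M : Model c V) (w : List (Fin 3 × Fin 3 × ℂ)) : ℂ :=
  M.dualVac (M.wordOp w M.vac)

/-- The height of `T_{ij}`. -/
def height (p : Fin 3 × Fin 3 × ℂ) : ℤ := (p.2.1 : ℕ) - (p.1 : ℕ)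

/-- A bounded quantity that grows when creation operators are moved to the left. -/
def disorder : List (Fin 3 × Fin 3 × ℂ) → ℤ
  | [] => 0
  | p :: l => height p * l.length + disorder l

theorem height_le (p : Fin 3 × Fin 3 × ℂ) : height p ≤ 2 := by
  have := p.2.1.isLt; rw [height]; omega

theorem disorder_le (w : List (Fin 3 × Fin 3 × ℂ)) : disorder w ≤ 2 * w.length ^ 2 := by
  induction w with
  | nil => simp [disorder]
  | cons p l ih =>
    rw [disorder, List.length_cons]
    have := mul_le_mul_of_nonneg_right (height_le p) (Int.natCast_nonneg l.length)
    push_cast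
    nlinarith

/-- Only the two letters change, their total height is preserved, and the left one is weighted by
one letter more than the right one. -/
theorem disorder_lt {w₁ w₂ : List (Fin 3 × Fin 3 × ℂ)} {p q p' q' : Fin 3 × Fin 3 × ℂ}
    (hsum : height p' + height q' = height p + height q) (hlt : height p < height p') :
    disorder (w₁ ++ p :: q :: w₂) < disorder (w₁ ++ p' :: q' :: w₂) := by
  induction w₁ with
  | nil =>
    simp only [List.nil_append, disorder, List.length_cons]
    push_cast
    nlinarith
  | cons r l ih => simpa [disorder] using ih

theorem exists_descent (w : List (Fin 3 × Fin 3 × ℂ)) :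
    (∃ w₁ p q w₂, w = w₁ ++ p :: q :: w₂ ∧ height p < height q) ∨
      w.Pairwise (fun p q => height q ≤ height p) := by
  induction w with
  | nil => exact Or.inr List.Pairwise.nil
  | cons p l ih =>
    rcases ih with ⟨w₁, q, r, w₂, rfl, h⟩ | h
    · exact Or.inl ⟨p :: w₁, q, r, w₂, rfl, h⟩
    · cases l with
      | nil => exact Or.inr (List.pairwise_singleton _ _)
      | cons q l =>
        by_cases hpq : height p < height q
        · exact Or.inl ⟨[], p, q, l, rfl, hpq⟩
        · refine Or.inr (List.pairwise_cons.2 ⟨fun r hr => ?_, h⟩)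
          rcases List.mem_cons.1 hr with rfl | hr
          · omega
          · have := (List.pairwise_cons.1 h).1 r hr; omega

theorem wordOp_vac_of_height_nonpos {V : Type*} [AddCommGroup V] [Module ℂ V] (M : Model c V)
    {w : List (Fin 3 × Fin 3 × ℂ)} (h : ∀ p ∈ w, height p ≤ 0) :
    M.wordOp w M.vac =
      if ∀ p ∈ w, height p = 0 then (w.map fun p => M.lam p.1 p.2.2).prod • M.vac else 0 := by
  induction w with
  | nil => simp [Model.wordOp]
  | cons p l ih =>
    have e : M.wordOp (p :: l) M.vac = M.T p.1 p.2.1 p.2.2 (M.wordOp l M.vac) := by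
      simp [Model.wordOp, Module.End.mul_apply]
    rw [e, ih fun q hq => h q (List.mem_cons_of_mem _ hq)]
    have hp := h p List.mem_cons_self
    by_cases hl : ∀ q ∈ l, height q = 0
    · rw [if_pos hl, map_smul]
      obtain ⟨i, j, z⟩ := p
      rcases eq_or_lt_of_le hp with h0 | h0
      · have hij : j = i := by
          have : ((j : ℕ) : ℤ) - (i : ℕ) = 0 := h0
          ext; omega
        subst hij
        rw [if_pos (by simpa [h0] using hl), M.diag_vac, smul_smul, List.map_cons, List.prod_cons, mul_comm]
      · have hij : j < i := by
          have : ((j : ℕ) : ℤ) - (i : ℕ) < 0 := h0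
          rw [Fin.lt_def]; omega
        rw [M.lower_vac j i z hij, smul_zero, if_neg]
        intro hall; have := hall _ List.mem_cons_self; omega
    · rw [if_neg hl, map_zero, if_neg]
      exact fun hall => hl fun q hq => hall q (List.mem_cons_of_mem _ hq)

/-- If l - k exceeds j - i, then k < i or j < l. The relation as given has exchange terms starting
with T_{kj}, which is higher than T_{ij} in the first case; the relation for the opposite order has
terms starting with T_{il}, which is higher in the second case. Both kinds keep the row indices and
the points of the pair. -/
theorem rtt_reorder {p q : Fin 3 × Fin 3 × ℂ} (hne : p.2.2 ≠ q.2.2) (h : height p < height q) :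
    ∃ (α β γ : ℂ) (p₁ q₁ p₂ q₂ : Fin 3 × Fin 3 × ℂ),
      (∀ X : BModel.{u} c, X.M.T p.1 p.2.1 p.2.2 * X.M.T q.1 q.2.1 q.2.2 =
        α • (X.M.T q.1 q.2.1 q.2.2 * X.M.T p.1 p.2.1 p.2.2) +
        β • (X.M.T p₁.1 p₁.2.1 p₁.2.2 * X.M.T q₁.1 q₁.2.1 q₁.2.2) +
        γ • (X.M.T p₂.1 p₂.2.1 p₂.2.2 * X.M.T q₂.1 q₂.2.1 q₂.2.2)) ∧
      (∀ p' q', (p', q') = (p₁, q₁) ∨ (p', q') = (p₂, q₂) →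
        height p' + height q' = height p + height q ∧ height p < height p' ∧
        ({p'.1, q'.1} : Multiset (Fin 3)) = {p.1, q.1} ∧ ({p'.2.2, q'.2.2} : Multiset ℂ) = {p.2.2, q.2.2}) := by
  obtain ⟨i, j, x⟩ := p
  obtain ⟨k, l, y⟩ := q
  simp only [height] at h hne ⊢
  by_cases hki : k < i
  · refine ⟨(-1 : ℂ) ^ ((par i + par j) * (par k + par l)), (-1 : ℂ) ^ (par i * (par k + par l) + par k * par l) * g c x y,
      -((-1 : ℂ) ^ (par i * (par k + par l) + par k * par l) * g c x y), (k, j, y), (i, l, x), (k, j, x), (i, l, y),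
      fun X => ?_, ?_⟩
    · have := X.M.rtt i j k l x y hne
      rw [sub_eq_iff_eq_add] at this
      rw [this]; module
    · rw [Fin.lt_def] at hki
      rintro p' q' (h' | h') <;> obtain ⟨rfl, rfl⟩ := Prod.mk.inj h' <;> simp only
      · exact ⟨by ring, by omega, Multiset.pair_comm _ _, Multiset.pair_comm _ _⟩
      · exact ⟨by ring, by omega, Multiset.pair_comm _ _, trivial⟩
  · have hjl : j < l := by rw [Fin.lt_def] at *; omega
    refine ⟨(-1 : ℂ) ^ ((par i + par j) * (par k + par l)),
      -((-1 : ℂ) ^ ((par i + par j) * (par k + par l)) * ((-1 : ℂ) ^ (par k * (par i + par j) + par i * par j) * g c y x)),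
      (-1 : ℂ) ^ ((par i + par j) * (par k + par l)) * ((-1 : ℂ) ^ (par k * (par i + par j) + par i * par j) * g c y x),
      (i, l, x), (k, j, y), (i, l, y), (k, j, x), fun X => ?_, ?_⟩
    · have := X.M.rtt k l i j y x hne.symm
      rw [sub_eq_iff_eq_add, mul_comm (par k + par l)] at this
      rw [this]
      have hs : (-1 : ℂ) ^ ((par i + par j) * (par k + par l)) * (-1 : ℂ) ^ ((par i + par j) * (par k + par l)) = 1 := by
        rw [← mul_pow]; simp
      generalize (-1 : ℂ) ^ ((par i + par j) * (par k + par l)) = s at hs ⊢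
      generalize ((-1 : ℂ) ^ (par k * (par i + par j) + par i * par j) * g c y x) = e
      calc X.M.T i j x * X.M.T k l y = (s * s) • (X.M.T i j x * X.M.T k l y) := by rw [hs, one_smul]
        _ = _ := by module
    · rw [Fin.lt_def] at hjl
      rintro p' q' (h' | h') <;> obtain ⟨rfl, rfl⟩ := Prod.mk.inj h' <;> simp only
      · exact ⟨by ring, by omega, trivial, trivial⟩
      · exact ⟨by ring, by omega, trivial, Multiset.pair_comm _ _⟩

/-- Induction on the distance of `disorder` from its upper bound: `rtt_reorder` replaces a word with
an ascent of heights by more ordered words with the same row indices and points. Distinctness of the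
points is what allows the relation to be applied. Since diagonal operators have equal row and column
index, the surviving monomials have the row indices of the word as their indices. -/
theorem vev_mem_lamSpan (w : List (Fin 3 × Fin 3 × ℂ)) (hw : (w.map fun p => p.2.2).Nodup) :
    (fun X : BModel.{u} c => X.M.vev w) ∈
      lamSpan c (w.map fun p => p.1 : Multiset (Fin 3)) (w.map fun p => p.2.2 : Multiset ℂ) := by
  obtain ⟨n, hn⟩ : ∃ n, n = (2 * (w.length : ℤ) ^ 2 - disorder w).toNat := ⟨_, rfl⟩
  induction n using Nat.strong_induction_on generalizing w with
  | _ n ih =>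
  rcases exists_descent w with ⟨w₁, p, q, w₂, rfl, hpq⟩ | hsorted
  · have hne : p.2.2 ≠ q.2.2 := by
      simp only [List.map_append, List.map_cons] at hw
      have := (List.nodup_append.1 hw).2.1
      simp only [List.nodup_cons, List.mem_cons, not_or] at this
      exact this.1.1
    obtain ⟨α, β, γ, p₁, q₁, p₂, q₂, hop, hpr⟩ := rtt_reorder.{u} (c := c) hne hpq
    have main : ∀ p' q' : Fin 3 × Fin 3 × ℂ, height p' + height q' = height p + height q → height p < height p' →
        ({p'.1, q'.1} : Multiset (Fin 3)) = {p.1, q.1} → ({p'.2.2, q'.2.2} : Multiset ℂ) = {p.2.2, q.2.2} →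
        (fun X : BModel.{u} c => X.M.vev (w₁ ++ p' :: q' :: w₂)) ∈
          lamSpan c ((w₁ ++ p :: q :: w₂).map fun p => p.1 : Multiset (Fin 3))
            ((w₁ ++ p :: q :: w₂).map fun p => p.2.2 : Multiset ℂ) := by
      intro p' q' hsum hlt hrow hpt
      have e1 : (((w₁ ++ p' :: q' :: w₂).map fun p => p.1 : List (Fin 3)) : Multiset (Fin 3)) =
          ((w₁ ++ p :: q :: w₂).map fun p => p.1 : List (Fin 3)) := by
        have : ∀ a b : Fin 3 × Fin 3 × ℂ, (((w₁ ++ a :: b :: w₂).map fun p => p.1 : List (Fin 3)) : Multiset (Fin 3)) =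
            (w₁.map fun p => p.1 : List (Fin 3)) + ({a.1, b.1} + (w₂.map fun p => p.1 : List (Fin 3))) := by
          intro a b; simp only [List.map_append, List.map_cons, ← Multiset.coe_add]; rfl
        rw [this, this, hrow]
      have e2 : (((w₁ ++ p' :: q' :: w₂).map fun p => p.2.2 : List ℂ) : Multiset ℂ) =
          ((w₁ ++ p :: q :: w₂).map fun p => p.2.2 : List ℂ) := by
        have : ∀ a b : Fin 3 × Fin 3 × ℂ, (((w₁ ++ a :: b :: w₂).map fun p => p.2.2 : List ℂ) : Multiset ℂ) =
            (w₁.map fun p => p.2.2 : List ℂ) + ({a.2.2, b.2.2} + (w₂.map fun p => p.2.2 : List ℂ)) := by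
          intro a b; simp only [List.map_append, List.map_cons, ← Multiset.coe_add]; rfl
        rw [this, this, hpt]
      rw [← e1, ← e2]
      refine ih _ ?_ _ ?_ rfl
      · rw [hn]
        have h1 := disorder_lt (w₁ := w₁) (w₂ := w₂) hsum hlt
        have h2 := disorder_le (w₁ ++ p' :: q' :: w₂)
        simp only [List.length_append, List.length_cons] at h2 ⊢
        omega
      · rw [← Multiset.coe_nodup, e2, Multiset.coe_nodup]; exact hw
    have hsplit : (fun X : BModel.{u} c => X.M.vev (w₁ ++ p :: q :: w₂)) =
        α • (fun X : BModel.{u} c => X.M.vev (w₁ ++ q :: p :: w₂)) +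
        β • (fun X : BModel.{u} c => X.M.vev (w₁ ++ p₁ :: q₁ :: w₂)) +
        γ • (fun X : BModel.{u} c => X.M.vev (w₁ ++ p₂ :: q₂ :: w₂)) := by
      funext X
      have e : ∀ a b : Fin 3 × Fin 3 × ℂ, X.M.vev (w₁ ++ a :: b :: w₂) =
          X.M.dualVac ((X.M.wordOp w₁ * (X.M.T a.1 a.2.1 a.2.2 * X.M.T b.1 b.2.1 b.2.2) * X.M.wordOp w₂) X.M.vac) := by
        intro a b
        simp only [Model.vev, Model.wordOp, List.map_append, List.map_cons, List.prod_append, List.prod_cons, mul_assoc]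
      simp only [Pi.add_apply, Pi.smul_apply, e, hop X, mul_add, add_mul, mul_smul_comm, smul_mul_assoc,
        LinearMap.add_apply, LinearMap.smul_apply, map_add, map_smul]
    rw [hsplit]
    refine Submodule.add_mem _ (Submodule.add_mem _ (Submodule.smul_mem _ _ ?_) (Submodule.smul_mem _ _ ?_))
      (Submodule.smul_mem _ _ ?_)
    · exact main q p (add_comm _ _) hpq (Multiset.pair_comm _ _) (Multiset.pair_comm _ _)
    · obtain ⟨a1, a2, a3, a4⟩ := hpr p₁ q₁ (Or.inl rfl)
      exact main _ _ a1 a2 a3 a4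
    · obtain ⟨a1, a2, a3, a4⟩ := hpr p₂ q₂ (Or.inr rfl)
      exact main _ _ a1 a2 a3 a4
  -- In a word with nonincreasing heights, a creation operator anywhere forces one in front, which
  -- the dual vacuum kills. Otherwise the word acts on the vacuum by zero or, if all letters are
  -- diagonal, by a monomial.
  · by_cases hneg : ∀ p ∈ w, height p ≤ 0
    · have e : (fun X : BModel.{u} c => X.M.vev w) =
          if ∀ p ∈ w, height p = 0 then
            lamMono (w.map fun p => (p.1, p.2.2) : Multiset (Fin 3 × ℂ)) else 0 := by
        funext X
        rw [Model.vev, wordOp_vac_of_height_nonpos X.M hneg]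
        split_ifs
        · simp [X.M.dualVac_vac, lamMono, Function.comp_def]
        · simp
      rw [e]
      split_ifs
      · have := lamMono_mem.{u} (c := c) (w.map fun p => (p.1, p.2.2) : Multiset (Fin 3 × ℂ))
        simpa [Function.comp_def] using this
      · exact Submodule.zero_mem _
    · push Not at hneg
      obtain ⟨p, hp, hpos⟩ := hneg
      cases w with
      | nil => simp at hp
      | cons q l =>
        have hq : 0 < height q := by
          rcases List.mem_cons.1 hp with rfl | hp
          · exact hpos
          · exact hpos.trans_le ((List.pairwise_cons.1 hsorted).1 p hp)
        have e : (fun X : BModel.{u} c => X.M.vev (q :: l)) = 0 := by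
          funext X
          have h1 : q.1 < q.2.1 := by rw [Fin.lt_def]; rw [height] at hq; omega
          have h2 := LinearMap.congr_fun (X.M.dualVac_upper q.1 q.2.1 q.2.2 h1) (X.M.wordOp l X.M.vac)
          simpa [Model.vev, Model.wordOp, Module.End.mul_apply] using h2
        rw [e]; exact Submodule.zero_mem _

end universality

theorem neg_one_pow_congr {a b : ℕ} (h : a % 2 = b % 2) : (-1 : ℂ) ^ a = (-1) ^ b := by
  rw [neg_one_pow_eq_pow_mod_two, h, ← neg_one_pow_eq_pow_mod_two]

/-! ### Composite models and parity operators -/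

section graded
variable {c : ℂ} {V W : Type*} [AddCommGroup V] [Module ℂ V] [AddCommGroup W] [Module ℂ W]

/-- A parity operator compatible with a model. -/
structure Parity (M : Model c V) where
  Θ : Module.End ℂ V
  sq : Θ * Θ = 1
  comm : ∀ (i j : Fin 3) (u : ℂ), M.T i j u * Θ = ((-1 : ℂ) ^ (par i + par j)) • (Θ * M.T i j u)
  vac : Θ M.vac = M.vac
  dualVac : M.dualVac ∘ₗ Θ = M.dualVac

theorem Parity.comm_pow {M : Model c V} (P : Parity M) (i j : Fin 3) (u : ℂ) (n : ℕ) :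
    M.T i j u * P.Θ ^ n = ((-1 : ℂ) ^ (n * (par i + par j))) • (P.Θ ^ n * M.T i j u) := by
  induction n with
  | zero => simp
  | succ n ih =>
    rw [pow_succ, ← mul_assoc, ih, smul_mul_assoc, mul_assoc, P.comm, mul_smul_comm, smul_smul, ← mul_assoc,
      ← pow_add, add_mul, one_mul]

theorem Parity.pow_vac {M : Model c V} (P : Parity M) (n : ℕ) : (P.Θ ^ n) M.vac = M.vac := by
  induction n with
  | zero => simp
  | succ n ih => rw [pow_succ, Module.End.mul_apply, P.vac, ih]

theorem Parity.dualVac_pow {M : Model c V} (P : Parity M) (n : ℕ) : M.dualVac ∘ₗ (P.Θ ^ n) = M.dualVac := by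
  induction n with
  | zero => ext; simp
  | succ n ih => rw [pow_succ', Module.End.mul_eq_comp, ← LinearMap.comp_assoc, P.dualVac, ih]

variable (A : Model c V) (P : Parity A) (B : Model c W)

/-- The monodromy matrix of a composite model. -/
def tensorT (i j : Fin 3) (u : ℂ) : Module.End ℂ (V ⊗[ℂ] W) :=
  ∑ k, TensorProduct.mapBilinear (.id ℂ) V W V W (P.Θ ^ (par k + par j) * A.T i k u) (B.T k j u)

/-- The bilinear building block of products in a composite model. -/
def tensorBlock (n : ℕ) : Module.End ℂ V →ₗ[ℂ] Module.End ℂ W →ₗ[ℂ] Module.End ℂ (V ⊗[ℂ] W) :=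
  (TensorProduct.mapBilinear (.id ℂ) V W V W).comp (LinearMap.mulLeft ℂ (P.Θ ^ n))

theorem tensorT_mul (i j k l : Fin 3) (u v : ℂ) :
    tensorT A P B i j u * tensorT A P B k l v = ∑ m, ∑ n,
      ((-1 : ℂ) ^ ((par n + par l) * (par i + par m))) •
        tensorBlock A P (W := W) (par m + par j + (par n + par l)) (A.T i m u * A.T k n v) (B.T m j u * B.T n l v) := by
  rw [tensorT, tensorT, Finset.sum_mul_sum]
  refine Finset.sum_congr rfl fun m _ => Finset.sum_congr rfl fun n _ => ?_
  rw [tensorBlock, LinearMap.comp_apply, TensorProduct.mapBilinear_apply, TensorProduct.mapBilinear_apply,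
    TensorProduct.mapBilinear_apply, ← TensorProduct.map_mul, LinearMap.mulLeft_apply,
    mul_assoc, ← mul_assoc (A.T i m u), P.comm_pow, smul_mul_assoc, mul_smul_comm, TensorProduct.map_smul_left,
    pow_add P.Θ (par m + par j)]
  simp only [mul_assoc]

/-- The relation in the form R T T = T T R, with the exchange terms distributed over the two sides.
In this form it can be carried through one tensor factor after the other. -/
theorem rtt_symm_form (M : Model c V) (i j k l : Fin 3) {u v : ℂ} (huv : u ≠ v) :
    M.T i j u * M.T k l v + ((-1 : ℂ) ^ (par i * (par k + par l) + par k * par l) * g c u v) • (M.T k j u * M.T i l v) =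
      ((-1 : ℂ) ^ ((par i + par j) * (par k + par l))) • (M.T k l v * M.T i j u) +
      ((-1 : ℂ) ^ (par i * (par k + par l) + par k * par l) * g c u v) • (M.T k j v * M.T i l u) := by
  have := M.rtt i j k l u v huv
  rw [sub_eq_iff_eq_add] at this
  rw [this]; module

-- The R-matrix passes first through the factor A (`e1`), then through B (`e2`); between the two
-- steps the summation indices m, n of the exchange terms are interchanged. The powers of Θ replace
-- the graded tensor product by the ordinary one.
set_option maxRecDepth 4000 in
theorem tensorT_rtt (i j k l : Fin 3) {u v : ℂ} (huv : u ≠ v) :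
    tensorT A P B i j u * tensorT A P B k l v
        - ((-1 : ℂ) ^ ((par i + par j) * (par k + par l))) • (tensorT A P B k l v * tensorT A P B i j u)
      = ((-1 : ℂ) ^ (par i * (par k + par l) + par k * par l) * g c u v) •
          (tensorT A P B k j v * tensorT A P B i l u - tensorT A P B k j u * tensorT A P B i l v) := by
  suffices h : tensorT A P B i j u * tensorT A P B k l v +
      ((-1 : ℂ) ^ (par i * (par k + par l) + par k * par l) * g c u v) •
        (tensorT A P B k j u * tensorT A P B i l v) =
      ((-1 : ℂ) ^ ((par i + par j) * (par k + par l))) • (tensorT A P B k l v * tensorT A P B i j u) +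
      ((-1 : ℂ) ^ (par i * (par k + par l) + par k * par l) * g c u v) •
        (tensorT A P B k j v * tensorT A P B i l u) by
    rw [sub_eq_iff_eq_add, smul_sub]
    rw [← eq_sub_iff_add_eq] at h
    rw [h]; abel
  -- These four sign identities concern parities only and are settled by running through all
  -- indices.
  have s1 : ∀ m n, (-1 : ℂ) ^ (par i * (par k + par l) + par k * par l) * (-1) ^ ((par n + par l) * (par k + par m)) =
      (-1) ^ ((par n + par l) * (par i + par m)) * (-1) ^ (par i * (par k + par n) + par k * par n) := by
    intro m n; rw [← pow_add, ← pow_add]; apply neg_one_pow_congr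
    clear * -; revert i k l m n; decide
  have s2 : ∀ m n, (-1 : ℂ) ^ ((par m + par l) * (par i + par n)) * (-1) ^ (par i * (par k + par m) + par k * par m) =
      (-1) ^ ((par n + par l) * (par i + par m)) * (-1) ^ ((par i + par m) * (par k + par n)) *
        (-1) ^ (par m * (par n + par l) + par n * par l) := by
    intro m n; rw [← pow_add, ← pow_add, ← pow_add]; apply neg_one_pow_congr
    clear * -; revert i k l m n; decide
  have s3 : ∀ m n, (-1 : ℂ) ^ ((par n + par l) * (par i + par m)) * (-1) ^ ((par i + par m) * (par k + par n)) *
      (-1) ^ ((par m + par j) * (par n + par l)) =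
      (-1) ^ ((par i + par j) * (par k + par l)) * (-1) ^ ((par m + par j) * (par k + par n)) := by
    intro m n; rw [← pow_add, ← pow_add, ← pow_add]; apply neg_one_pow_congr
    clear * -; revert i j k l m n; decide
  have s4 : ∀ m n, (-1 : ℂ) ^ ((par n + par l) * (par i + par m)) * (-1) ^ ((par i + par m) * (par k + par n)) *
      (-1) ^ (par m * (par n + par l) + par n * par l) =
      (-1) ^ (par i * (par k + par l) + par k * par l) * (-1) ^ ((par m + par l) * (par k + par n)) := by
    intro m n; rw [← pow_add, ← pow_add, ← pow_add]; apply neg_one_pow_congr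
    clear * -; revert i k l m n; decide
  simp only [tensorT_mul, Finset.smul_sum, smul_smul]
  have e1 : ∀ m n : Fin 3, (-1 : ℂ) ^ ((par n + par l) * (par i + par m)) •
        tensorBlock A P (W := W) (par m + par j + (par n + par l)) (A.T i m u * A.T k n v) (B.T m j u * B.T n l v) +
      ((-1 : ℂ) ^ (par i * (par k + par l) + par k * par l) * g c u v * (-1) ^ ((par n + par l) * (par k + par m))) •
        tensorBlock A P (W := W) (par m + par j + (par n + par l)) (A.T k m u * A.T i n v) (B.T m j u * B.T n l v) =
      ((-1 : ℂ) ^ ((par n + par l) * (par i + par m)) * (-1) ^ ((par i + par m) * (par k + par n))) •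
        tensorBlock A P (W := W) (par m + par j + (par n + par l)) (A.T k n v * A.T i m u) (B.T m j u * B.T n l v) +
      ((-1 : ℂ) ^ ((par n + par l) * (par i + par m)) * (-1) ^ (par i * (par k + par n) + par k * par n) * g c u v) •
        tensorBlock A P (W := W) (par m + par j + (par n + par l)) (A.T k m v * A.T i n u) (B.T m j u * B.T n l v) := by
    intro m n
    have hA := congrArg (fun a => ((-1 : ℂ) ^ ((par n + par l) * (par i + par m))) •
      tensorBlock A P (W := W) (par m + par j + (par n + par l)) a (B.T m j u * B.T n l v)) (rtt_symm_form A i m k n huv)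
    simp only [map_add, map_smul, LinearMap.add_apply, LinearMap.smul_apply, smul_add, smul_smul] at hA
    rw [mul_right_comm ((-1 : ℂ) ^ (par i * (par k + par l) + par k * par l)), s1 m n]
    simpa only [mul_assoc] using hA
  have e2 : ∀ m n : Fin 3,
      ((-1 : ℂ) ^ ((par n + par l) * (par i + par m)) * (-1) ^ ((par i + par m) * (par k + par n))) •
        tensorBlock A P (W := W) (par m + par j + (par n + par l)) (A.T k n v * A.T i m u) (B.T m j u * B.T n l v) +
      ((-1 : ℂ) ^ ((par m + par l) * (par i + par n)) * (-1) ^ (par i * (par k + par m) + par k * par m) * g c u v) •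
        tensorBlock A P (W := W) (par m + par j + (par n + par l)) (A.T k n v * A.T i m u) (B.T n j u * B.T m l v) =
      ((-1 : ℂ) ^ ((par i + par j) * (par k + par l)) * (-1) ^ ((par m + par j) * (par k + par n))) •
        tensorBlock A P (W := W) (par m + par j + (par n + par l)) (A.T k n v * A.T i m u) (B.T n l v * B.T m j u) +
      ((-1 : ℂ) ^ (par i * (par k + par l) + par k * par l) * g c u v * (-1) ^ ((par m + par l) * (par k + par n))) •
        tensorBlock A P (W := W) (par m + par j + (par n + par l)) (A.T k n v * A.T i m u) (B.T n j v * B.T m l u) := by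
    intro m n
    have hB := congrArg (fun b => ((-1 : ℂ) ^ ((par n + par l) * (par i + par m)) *
      (-1) ^ ((par i + par m) * (par k + par n))) •
      tensorBlock A P (W := W) (par m + par j + (par n + par l)) (A.T k n v * A.T i m u) b) (rtt_symm_form B m j n l huv)
    simp only [map_add, map_smul, smul_add, smul_smul] at hB
    rw [s2 m n, mul_right_comm ((-1 : ℂ) ^ (par i * (par k + par l) + par k * par l)), ← s4 m n, ← s3 m n]
    simpa only [mul_assoc] using hB
  have idx : ∀ m n : Fin 3, par n + par j + (par m + par l) = par m + par j + (par n + par l) := fun m n => by ring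
  rw [← Finset.sum_add_distrib]
  simp only [← Finset.sum_add_distrib]
  rw [Finset.sum_congr rfl fun m _ => Finset.sum_congr rfl fun n _ => e1 m n]
  simp only [Finset.sum_add_distrib]
  rw [Finset.sum_comm (f := fun m n => ((-1 : ℂ) ^ ((par n + par l) * (par i + par m)) *
      (-1) ^ (par i * (par k + par n) + par k * par n) * g c u v) •
        tensorBlock A P (W := W) (par m + par j + (par n + par l)) (A.T k m v * A.T i n u) (B.T m j u * B.T n l v))]
  simp only [idx]
  rw [← Finset.sum_add_distrib]
  simp only [← Finset.sum_add_distrib]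
  rw [Finset.sum_congr rfl fun m _ => Finset.sum_congr rfl fun n _ => e2 m n]
  simp only [Finset.sum_add_distrib]
  congr 1
  · rw [Finset.sum_comm]
    refine Finset.sum_congr rfl fun m _ => Finset.sum_congr rfl fun n _ => ?_
    rw [add_comm (par m + par l)]
  · rw [Finset.sum_comm]
    refine Finset.sum_congr rfl fun m _ => Finset.sum_congr rfl fun n _ => ?_
    rw [idx]

theorem tensorT_tmul (i j : Fin 3) (u : ℂ) (x : V) (y : W) :
    tensorT A P B i j u (x ⊗ₜ[ℂ] y) = ∑ k, (P.Θ ^ (par k + par j)) (A.T i k u x) ⊗ₜ[ℂ] (B.T k j u y) := by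
  simp [tensorT, LinearMap.sum_apply]

/-- The composite of two models. -/
def tensorModel : Model c (V ⊗[ℂ] W) where
  T := tensorT A P B
  rtt i j k l u v huv := tensorT_rtt A P B i j k l huv
  vac := A.vac ⊗ₜ[ℂ] B.vac
  dualVac := TensorProduct.dualDistrib ℂ V W (A.dualVac ⊗ₜ[ℂ] B.dualVac)
  lam i u := A.lam i u * B.lam i u
  dualVac_vac := by simp [A.dualVac_vac, B.dualVac_vac]
  diag_vac i u := by
    rw [tensorT_tmul, Finset.sum_eq_single i]
    · rw [A.diag_vac, B.diag_vac, map_smul, P.pow_vac, TensorProduct.smul_tmul_smul]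
    · intro k _ hk
      rcases lt_or_gt_of_ne hk with h | h
      · rw [A.lower_vac k i u h]; simp
      · rw [B.lower_vac i k u h]; simp
    · simp
  lower_vac i j u hij := by
    rw [tensorT_tmul]
    refine Finset.sum_eq_zero fun k _ => ?_
    rcases lt_or_ge k j with h | h
    · rw [A.lower_vac k j u h]; simp
    · rw [B.lower_vac i k u (hij.trans_le h)]; simp
  dualVac_diag i u := by
    refine TensorProduct.ext' fun x y => ?_
    rw [LinearMap.comp_apply, tensorT_tmul, map_sum, Finset.sum_eq_single i]
    · have h1 := LinearMap.congr_fun (P.dualVac_pow (par i + par i)) (A.T i i u x)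
      have h2 := LinearMap.congr_fun (A.dualVac_diag i u) x
      have h3 := LinearMap.congr_fun (B.dualVac_diag i u) y
      simp only [LinearMap.comp_apply, LinearMap.smul_apply, smul_eq_mul] at h1 h2 h3
      simp only [TensorProduct.dualDistrib_apply, h1, h2, h3, LinearMap.smul_apply, smul_eq_mul]
      ring
    · intro k _ hk
      have h1 := LinearMap.congr_fun (P.dualVac_pow (par k + par i)) (A.T i k u x)
      simp only [LinearMap.comp_apply] at h1
      rw [TensorProduct.dualDistrib_apply, h1]
      rcases lt_or_gt_of_ne hk with h | h
      · have := LinearMap.congr_fun (B.dualVac_upper k i u h) y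
        simp only [LinearMap.comp_apply, LinearMap.zero_apply] at this
        rw [this, mul_zero]
      · have := LinearMap.congr_fun (A.dualVac_upper i k u h) x
        simp only [LinearMap.comp_apply, LinearMap.zero_apply] at this
        rw [this, zero_mul]
    · simp
  dualVac_upper i j u hij := by
    refine TensorProduct.ext' fun x y => ?_
    rw [LinearMap.comp_apply, tensorT_tmul, map_sum, LinearMap.zero_apply]
    refine Finset.sum_eq_zero fun k _ => ?_
    have h1 := LinearMap.congr_fun (P.dualVac_pow (par k + par j)) (A.T i k u x)
    simp only [LinearMap.comp_apply] at h1
    rw [TensorProduct.dualDistrib_apply, h1]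
    rcases lt_or_ge k j with h | h
    · have := LinearMap.congr_fun (B.dualVac_upper k j u h) y
      simp only [LinearMap.comp_apply, LinearMap.zero_apply] at this
      rw [this, mul_zero]
    · have := LinearMap.congr_fun (A.dualVac_upper i k u (hij.trans_le h)) x
      simp only [LinearMap.comp_apply, LinearMap.zero_apply] at this
      rw [this, zero_mul]

/-- The parity operator of a composite model. -/
def tensorParity (Q : Parity B) : Parity (tensorModel A P B) where
  Θ := TensorProduct.map P.Θ Q.Θ
  sq := by rw [← TensorProduct.map_mul, P.sq, Q.sq, TensorProduct.map_one]
  comm i j u := by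
    change tensorT A P B i j u * _ = _ • (_ * tensorT A P B i j u)
    rw [tensorT, Finset.sum_mul, Finset.mul_sum, Finset.smul_sum]
    refine Finset.sum_congr rfl fun k _ => ?_
    rw [TensorProduct.mapBilinear_apply, ← TensorProduct.map_mul, ← TensorProduct.map_mul, Q.comm, mul_assoc,
      P.comm, mul_smul_comm, ← mul_assoc, ← mul_assoc, pow_mul_comm', TensorProduct.map_smul_left,
      TensorProduct.map_smul_right, smul_smul, ← pow_add]
    congr 1
    apply neg_one_pow_congr
    revert i j k; decide
  vac := by
    change TensorProduct.map P.Θ Q.Θ (A.vac ⊗ₜ[ℂ] B.vac) = A.vac ⊗ₜ[ℂ] B.vac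
    rw [TensorProduct.map_tmul, P.vac, Q.vac]
  dualVac := by
    refine TensorProduct.ext' fun x y => ?_
    have h1 := LinearMap.congr_fun P.dualVac x
    have h2 := LinearMap.congr_fun Q.dualVac y
    simp only [LinearMap.comp_apply] at h1 h2
    simp only [tensorModel, LinearMap.comp_apply, TensorProduct.map_tmul, TensorProduct.dualDistrib_apply, h1, h2]

end graded

/-! ### One-site models and indicator models -/

section sites
variable {c : ℂ}

/-- The space `ℂ³` in a prescribed universe. -/
abbrev SiteSpace : Type u := ULift.{u} (Fin 3) → ℂ

/-- The matrix units. -/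
def unitOp (i j : Fin 3) : Module.End ℂ SiteSpace.{u} := Matrix.toLin' (Matrix.single ⟨i⟩ ⟨j⟩ 1)

theorem unitOp_mul (i j k l : Fin 3) :
    unitOp.{u} i j * unitOp.{u} k l = if j = k then unitOp.{u} i l else 0 := by
  rw [unitOp, unitOp, Module.End.mul_eq_comp, ← Matrix.toLin'_mul]
  split_ifs with h
  · subst h; rw [Matrix.single_mul_single_same, mul_one, unitOp]
  · rw [Matrix.single_mul_single_of_ne (h := fun e => h (by simpa using e))]; simp

theorem unitOp_single (i j k : Fin 3) :
    unitOp.{u} i j (Pi.single ⟨k⟩ 1) = if j = k then Pi.single ⟨i⟩ 1 else 0 := by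
  rw [unitOp, Matrix.toLin'_apply]
  ext a
  by_cases h : j = k
  · subst h
    simp [Matrix.single_apply, Pi.single_apply, eq_comm]
  · simp [h]

theorem proj_unitOp (i j k : Fin 3) :
    (LinearMap.proj ⟨i⟩ : SiteSpace.{u} →ₗ[ℂ] ℂ) ∘ₗ unitOp.{u} j k =
      if i = j then (LinearMap.proj ⟨k⟩ : SiteSpace.{u} →ₗ[ℂ] ℂ) else 0 := by
  ext a
  obtain ⟨a⟩ := a
  simp only [LinearMap.comp_apply, LinearMap.single_apply, unitOp_single]
  by_cases h : k = a <;> by_cases h' : i = j <;> simp [h, h']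

/-- The parity operator on `ℂ³`. -/
def sitePar : Module.End ℂ SiteSpace.{u} := unitOp 0 0 + unitOp 1 1 - unitOp 2 2

theorem sitePar_mul (i j : Fin 3) : sitePar * unitOp.{u} i j = (-1 : ℂ) ^ par i • unitOp i j := by
  simp only [sitePar, sub_mul, add_mul, unitOp_mul]
  fin_cases i
  · simp [par]
  · simp [par]
  · rw [show par ⟨2, by decide⟩ = 1 from rfl, pow_one]; refine LinearMap.ext fun x => ?_; simp

theorem mul_sitePar (i j : Fin 3) : unitOp.{u} i j * sitePar = (-1 : ℂ) ^ par j • unitOp i j := by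
  simp only [sitePar, mul_sub, mul_add, unitOp_mul]
  fin_cases j
  · simp [par]
  · simp [par]
  · rw [show par ⟨2, by decide⟩ = 1 from rfl, pow_one]; refine LinearMap.ext fun x => ?_; simp

theorem unitOp_sum : unitOp.{u} 0 0 + unitOp 1 1 + unitOp 2 2 = 1 := by
  refine LinearMap.pi_ext' fun a => LinearMap.ext_ring ?_
  obtain ⟨a⟩ := a
  simp only [LinearMap.comp_apply, LinearMap.single_apply, LinearMap.add_apply, unitOp_single,
    Module.End.one_apply]
  fin_cases a <;> simp

theorem sitePar_sq : sitePar.{u} * sitePar = 1 := by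
  conv_lhs => rw [sitePar]
  rw [sub_mul, add_mul]
  simp only [← unitOp_sum, mul_sub, mul_add, unitOp_mul]
  simp

/-- A one-site model built from matrix units: `e_{ij}` is a multiple of a matrix unit. -/
theorem site_rtt {V : Type*} [AddCommGroup V] [Module ℂ V] (e : Fin 3 → Fin 3 → Module.End ℂ V) (ξ : ℂ)
    (he : ∀ i j k l, e i j * e k l - ((-1 : ℂ) ^ ((par i + par j) * (par k + par l))) • (e k l * e i j) =
      ((-1 : ℂ) ^ (par i * (par k + par l) + par k * par l)) •
        ((if i = l then e k j else 0) - (if k = j then e i l else 0)))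
    (i j k l : Fin 3) {u v : ℂ} (huv : u ≠ v) :
    ((if i = j then (u - ξ) • (1 : Module.End ℂ V) else 0) + c • e i j) *
        ((if k = l then (v - ξ) • (1 : Module.End ℂ V) else 0) + c • e k l)
      - ((-1 : ℂ) ^ ((par i + par j) * (par k + par l))) •
        (((if k = l then (v - ξ) • (1 : Module.End ℂ V) else 0) + c • e k l) *
          ((if i = j then (u - ξ) • (1 : Module.End ℂ V) else 0) + c • e i j))
    = ((-1 : ℂ) ^ (par i * (par k + par l) + par k * par l) * g c u v) •
        (((if k = j then (v - ξ) • (1 : Module.End ℂ V) else 0) + c • e k j) *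
          ((if i = l then (u - ξ) • (1 : Module.End ℂ V) else 0) + c • e i l) -
        ((if k = j then (u - ξ) • (1 : Module.End ℂ V) else 0) + c • e k j) *
          ((if i = l then (v - ξ) • (1 : Module.End ℂ V) else 0) + c • e i l)) := by
  have hg : g c u v * (u - v) = c := by rw [g]; field_simp [sub_ne_zero.2 huv]
  have h1 : ∀ (p q : Prop) [Decidable p] [Decidable q] (x y : Module.End ℂ V) (a b : ℂ),
      ((if p then a • (1 : Module.End ℂ V) else 0) + c • x) * ((if q then b • (1 : Module.End ℂ V) else 0) + c • y) =
      (if p ∧ q then (a * b) • (1 : Module.End ℂ V) else 0) + (if p then (a * c) • y else 0) +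
        (if q then (b * c) • x else 0) + (c * c) • (x * y) := by
    intro p q _ _ x y a b
    by_cases hp : p <;> by_cases hq : q <;> simp [hp, hq, mul_add, add_mul, smul_smul, mul_comm]
    module
  simp only [h1]
  have hs : ∀ p : Prop, p = (i = j) ∨ p = (k = l) → p →
      (-1 : ℂ) ^ ((par i + par j) * (par k + par l)) = 1 := by
    rintro p (rfl | rfl) h
    · subst h; rw [← two_mul, mul_assoc, pow_mul]; simp
    · subst h; rw [← two_mul, mul_left_comm, pow_mul]; simp
  have hs1 := hs _ (Or.inl rfl)
  have hs2 := hs _ (Or.inr rfl)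
  have hmain := congrArg (fun x => (c * c) • x) (he i j k l)
  simp only [smul_sub, smul_smul] at hmain
  generalize (-1 : ℂ) ^ ((par i + par j) * (par k + par l)) = s at *
  generalize (-1 : ℂ) ^ (par i * (par k + par l) + par k * par l) = ε at *
  have hL : (((if i = j ∧ k = l then ((u - ξ) * (v - ξ)) • (1 : Module.End ℂ V) else 0) + (if i = j then ((u - ξ) * c) • e k l else 0) +
        (if k = l then ((v - ξ) * c) • e i j else 0) + (c * c) • (e i j * e k l)) -
      s • ((if k = l ∧ i = j then ((v - ξ) * (u - ξ)) • (1 : Module.End ℂ V) else 0) + (if k = l then ((v - ξ) * c) • e i j else 0) +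
        (if i = j then ((u - ξ) * c) • e k l else 0) + (c * c) • (e k l * e i j))) =
      (c * c) • (e i j * e k l) - (c * c * s) • (e k l * e i j) := by
    by_cases h1 : i = j <;> by_cases h2 : k = l
    · simp only [h1, h2, and_self, if_true, hs1 h1]; module
    · simp only [h1, h2, and_false, false_and, if_true, if_false, hs1 h1]; module
    · simp only [h1, h2, and_false, false_and, if_true, if_false, hs2 h2]; module
    · simp only [h1, h2, and_false, if_false]; module
  rw [hL, hmain]
  have hg' : ε * g c u v * ((u - v) * c) = c * c * ε := by linear_combination ε * c * hg
  by_cases h1 : i = l <;> by_cases h2 : k = j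
  · simp only [h1, h2, and_self, if_true]
    rw [← hg']; module
  · simp only [h1, h2, false_and, if_true, if_false]
    rw [← hg']; module
  · simp only [h1, h2, and_false, if_true, if_false]
    rw [← hg']; module
  · simp only [h1, h2, and_false, if_false]; module

theorem unit_rel_fund (i j k l : Fin 3) :
    ((-1 : ℂ) ^ par i • unitOp.{u} j i) * ((-1 : ℂ) ^ par k • unitOp.{u} l k) -
      ((-1 : ℂ) ^ ((par i + par j) * (par k + par l))) •
        (((-1 : ℂ) ^ par k • unitOp.{u} l k) * ((-1 : ℂ) ^ par i • unitOp.{u} j i)) =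
      ((-1 : ℂ) ^ (par i * (par k + par l) + par k * par l)) •
        ((if i = l then (-1 : ℂ) ^ par k • unitOp.{u} j k else 0) -
          (if k = j then (-1 : ℂ) ^ par i • unitOp.{u} l i else 0)) := by
  have s1 : ∀ i k : Fin 3, (par i + par k) % 2 = (par i * (par k + par i) + par k * par i + par k) % 2 := by decide
  have s2 : ∀ i k l : Fin 3, ((par i + par k) * (par k + par l) + (par i + par k)) % 2 =
    (par i * (par k + par l) + par k * par l + par i) % 2 := by decide
  simp only [smul_mul_smul_comm, unitOp_mul, smul_sub]
  congr 1
  · by_cases h : i = l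
    · subst h; rw [if_pos rfl, if_pos rfl, smul_smul, ← pow_add, ← pow_add]
      congr 1; exact neg_one_pow_congr (s1 i k)
    · simp [h]
  · by_cases h : k = j
    · subst h; rw [if_pos rfl, if_pos rfl, smul_smul, smul_smul, ← pow_add, ← pow_add, ← pow_add]
      congr 1; apply neg_one_pow_congr; rw [add_comm (par k) (par i)]; exact s2 i k l
    · simp [h]

theorem unit_rel_dual (i j k l : Fin 3) :
    ((-1 : ℂ) ^ (par i * par j + 1) • unitOp.{u} i j) * ((-1 : ℂ) ^ (par k * par l + 1) • unitOp.{u} k l) -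
      ((-1 : ℂ) ^ ((par i + par j) * (par k + par l))) •
        (((-1 : ℂ) ^ (par k * par l + 1) • unitOp.{u} k l) * ((-1 : ℂ) ^ (par i * par j + 1) • unitOp.{u} i j)) =
      ((-1 : ℂ) ^ (par i * (par k + par l) + par k * par l)) •
        ((if i = l then (-1 : ℂ) ^ (par k * par j + 1) • unitOp.{u} k j else 0) -
          (if k = j then (-1 : ℂ) ^ (par i * par l + 1) • unitOp.{u} i l else 0)) := by
  have s1 : ∀ i k l : Fin 3, (par i * par k + 1 + (par k * par l + 1)) % 2 =
    (par i * (par k + par l) + par k * par l + (par i * par l + 1) + 1) % 2 := by decide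
  have s2 : ∀ i j k : Fin 3, ((par i + par j) * (par k + par i) + (par k * par i + 1 + (par i * par j + 1))) % 2 =
    (par i * (par k + par i) + par k * par i + (par k * par j + 1) + 1) % 2 := by decide
  simp only [smul_mul_smul_comm, unitOp_mul, smul_sub]
  rw [← sub_eq_zero]
  have e1 : ((-1 : ℂ) ^ (par i * par j + 1) * (-1) ^ (par k * par l + 1)) • (if j = k then unitOp.{u} i l else 0) =
      -((-1 : ℂ) ^ (par i * (par k + par l) + par k * par l) •
        (if k = j then (-1 : ℂ) ^ (par i * par l + 1) • unitOp.{u} i l else 0)) := by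
    by_cases h : j = k
    · subst h; rw [if_pos rfl, if_pos rfl, smul_smul, ← pow_add, ← pow_add, ← neg_smul]
      congr 1; rw [neg_one_pow_congr (s1 i j l), pow_succ]; ring
    · simp [h, Ne.symm h]
  have e2 : ((-1 : ℂ) ^ ((par i + par j) * (par k + par l))) •
      (((-1 : ℂ) ^ (par k * par l + 1) * (-1) ^ (par i * par j + 1)) • (if l = i then unitOp.{u} k j else 0)) =
      -((-1 : ℂ) ^ (par i * (par k + par l) + par k * par l) •
        (if i = l then (-1 : ℂ) ^ (par k * par j + 1) • unitOp.{u} k j else 0)) := by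
    by_cases h : i = l
    · subst h; rw [if_pos rfl, if_pos rfl, smul_smul, smul_smul, ← pow_add, ← pow_add, ← pow_add, ← neg_smul]
      congr 1; rw [neg_one_pow_congr (s2 i j k), pow_succ]; ring
    · simp [h, Ne.symm h]
  rw [e1, e2]; abel

/-- The one-site model built from operators `e_{ij}` obeying the commutation relations of `gl(2|1)`. -/
def fundModel (c ξ : ℂ) : Model c SiteSpace.{u} where
  T i j u := (if i = j then (u - ξ) • (1 : Module.End ℂ SiteSpace.{u}) else 0) + c • ((-1 : ℂ) ^ par i • unitOp j i)
  rtt i j k l u v huv := site_rtt (fun i j => (-1 : ℂ) ^ par i • unitOp.{u} j i) ξ unit_rel_fund i j k l huv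
  vac := Pi.single ⟨0⟩ 1
  dualVac := LinearMap.proj ⟨0⟩
  lam i u := u - ξ + if i = 0 then c else 0
  dualVac_vac := by simp
  diag_vac i u := by
    simp only [if_true, LinearMap.add_apply, LinearMap.smul_apply, unitOp_single, Module.End.one_apply]
    by_cases h : i = 0
    · subst h; simp [par, add_smul]
    · simp [h]
  dualVac_diag i u := by
    simp only [if_true, LinearMap.comp_add, LinearMap.comp_smul, proj_unitOp, Module.End.one_eq_id, LinearMap.comp_id]
    by_cases h : i = 0
    · subst h; simp [par, add_smul]
    · simp [h, Ne.symm h]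
  lower_vac i j u hij := by
    have h : j ≠ 0 := by rintro rfl; exact absurd hij (by simp)
    simp [hij.ne', unitOp_single, h]
  dualVac_upper i j u hij := by
    have h : j ≠ 0 := by rintro rfl; exact absurd hij (by simp)
    simp [hij.ne, LinearMap.comp_smul, proj_unitOp, h.symm]

/-- The one-site model on the dual of the defining representation. -/
def dualModel (c ξ : ℂ) : Model c SiteSpace.{u} where
  T i j u := (if i = j then (u - ξ) • (1 : Module.End ℂ SiteSpace.{u}) else 0) +
    c • ((-1 : ℂ) ^ (par i * par j + 1) • unitOp i j)
  rtt i j k l u v huv := site_rtt (fun i j => (-1 : ℂ) ^ (par i * par j + 1) • unitOp.{u} i j) ξ unit_rel_dual i j k l huv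
  vac := Pi.single ⟨2⟩ 1
  dualVac := LinearMap.proj ⟨2⟩
  lam i u := u - ξ + if i = 2 then c else 0
  dualVac_vac := by simp
  diag_vac i u := by
    simp only [if_true, LinearMap.add_apply, LinearMap.smul_apply, unitOp_single, Module.End.one_apply]
    by_cases h : i = 2
    · subst h; simp [par, add_smul]
    · simp [h]
  dualVac_diag i u := by
    simp only [if_true, LinearMap.comp_add, LinearMap.comp_smul, proj_unitOp, Module.End.one_eq_id, LinearMap.comp_id]
    by_cases h : i = 2
    · subst h; simp [par, add_smul]
    · simp [h, Ne.symm h]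
  lower_vac i j u hij := by
    have h : i ≠ 2 := by rintro rfl; omega
    simp [hij.ne', unitOp_single, h]
  dualVac_upper i j u hij := by
    have h : i ≠ 2 := by rintro rfl; omega
    simp [hij.ne, LinearMap.comp_smul, proj_unitOp, h.symm]

/-- The parity operator of a fundamental site. -/
def fundParity (c ξ : ℂ) : Parity (fundModel.{u} c ξ) where
  Θ := sitePar
  sq := sitePar_sq
  comm i j u := by
    simp only [fundModel, add_mul, mul_add, smul_mul_assoc, mul_smul_comm, mul_sitePar, sitePar_mul]
    by_cases h : i = j
    · subst h
      rw [← two_mul, pow_mul]; simp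
    · have : (-1 : ℂ) ^ par i = (-1) ^ (par i + par j) * (-1) ^ par j := by
        rw [← pow_add]; apply neg_one_pow_congr; omega
      simp only [h, if_false, zero_mul, mul_zero, zero_add]
      rw [smul_smul, smul_smul, smul_smul, smul_smul, smul_smul]
      congr 1
      linear_combination c * (-1) ^ par i * this
  vac := by
    simp [sitePar, fundModel, unitOp_single]
  dualVac := by
    simp [sitePar, fundModel, LinearMap.comp_add, LinearMap.comp_sub, proj_unitOp]

/-- The parity operator of a dual site. -/
def dualParity (c ξ : ℂ) : Parity (dualModel.{u} c ξ) where
  -- The vacuum of this site is the odd basis vector; the additional sign makes the operator fix it.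
  Θ := (-1 : ℂ) • sitePar
  sq := by rw [smul_mul_smul_comm, sitePar_sq]; simp
  comm i j u := by
    rw [mul_smul_comm, smul_mul_assoc, smul_comm _ (-1 : ℂ)]
    congr 1
    simp only [dualModel, add_mul, mul_add, smul_mul_assoc, mul_smul_comm, mul_sitePar, sitePar_mul]
    by_cases h : i = j
    · subst h
      rw [← two_mul, pow_mul]; simp
    · have : (-1 : ℂ) ^ par j = (-1) ^ (par i + par j) * (-1) ^ par i := by
        rw [← pow_add]; apply neg_one_pow_congr; omega
      simp only [h, if_false, zero_mul, mul_zero, zero_add]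
      rw [this]; module
  vac := by
    rw [LinearMap.smul_apply]; simp [sitePar, dualModel, unitOp_single]
  dualVac := by
    rw [LinearMap.comp_smul, neg_one_smul]
    simp [sitePar, dualModel, LinearMap.comp_add, LinearMap.comp_sub, proj_unitOp]

/-- The model with one-dimensional space and identity monodromy matrix. -/
def trivialModel (c : ℂ) : Model c (ULift.{u} ℂ) where
  T i j _ := if i = j then 1 else 0
  rtt i j k l u v _ := by
    by_cases h : i = j
    · subst h; rw [← two_mul, mul_assoc, pow_mul]; simp
    · simp [h]
  vac := ⟨1⟩
  dualVac := ULift.moduleEquiv.toLinearMap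
  lam _ _ := 1
  dualVac_vac := by simp
  diag_vac i u := by simp
  dualVac_diag i u := by simp [Module.End.one_eq_id]
  lower_vac i j u hij := by simp [hij.ne']
  dualVac_upper i j u hij := by simp [hij.ne]

/-- The parity operator of the trivial model. -/
def trivialParity (c : ℂ) : Parity (trivialModel.{u} c) where
  Θ := 1
  sq := one_mul 1
  comm i j u := by
    by_cases h : i = j
    · subst h; rw [← two_mul, pow_mul]; simp
    · simp [trivialModel, h]
  vac := rfl
  dualVac := rfl

/-- Multiplication of the monodromy matrix by a scalar function. -/
def rescaleModel {V : Type*} [AddCommGroup V] [Module ℂ V] (M : Model c V) (s : ℂ → ℂ) : Model c V where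
  T i j u := s u • M.T i j u
  rtt i j k l u v huv := by
    have := congrArg (fun x => (s u * s v) • x) (M.rtt i j k l u v huv)
    simp only [smul_mul_smul_comm]
    simp only [smul_sub, smul_smul] at this ⊢
    rw [mul_comm (s v) (s u)]
    convert this using 3 <;> ring
  vac := M.vac
  dualVac := M.dualVac
  lam i u := s u * M.lam i u
  dualVac_vac := M.dualVac_vac
  diag_vac i u := by rw [LinearMap.smul_apply, M.diag_vac, smul_smul]
  dualVac_diag i u := by rw [LinearMap.comp_smul, M.dualVac_diag, smul_smul]
  lower_vac i j u hij := by rw [LinearMap.smul_apply, M.lower_vac i j u hij, smul_zero]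
  dualVac_upper i j u hij := by rw [LinearMap.comp_smul, M.dualVac_upper i j u hij, smul_zero]

/-- The parity operator of a rescaled model. -/
def rescaleParity {V : Type*} [AddCommGroup V] [Module ℂ V] {M : Model c V} (P : Parity M) (s : ℂ → ℂ) :
    Parity (rescaleModel M s) where
  Θ := P.Θ
  sq := P.sq
  comm i j u := by
    change (s u • M.T i j u) * _ = _ • (_ * (s u • M.T i j u))
    rw [smul_mul_assoc, P.comm, mul_smul_comm, smul_comm]
  vac := P.vac
  dualVac := P.dualVac

/-- The fundamental site at p has eigenvalues (z - p + c, z - p, z - p), the dual one (z - p, z - p,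
z - p + c), so at z = p only the first, respectively the last, survives. For the middle one, take
both sites at p + c: the eigenvalues (z - p)(z - p - c), (z - p - c)², (z - p)(z - p - c) leave only
the middle one at z = p. All zeros lie at p and p ± c, away from the other generic points. -/
theorem exists_site (hc : c ≠ 0) (p : ℂ) (m : Fin 3) : ∃ (X : BModel.{u} c) (_ : Parity X.M),
    (∀ i, X.M.lam i p ≠ 0 ↔ i = m) ∧ ∀ z, z ≠ p → z - p ≠ c → p - z ≠ c → ∀ i, X.M.lam i z ≠ 0 := by
  have hne : ∀ z, z ≠ p → z - p ≠ c → p - z ≠ c → z - p ≠ 0 ∧ z - p + c ≠ 0 ∧ z - (p + c) ≠ 0 := by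
    intro z h1 h2 h3
    refine ⟨sub_ne_zero.2 h1, fun e => h3 ?_, fun e => h2 ?_⟩
    · linear_combination -e
    · linear_combination e
  have hpc : p - (p + c) = -c := by ring
  have hpc' : ∀ z, z - (p + c) + c = z - p := fun z => by ring
  match m with
  | 0 =>
    refine ⟨⟨_, fundModel c p⟩, fundParity c p, fun i => ?_, fun z h1 h2 h3 i => ?_⟩
    · fin_cases i <;> simp [fundModel, hc]
    · obtain ⟨h4, h5, h6⟩ := hne z h1 h2 h3
      fin_cases i <;> simp [fundModel, h4, h5]
  | 2 =>
    refine ⟨⟨_, dualModel c p⟩, dualParity c p, fun i => ?_, fun z h1 h2 h3 i => ?_⟩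
    · fin_cases i <;> simp [dualModel, hc]
    · obtain ⟨h4, h5, h6⟩ := hne z h1 h2 h3
      fin_cases i <;> simp [dualModel, h4, h5]
  | 1 =>
    refine ⟨⟨_, tensorModel (fundModel.{u} c (p + c)) (fundParity.{u} c (p + c)) (dualModel.{u} c (p + c))⟩,
      tensorParity _ _ _ (dualParity c (p + c)), fun i => ?_, fun z h1 h2 h3 i => ?_⟩
    · fin_cases i <;> simp [tensorModel, fundModel, dualModel, hc, hpc]
    · obtain ⟨h4, h5, h6⟩ := hne z h1 h2 h3
      fin_cases i <;> simp [tensorModel, fundModel, dualModel, hpc', h4, h6]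

/-- Graded models realize all assignments of a single nonzero vacuum eigenvalue to each generic point. -/
theorem exists_indicator_model (hc : c ≠ 0) {Z : Finset ℂ} (hZ : Gen c Z) (σ : ℂ → Fin 3) :
    ∃ (X : BModel.{u} c) (_ : Parity X.M), ∀ z ∈ Z, ∀ i, X.M.lam i z = if i = σ z then 1 else 0 := by
  -- Points of S are already decided; at the other points every eigenvalue is still nonzero, so
  -- multiplying by one more site can decide one more point.
  have key : ∀ S ⊆ Z, ∃ (X : BModel.{u} c) (_ : Parity X.M),
      (∀ z ∈ S, ∀ i, X.M.lam i z ≠ 0 ↔ i = σ z) ∧ ∀ z ∈ Z, z ∉ S → ∀ i, X.M.lam i z ≠ 0 := by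
    intro S
    induction S using Finset.induction_on with
    | empty => exact fun _ => ⟨⟨_, trivialModel c⟩, trivialParity c, by simp, fun z _ _ i => by simp [trivialModel]⟩
    | insert p S hp ih =>
      intro hS
      obtain ⟨X, P, h1, h2⟩ := ih ((Finset.subset_insert _ _).trans hS)
      obtain ⟨Y, Q, h3, h4⟩ := exists_site.{u} hc p (σ p)
      have hpZ : p ∈ Z := hS (Finset.mem_insert_self _ _)
      have h5 : ∀ z ∈ Z, z ≠ p → ∀ i, Y.M.lam i z ≠ 0 := fun z hz hzp =>
        h4 z hzp (hZ z hz p hpZ hzp) (hZ p hpZ z hz hzp.symm)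
      refine ⟨⟨_, tensorModel X.M P Y.M⟩, tensorParity _ _ _ Q, fun z hz i => ?_, fun z hz hzS i => ?_⟩
      · change X.M.lam i z * Y.M.lam i z ≠ 0 ↔ _
        rw [mul_ne_zero_iff]
        rcases Finset.mem_insert.1 hz with rfl | hz'
        · exact ⟨fun h => (h3 i).1 h.2, fun h => ⟨h2 z hpZ hp i, (h3 i).2 h⟩⟩
        · have hzp : z ≠ p := fun e => hp (e ▸ hz')
          exact ⟨fun h => (h1 z hz' i).1 h.1, fun h => ⟨(h1 z hz' i).2 h, h5 z (hS hz) hzp i⟩⟩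
      · change X.M.lam i z * Y.M.lam i z ≠ 0
        rw [Finset.mem_insert, not_or] at hzS
        exact mul_ne_zero (h2 z hz hzS.2 i) (h5 z hz hzS.1 i)
  obtain ⟨X, P, h1, -⟩ := key Z subset_rfl
  -- The RTT relation is homogeneous at each of its two points, so the surviving eigenvalues can be
  -- rescaled to 1 pointwise.
  refine ⟨⟨_, rescaleModel X.M fun u => (X.M.lam (σ u) u)⁻¹⟩, rescaleParity P _, fun z hz i => ?_⟩
  change (X.M.lam (σ z) z)⁻¹ * X.M.lam i z = _
  split_ifs with h
  · subst h; exact inv_mul_cancel₀ ((h1 z hz _).2 rfl)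
  · rw [not_not.1 (fun h' => h ((h1 z hz i).1 h')), mul_zero]

end sites

/-! ### Symmetric products of operators -/

section symprod
variable {R : Type*} [Ring R] [Algebra ℂ R]

/-- The product of `T x` over a list, divided by the product of `w x y` over the pairs with `x` before `y`. -/
def spL (w : ℂ → ℂ → ℂ) (T : ℂ → R) : List ℂ → R
  | [] => 1
  | x :: l => ((l.map (w x)).prod)⁻¹ • (T x * spL w T l)

/-- The condition for the normalized products of `T` over subsets of `S` not to depend on the order. -/
def SymmOn (w : ℂ → ℂ → ℂ) (T : ℂ → R) (S : Finset ℂ) : Prop :=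
  ∀ x ∈ S, ∀ y ∈ S, x ≠ y → (w x y)⁻¹ • (T x * T y) = (w y x)⁻¹ • (T y * T x)

theorem spL_perm {w : ℂ → ℂ → ℂ} {T : ℂ → R} {l l' : List ℂ} (hl : l.Perm l')
    (h : ∀ x ∈ l, ∀ y ∈ l, x ≠ y → (w x y)⁻¹ • (T x * T y) = (w y x)⁻¹ • (T y * T x)) :
    spL w T l = spL w T l' := by
  induction hl with
  | nil => rfl
  | cons x hl ih =>
    rw [spL, spL, ih fun y hy z hz => h y (List.mem_cons_of_mem _ hy) z (List.mem_cons_of_mem _ hz),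
      (hl.map (w x)).prod_eq]
  | swap x y l =>
    rcases eq_or_ne y x with rfl | hxy
    · rfl
    have := h y (by simp) x (by simp) hxy
    simp only [spL, List.map_cons, List.prod_cons, mul_inv, mul_smul_comm, smul_smul, ← mul_assoc]
    have e := congrArg (fun z => (((l.map (w y)).prod)⁻¹ * ((l.map (w x)).prod)⁻¹) • (z * spL w T l)) this
    simp only [smul_mul_assoc, smul_smul] at e
    convert e using 2 <;> ring
  | trans h₁ _ ih₁ ih₂ =>
    rw [ih₁ h, ih₂ fun y hy z hz => h y (h₁.mem_iff.2 hy) z (h₁.mem_iff.2 hz)]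

theorem spL_concat (w : ℂ → ℂ → ℂ) (T : ℂ → R) (l : List ℂ) (x : ℂ) :
    spL w T (l ++ [x]) = ((l.map fun y => w y x).prod)⁻¹ • (spL w T l * T x) := by
  induction l with
  | nil => simp [spL]
  | cons y l ih =>
    rw [List.cons_append, spL, ih, spL]
    simp only [List.map_append, List.prod_append, List.map_cons, List.prod_cons, List.map_nil, List.prod_nil,
      mul_one, mul_smul_comm, smul_mul_assoc, smul_smul, mul_inv, mul_assoc]
    congr 1; ring

/-- An antihomomorphism reverses the word, so the weight is evaluated with its arguments exchanged.
Under transposition this takes the products of T_{31}, T_{32} to products of the type of T_{13},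
T_{23}. -/
theorem map_spL {R' : Type*} [Ring R'] [Algebra ℂ R'] (φ : R →ₗ[ℂ] R') (h1 : φ 1 = 1)
    (hm : ∀ a b, φ (a * b) = φ b * φ a) (w : ℂ → ℂ → ℂ) (T : ℂ → R) (l : List ℂ) :
    φ (spL w T l) = spL (fun x y => w y x) (fun x => φ (T x)) l.reverse := by
  induction l with
  | nil => simpa [spL] using h1
  | cons x l ih =>
    rw [List.reverse_cons, spL_concat, ← ih, spL, map_smul, hm, List.map_reverse, List.prod_reverse]

/-- The symmetric product of `T x` over a finite set. -/
def sp (w : ℂ → ℂ → ℂ) (T : ℂ → R) (S : Finset ℂ) : R := spL w T S.toList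

variable {w : ℂ → ℂ → ℂ} {T : ℂ → R} {S : Finset ℂ} {x : ℂ}

@[simp] theorem sp_empty : sp w T ∅ = 1 := by simp [sp, spL]

theorem sp_eq_spL {l : List ℂ} (h : SymmOn w T S) (hl : l.Nodup) (hS : l.toFinset = S) :
    sp w T S = spL w T l := by
  refine spL_perm ?_ fun x hx y hy => h x (by simpa using hx) y (by simpa using hy)
  rw [← hS]; exact List.toFinset_toList hl

theorem sp_insert (h : SymmOn w T (insert x S)) (hx : x ∉ S) :
    sp w T (insert x S) = (∏ y ∈ S, w x y)⁻¹ • (T x * sp w T S) := by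
  rw [sp_eq_spL (l := x :: S.toList) h (by simp [hx, S.nodup_toList]) (by simp), spL, Finset.prod_map_toList, sp]

theorem sp_insert_right (h : SymmOn w T (insert x S)) (hx : x ∉ S) :
    sp w T (insert x S) = (∏ y ∈ S, w y x)⁻¹ • (sp w T S * T x) := by
  rw [sp_eq_spL (l := S.toList ++ [x]) h (by
    rw [List.nodup_append]; exact ⟨S.nodup_toList, by simp, by simpa using hx⟩)
    (by ext; simp), spL_concat, Finset.prod_map_toList, sp]

theorem map_sp {R' : Type*} [Ring R'] [Algebra ℂ R'] (φ : R →ₗ[ℂ] R') (h1 : φ 1 = 1)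
    (hm : ∀ a b, φ (a * b) = φ b * φ a) (h : SymmOn w T S) :
    φ (sp w T S) = sp (fun x y => w y x) (fun x => φ (T x)) S := by
  rw [sp, map_spL φ h1 hm]
  symm
  refine sp_eq_spL (fun x hx y hy hxy => ?_) (by simpa using S.nodup_toList) (by simp)
  rw [← hm, ← hm, ← map_smul, ← map_smul, h y hy x hx hxy.symm]

end symprod

/-! ### Actions on products of creation operators -/

section actions
variable {c : ℂ} {R : Type*} [Ring R] [Algebra ℂ R]

/-- The exchange relation of the odd operators `T_{13}` and `T_{23}`. -/
def OddUp (c : ℂ) (C : ℂ → R) : Prop := ∀ x y, x ≠ y → h c x y • (C x * C y) = h c y x • (C y * C x)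

/-- The exchange relation of the odd operators `T_{31}` and `T_{32}`. -/
def OddDown (c : ℂ) (C : ℂ → R) : Prop := ∀ x y, x ≠ y → h c y x • (C x * C y) = h c x y • (C y * C x)

/-- The symmetric product of the operators `T_{13}` or `T_{23}`. -/
def oddU (c : ℂ) (C : ℂ → R) (S : Finset ℂ) : R := sp (fun x y => h c y x) C S

/-- The symmetric product of the operators `T_{31}` or `T_{32}`. -/
def oddD (c : ℂ) (C : ℂ → R) (S : Finset ℂ) : R := sp (h c) C S

/-- The product of commuting operators. -/
def evenP (C : ℂ → R) (S : Finset ℂ) : R := sp (fun _ _ => 1) C S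

theorem Gen.h_ne_zero (hc : c ≠ 0) {S : Finset ℂ} (hS : Gen c S) {x y : ℂ} (hx : x ∈ S) (hy : y ∈ S) :
    h c x y ≠ 0 := by
  rcases eq_or_ne x y with rfl | hxy
  · rw [h_self hc]; exact one_ne_zero
  · refine div_ne_zero (fun e => hS y hy x hx hxy.symm ?_) hc
    linear_combination -e

theorem OddUp.symmOn (hc : c ≠ 0) {C : ℂ → R} (hC : OddUp c C) {S : Finset ℂ} (hS : Gen c S) :
    SymmOn (fun x y => h c y x) C S := by
  intro x hx y hy hxy
  have h1 := hS.h_ne_zero hc hx hy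
  have h2 := hS.h_ne_zero hc hy hx
  have := congrArg (fun z => ((h c x y)⁻¹ * (h c y x)⁻¹) • z) (hC x y hxy)
  simp only [smul_smul] at this
  rwa [mul_right_comm, inv_mul_cancel₀ h1, one_mul, mul_assoc, inv_mul_cancel₀ h2, mul_one] at this

theorem OddDown.symmOn (hc : c ≠ 0) {C : ℂ → R} (hC : OddDown c C) {S : Finset ℂ} (hS : Gen c S) :
    SymmOn (h c) C S := by
  intro x hx y hy hxy
  have h1 := hS.h_ne_zero hc hx hy
  have h2 := hS.h_ne_zero hc hy hx
  have := congrArg (fun z => ((h c y x)⁻¹ * (h c x y)⁻¹) • z) (hC x y hxy)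
  simp only [smul_smul] at this
  rwa [mul_right_comm, inv_mul_cancel₀ h2, one_mul, mul_assoc, inv_mul_cancel₀ h1, mul_one] at this

/-- The operators `C x` commute with each other. -/
def Comm (C : ℂ → R) : Prop := ∀ x y, C x * C y = C y * C x

theorem Comm.symmOn {C : ℂ → R} (hC : Comm C) (S : Finset ℂ) : SymmOn (fun _ _ => 1) C S :=
  fun x _ y _ _ => by rw [hC]

@[simp] theorem oddU_empty (C : ℂ → R) : oddU c C ∅ = 1 := sp_empty
@[simp] theorem oddD_empty (C : ℂ → R) : oddD c C ∅ = 1 := sp_empty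
@[simp] theorem evenP_empty (C : ℂ → R) : evenP C ∅ = 1 := sp_empty

theorem mul_evenP {C : ℂ → R} (hC : Comm C) {x : ℂ} {S : Finset ℂ} (hx : x ∉ S) :
    C x * evenP C S = evenP C (insert x S) := by
  rw [evenP, evenP, sp_insert (hC.symmOn _) hx]; simp

theorem evenP_mul {C : ℂ → R} (hC : Comm C) {x : ℂ} {S : Finset ℂ} (hx : x ∉ S) :
    evenP C S * C x = evenP C (insert x S) := by
  rw [evenP, evenP, sp_insert_right (hC.symmOn _) hx]; simp

theorem pp_h_ne_zero (hc : c ≠ 0) {S U V : Finset ℂ} (hS : Gen c S) (hU : U ⊆ S) (hV : V ⊆ S) :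
    pp (h c) U V ≠ 0 := pp_ne_zero fun _ hx _ hy => hS.h_ne_zero hc (hU hx) (hV hy)

theorem oddU_insert (hc : c ≠ 0) {C : ℂ → R} (hC : OddUp c C) {x : ℂ} {S : Finset ℂ} (hS : Gen c (insert x S))
    (hx : x ∉ S) : oddU c C (insert x S) = (pp (h c) S {x})⁻¹ • (C x * oddU c C S) := by
  rw [oddU, oddU, sp_insert (hC.symmOn hc hS) hx, pp_singleton_right]

theorem oddU_insert_right (hc : c ≠ 0) {C : ℂ → R} (hC : OddUp c C) {x : ℂ} {S : Finset ℂ} (hS : Gen c (insert x S))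
    (hx : x ∉ S) : oddU c C (insert x S) = (pp (h c) {x} S)⁻¹ • (oddU c C S * C x) := by
  rw [oddU, oddU, sp_insert_right (hC.symmOn hc hS) hx, pp_singleton_left]

theorem oddD_insert (hc : c ≠ 0) {C : ℂ → R} (hC : OddDown c C) {x : ℂ} {S : Finset ℂ} (hS : Gen c (insert x S))
    (hx : x ∉ S) : oddD c C (insert x S) = (pp (h c) {x} S)⁻¹ • (C x * oddD c C S) := by
  rw [oddD, oddD, sp_insert (hC.symmOn hc hS) hx, pp_singleton_left]

theorem oddD_insert_right (hc : c ≠ 0) {C : ℂ → R} (hC : OddDown c C) {x : ℂ} {S : Finset ℂ} (hS : Gen c (insert x S))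
    (hx : x ∉ S) : oddD c C (insert x S) = (pp (h c) S {x})⁻¹ • (oddD c C S * C x) := by
  rw [oddD, oddD, sp_insert_right (hC.symmOn hc hS) hx, pp_singleton_right]

/-- The partial fraction identity of both action lemmas: a point l becomes the argument of D either
directly, or after x and v have been exchanged first, and the two contributions combine. -/
theorem g_mul_f_add (x v l : ℂ) (h1 : x ≠ v) (h2 : l ≠ x) (h3 : l ≠ v) :
    g c l x * f c x v + g c v x * g c l v = g c l x * f c l v := by
  rw [f_eq_one_add h1, f_eq_one_add h3]
  simp only [g]
  have := sub_ne_zero.2 h1; have := sub_ne_zero.2 h2; have := sub_ne_zero.2 h3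
  have := sub_ne_zero.2 h1.symm
  field_simp; ring

theorem OddUp.f_form (hc : c ≠ 0) {C : ℂ → R} (hC : OddUp c C) {x v : ℂ} (h : x ≠ v) :
    f c v x • (C v * C x) = -(f c x v • (C x * C v)) := by
  rw [f_eq hc, mul_smul, ← hC x v h, smul_smul, f_eq hc x v, g_antisymm c v x, neg_mul, neg_smul]

/-- The action of a diagonal-type operator on a symmetric product of odd creation operators. -/
theorem mul_oddU_action (hc : c ≠ 0) {C D : ℂ → R} (hC : OddUp c C)
    (hD : ∀ u v, u ≠ v → D u * C v = f c v u • (C v * D u) - g c v u • (C u * D v))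
    {x : ℂ} {V : Finset ℂ} (hV : Gen c V) (hx : x ∉ V) :
    D x * oddU c C V = pp (f c) V {x} • (oddU c C V * D x) -
      ∑ l ∈ V, (g c l x * pp (g c) (V.erase l) {l}) • (C x * oddU c C (V.erase l) * D l) := by
  induction V using Finset.induction_on generalizing x with
  | empty => simp
  | insert v V hv ih =>
    have hV' : Gen c V := hV.mono (Finset.subset_insert _ _)
    rw [Finset.mem_insert, not_or] at hx
    have hH : pp (h c) V {v} ≠ 0 := pp_h_ne_zero hc hV (Finset.subset_insert _ _) (by simp)
    rw [Finset.sum_insert hv, Finset.erase_insert hv, pp_insert_left _ hv, pp_pair]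
    have key : ∀ l ∈ V, (g c l x * pp (g c) ((insert v V).erase l) {l}) • (C x * oddU c C ((insert v V).erase l) * D l) =
        -(((pp (h c) V {v})⁻¹ * (g c l x * f c l v * pp (g c) (V.erase l) {l})) • (C x * C v * oddU c C (V.erase l) * D l)) := by
      intro l hl
      have hlv : l ≠ v := fun e => hv (e ▸ hl)
      have hins : insert v (V.erase l) ⊆ insert v V := Finset.insert_subset_insert _ (Finset.erase_subset _ _)
      have hlH : h c l v ≠ 0 := hV.h_ne_zero hc (by simp [hl]) (by simp)
      have hH' : pp (h c) (V.erase l) {v} ≠ 0 :=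
        pp_h_ne_zero hc hV ((Finset.erase_subset _ _).trans (Finset.subset_insert _ _)) (by simp)
      rw [Finset.erase_insert_of_ne hlv.symm, pp_insert_left _ (by simp [hv]), pp_pair,
        oddU_insert hc hC (hV.mono hins) (by simp [hv]), ← pp_erase_left (h c) hl, pp_pair, f_eq hc l v,
        g_antisymm c v l, mul_smul_comm, smul_mul_assoc, smul_smul, ← neg_smul, ← mul_assoc (C x)]
      congr 1; field_simp
    rw [Finset.sum_congr rfl key, oddU_insert hc hC hV hv, mul_smul_comm, ← mul_assoc, hD x v hx.1, sub_mul,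
      smul_mul_assoc, smul_mul_assoc, mul_assoc, mul_assoc, ih hV' hx.2, ih hV' hv]
    simp only [mul_sub, Finset.mul_sum, mul_smul_comm, smul_sub, Finset.smul_sum, smul_mul_assoc, smul_smul]
    have hf : pp (f c) V {v} = pp (g c) V {v} * pp (h c) V {v} := pp_f_eq hc _ _
    have e2 : ∀ l ∈ V, ((pp (h c) V {v})⁻¹ * (f c v x * (g c l x * pp (g c) (V.erase l) {l}))) •
          (C v * (C x * oddU c C (V.erase l) * D l)) =
        -(((pp (h c) V {v})⁻¹ * (f c x v * (g c l x * pp (g c) (V.erase l) {l}))) •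
          (C x * C v * oddU c C (V.erase l) * D l)) := by
      intro l hl
      have := congrArg (fun z => ((pp (h c) V {v})⁻¹ * (g c l x * pp (g c) (V.erase l) {l})) •
        (z * (oddU c C (V.erase l) * D l))) (hC.f_form hc hx.1)
      simp only [neg_mul, smul_neg, smul_mul_assoc, smul_smul, ← mul_assoc] at this ⊢
      convert this using 2
      · ring
      · congr 1; ring
    have e3 : ∀ l ∈ V, ((pp (h c) V {v})⁻¹ * (g c l x * f c l v * pp (g c) (V.erase l) {l})) •
          (C x * C v * oddU c C (V.erase l) * D l) =
        ((pp (h c) V {v})⁻¹ * (f c x v * (g c l x * pp (g c) (V.erase l) {l}))) •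
          (C x * C v * oddU c C (V.erase l) * D l) +
        ((pp (h c) V {v})⁻¹ * (g c v x * (g c l v * pp (g c) (V.erase l) {l}))) •
          (C x * (C v * oddU c C (V.erase l) * D l)) := by
      intro l hl
      have hlv : l ≠ v := fun e => hv (e ▸ hl)
      have hlx : l ≠ x := fun e => hx.2 (e ▸ hl)
      rw [← g_mul_f_add x v l hx.1 hlx hlv, ← mul_assoc (C x), ← mul_assoc (C x), ← add_smul]
      congr 1; ring
    rw [Finset.sum_congr rfl e2]
    simp only [Finset.sum_neg_distrib]
    rw [Finset.sum_congr rfl e3, Finset.sum_add_distrib, hf]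
    have e4 : (pp (h c) V {v})⁻¹ * (g c v x * (pp (g c) V {v} * pp (h c) V {v})) = g c v x * pp (g c) V {v} := by
      field_simp
    rw [e4]
    simp only [mul_assoc]
    have e5 : (pp (h c) V {v})⁻¹ * (f c v x * pp (f c) V {x}) = f c v x * (pp (f c) V {x} * (pp (h c) V {v})⁻¹) := by ring
    rw [e5]
    abel

/-- The action of a diagonal-type operator on a product of even creation operators. -/
theorem mul_evenP_action {c : ℂ} {C D : ℂ → R} (hC : Comm C)
    (hD : ∀ u v, u ≠ v → D u * C v = f c u v • (C v * D u) + g c v u • (C u * D v))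
    {x : ℂ} {V : Finset ℂ} (hx : x ∉ V) :
    D x * evenP C V = pp (f c) {x} V • (evenP C V * D x) +
      ∑ l ∈ V, (g c l x * pp (f c) {l} (V.erase l)) • (C x * evenP C (V.erase l) * D l) := by
  induction V using Finset.induction_on generalizing x with
  | empty => simp
  | insert v V hv ih =>
    rw [Finset.mem_insert, not_or] at hx
    rw [Finset.sum_insert hv, Finset.erase_insert hv, pp_insert_right _ hv, pp_pair, ← mul_evenP hC hv,
      ← mul_assoc, hD x v hx.1, add_mul, smul_mul_assoc, smul_mul_assoc, mul_assoc, mul_assoc, ih hx.2, ih hv]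
    have key : ∀ l ∈ V, (g c l x * pp (f c) {l} ((insert v V).erase l)) • (C x * evenP C ((insert v V).erase l) * D l) =
        (f c x v * (g c l x * pp (f c) {l} (V.erase l))) • (C v * (C x * evenP C (V.erase l) * D l)) +
        (g c v x * (g c l v * pp (f c) {l} (V.erase l))) • (C x * (C v * evenP C (V.erase l) * D l)) := by
      intro l hl
      have hlv : l ≠ v := fun e => hv (e ▸ hl)
      have hlx : l ≠ x := fun e => hx.2 (e ▸ hl)
      rw [Finset.erase_insert_of_ne hlv.symm, pp_insert_right _ (by simp [hv]), pp_pair,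
        ← mul_evenP hC (by simp [hv] : v ∉ V.erase l), ← mul_assoc (g c l x), ← g_mul_f_add x v l hx.1 hlx hlv]
      simp only [← mul_assoc]
      rw [hC v x, ← add_smul]
      congr 1; ring
    rw [Finset.sum_congr rfl key, Finset.sum_add_distrib]
    simp only [mul_add, Finset.mul_sum, mul_smul_comm, smul_add, Finset.smul_sum, smul_smul, ← mul_assoc]
    abel

end actions

/-! ### Commutation relations of the entries of the monodromy matrix -/

namespace Model
variable {c : ℂ} {V : Type*} [AddCommGroup V] [Module ℂ V] (M : Model c V)

/-- The relation says that f(x, y) annihilates the commutator. If f(x, y) = 0, exchange the two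
points: f(x, y) and f(y, x) cannot both vanish when c is nonzero. -/
theorem comm_of_rtt {R : Type*} [Ring R] [Algebra ℂ R] (hc : c ≠ 0) {C : ℂ → R}
    (h : ∀ x y, x ≠ y → C x * C y - C y * C x = g c x y • (C y * C x - C x * C y)) : Comm C := by
  have key : ∀ x y, x ≠ y → f c x y ≠ 0 → C x * C y = C y * C x := by
    intro x y hxy hf
    have : f c x y • (C x * C y - C y * C x) = 0 := by
      rw [f_eq_one_add hxy]; linear_combination (norm := module) h x y hxy
    exact sub_eq_zero.1 ((smul_eq_zero.1 this).resolve_left hf)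
  intro x y
  rcases eq_or_ne x y with rfl | hxy
  · rfl
  by_cases hf : f c x y = 0
  · refine (key y x hxy.symm (div_ne_zero (fun e => hc ?_) (sub_ne_zero.2 hxy.symm))).symm
    have : x - y + c = 0 := (div_eq_zero_iff.1 hf).resolve_right (sub_ne_zero.2 hxy)
    linear_combination (this + e) / 2
  · exact key x y hxy hf

theorem comm₁₂ (hc : c ≠ 0) : Comm (M.T 0 1) :=
  comm_of_rtt hc fun x y hxy => by simpa [par] using M.rtt 0 1 0 1 x y hxy

theorem comm₂₁ (hc : c ≠ 0) : Comm (M.T 1 0) :=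
  comm_of_rtt hc fun x y hxy => by simpa [par] using M.rtt 1 0 1 0 x y hxy

theorem h_smul_of_f {R : Type*} [Ring R] [Algebra ℂ R] (hc : c ≠ 0) {x y : ℂ} (hxy : x ≠ y) {p q : R}
    (e : p + q = g c x y • (q - p)) : h c x y • p = h c y x • q := by
  have e1 : f c x y • p = -(f c y x • q) := by
    rw [f_eq_one_add hxy, f_eq_one_add hxy.symm, g_antisymm c y x, eq_neg_iff_add_eq_zero]
    have : p + q - g c x y • (q - p) = 0 := sub_eq_zero.2 e
    rw [← this]; module
  have hg := g_ne_zero hc hxy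
  have e2 := congrArg (fun z => (g c x y)⁻¹ • z) e1
  simp only [f_eq hc x y, f_eq hc y x, g_antisymm c y x, neg_mul, neg_smul, neg_neg, smul_smul] at e2
  rwa [← mul_assoc, ← mul_assoc, inv_mul_cancel₀ hg, one_mul, one_mul] at e2

theorem oddUp₁₃ (hc : c ≠ 0) : OddUp c (M.T 0 2) := fun x y hxy =>
  h_smul_of_f hc hxy (by simpa [par] using M.rtt 0 2 0 2 x y hxy)

theorem oddUp₂₃ (hc : c ≠ 0) : OddUp c (M.T 1 2) := fun x y hxy =>
  h_smul_of_f hc hxy (by simpa [par] using M.rtt 1 2 1 2 x y hxy)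

theorem oddDown₃₁ (hc : c ≠ 0) : OddDown c (M.T 2 0) := fun x y hxy =>
  (h_smul_of_f hc hxy (by
    have := M.rtt 2 0 2 0 x y hxy
    simp [par] at this
    rw [add_comm, this, ← smul_neg, neg_sub])).symm

theorem oddDown₃₂ (hc : c ≠ 0) : OddDown c (M.T 2 1) := fun x y hxy =>
  (h_smul_of_f hc hxy (by
    have := M.rtt 2 1 2 1 x y hxy
    simp [par] at this
    rw [add_comm, this, ← smul_neg, neg_sub])).symm

theorem rel₂₂_₂₃ (u v : ℂ) (huv : u ≠ v) :
    M.T 1 1 u * M.T 1 2 v = f c v u • (M.T 1 2 v * M.T 1 1 u) - g c v u • (M.T 1 2 u * M.T 1 1 v) := by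
  have := M.rtt 1 2 1 1 v u huv.symm
  simp [par] at this
  rw [f_eq_one_add huv.symm]
  linear_combination (norm := module) (-1 : ℂ) • this

theorem rel₃₃_₂₃ (u v : ℂ) (huv : u ≠ v) :
    M.T 2 2 u * M.T 1 2 v = f c v u • (M.T 1 2 v * M.T 2 2 u) - g c v u • (M.T 1 2 u * M.T 2 2 v) := by
  have := M.rtt 2 2 1 2 u v huv
  simp [par] at this
  rw [f_eq_one_add huv.symm]
  rw [g_antisymm c u v] at this
  linear_combination (norm := module) (1 : ℂ) • this

theorem rel₁₂_₁₃ (u v : ℂ) (huv : u ≠ v) :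
    M.T 0 1 u * M.T 0 2 v = f c v u • (M.T 0 2 v * M.T 0 1 u) - g c v u • (M.T 0 2 u * M.T 0 1 v) := by
  have := M.rtt 0 2 0 1 v u huv.symm
  simp [par] at this
  rw [f_eq_one_add huv.symm]
  linear_combination (norm := module) (-1 : ℂ) • this

theorem rel₂₁_₂₃ (u v : ℂ) (huv : u ≠ v) :
    M.T 1 0 u * M.T 1 2 v = f c v u • (M.T 1 2 v * M.T 1 0 u) - g c v u • (M.T 1 2 u * M.T 1 0 v) := by
  have := M.rtt 1 2 1 0 v u huv.symm
  simp [par] at this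
  rw [f_eq_one_add huv.symm]
  linear_combination (norm := module) (-1 : ℂ) • this

theorem rel₂₂_₁₂ (u v : ℂ) (huv : u ≠ v) :
    M.T 1 1 u * M.T 0 1 v = f c u v • (M.T 0 1 v * M.T 1 1 u) + g c v u • (M.T 0 1 u * M.T 1 1 v) := by
  have := M.rtt 1 1 0 1 u v huv
  simp [par] at this
  rw [f_eq_one_add huv, g_antisymm c v u]
  linear_combination (norm := module) (1 : ℂ) • this

theorem rel₃₂_₁₂ (u v : ℂ) (huv : u ≠ v) :
    M.T 2 1 u * M.T 0 1 v = f c u v • (M.T 0 1 v * M.T 2 1 u) + g c v u • (M.T 0 1 u * M.T 2 1 v) := by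
  have := M.rtt 2 1 0 1 u v huv
  simp [par] at this
  rw [f_eq_one_add huv, g_antisymm c v u]
  linear_combination (norm := module) (1 : ℂ) • this

/-- Written with -c so that it has the form of the relation for T_{22} and `mul_evenP_action` covers
both; `pp_f_neg` translates back. -/
theorem rel₁₁_₁₂ (u v : ℂ) (huv : u ≠ v) :
    M.T 0 0 u * M.T 0 1 v = f (-c) u v • (M.T 0 1 v * M.T 0 0 u) + g (-c) v u • (M.T 0 1 u * M.T 0 0 v) := by
  have := M.rtt 0 1 0 0 v u huv.symm
  simp [par] at this
  have e1 : f (-c) u v = 1 + g c v u := by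
    rw [f_eq_one_add huv, g, g, ← neg_sub v u, neg_div_neg_eq]
  have e2 : g (-c) v u = -g c v u := by rw [g, g, neg_div]
  rw [e1, e2]
  linear_combination (norm := module) (-1 : ℂ) • this

theorem rel₃₃_₁₂ (u v : ℂ) (huv : u ≠ v) :
    M.T 2 2 u * M.T 0 1 v = M.T 0 1 v * M.T 2 2 u + g c u v • (M.T 0 2 v * M.T 2 1 u - M.T 0 2 u * M.T 2 1 v) := by
  have := M.rtt 2 2 0 1 u v huv
  simp [par] at this
  linear_combination (norm := module) (1 : ℂ) • this

theorem rel₁₂_₂₃ (u v : ℂ) (huv : u ≠ v) :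
    M.T 0 1 u * M.T 1 2 v = M.T 1 2 v * M.T 0 1 u - g c v u • (M.T 0 2 u * M.T 1 1 v - M.T 0 2 v * M.T 1 1 u) := by
  have := M.rtt 1 2 0 1 v u huv.symm
  simp [par] at this
  linear_combination (norm := module) (-1 : ℂ) • this

theorem rel₂₃_₁₃ (u v : ℂ) (huv : u ≠ v) :
    M.T 1 2 v * M.T 0 2 u = -(M.T 0 2 u * M.T 1 2 v) + g c v u • (M.T 0 2 u * M.T 1 2 v - M.T 0 2 v * M.T 1 2 u) := by
  have := M.rtt 1 2 0 2 v u huv.symm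
  simp [par] at this
  linear_combination (norm := module) (1 : ℂ) • this

theorem rel₃₂_₂₃ (u v : ℂ) (huv : u ≠ v) :
    M.T 2 1 u * M.T 1 2 v = -(M.T 1 2 v * M.T 2 1 u) + (-1 * g c u v) • (M.T 1 1 v * M.T 2 2 u - M.T 1 1 u * M.T 2 2 v) := by
  have := M.rtt 2 1 1 2 u v huv
  simp [par] at this
  linear_combination (norm := module) (1 : ℂ) • this

/-- The opposite order of the RTT relation exchanges the roles of T_{22} and T_{33} in `rel₃₂_₂₃`.
`odd_annihilation` is used with both versions, according to which of the two operators annihilates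
the given vector at the points of the product. -/
theorem rel₃₂_₂₃' (u v : ℂ) (huv : u ≠ v) :
    M.T 2 1 u * M.T 1 2 v = -(M.T 1 2 v * M.T 2 1 u) + (1 * g c u v) • (M.T 2 2 v * M.T 1 1 u - M.T 2 2 u * M.T 1 1 v) := by
  have := M.rtt 1 2 2 1 v u huv.symm
  simp [par] at this
  rw [g_antisymm c v u] at this
  linear_combination (norm := module) (1 : ℂ) • this

theorem rel₂₁_₁₂ (u v : ℂ) (huv : u ≠ v) :
    M.T 1 0 u * M.T 0 1 v = M.T 0 1 v * M.T 1 0 u + g c u v • (M.T 0 0 v * M.T 1 1 u - M.T 0 0 u * M.T 1 1 v) := by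
  have := M.rtt 1 0 0 1 u v huv
  simp [par] at this
  linear_combination (norm := module) (1 : ℂ) • this

theorem rel₁₁_₂₃ (u v : ℂ) (huv : u ≠ v) :
    M.T 0 0 u * M.T 1 2 v = M.T 1 2 v * M.T 0 0 u - g c v u • (M.T 0 2 u * M.T 1 0 v - M.T 0 2 v * M.T 1 0 u) := by
  have := M.rtt 1 2 0 0 v u huv.symm
  simp [par] at this
  linear_combination (norm := module) (-1 : ℂ) • this

/-- The product of the operators `T_{12}`. -/
abbrev b12 (S : Finset ℂ) : Module.End ℂ V := evenP (M.T 0 1) S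
/-- The symmetric product of the operators `T_{13}`. -/
abbrev b13 (S : Finset ℂ) : Module.End ℂ V := oddU c (M.T 0 2) S
/-- The symmetric product of the operators `T_{23}`. -/
abbrev b23 (S : Finset ℂ) : Module.End ℂ V := oddU c (M.T 1 2) S
/-- The product of the operators `T_{21}`. -/
abbrev c21 (S : Finset ℂ) : Module.End ℂ V := evenP (M.T 1 0) S
/-- The symmetric product of the operators `T_{31}`. -/
abbrev c31 (S : Finset ℂ) : Module.End ℂ V := oddD c (M.T 2 0) S
/-- The symmetric product of the operators `T_{32}`. -/
abbrev c32 (S : Finset ℂ) : Module.End ℂ V := oddD c (M.T 2 1) S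

end Model

/-! ### Actions on vectors built from the vacuum -/

section vectors
variable {c : ℂ} {V : Type*} [AddCommGroup V] [Module ℂ V]

theorem oddU_action_apply (hc : c ≠ 0) {C D : ℂ → Module.End ℂ V} (hC : OddUp c C)
    (hD : ∀ u v, u ≠ v → D u * C v = f c v u • (C v * D u) - g c v u • (C u * D v))
    {x : ℂ} {S : Finset ℂ} (hS : Gen c S) (hx : x ∉ S) {ψ : V} {μ : ℂ → ℂ} (hμ : ∀ l ∈ S, D l ψ = μ l • ψ) :
    D x (oddU c C S ψ) = pp (f c) S {x} • oddU c C S (D x ψ) -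
      ∑ l ∈ S, (g c l x * pp (g c) (S.erase l) {l} * μ l) • C x (oddU c C (S.erase l) ψ) := by
  have := LinearMap.congr_fun (mul_oddU_action hc hC hD hS hx) ψ
  simp only [Module.End.mul_apply, LinearMap.sub_apply, LinearMap.smul_apply, LinearMap.sum_apply] at this
  rw [this]
  congr 1
  refine Finset.sum_congr rfl fun l hl => ?_
  rw [hμ l hl, map_smul, map_smul, smul_smul]

theorem oddU_action_of_eq_zero (hc : c ≠ 0) {C D : ℂ → Module.End ℂ V} (hC : OddUp c C)
    (hD : ∀ u v, u ≠ v → D u * C v = f c v u • (C v * D u) - g c v u • (C u * D v))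
    {x : ℂ} {S : Finset ℂ} (hS : Gen c S) (hx : x ∉ S) {ψ : V} (hψ : ∀ l ∈ S, D l ψ = 0) :
    D x (oddU c C S ψ) = pp (f c) S {x} • oddU c C S (D x ψ) := by
  rw [oddU_action_apply hc hC hD hS hx (μ := 0) (by simpa using hψ)]; simp

theorem evenP_action_of_eq_zero {C D : ℂ → Module.End ℂ V} (hC : Comm C)
    (hD : ∀ u v, u ≠ v → D u * C v = f c u v • (C v * D u) + g c v u • (C u * D v))
    {x : ℂ} {S : Finset ℂ} (hx : x ∉ S) {ψ : V} (hψ : ∀ l ∈ S, D l ψ = 0) :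
    D x (evenP C S ψ) = pp (f c) {x} S • evenP C S (D x ψ) := by
  have := LinearMap.congr_fun (mul_evenP_action hC hD hx) ψ
  simp only [Module.End.mul_apply, LinearMap.add_apply, LinearMap.smul_apply, LinearMap.sum_apply] at this
  rw [this, Finset.sum_eq_zero, add_zero]
  intro l hl; rw [hψ l hl]; simp

theorem g_add_g_mul (u v l : ℂ) (h1 : u ≠ v) (h2 : u ≠ l) (h3 : l ≠ v) :
    g c u l + g c u v * f c l u * g c l v = g c u l * f c v u * f c l v := by
  rw [f_eq_one_add h1.symm, f_eq_one_add h3, f_eq_one_add h2.symm]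
  simp only [g]
  have := sub_ne_zero.2 h1; have := sub_ne_zero.2 h2; have := sub_ne_zero.2 h3
  have := sub_ne_zero.2 h1.symm; have := sub_ne_zero.2 h2.symm
  field_simp; ring

/-- The action of an odd annihilation operator on a symmetric product of odd creation operators. -/
theorem odd_annihilation (hc : c ≠ 0) {C C' D E : ℂ → Module.End ℂ V} {ε : ℂ} (hC : OddUp c C)
    (hD : ∀ u v, u ≠ v → D u * C v = f c v u • (C v * D u) - g c v u • (C u * D v))
    (hE : ∀ u v, u ≠ v → E u * C v = f c v u • (C v * E u) - g c v u • (C u * E v))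
    (hC' : ∀ u v, u ≠ v → C' u * C v = -(C v * C' u) + (ε * g c u v) • (D v * E u - D u * E v))
    {u e : ℂ} {d : ℂ → ℂ} {S : Finset ℂ} (hS : Gen c S) (hu : u ∉ S) {ψ : V} (h0 : C' u ψ = 0)
    (hEu : E u ψ = e • ψ) (hES : ∀ l ∈ S, E l ψ = 0) (hDS : ∀ l ∈ S, D l ψ = d l • ψ) :
    C' u (oddU c C S ψ) = ∑ l ∈ S, (ε * e * (g c u l * d l * pp (f c) (S.erase l) {u} * pp (g c) (S.erase l) {l})) •
      oddU c C (S.erase l) ψ := by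
  induction S using Finset.induction_on with
  | empty => simpa using h0
  | insert v S hv ih =>
    have hS' : Gen c S := hS.mono (Finset.subset_insert _ _)
    rw [Finset.mem_insert, not_or] at hu
    have hH : pp (h c) S {v} ≠ 0 := pp_h_ne_zero hc hS (Finset.subset_insert _ _) (by simp)
    have hES' : ∀ l ∈ S, E l ψ = 0 := fun l hl => hES l (by simp [hl])
    have hDS' : ∀ l ∈ S, D l ψ = d l • ψ := fun l hl => hDS l (by simp [hl])
    have e1 : E u (oddU c C S ψ) = (pp (f c) S {u} * e) • oddU c C S ψ := by
      rw [oddU_action_of_eq_zero hc hC hE hS' hu.2 hES', hEu, map_smul, smul_smul]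
    have e2 : E v (oddU c C S ψ) = 0 := by
      rw [oddU_action_of_eq_zero hc hC hE hS' hv hES', hES v (by simp)]; simp
    have e3 := oddU_action_apply hc hC hD hS' hv hDS'
    rw [hDS v (by simp), map_smul] at e3
    have key : ∀ l ∈ S, (ε * e * (g c u l * d l * pp (f c) ((insert v S).erase l) {u} * pp (g c) ((insert v S).erase l) {l})) •
        oddU c C ((insert v S).erase l) ψ =
        (-(pp (h c) S {v})⁻¹ * (ε * e * (g c u l * d l * pp (f c) (S.erase l) {u} * pp (g c) (S.erase l) {l})) -
          (pp (h c) S {v})⁻¹ * (ε * g c u v) * (pp (f c) S {u} * e) * (g c l v * pp (g c) (S.erase l) {l} * d l)) •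
        C v (oddU c C (S.erase l) ψ) := by
      intro l hl
      have hlv : l ≠ v := fun e => hv (e ▸ hl)
      have hul : u ≠ l := fun e => hu.2 (e ▸ hl)
      have hins : insert v (S.erase l) ⊆ insert v S := Finset.insert_subset_insert _ (Finset.erase_subset _ _)
      have hlH : h c l v ≠ 0 := hS.h_ne_zero hc (by simp [hl]) (by simp)
      have hH' : pp (h c) (S.erase l) {v} ≠ 0 :=
        pp_h_ne_zero hc hS ((Finset.erase_subset _ _).trans (Finset.subset_insert _ _)) (by simp)
      rw [Finset.erase_insert_of_ne hlv.symm, pp_insert_left _ (by simp [hv]), pp_insert_left _ (by simp [hv]),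
        pp_pair, pp_pair, oddU_insert hc hC (hS.mono hins) (by simp [hv]), ← pp_erase_left (h c) hl,
        ← pp_erase_left (f c) hl, pp_pair, pp_pair, LinearMap.smul_apply, smul_smul, Module.End.mul_apply]
      congr 1
      -- The operator at u reaches l directly, or it is exchanged with v, after which the operator
      -- at v is exchanged with l.
      have hid := g_add_g_mul (c := c) u v l hu.1 hul hlv
      rw [f_eq hc l v] at hid
      rw [g_antisymm c v l]
      field_simp
      linear_combination ε * pp (f c) (S.erase l) {u} * e * pp (g c) (S.erase l) {l} * d l * hid
    rw [Finset.sum_insert hv, Finset.sum_congr rfl key, Finset.erase_insert hv, oddU_insert hc hC hS hv,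
      LinearMap.smul_apply, map_smul, ← Module.End.mul_apply, ← mul_assoc, hC' u v hu.1]
    simp only [Module.End.mul_apply, LinearMap.add_apply, LinearMap.neg_apply, LinearMap.smul_apply, LinearMap.sub_apply,
      e2, map_zero, sub_zero, e1, map_smul]
    rw [e3, ih hS' hu.2 hES' hDS', pp_f_eq hc S {v}]
    simp only [map_sum, map_smul, smul_add, smul_sub, smul_neg, Finset.smul_sum, smul_smul, sub_smul, Finset.sum_sub_distrib]
    have e4 : (pp (h c) S {v})⁻¹ * (ε * g c u v * (pp (f c) S {u} * e * (pp (g c) S {v} * pp (h c) S {v} * d v))) =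
      ε * e * (g c u v * d v * pp (f c) S {u} * pp (g c) S {v}) := by field_simp
    simp only [mul_assoc] at e4 ⊢
    simp only [e4, neg_mul, neg_smul, Finset.sum_neg_distrib]
    abel

end vectors

namespace Model
variable {c : ℂ} {V : Type*} [AddCommGroup V] [Module ℂ V] (M : Model c V)

/-- Each exchange of T_{12}(x) with T_{23}(v) creates T_{13} T_{22}. As T_{22}(x) kills the vector,
the terms accumulate only the eigenvalues of T_{22} at points of S. -/
theorem T₁₂_b23 (hc : c ≠ 0) {x : ℂ} {S : Finset ℂ} (hS : Gen c S) (hx : x ∉ S) {ψ : V} {μ : ℂ → ℂ}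
    (h0 : M.T 1 1 x ψ = 0) (hμ : ∀ l ∈ S, M.T 1 1 l ψ = μ l • ψ) :
    M.T 0 1 x (M.b23 S ψ) = M.b23 S (M.T 0 1 x ψ) -
      ∑ l ∈ S, (g c l x * pp (g c) (S.erase l) {l} * μ l) • M.T 0 2 x (M.b23 (S.erase l) ψ) := by
  induction S using Finset.induction_on with
  | empty => simp
  | insert v S hv ih =>
    have hS' : Gen c S := hS.mono (Finset.subset_insert _ _)
    rw [Finset.mem_insert, not_or] at hx
    have hH : pp (h c) S {v} ≠ 0 := pp_h_ne_zero hc hS (Finset.subset_insert _ _) (by simp)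
    have hμ' : ∀ l ∈ S, M.T 1 1 l ψ = μ l • ψ := fun l hl => hμ l (by simp [hl])
    have e1 := oddU_action_apply hc (M.oddUp₂₃ hc) M.rel₂₂_₂₃ hS' hv hμ'
    have e2 := oddU_action_apply hc (M.oddUp₂₃ hc) M.rel₂₂_₂₃ hS' hx.2 hμ'
    rw [h0, map_zero, smul_zero, zero_sub] at e2
    rw [hμ v (by simp), map_smul] at e1
    have key : ∀ l ∈ S, (g c l x * pp (g c) ((insert v S).erase l) {l} * μ l) •
        M.T 0 2 x (M.b23 ((insert v S).erase l) ψ) =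
        -(((pp (h c) S {v})⁻¹ * (g c l x * (1 - g c v x) + g c v x * g c l v) * pp (g c) (S.erase l) {l} * μ l) •
          M.T 0 2 x (M.T 1 2 v (M.b23 (S.erase l) ψ))) := by
      intro l hl
      have hlv : l ≠ v := fun e => hv (e ▸ hl)
      have hlx : l ≠ x := fun e => hx.2 (e ▸ hl)
      have hins : insert v (S.erase l) ⊆ insert v S := Finset.insert_subset_insert _ (Finset.erase_subset _ _)
      have hlH : h c l v ≠ 0 := hS.h_ne_zero hc (by simp [hl]) (by simp)
      have hH' : pp (h c) (S.erase l) {v} ≠ 0 :=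
        pp_h_ne_zero hc hS ((Finset.erase_subset _ _).trans (Finset.subset_insert _ _)) (by simp)
      have hid := g_mul_f_add (c := c) x v l hx.1 hlx hlv
      rw [f_eq_one_add hx.1, f_eq hc l v, g_antisymm c x v] at hid
      rw [Finset.erase_insert_of_ne hlv.symm, pp_insert_left _ (by simp [hv]),
        pp_pair, b23, oddU_insert hc (M.oddUp₂₃ hc) (hS.mono hins) (by simp [hv]), ← pp_erase_left (h c) hl,
        pp_pair, LinearMap.smul_apply, map_smul, smul_smul, Module.End.mul_apply, ← neg_smul]
      congr 1
      rw [g_antisymm c v l]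
      field_simp
      linear_combination pp (g c) (S.erase l) {l} * μ l * hid
    rw [Finset.sum_insert hv, Finset.sum_congr rfl key, Finset.erase_insert hv, b23, oddU_insert hc (M.oddUp₂₃ hc) hS hv,
      LinearMap.smul_apply, map_smul, ← Module.End.mul_apply, ← mul_assoc, M.rel₁₂_₂₃ x v hx.1]
    simp only [Module.End.mul_apply, LinearMap.smul_apply, LinearMap.sub_apply]
    rw [e1, e2, ih hS' hx.2 hμ']
    simp only [map_sub, map_neg, map_sum, map_smul]
    have e3 : ∀ ξ : V, M.T 1 2 v (M.T 0 2 x ξ) = -(M.T 0 2 x (M.T 1 2 v ξ)) + g c v x • (M.T 0 2 x (M.T 1 2 v ξ) - M.T 0 2 v (M.T 1 2 x ξ)) := by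
      intro ξ
      simpa using LinearMap.congr_fun (M.rel₂₃_₁₃ x v hx.1) ξ
    simp only [e3]
    have hsum : ∑ l ∈ S, -(((pp (h c) S {v})⁻¹ * (g c l x * (1 - g c v x) + g c v x * g c l v) * pp (g c) (S.erase l) {l} * μ l) •
          M.T 0 2 x (M.T 1 2 v (M.b23 (S.erase l) ψ))) = (pp (h c) S {v})⁻¹ •
        (∑ l ∈ S, (g c l x * pp (g c) (S.erase l) {l} * μ l) • (-(M.T 0 2 x (M.T 1 2 v (M.b23 (S.erase l) ψ))) +
            g c v x • (M.T 0 2 x (M.T 1 2 v (M.b23 (S.erase l) ψ)) - M.T 0 2 v (M.T 1 2 x (M.b23 (S.erase l) ψ)))) -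
          g c v x • ∑ l ∈ S, (g c l v * pp (g c) (S.erase l) {l} * μ l) • M.T 0 2 x (M.T 1 2 v (M.b23 (S.erase l) ψ)) +
          g c v x • ∑ l ∈ S, (g c l x * pp (g c) (S.erase l) {l} * μ l) • M.T 0 2 v (M.T 1 2 x (M.b23 (S.erase l) ψ))) := by
      simp only [Finset.smul_sum, ← Finset.sum_sub_distrib, ← Finset.sum_add_distrib]
      exact Finset.sum_congr rfl fun l _ => by module
    have hf : (pp (h c) S {v})⁻¹ * pp (f c) S {v} = pp (g c) S {v} := by
      rw [pp_f_eq hc]; field_simp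
    rw [hsum]
    linear_combination (norm := module) (-(g c v x * μ v) * hf) • M.T 0 2 x (M.b23 S ψ)

theorem T₂₂_b12_vac (hc : c ≠ 0) {x : ℂ} {S : Finset ℂ} (hx : x ∉ S) (hS : ∀ s ∈ S, M.lam 1 s = 0) :
    M.T 1 1 x (M.b12 S M.vac) = (pp (f c) {x} S * M.lam 1 x) • M.b12 S M.vac := by
  rw [b12, evenP_action_of_eq_zero (M.comm₁₂ hc) M.rel₂₂_₁₂ hx, M.diag_vac, map_smul, smul_smul]
  intro s hs; rw [M.diag_vac, hS s hs, zero_smul]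

theorem T₃₂_b12_vac (hc : c ≠ 0) {x : ℂ} {S : Finset ℂ} (hx : x ∉ S) : M.T 2 1 x (M.b12 S M.vac) = 0 := by
  have h0 : ∀ z, M.T 2 1 z M.vac = 0 := fun z => M.lower_vac 1 2 z (by decide)
  rw [b12, evenP_action_of_eq_zero (M.comm₁₂ hc) M.rel₃₂_₁₂ hx fun s _ => h0 s, h0]; simp

theorem T₃₃_b12_vac (hc : c ≠ 0) {x : ℂ} {S : Finset ℂ} (hx : x ∉ S) :
    M.T 2 2 x (M.b12 S M.vac) = M.lam 2 x • M.b12 S M.vac := by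
  induction S using Finset.induction_on with
  | empty => simpa using M.diag_vac 2 x
  | insert v S hv ih =>
    rw [Finset.mem_insert, not_or] at hx
    rw [b12, ← mul_evenP (M.comm₁₂ hc) hv, Module.End.mul_apply]
    have := LinearMap.congr_fun (M.rel₃₃_₁₂ x v hx.1) (M.b12 S M.vac)
    simp only [Module.End.mul_apply, LinearMap.add_apply, LinearMap.sub_apply, LinearMap.smul_apply] at this
    rw [this, M.T₃₂_b12_vac hc hx.2, M.T₃₂_b12_vac hc hv, ih hx.2]; simp

theorem T₂₁_b23_vac (hc : c ≠ 0) {x : ℂ} {S : Finset ℂ} (hS : Gen c S) (hx : x ∉ S) :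
    M.T 1 0 x (M.b23 S M.vac) = 0 := by
  have h0 : ∀ z, M.T 1 0 z M.vac = 0 := fun z => M.lower_vac 0 1 z (by decide)
  rw [b23, oddU_action_of_eq_zero hc (M.oddUp₂₃ hc) M.rel₂₁_₂₃ hS hx fun s _ => h0 s, h0]; simp

theorem T₁₁_b23_vac (hc : c ≠ 0) {x : ℂ} {S : Finset ℂ} (hS : Gen c S) (hx : x ∉ S) :
    M.T 0 0 x (M.b23 S M.vac) = M.lam 0 x • M.b23 S M.vac := by
  induction S using Finset.induction_on with
  | empty => simpa using M.diag_vac 0 x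
  | insert v S hv ih =>
    have hS' : Gen c S := hS.mono (Finset.subset_insert _ _)
    rw [Finset.mem_insert, not_or] at hx
    rw [b23, oddU_insert hc (M.oddUp₂₃ hc) hS hv, LinearMap.smul_apply, map_smul, Module.End.mul_apply]
    have := LinearMap.congr_fun (M.rel₁₁_₂₃ x v hx.1) (M.b23 S M.vac)
    simp only [Module.End.mul_apply, LinearMap.sub_apply, LinearMap.smul_apply] at this
    rw [this, M.T₂₁_b23_vac hc hS' hx.2, M.T₂₁_b23_vac hc hS' hv, ih hS' hx.2]
    simp only [map_zero, sub_zero, smul_zero, map_smul]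
    exact smul_comm _ _ _

theorem pp_f_neg (c : ℂ) {S U : Finset ℂ} : pp (f (-c)) S U = pp (f c) U S := by
  rw [← pp_flip (f c)]
  refine pp_congr fun x _ y _ => ?_
  rw [f, f, ← neg_sub y x, ← neg_add, neg_div_neg_eq]

theorem T₁₁_b12 (hc : c ≠ 0) {x : ℂ} {S : Finset ℂ} (hx : x ∉ S) {ψ : V} (hψ : ∀ s ∈ S, M.T 0 0 s ψ = 0) :
    M.T 0 0 x (M.b12 S ψ) = pp (f c) S {x} • M.b12 S (M.T 0 0 x ψ) := by
  rw [b12, evenP_action_of_eq_zero (M.comm₁₂ hc) M.rel₁₁_₁₂ hx hψ, pp_f_neg]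

theorem T₂₂_b23 (hc : c ≠ 0) {x : ℂ} {S : Finset ℂ} (hS : Gen c S) (hx : x ∉ S) {ψ : V} {μ : ℂ → ℂ}
    (hμ : ∀ l ∈ S, M.T 1 1 l ψ = μ l • ψ) :
    M.T 1 1 x (M.b23 S ψ) = pp (f c) S {x} • M.b23 S (M.T 1 1 x ψ) -
      ∑ l ∈ S, (g c l x * pp (g c) (S.erase l) {l} * μ l) • M.T 1 2 x (M.b23 (S.erase l) ψ) :=
  oddU_action_apply hc (M.oddUp₂₃ hc) M.rel₂₂_₂₃ hS hx hμ

theorem T₃₃_b23 (hc : c ≠ 0) {x : ℂ} {S : Finset ℂ} (hS : Gen c S) (hx : x ∉ S) {ψ : V}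
    (hψ : ∀ l ∈ S, M.T 2 2 l ψ = 0) : M.T 2 2 x (M.b23 S ψ) = pp (f c) S {x} • M.b23 S (M.T 2 2 x ψ) :=
  oddU_action_of_eq_zero hc (M.oddUp₂₃ hc) M.rel₃₃_₂₃ hS hx hψ

/-- The factor T_{33}(x) is left unevaluated: in `Splitting.step` exactly these vectors cancel
against those coming from T_{13}(x). -/
theorem T₃₂_b23 (hc : c ≠ 0) {x e : ℂ} {S : Finset ℂ} (hS : Gen c S) (hx : x ∉ S) {ψ : V} {μ : ℂ → ℂ}
    (hμ : ∀ l ∈ S, M.T 1 1 l ψ = μ l • ψ) (h0 : M.T 2 1 x ψ = 0) (hψ : ∀ l ∈ S, M.T 2 2 l ψ = 0)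
    (he : M.T 2 2 x ψ = e • ψ) :
    M.T 2 1 x (M.b23 S ψ) =
      ∑ l ∈ S, (g c l x * pp (g c) (S.erase l) {l} * μ l) • M.T 2 2 x (M.b23 (S.erase l) ψ) := by
  rw [b23, odd_annihilation (ε := -1) hc (M.oddUp₂₃ hc) M.rel₂₂_₂₃ M.rel₃₃_₂₃ M.rel₃₂_₂₃ hS hx h0 he hψ hμ]
  refine Finset.sum_congr rfl fun l hl => ?_
  rw [M.T₃₃_b23 hc (hS.mono (Finset.erase_subset _ _)) (fun h => hx (Finset.mem_of_mem_erase h))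
    fun s hs => hψ s (Finset.mem_of_mem_erase hs), he, map_smul, smul_smul, smul_smul, g_antisymm c x l]
  congr 1; ring

/-- The action of `T_{32}` on the vacuum descendants of `T_{23}` with `λ_2 = 0`. -/
theorem T₃₂_b23_vac (hc : c ≠ 0) {x : ℂ} {S : Finset ℂ} (hS : Gen c S) (hx : x ∉ S) (h2 : ∀ l ∈ S, M.lam 1 l = 0) :
    M.T 2 1 x (M.b23 S M.vac) = ∑ l ∈ S, (M.lam 1 x * (g c x l * M.lam 2 l * pp (f c) (S.erase l) {x} *
      pp (g c) (S.erase l) {l})) • M.b23 (S.erase l) M.vac := by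
  have := odd_annihilation (ε := 1) hc (M.oddUp₂₃ hc) M.rel₃₃_₂₃ M.rel₂₂_₂₃ M.rel₃₂_₂₃' hS hx
    (M.lower_vac 1 2 x (by decide)) (M.diag_vac 1 x) (fun l hl => by rw [M.diag_vac, h2 l hl, zero_smul])
    (fun l _ => M.diag_vac 2 l)
  simpa only [one_mul] using this

end Model

/-! ### Rational identities for the recursion of Bethe vectors -/

section sums
variable {M : Type*} [AddCommMonoid M]

theorem sum_powerset_move (X : Finset ℂ) (F : ℂ → Finset ℂ → M) :
    ∑ Z ∈ X.powerset, ∑ x ∈ Z, F x (Z.erase x) = ∑ Z ∈ X.powerset, ∑ x ∈ X \ Z, F x Z := by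
  rw [sum_powerset_mem, sum_powerset_sdiff]

theorem sum_powersetCard_mem (X : Finset ℂ) (n : ℕ) (F : ℂ → Finset ℂ → M) :
    ∑ x ∈ X, ∑ Z ∈ (X.erase x).powersetCard n, F x Z =
      ∑ Z ∈ X.powersetCard (n + 1), ∑ x ∈ Z, F x (Z.erase x) := by
  have := sum_powerset_mem X fun x Z => if Z.card = n then F x Z else 0
  simp only [Finset.powersetCard_eq_filter, Finset.sum_filter]
  rw [← this]
  refine Finset.sum_congr rfl fun Z _ => ?_
  by_cases h : Z.card = n + 1
  · rw [if_pos h]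
    exact Finset.sum_congr rfl fun x hx => by rw [if_pos]; rw [Finset.card_erase_of_mem hx, h]; rfl
  · rw [if_neg h]
    refine Finset.sum_eq_zero fun x hx => if_neg fun e => h ?_
    rw [Finset.card_erase_of_mem hx] at e
    have := Finset.card_pos.2 ⟨x, hx⟩
    omega

end sums

section identities
variable {c : ℂ}

theorem eval_nod_shift (c : ℂ) (S : Finset ℂ) (z : ℂ) :
    (nod (S.image (· - c))).eval z = ∏ s ∈ S, (z - s + c) := by
  rw [eval_nod, Finset.prod_image fun _ _ _ _ e => sub_left_injective e]
  exact Finset.prod_congr rfl fun s _ => by ring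

theorem card_shift (c : ℂ) (S : Finset ℂ) : (S.image (· - c)).card = S.card :=
  Finset.card_image_of_injective _ sub_left_injective

theorem prod_shift_eq (hc : c ≠ 0) (S : Finset ℂ) (z : ℂ) :
    ∏ s ∈ S, (z - s + c) = c ^ S.card * pp (h c) {z} S := by
  rw [pp_singleton_left, ← Finset.prod_const, ← Finset.prod_mul_distrib]
  exact Finset.prod_congr rfl fun s _ => by rw [h]; field_simp

theorem inv_prod_sub (hc : c ≠ 0) (S : Finset ℂ) (z : ℂ) :
    (∏ s ∈ S, (z - s))⁻¹ = (-c)⁻¹ ^ S.card * pp (g c) S {z} := by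
  rw [pp_singleton_right, ← Finset.prod_const, ← Finset.prod_mul_distrib, ← Finset.prod_inv_distrib]
  refine Finset.prod_congr rfl fun s _ => ?_
  rw [g, ← neg_sub z s, div_neg, inv_neg, neg_mul_neg]
  field_simp

/-- The residues of ∏_{II}(z - i + c) ∏_I(z - i + c) / ((z - x) ∏_{II}(z - i) ∏_J(z - l)) add up to
zero: since |J| = |I| + 1, the denominator has degree two more than the numerator. -/
theorem bethe_rec_identity (hc : c ≠ 0) {x : ℂ} {I II J : Finset ℂ} (hcard : J.card = I.card + 1)
    (hd : Disjoint II J) (hxI : x ∉ II) (hxJ : x ∉ J) :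
    pp (g c) J {x} * pp (f c) {x} II * pp (h c) {x} I =
      ∑ i ∈ II, g c x i * pp (g c) J {i} * pp (f c) {i} (II.erase i) * pp (h c) {i} I +
      ∑ l ∈ J, g c l x * pp (f c) {l} II * pp (h c) {l} I * pp (g c) (J.erase l) {l} := by
  have hx : x ∉ II ∪ J := by simp [hxI, hxJ]
  set P := nod (II.image (· - c)) * nod (I.image (· - c)) with hP
  have hdeg : P.natDegree = II.card + I.card := by
    rw [hP, (monic_nod _).natDegree_mul (monic_nod _), natDegree_nod, natDegree_nod, card_shift, card_shift]
  have hN : (insert x (II ∪ J)).card = II.card + I.card + 2 := by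
    rw [Finset.card_insert_of_notMem hx, Finset.card_union_of_disjoint hd, hcard]; ring
  have h0 := sum_eval_div (insert x (II ∪ J)) P (by
    rw [Polynomial.degree_eq_natDegree ((monic_nod _).mul (monic_nod _)).ne_zero, hdeg, hN]
    exact_mod_cast (by omega : II.card + I.card < II.card + I.card + 2))
  rw [Polynomial.coeff_eq_zero_of_natDegree_lt (by rw [hdeg, hN]; omega)] at h0
  have hev : ∀ z, P.eval z = (∏ i ∈ II, (z - i + c)) * (c ^ I.card * pp (h c) {z} I) := by
    intro z; rw [hP, Polynomial.eval_mul, eval_nod_shift, eval_nod_shift, prod_shift_eq hc I]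
  have hff : ∀ z (S : Finset ℂ), (∏ i ∈ S, (z - i + c)) * (∏ i ∈ S, (z - i))⁻¹ = pp (f c) {z} S := by
    intro z S
    rw [pp_singleton_left, ← Finset.prod_inv_distrib, ← Finset.prod_mul_distrib]
    exact Finset.prod_congr rfl fun s _ => by rw [f, div_eq_mul_inv]
  have hcc : (-c) ≠ 0 := neg_ne_zero.2 hc
  have tx : P.eval x / ∏ y ∈ (insert x (II ∪ J)).erase x, (x - y) =
      c ^ I.card * (-c)⁻¹ ^ J.card * (pp (g c) J {x} * pp (f c) {x} II * pp (h c) {x} I) := by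
    rw [Finset.erase_insert hx, Finset.prod_union hd, div_eq_mul_inv, mul_inv, inv_prod_sub hc J, hev, ← hff]
    ring
  have ti : ∀ i ∈ II, P.eval i / ∏ y ∈ (insert x (II ∪ J)).erase i, (i - y) =
      -(c ^ I.card * (-c)⁻¹ ^ J.card) * (g c x i * pp (g c) J {i} * pp (f c) {i} (II.erase i) * pp (h c) {i} I) := by
    intro i hi
    have hxi : x ≠ i := fun e => hxI (e ▸ hi)
    have hiJ : i ∉ J := Finset.disjoint_left.1 hd hi
    have e : (insert x (II ∪ J)).erase i = insert x (II.erase i ∪ J) := by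
      rw [Finset.erase_insert_of_ne hxi, Finset.erase_union_distrib, Finset.erase_eq_of_notMem hiJ]
    rw [e, Finset.prod_insert (by simp [hxI, hxJ]), Finset.prod_union (hd.mono_left (Finset.erase_subset _ _)),
      div_eq_mul_inv, mul_inv, mul_inv, inv_prod_sub hc J, hev, ← hff, ← Finset.mul_prod_erase _ _ hi, sub_self, zero_add,
      g, ← neg_sub i x, div_neg, div_eq_mul_inv]
    ring
  have tl : ∀ l ∈ J, P.eval l / ∏ y ∈ (insert x (II ∪ J)).erase l, (l - y) =
      -(c ^ I.card * (-c)⁻¹ ^ J.card) * (g c l x * pp (f c) {l} II * pp (h c) {l} I * pp (g c) (J.erase l) {l}) := by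
    intro l hl
    have hxl : x ≠ l := fun e => hxJ (e ▸ hl)
    have hlI : l ∉ II := Finset.disjoint_right.1 hd hl
    have e : (insert x (II ∪ J)).erase l = insert x (II ∪ J.erase l) := by
      rw [Finset.erase_insert_of_ne hxl, Finset.erase_union_distrib, Finset.erase_eq_of_notMem hlI]
    have hJ : (-c)⁻¹ ^ J.card = (-c)⁻¹ ^ (J.erase l).card * (-c)⁻¹ := by
      rw [← pow_succ, Finset.card_erase_add_one hl]
    rw [e, Finset.prod_insert (by simp [hxI, hxJ]), Finset.prod_union (hd.mono_right (Finset.erase_subset _ _)),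
      div_eq_mul_inv, mul_inv, mul_inv, inv_prod_sub hc (J.erase l), hev, ← hff, g, hJ, div_eq_mul_inv]
    field_simp
  rw [Finset.sum_insert hx, Finset.sum_union hd, tx, Finset.sum_congr rfl ti, Finset.sum_congr rfl tl,
    ← Finset.mul_sum, ← Finset.mul_sum] at h0
  have hκ : c ^ I.card * (-c)⁻¹ ^ J.card ≠ 0 := mul_ne_zero (pow_ne_zero _ hc) (pow_ne_zero _ (inv_ne_zero hcc))
  refine mul_left_cancel₀ hκ ?_
  linear_combination h0

/-- Interpolation at the nodes η of the polynomial ∏ (X - y + c) over y in s, whose degree is |η| -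
1. -/
theorem sum_pp_h_lagrange (hc : c ≠ 0) {z : ℂ} {η s : Finset ℂ} (hcard : η.card = s.card + 1) (hz : z ∉ η) :
    ∑ l ∈ η, pp (h c) {l} s * (pp (g c) (η.erase l) {l} * (pp (g c) (η.erase l) {z})⁻¹) = pp (h c) {z} s := by
  have h0 := eval_eq_sum η (nod (s.image (· - c))) (by
    rw [degree_nod, card_shift, hcard]; exact_mod_cast Nat.lt_succ_self _) z
  have hcs : c ^ s.card ≠ 0 := pow_ne_zero _ hc
  refine mul_left_cancel₀ hcs ?_
  rw [← prod_shift_eq hc, ← eval_nod_shift, h0, Finset.mul_sum]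
  refine Finset.sum_congr rfl fun l hl => ?_
  rw [eval_nod_shift, prod_shift_eq hc, ← mul_assoc]
  congr 1
  rw [pp_singleton_right, pp_singleton_right, ← Finset.prod_inv_distrib, ← Finset.prod_mul_distrib]
  refine Finset.prod_congr rfl fun y hy => ?_
  have h1 : y - l ≠ 0 := sub_ne_zero.2 (Finset.ne_of_mem_erase hy)
  have h2 : l - y ≠ 0 := sub_ne_zero.2 (Finset.ne_of_mem_erase hy).symm
  have h3 : y - z ≠ 0 := sub_ne_zero.2 fun e => hz (e ▸ Finset.mem_of_mem_erase hy)
  rw [g, g]; field_simp; ring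

/-- Interpolation of ∏_{s ∈ η} (X - s) at the nodes K, evaluated at u - c, where linear factors turn
into h(·, u). -/
theorem sum_pp_h_lagrange' (hc : c ≠ 0) {u : ℂ} {K η : Finset ℂ} (hcard : K.card = η.card + 1) :
    ∑ v ∈ K, pp (h c) (K.erase v) {u} * (pp (g c) (K.erase v) {v} * (pp (g c) η {v})⁻¹) = pp (h c) η {u} := by
  have h0 := eval_eq_sum K (nod η) (by
    rw [degree_nod, hcard]; exact_mod_cast Nat.lt_succ_self _) (u - c)
  have e : ∀ v, (pp (g c) η {v})⁻¹ = (-c)⁻¹ ^ η.card * (nod η).eval v := by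
    intro v
    rw [eval_nod, pp_singleton_right, ← Finset.prod_const, ← Finset.prod_mul_distrib, ← Finset.prod_inv_distrib]
    refine Finset.prod_congr rfl fun s _ => ?_
    rw [g, ← neg_sub v s, div_neg, inv_neg, inv_div, inv_neg]
    field_simp
  have e' : pp (h c) η {u} = (-c)⁻¹ ^ η.card * (nod η).eval (u - c) := by
    rw [eval_nod, pp_singleton_right, ← Finset.prod_const, ← Finset.prod_mul_distrib]
    refine Finset.prod_congr rfl fun s _ => ?_
    rw [h, inv_neg]; field_simp; ring
  rw [e', h0, Finset.mul_sum]
  refine Finset.sum_congr rfl fun v hv => ?_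
  have e2 : pp (h c) (K.erase v) {u} * pp (g c) (K.erase v) {v} = ∏ y ∈ K.erase v, (u - c - y) / (v - y) := by
    rw [pp_singleton_right, pp_singleton_right, ← Finset.prod_mul_distrib]
    refine Finset.prod_congr rfl fun y hy => ?_
    have h1 : y - v ≠ 0 := sub_ne_zero.2 (Finset.ne_of_mem_erase hy)
    have h2 : v - y ≠ 0 := sub_ne_zero.2 (Finset.ne_of_mem_erase hy).symm
    rw [g, h]; field_simp; ring
  rw [e, ← e2]; ring

end identities

/-! ### The recursion of Bethe vectors -/

namespace Model
variable {c : ℂ} {V : Type*} [AddCommGroup V] [Module ℂ V] (M : Model c V)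

/-- The Bethe vector, up to normalization, labelled by finite sets. -/
def bet (u v : Finset ℂ) : V :=
  ∑ I ∈ u.powerset, ∑ J ∈ v.powersetCard I.card,
    (pp (g c) J I * pp (f c) I (u \ I) * pp (g c) (v \ J) J * pp (h c) I I * ∏ l ∈ J, M.lam 1 l) •
      M.b13 I (M.b12 (u \ I) (M.b23 (v \ J) M.vac))

theorem bet_empty (v : Finset ℂ) : M.bet ∅ v = M.b23 v M.vac := by simp [bet]

theorem T₁₂_b13 (hc : c ≠ 0) {x : ℂ} {I : Finset ℂ} (hI : Gen c I) (hx : x ∉ I) (ψ : V) :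
    M.T 0 1 x (M.b13 I ψ) = pp (f c) I {x} • M.b13 I (M.T 0 1 x ψ) -
      ∑ i ∈ I, (g c i x * pp (g c) (I.erase i) {i}) • M.T 0 2 x (M.b13 (I.erase i) (M.T 0 1 i ψ)) := by
  simpa [Module.End.mul_apply, LinearMap.sum_apply] using
    LinearMap.congr_fun (mul_oddU_action hc (M.oddUp₁₃ hc) M.rel₁₂_₁₃ hI hx) ψ

theorem b12_insert_apply (hc : c ≠ 0) {x : ℂ} {S : Finset ℂ} (hx : x ∉ S) (ψ : V) :
    M.b12 (insert x S) ψ = M.T 0 1 x (M.b12 S ψ) := by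
  rw [b12, ← mul_evenP (M.comm₁₂ hc) hx, Module.End.mul_apply]

theorem b23_insert_apply (hc : c ≠ 0) {x : ℂ} {S : Finset ℂ} (hS : Gen c (insert x S)) (hx : x ∉ S) (ψ : V) :
    M.b23 (insert x S) ψ = (pp (h c) S {x})⁻¹ • M.T 1 2 x (M.b23 S ψ) := by
  rw [b23, oddU_insert hc (M.oddUp₂₃ hc) hS hx, LinearMap.smul_apply, Module.End.mul_apply]

/-- The recursion of Bethe vectors in the first set of parameters. -/
theorem bet_insert (hc : c ≠ 0) {x : ℂ} {u v : Finset ℂ} (hu : Gen c (insert x u)) (hx : x ∉ u)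
    (hxv : x ∉ v) (hd : Disjoint u v) :
    M.bet (insert x u) v = M.T 0 1 x (M.bet u v) +
      ∑ l ∈ v, (g c l x * pp (g c) (v.erase l) {l} * pp (f c) {l} u * M.lam 1 l) •
        M.T 0 2 x (M.bet u (v.erase l)) := by
  have hu' : Gen c u := hu.mono (Finset.subset_insert _ _)
  -- the target vectors
  set X : Finset ℂ → Finset ℂ → V := fun I J => M.T 0 2 x (M.b13 I (M.b12 (u \ I) (M.b23 (v \ J) M.vac))) with hX
  set k : Finset ℂ → Finset ℂ → ℂ := fun I J => pp (g c) J I * pp (f c) I (u \ I) * pp (g c) (v \ J) J * pp (h c) I I *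
    ∏ l ∈ J, M.lam 1 l with hk
  have e1 : M.bet (insert x u) v =
      ∑ I ∈ u.powerset, ∑ J ∈ v.powersetCard I.card,
        (k I J * pp (f c) I {x}) • M.b13 I (M.T 0 1 x (M.b12 (u \ I) (M.b23 (v \ J) M.vac))) +
      ∑ I ∈ u.powerset, ∑ J ∈ v.powersetCard (I.card + 1),
        (k I J * (pp (g c) J {x} * pp (f c) {x} (u \ I) * pp (h c) {x} I)) • X I J := by
    -- The new parameter is either an argument of T_{12} or belongs to I, as an argument of T_{13}.
    rw [bet, Finset.sum_powerset_insert hx]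
    congr 1
    · refine Finset.sum_congr rfl fun I hI => Finset.sum_congr rfl fun J _ => ?_
      rw [Finset.mem_powerset] at hI
      have hxI : x ∉ I := fun h => hx (hI h)
      have hxs : x ∉ u \ I := fun h => hx (Finset.sdiff_subset h)
      rw [Finset.insert_sdiff_of_notMem _ hxI, M.b12_insert_apply hc hxs, pp_insert_right _ hxs]
      congr 1; simp only [hk]; ring
    · refine Finset.sum_congr rfl fun I hI => ?_
      rw [Finset.mem_powerset] at hI
      have hxI : x ∉ I := fun h => hx (hI h)
      rw [Finset.card_insert_of_notMem hxI]
      refine Finset.sum_congr rfl fun J _ => ?_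
      have hG : Gen c (insert x I) := hu.mono (Finset.insert_subset_insert _ hI)
      have hH : pp (h c) I {x} ≠ 0 := pp_h_ne_zero hc hG (Finset.subset_insert _ _) (by simp)
      rw [Finset.insert_sdiff_insert, Finset.sdiff_insert_of_notMem hx, b13, oddU_insert hc (M.oddUp₁₃ hc) hG hxI,
        LinearMap.smul_apply, Module.End.mul_apply, smul_smul, pp_insert_right _ hxI, pp_insert_left (f c) hxI,
        pp_insert_left (h c) hxI, pp_insert_right (h c) hxI, pp_insert_right (h c) hxI, pp_pair, h_self hc]
      congr 1; simp only [hk]; field_simp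
  have e2 : M.T 0 1 x (M.bet u v) =
      ∑ I ∈ u.powerset, ∑ J ∈ v.powersetCard I.card,
        (k I J * pp (f c) I {x}) • M.b13 I (M.T 0 1 x (M.b12 (u \ I) (M.b23 (v \ J) M.vac))) +
      ∑ I ∈ u.powerset, ∑ J ∈ v.powersetCard (I.card + 1),
        (k I J * ∑ i ∈ u \ I, g c x i * pp (g c) J {i} * pp (f c) {i} ((u \ I).erase i) * pp (h c) {i} I) • X I J := by
    have step : ∀ I ∈ u.powerset, ∀ J, M.T 0 1 x (k I J • M.b13 I (M.b12 (u \ I) (M.b23 (v \ J) M.vac))) =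
        (k I J * pp (f c) I {x}) • M.b13 I (M.T 0 1 x (M.b12 (u \ I) (M.b23 (v \ J) M.vac))) +
        ∑ i ∈ I, (k (insert i (I.erase i)) J * (g c x i * pp (g c) (I.erase i) {i})) • X (I.erase i) J := by
      intro I hI J
      rw [Finset.mem_powerset] at hI
      rw [map_smul, M.T₁₂_b13 hc (hu'.mono hI) (fun h => hx (hI h)), smul_sub, smul_smul, sub_eq_add_neg,
        Finset.smul_sum, ← Finset.sum_neg_distrib]
      congr 1
      refine Finset.sum_congr rfl fun i hi => ?_
      have e : u \ I.erase i = insert i (u \ I) := by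
        ext y
        simp only [Finset.mem_insert, Finset.mem_sdiff, Finset.mem_erase]
        have := @hI i hi
        by_cases h : y = i
        · subst h; tauto
        · tauto
      rw [Finset.insert_erase hi, hX]
      simp only
      rw [e, M.b12_insert_apply hc (by simp [hi]), smul_smul, ← neg_smul]
      congr 1; rw [g_antisymm c i x]; ring
    rw [bet, map_sum]
    simp only [map_sum]
    rw [Finset.sum_congr rfl fun I hI => Finset.sum_congr rfl fun J _ => step I hI J]
    simp only [Finset.sum_add_distrib]
    congr 1
    have c1 : ∑ I ∈ u.powerset, ∑ J ∈ v.powersetCard I.card, ∑ i ∈ I,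
        (k (insert i (I.erase i)) J * (g c x i * pp (g c) (I.erase i) {i})) • X (I.erase i) J =
        ∑ I ∈ u.powerset, ∑ i ∈ I, ∑ J ∈ v.powersetCard ((I.erase i).card + 1),
          (k (insert i (I.erase i)) J * (g c x i * pp (g c) (I.erase i) {i})) • X (I.erase i) J := by
      refine Finset.sum_congr rfl fun I _ => ?_
      rw [Finset.sum_comm]
      exact Finset.sum_congr rfl fun i hi => by rw [Finset.card_erase_add_one hi]
    rw [c1, sum_powerset_move u fun i I => ∑ J ∈ v.powersetCard (I.card + 1),
      (k (insert i I) J * (g c x i * pp (g c) I {i})) • X I J]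
    refine Finset.sum_congr rfl fun I hI => ?_
    rw [Finset.mem_powerset] at hI
    rw [Finset.sum_comm]
    refine Finset.sum_congr rfl fun J _ => ?_
    rw [Finset.mul_sum, Finset.sum_smul]
    refine Finset.sum_congr rfl fun i hi => ?_
    congr 1
    have hiI : i ∉ I := (Finset.mem_sdiff.1 hi).2
    have e3 : u \ insert i I = (u \ I).erase i := by
      ext y; simp only [Finset.mem_sdiff, Finset.mem_insert, Finset.mem_erase, not_or]; tauto
    simp only [hk, e3]
    rw [pp_insert_right _ hiI, pp_insert_left (f c) hiI,
      pp_insert_left (h c) hiI, pp_insert_right (h c) hiI, pp_insert_right (h c) hiI, pp_pair, h_self hc,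
      ← pp_erase_right (f c) hi (S := I), pp_f_eq hc I {i}]
    ring
  have e3 : ∑ l ∈ v, (g c l x * pp (g c) (v.erase l) {l} * pp (f c) {l} u * M.lam 1 l) •
        M.T 0 2 x (M.bet u (v.erase l)) =
      ∑ I ∈ u.powerset, ∑ J ∈ v.powersetCard (I.card + 1),
        (k I J * ∑ l ∈ J, g c l x * pp (f c) {l} (u \ I) * pp (h c) {l} I * pp (g c) (J.erase l) {l}) • X I J := by
    have s1 : ∀ l ∈ v, (g c l x * pp (g c) (v.erase l) {l} * pp (f c) {l} u * M.lam 1 l) •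
        M.T 0 2 x (M.bet u (v.erase l)) = ∑ I ∈ u.powerset, ∑ J ∈ (v.erase l).powersetCard I.card,
          (k I (insert l J) * (g c l x * pp (f c) {l} (u \ I) * pp (h c) {l} I * pp (g c) J {l})) •
            X I (insert l J) := by
      intro l hl
      rw [bet, map_sum, Finset.smul_sum]
      refine Finset.sum_congr rfl fun I hI => ?_
      rw [map_sum, Finset.smul_sum]
      refine Finset.sum_congr rfl fun J hJ => ?_
      rw [Finset.mem_powerset] at hI
      have hJv := (Finset.mem_powersetCard.1 hJ).1
      have hlJ : l ∉ J := fun h => Finset.notMem_erase l v (hJv h)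
      have hlI : Disjoint ({l} : Finset ℂ) I := by
        rw [Finset.disjoint_singleton_left]; exact fun h => Finset.disjoint_left.1 hd (hI h) hl
      have e : v \ insert l J = v.erase l \ J := by
        ext y; simp only [Finset.mem_sdiff, Finset.mem_insert, Finset.mem_erase, not_or]; tauto
      rw [map_smul, smul_smul, hX]
      simp only
      rw [e]
      congr 1
      simp only [hk, e]
      rw [pp_insert_left (g c) hlJ, pp_insert_right (g c) hlJ, Finset.prod_insert hlJ,
        ← pp_sdiff_left (g c) hJv, ← pp_sdiff_right (f c) hI, pp_f_eq hc {l} I]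
      ring
    rw [Finset.sum_congr rfl s1, Finset.sum_comm]
    refine Finset.sum_congr rfl fun I hI => ?_
    rw [sum_powersetCard_mem v I.card fun l J =>
      (k I (insert l J) * (g c l x * pp (f c) {l} (u \ I) * pp (h c) {l} I * pp (g c) J {l})) • X I (insert l J)]
    refine Finset.sum_congr rfl fun J hJ => ?_
    rw [Finset.mul_sum, Finset.sum_smul]
    exact Finset.sum_congr rfl fun l hl => by rw [Finset.insert_erase hl]
  rw [e1, e2, e3, add_assoc]
  congr 1
  rw [← Finset.sum_add_distrib]
  refine Finset.sum_congr rfl fun I hI => ?_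
  rw [← Finset.sum_add_distrib]
  refine Finset.sum_congr rfl fun J hJ => ?_
  rw [Finset.mem_powerset] at hI
  obtain ⟨hJv, hJc⟩ := Finset.mem_powersetCard.1 hJ
  -- The terms in which T_{12}(x) stands after the product of T_{13} match directly. For those
  -- starting with T_{13}(x), the coefficients of each pair (I, J) agree by this identity, with u \
  -- I as the second part.
  rw [bethe_rec_identity hc hJc (hd.mono Finset.sdiff_subset hJv) (fun h => hx (Finset.sdiff_subset h))
    (fun h => hxv (hJv h)), mul_add, add_smul]

end Model

/-! ### Bethe vectors in composites of indicator models -/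

section parity
variable {c : ℂ} {V : Type*} [AddCommGroup V] [Module ℂ V] {M : Model c V} (P : Parity M)

theorem Parity.Θ_T (i j : Fin 3) (u : ℂ) (x : V) :
    P.Θ (M.T i j u x) = ((-1 : ℂ) ^ (par i + par j)) • M.T i j u (P.Θ x) := by
  have := LinearMap.congr_fun (P.comm i j u) x
  simp only [Module.End.mul_apply, LinearMap.smul_apply] at this
  rw [this, smul_smul, ← mul_pow]; simp

theorem Parity.Θ_Θ (x : V) : P.Θ (P.Θ x) = x := by
  rw [← Module.End.mul_apply, P.sq, Module.End.one_apply]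

theorem Parity.Θ_b12 (hc : c ≠ 0) (S : Finset ℂ) (x : V) : P.Θ (M.b12 S x) = M.b12 S (P.Θ x) := by
  induction S using Finset.induction_on with
  | empty => simp
  | insert v S hv ih =>
    rw [M.b12_insert_apply hc hv, M.b12_insert_apply hc hv, P.Θ_T, ih]; simp [par]

theorem Parity.Θ_b23 (hc : c ≠ 0) {S : Finset ℂ} (hS : Gen c S) (x : V) :
    P.Θ (M.b23 S x) = ((-1 : ℂ) ^ S.card) • M.b23 S (P.Θ x) := by
  induction S using Finset.induction_on with
  | empty => simp
  | insert v S hv ih =>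
    rw [M.b23_insert_apply hc hS hv, M.b23_insert_apply hc hS hv, map_smul, P.Θ_T,
      ih (hS.mono (Finset.subset_insert _ _)), Finset.card_insert_of_notMem hv, map_smul, smul_smul, smul_smul, smul_smul]
    congr 1
    simp only [par, pow_succ]; simp; ring

end parity

section splitting
variable {c : ℂ} {V₁ V₂ U : Type*} [AddCommGroup V₁] [Module ℂ V₁] [AddCommGroup V₂] [Module ℂ V₂]
  [AddCommGroup U] [Module ℂ U]

/-- A bilinear map through which a model is the composite of two models. -/
structure Splitting (A : Model c V₁) (P : Parity A) (B : Model c V₂) (M : Model c U) where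
  m : V₁ →ₗ[ℂ] V₂ →ₗ[ℂ] U
  T_m : ∀ (i j : Fin 3) (u : ℂ) (x : V₁) (y : V₂),
    M.T i j u (m x y) = ∑ k, m ((P.Θ ^ (par k + par j)) (A.T i k u x)) (B.T k j u y)
  m_vac : m A.vac B.vac = M.vac
  lam_eq : ∀ (i : Fin 3) (u : ℂ), M.lam i u = A.lam i u * B.lam i u

/-- On `Z` exactly one vacuum eigenvalue is nonzero at each point, and it is `1`. -/
def Indicates {V : Type*} [AddCommGroup V] [Module ℂ V] (M : Model c V) (σ : ℂ → Fin 3) (Z : Finset ℂ) : Prop :=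
  ∀ z ∈ Z, ∀ i, M.lam i z = if i = σ z then 1 else 0

theorem Indicates.mono {V : Type*} [AddCommGroup V] [Module ℂ V] {M : Model c V} {σ : ℂ → Fin 3} {Z Z' : Finset ℂ}
    (h : Indicates M σ Z) (hZ : Z' ⊆ Z) : Indicates M σ Z' := fun z hz => h z (hZ hz)

theorem Indicates.one {V : Type*} [AddCommGroup V] [Module ℂ V] {M : Model c V} {σ : ℂ → Fin 3} {Z : Finset ℂ}
    (h : Indicates M σ Z) {z : ℂ} {i : Fin 3} (hz : z ∈ Z) (hi : σ z = i) : M.lam i z = 1 := by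
  rw [h z hz, if_pos hi.symm]

theorem Indicates.zero {V : Type*} [AddCommGroup V] [Module ℂ V] {M : Model c V} {σ : ℂ → Fin 3} {Z : Finset ℂ}
    (h : Indicates M σ Z) {z : ℂ} {i : Fin 3} (hz : z ∈ Z) (hi : σ z ≠ i) : M.lam i z = 0 := by
  rw [h z hz, if_neg hi.symm]

/-- The points of `S` with label `i`. -/
def cl (σ : ℂ → Fin 3) (i : Fin 3) (S : Finset ℂ) : Finset ℂ := S.filter fun z => σ z = i

theorem cl_subset (σ : ℂ → Fin 3) (i : Fin 3) (S : Finset ℂ) : cl σ i S ⊆ S := Finset.filter_subset _ _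

theorem mem_cl {σ : ℂ → Fin 3} {i : Fin 3} {S : Finset ℂ} {z : ℂ} : z ∈ cl σ i S ↔ z ∈ S ∧ σ z = i :=
  Finset.mem_filter

theorem cl_insert_of_eq {σ : ℂ → Fin 3} {i : Fin 3} {S : Finset ℂ} {x : ℂ} (h : σ x = i) :
    cl σ i (insert x S) = insert x (cl σ i S) := by rw [cl, Finset.filter_insert, if_pos h, cl]

theorem cl_insert_of_ne {σ : ℂ → Fin 3} {i : Fin 3} {S : Finset ℂ} {x : ℂ} (h : σ x ≠ i) :
    cl σ i (insert x S) = cl σ i S := by rw [cl, Finset.filter_insert, if_neg h, cl]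

theorem cl_erase_of_ne {σ : ℂ → Fin 3} {i : Fin 3} {S : Finset ℂ} {x : ℂ} (h : σ x ≠ i) :
    cl σ i (S.erase x) = cl σ i S := by
  rw [cl, Finset.filter_erase, Finset.erase_eq_of_notMem (by simp [h]), cl]

theorem cl_erase (σ : ℂ → Fin 3) (i : Fin 3) (S : Finset ℂ) (x : ℂ) :
    cl σ i (S.erase x) = (cl σ i S).erase x := by rw [cl, Finset.filter_erase, cl]

theorem disjoint_cl {σ : ℂ → Fin 3} {i j : Fin 3} (hij : i ≠ j) (S T : Finset ℂ) : Disjoint (cl σ i S) (cl σ j T) := by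
  rw [Finset.disjoint_left]
  intro z h1 h2
  exact hij ((mem_cl.1 h1).2.symm.trans (mem_cl.1 h2).2)

theorem cl_union_cl {σ : ℂ → Fin 3} {i j k : Fin 3} (hijk : ∀ a : Fin 3, a = i ∨ a = j ∨ a = k) {S : Finset ℂ}
    (hS : ∀ z ∈ S, σ z ≠ k) : cl σ i S ∪ cl σ j S = S := by
  ext z
  simp only [Finset.mem_union, mem_cl]
  constructor
  · rintro (h | h) <;> exact h.1
  · intro hz
    rcases hijk (σ z) with h | h | h
    · exact Or.inl ⟨hz, h⟩
    · exact Or.inr ⟨hz, h⟩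
    · exact absurd h (hS z hz)

variable {A : Model c V₁} {P : Parity A} {B : Model c V₂} {M : Model c U}

theorem Splitting.T₁₂ (s : Splitting A P B M) (u : ℂ) (x : V₁) (y : V₂) : M.T 0 1 u (s.m x y) = s.m (A.T 0 0 u x) (B.T 0 1 u y) +
    s.m (A.T 0 1 u x) (B.T 1 1 u y) + s.m (P.Θ (A.T 0 2 u x)) (B.T 2 1 u y) := by
  rw [s.T_m]; simp [Fin.sum_univ_three, par]

theorem Splitting.T₁₃ (s : Splitting A P B M) (u : ℂ) (x : V₁) (y : V₂) : M.T 0 2 u (s.m x y) = s.m (P.Θ (A.T 0 0 u x)) (B.T 0 2 u y) +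
    s.m (P.Θ (A.T 0 1 u x)) (B.T 1 2 u y) + s.m (A.T 0 2 u x) (B.T 2 2 u y) := by
  rw [s.T_m]; simp [Fin.sum_univ_three, par, pow_two, P.sq]

theorem Splitting.T₂₃ (s : Splitting A P B M) (u : ℂ) (x : V₁) (y : V₂) : M.T 1 2 u (s.m x y) = s.m (P.Θ (A.T 1 0 u x)) (B.T 0 2 u y) +
    s.m (P.Θ (A.T 1 1 u x)) (B.T 1 2 u y) + s.m (A.T 1 2 u x) (B.T 2 2 u y) := by
  rw [s.T_m]; simp [Fin.sum_univ_three, par, pow_two, P.sq]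

variable {σ : ℂ → Fin 3}

/-- At a point with label 0 both λ_2 and λ_3 vanish in both factors, and every term of the coproduct
of T_{23} contains T_{21}, T_{22} or T_{33} acting on a vacuum. -/
theorem Splitting.T₂₃_vac_eq_zero (s : Splitting A P B M) {z : ℂ} (hA : Indicates A σ {z}) (hB : Indicates B σ {z}) (hz : σ z = 0) :
    M.T 1 2 z M.vac = 0 := by
  have hz' : z ∈ ({z} : Finset ℂ) := Finset.mem_singleton_self z
  rw [← s.m_vac, s.T₂₃, A.lower_vac 0 1 z (by decide), A.diag_vac, B.diag_vac, hA.zero hz' (by rw [hz]; decide),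
    hB.zero hz' (by rw [hz]; decide)]
  simp

theorem Splitting.b23_eq_zero (s : Splitting A P B M) (hc : c ≠ 0) {v : Finset ℂ} (hv : Gen c v) (hA : Indicates A σ v) (hB : Indicates B σ v)
    {z : ℂ} (hzv : z ∈ v) (hz : σ z = 0) : M.b23 v M.vac = 0 := by
  have hz1 : ({z} : Finset ℂ) ⊆ v := Finset.singleton_subset_iff.2 hzv
  rw [Model.b23, ← Finset.insert_erase hzv, oddU_insert_right hc (M.oddUp₂₃ hc) (by rwa [Finset.insert_erase hzv])
    (Finset.notMem_erase _ _), LinearMap.smul_apply, Module.End.mul_apply,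
    s.T₂₃_vac_eq_zero (hA.mono hz1) (hB.mono hz1) hz]
  simp

/-- By the recursion: in the correction terms, either the point z stays among the parameters, or it
is the removed one and its eigenvalue λ_2 is zero. -/
theorem Splitting.bet_eq_zero (s : Splitting A P B M) (hc : c ≠ 0) {u v : Finset ℂ} (hu : Gen c u) (hv : Gen c v) (hd : Disjoint u v)
    (hA : Indicates A σ v) (hB : Indicates B σ v) {z : ℂ} (hzv : z ∈ v) (hz : σ z = 0) : M.bet u v = 0 := by
  induction u using Finset.induction_on generalizing v with
  | empty => rw [M.bet_empty, s.b23_eq_zero hc hv hA hB hzv hz]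
  | insert x u hx ih =>
    rw [Finset.disjoint_insert_left] at hd
    have hu' := hu.mono (Finset.subset_insert x u)
    rw [M.bet_insert hc hu hx hd.1 hd.2, ih hu' hv hd.2 hA hB hzv, map_zero, zero_add]
    refine Finset.sum_eq_zero fun l hl => ?_
    have hsub := Finset.erase_subset l v
    rcases eq_or_ne l z with rfl | hlz
    · rw [s.lam_eq, hA.zero hl (by rw [hz]; decide)]; simp
    · rw [ih hu' (hv.mono hsub) (hd.2.mono_right hsub) (hA.mono hsub) (hB.mono hsub)
        (Finset.mem_erase.2 ⟨hlz.symm, hzv⟩)]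
      simp

/-- On the product only one term of T_{23}(x) survives: T_{22} ⊗ T_{23} for label 1, T_{23} ⊗ T_{33}
for label 2. Thus the points with label 2 go to the first factor and those with label 1 to the
second. -/
theorem Splitting.b23_eq (s : Splitting A P B M) (hc : c ≠ 0) {v : Finset ℂ} (hv : Gen c v) (hA : Indicates A σ v) (hB : Indicates B σ v)
    (h0 : ∀ z ∈ v, σ z ≠ 0) : M.b23 v M.vac =
      pp (g c) (cl σ 1 v) (cl σ 2 v) • s.m (A.b23 (cl σ 2 v) A.vac) (B.b23 (cl σ 1 v) B.vac) := by
  induction v using Finset.induction_on with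
  | empty => simp [cl, s.m_vac]
  | insert x v hx ih =>
    have hsub := Finset.subset_insert x v
    have hxm := Finset.mem_insert_self x v
    have hv' := hv.mono hsub
    have hA' := hA.mono hsub
    have hB' := hB.mono hsub
    have h2s := cl_subset σ 2 v
    have h1s := cl_subset σ 1 v
    have hx1 : x ∉ cl σ 1 v := fun h => hx (h1s h)
    have hx2 : x ∉ cl σ 2 v := fun h => hx (h2s h)
    have hH : ∀ i, pp (h c) (cl σ i v) {x} ≠ 0 := fun i =>
      pp_h_ne_zero hc hv ((cl_subset _ _ _).trans hsub) (by simp)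
    have hHv : pp (h c) v {x} = pp (h c) (cl σ 1 v) {x} * pp (h c) (cl σ 2 v) {x} := by
      rw [← pp_union_left _ (disjoint_cl (by decide) _ _), cl_union_cl (k := 0) (by decide)
        fun z hz => h0 z (hsub hz)]
    rw [M.b23_insert_apply hc hv hx, ih hv' hA' hB' fun z hz => h0 z (hsub hz), map_smul, s.T₂₃,
      A.T₂₁_b23_vac hc (hv'.mono h2s) hx2,
      oddU_action_of_eq_zero hc (A.oddUp₂₃ hc) A.rel₂₂_₂₃ (hv'.mono h2s) hx2 (fun l hl => by
        rw [A.diag_vac, hA'.zero (h2s hl) (by rw [(mem_cl.1 hl).2]; decide), zero_smul]),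
      B.T₃₃_b23 hc (hv'.mono h1s) hx1 (fun l hl => by
        rw [B.diag_vac, hB'.zero (h1s hl) (by rw [(mem_cl.1 hl).2]; decide), zero_smul]),
      A.diag_vac, B.diag_vac, hHv]
    have hσ : σ x = 1 ∨ σ x = 2 := by
      have := h0 x hxm
      generalize σ x = a at this; revert a; decide
    rcases hσ with hσ | hσ
    · rw [hA.one hxm hσ, hB.zero hxm (by rw [hσ]; decide), cl_insert_of_eq hσ, cl_insert_of_ne (by rw [hσ]; decide),
        pp_insert_left _ hx1, B.b23_insert_apply hc (hv.mono (Finset.insert_subset_insert _ h1s)) hx1]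
      simp only [map_smul, zero_smul, map_zero, LinearMap.zero_apply, zero_add, smul_zero, add_zero, one_smul,
        P.Θ_b23 hc (hv'.mono h2s), P.vac, LinearMap.smul_apply, smul_smul]
      congr 1
      rw [pp_f_eq hc, pp_g_swap c (cl σ 2 v) {x}, Finset.card_singleton, mul_one]
      have hsq : ((-1 : ℂ) ^ (cl σ 2 v).card) * (-1) ^ (cl σ 2 v).card = 1 := by rw [← mul_pow]; simp
      have h1 := hH 1; have h2 := hH 2
      field_simp
      linear_combination pp (g c) (cl σ 1 v) (cl σ 2 v) * pp (g c) {x} (cl σ 2 v) * hsq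
    · rw [hA.zero hxm (by rw [hσ]; decide), hB.one hxm hσ, cl_insert_of_eq hσ, cl_insert_of_ne (by rw [hσ]; decide),
        pp_insert_right _ hx2, A.b23_insert_apply hc (hv.mono (Finset.insert_subset_insert _ h2s)) hx2]
      simp only [map_smul, zero_smul, map_zero, LinearMap.zero_apply, zero_add, smul_zero, one_smul,
        LinearMap.smul_apply, smul_smul]
      congr 1
      rw [pp_f_eq hc]
      have h1 := hH 1; have h2 := hH 2
      field_simp

/-- The step of the recursion for Bethe vectors of a composite model. -/
theorem Splitting.step (s : Splitting A P B M) (hc : c ≠ 0) {x e ε : ℂ} {S : Finset ℂ} (hS : Gen c S) (hx : x ∉ S) {a : V₁} {ψ : V₂} {μ : ℂ → ℂ}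
    (hε : ε * ε = 1) (ha : P.Θ a = ε • a) (hμ : ∀ l ∈ S, B.T 1 1 l ψ = μ l • ψ) (h32 : B.T 2 1 x ψ = 0)
    (h33 : ∀ l ∈ S, B.T 2 2 l ψ = 0) (he : B.T 2 2 x ψ = e • ψ) (hor : A.T 0 0 x a = 0 ∨ B.T 1 1 x ψ = 0) :
    M.T 0 1 x (s.m a (B.b23 S ψ)) + ∑ l ∈ S, (ε * (g c l x * pp (g c) (S.erase l) {l} * μ l)) •
        M.T 0 2 x (s.m a (B.b23 (S.erase l) ψ)) =
      s.m (A.T 0 0 x a) (B.b23 S (B.T 0 1 x ψ)) + pp (f c) S {x} • s.m (A.T 0 1 x a) (B.b23 S (B.T 1 1 x ψ)) := by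
  have e0 : P.Θ (A.T 0 0 x a) = ε • A.T 0 0 x a := by rw [P.Θ_T, ha]; simp [par]
  have e1 : P.Θ (A.T 0 1 x a) = ε • A.T 0 1 x a := by rw [P.Θ_T, ha]; simp [par]
  have e2 : P.Θ (A.T 0 2 x a) = -(ε • A.T 0 2 x a) := by rw [P.Θ_T, ha]; simp [par]
  -- If T_{11}(x) kills the first vector there is nothing to prove; otherwise T_{22}(x) kills the
  -- second, as `Model.T₁₂_b23` requires.
  have k1 : s.m (A.T 0 0 x a) (B.T 0 1 x (B.b23 S ψ)) = s.m (A.T 0 0 x a) (B.b23 S (B.T 0 1 x ψ)) -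
      ∑ l ∈ S, (g c l x * pp (g c) (S.erase l) {l} * μ l) • s.m (A.T 0 0 x a) (B.T 0 2 x (B.b23 (S.erase l) ψ)) := by
    rcases hor with h | h
    · simp [h]
    · rw [B.T₁₂_b23 hc hS hx h hμ, map_sub, map_sum]; simp only [map_smul]
  rw [s.T₁₂, k1, B.T₂₂_b23 hc hS hx hμ, B.T₃₂_b23 hc hS hx hμ h32 h33 he, e2]
  simp only [s.T₁₃, e0, e1, map_sub, map_sum, map_smul, map_neg, LinearMap.neg_apply, LinearMap.smul_apply]
  have hsum : ∑ l ∈ S, (ε * (g c l x * pp (g c) (S.erase l) {l} * μ l)) •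
        (ε • s.m (A.T 0 0 x a) (B.T 0 2 x (B.b23 (S.erase l) ψ)) + ε • s.m (A.T 0 1 x a) (B.T 1 2 x (B.b23 (S.erase l) ψ)) +
          s.m (A.T 0 2 x a) (B.T 2 2 x (B.b23 (S.erase l) ψ))) =
      ∑ l ∈ S, (g c l x * pp (g c) (S.erase l) {l} * μ l) • s.m (A.T 0 0 x a) (B.T 0 2 x (B.b23 (S.erase l) ψ)) +
      ∑ l ∈ S, (g c l x * pp (g c) (S.erase l) {l} * μ l) • s.m (A.T 0 1 x a) (B.T 1 2 x (B.b23 (S.erase l) ψ)) +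
      ε • ∑ l ∈ S, (g c l x * pp (g c) (S.erase l) {l} * μ l) • s.m (A.T 0 2 x a) (B.T 2 2 x (B.b23 (S.erase l) ψ)) := by
    rw [Finset.smul_sum, ← Finset.sum_add_distrib, ← Finset.sum_add_distrib]
    refine Finset.sum_congr rfl fun l _ => ?_
    linear_combination (norm := module) (hε * (g c l x * pp (g c) (S.erase l) {l} * μ l)) •
      (s.m (A.T 0 0 x a) (B.T 0 2 x (B.b23 (S.erase l) ψ)) + s.m (A.T 0 1 x a) (B.T 1 2 x (B.b23 (S.erase l) ψ)))
  have hneg : ∑ l ∈ S, (g c l x * pp (g c) (S.erase l) {l} * μ l) • -(ε • s.m (A.T 0 2 x a) (B.T 2 2 x (B.b23 (S.erase l) ψ))) =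
      -(ε • ∑ l ∈ S, (g c l x * pp (g c) (S.erase l) {l} * μ l) • s.m (A.T 0 2 x a) (B.T 2 2 x (B.b23 (S.erase l) ψ))) := by
    rw [Finset.smul_sum, ← Finset.sum_neg_distrib]
    exact Finset.sum_congr rfl fun l _ => by module
  rw [hsum, hneg]
  module

/-- The Bethe vectors of a composite of two indicator models. -/
theorem Splitting.bet_eq (s : Splitting A P B M) (hc : c ≠ 0) {u v : Finset ℂ} (hG : Gen c (u ∪ v)) (hd : Disjoint u v)
    (hA : Indicates A σ (u ∪ v)) (hB : Indicates B σ (u ∪ v)) (h0 : ∀ z ∈ v, σ z ≠ 0) :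
    M.bet u v = (if ∀ z ∈ u, σ z ≠ 2 then
        pp (f c) (cl σ 1 u) (cl σ 0 u) * pp (f c) (cl σ 1 v) (cl σ 1 u) * pp (g c) (cl σ 1 v) (cl σ 2 v) else 0) •
      s.m (A.b12 (cl σ 1 u) (A.b23 (cl σ 2 v) A.vac)) (B.b23 (cl σ 1 v) (B.b12 (cl σ 0 u) B.vac)) := by
  induction u using Finset.induction_on generalizing v with
  | empty =>
    have hv : Gen c v := hG.mono Finset.subset_union_right
    rw [M.bet_empty, s.b23_eq hc hv (hA.mono Finset.subset_union_right) (hB.mono Finset.subset_union_right) h0]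
    simp [cl]
  | insert x u hx ih =>
    rw [Finset.disjoint_insert_left] at hd
    have hsub : u ∪ v ⊆ insert x u ∪ v := Finset.union_subset_union_left (Finset.subset_insert _ _)
    have hu : Gen c (insert x u) := hG.mono Finset.subset_union_left
    have hv : Gen c v := hG.mono Finset.subset_union_right
    have hxm : x ∈ insert x u ∪ v := by simp
    have hG' := hG.mono hsub
    have hA' := hA.mono hsub
    have hB' := hB.mono hsub
    rw [M.bet_insert hc hu hx hd.1 hd.2]
    have hrec : ∀ l ∈ v, M.bet u (v.erase l) = _ := fun l hl =>
      ih (v := v.erase l) (hG'.mono (Finset.union_subset_union_right (Finset.erase_subset _ _)))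
        (hd.2.mono_right (Finset.erase_subset _ _)) (hA'.mono (Finset.union_subset_union_right (Finset.erase_subset _ _)))
        (hB'.mono (Finset.union_subset_union_right (Finset.erase_subset _ _)))
        fun z hz => h0 z (Finset.mem_of_mem_erase hz)
    rw [ih hG' hd.2 hA' hB' h0]
    by_cases h2 : ∀ z ∈ u, σ z ≠ 2
    swap
    · have h2' : ¬ ∀ z ∈ insert x u, σ z ≠ 2 := fun h => h2 fun z hz => h z (Finset.mem_insert_of_mem hz)
      rw [if_neg h2, if_neg h2', zero_smul, zero_smul, map_zero, zero_add]
      refine Finset.sum_eq_zero fun l hl => ?_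
      rw [hrec l hl, if_neg h2]; simp
    rw [if_pos h2]
    set a := A.b12 (cl σ 1 u) (A.b23 (cl σ 2 v) A.vac) with ha
    set ψ := B.b12 (cl σ 0 u) B.vac with hψ
    set S := cl σ 1 v with hS
    set K := cl σ 2 v with hK
    set F := pp (f c) (cl σ 1 u) (cl σ 0 u) * pp (f c) S (cl σ 1 u) * pp (g c) S K with hF
    have hSv : S ⊆ v := cl_subset _ _ _
    have hKv : K ⊆ v := cl_subset _ _ _
    have hu0 : cl σ 0 u ⊆ u := cl_subset _ _ _
    have hu1 : cl σ 1 u ⊆ u := cl_subset _ _ _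
    have hSK : Disjoint S K := disjoint_cl (by decide) _ _
    have hvSK : S ∪ K = v := cl_union_cl (k := 0) (by decide) h0
    have huu : cl σ 0 u ∪ cl σ 1 u = u := cl_union_cl (k := 2) (by decide) h2
    have hxS : x ∉ S := fun h => hd.1 (hSv h)
    have hSG : Gen c S := hv.mono hSv
    have hnot : ∀ {l}, l ∈ v → l ∉ u := fun hl h => Finset.disjoint_left.1 hd.2 h hl
    have hεε : ((-1 : ℂ) ^ K.card) * (-1) ^ K.card = 1 := by rw [← mul_pow]; simp
    have hΘ : P.Θ a = ((-1 : ℂ) ^ K.card) • a := by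
      rw [ha, P.Θ_b12 hc, P.Θ_b23 hc (hv.mono hKv), P.vac, map_smul]
    have hψ22 : ∀ l, l ∉ u → B.T 1 1 l ψ = (pp (f c) {l} (cl σ 0 u) * B.lam 1 l) • ψ := fun l hl =>
      B.T₂₂_b12_vac hc (fun h => hl (hu0 h)) fun z hz =>
        hB'.zero (Finset.mem_union_left _ (hu0 hz)) (by rw [(mem_cl.1 hz).2]; decide)
    have hlam1 : ∀ l ∈ S, B.lam 1 l = 1 := fun l hl => hB'.one (Finset.mem_union_right _ (hSv hl)) (mem_cl.1 hl).2
    have hμ : ∀ l ∈ S, B.T 1 1 l ψ = pp (f c) {l} (cl σ 0 u) • ψ := fun l hl => by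
      rw [hψ22 l (hnot (hSv hl)), hlam1 l hl, mul_one]
    have h33 : ∀ l, l ∉ u → B.T 2 2 l ψ = B.lam 2 l • ψ := fun l hl => B.T₃₃_b12_vac hc fun h => hl (hu0 h)
    have hA00 : A.T 0 0 x a = (pp (f c) (cl σ 1 u) {x} * A.lam 0 x) • a := by
      have hKG := hv.mono hKv
      rw [ha, A.T₁₁_b12 hc (fun h => hx (hu1 h)), A.T₁₁_b23_vac hc hKG (fun h => hd.1 (hKv h)), map_smul, smul_smul]
      intro z hz
      rw [A.T₁₁_b23_vac hc hKG (fun h => hnot (hKv h) (hu1 hz)),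
        hA'.zero (Finset.mem_union_left _ (hu1 hz)) (by rw [(mem_cl.1 hz).2]; decide), zero_smul]
    -- For label 0 the eigenvalue λ_2 vanishes at x, for the other labels λ_1 does.
    have hor : A.T 0 0 x a = 0 ∨ B.T 1 1 x ψ = 0 := by
      by_cases h : σ x = 0
      · right; rw [hψ22 x hx, hB.zero hxm (by rw [h]; decide)]; simp
      · left; rw [hA00, hA.zero hxm h]; simp
    have hstep := s.step hc hSG hxS hεε hΘ hμ (B.T₃₂_b12_vac hc fun h => hx (hu0 h))
      (fun l hl => by
        rw [h33 l (hnot (hSv hl)), hB'.zero (Finset.mem_union_right _ (hSv hl)) (by rw [(mem_cl.1 hl).2]; decide), zero_smul])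
      (h33 x hx) hor
    -- The factor λ_2(l) restricts the correction terms to points l with label 1; for these the
    -- shape of the vector is known by induction, with l removed from the second factor.
    have hsum : ∑ l ∈ v, (g c l x * pp (g c) (v.erase l) {l} * pp (f c) {l} u * M.lam 1 l) •
        M.T 0 2 x (M.bet u (v.erase l)) =
        F • ∑ l ∈ S, ((-1 : ℂ) ^ K.card * (g c l x * pp (g c) (S.erase l) {l} * pp (f c) {l} (cl σ 0 u))) •
        M.T 0 2 x (s.m a (B.b23 (S.erase l) ψ)) := by
      rw [← Finset.sum_subset hSv, Finset.smul_sum]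
      · refine Finset.sum_congr rfl fun l hl => ?_
        have hl1 : σ l = 1 := (mem_cl.1 hl).2
        have hlK : l ∉ K := Finset.disjoint_left.1 hSK hl
        have e1 : v.erase l = S.erase l ∪ K := by
          rw [← hvSK, Finset.erase_union_distrib, Finset.erase_eq_of_notMem hlK]
        have e2 : pp (f c) {l} u = pp (f c) {l} (cl σ 0 u) * pp (f c) {l} (cl σ 1 u) := by
          rw [← pp_union_right _ (disjoint_cl (by decide) _ _), huu]
        rw [hrec l (hSv hl), if_pos h2, cl_erase_of_ne (i := 2) (by rw [hl1]; decide), cl_erase, map_smul, smul_smul, smul_smul,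
          ← hS, ← hK, ← ha, e2, e1, pp_union_left _ (hSK.mono_left (Finset.erase_subset _ _)), s.lam_eq,
          hA'.one (Finset.mem_union_right _ (hSv hl)) hl1, hlam1 l hl, hF, ← pp_erase_left (f c) hl,
          ← pp_erase_left (g c) hl (T := K), pp_g_swap c K {l}, Finset.card_singleton, mul_one]
        congr 1; ring
      · intro l hl hlS
        have : σ l ≠ 1 := fun h => hlS (mem_cl.2 ⟨hl, h⟩)
        rw [s.lam_eq, hA'.zero (Finset.mem_union_right _ hl) this]; simp
    rw [hsum, map_smul, ← smul_add, hstep, hA00, hψ22 x hx]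
    -- A parameter with label 0 ends up in T_{12} of the second factor, one with label 1 in T_{12}
    -- of the first, and label 2 kills the vector.
    have hcases : σ x = 0 ∨ σ x = 1 ∨ σ x = 2 := by generalize σ x = a; revert a; decide
    rcases hcases with h | h | h
    · have h2' : ∀ z ∈ insert x u, σ z ≠ 2 := by
        intro z hz
        rcases Finset.mem_insert.1 hz with rfl | hz
        · rw [h]; decide
        · exact h2 z hz
      rw [if_pos h2', cl_insert_of_eq h, cl_insert_of_ne (by rw [h]; decide), hA.one hxm h, hB.zero hxm (by rw [h]; decide),
        B.b12_insert_apply hc (fun h => hx (hu0 h)), pp_insert_right _ (fun h => hx (hu0 h)), ← ha, ← hψ]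
      simp only [mul_zero, zero_smul, map_zero, smul_zero, add_zero, map_smul, LinearMap.smul_apply, smul_smul, hF]
      congr 1; ring
    · have h2' : ∀ z ∈ insert x u, σ z ≠ 2 := by
        intro z hz
        rcases Finset.mem_insert.1 hz with rfl | hz
        · rw [h]; decide
        · exact h2 z hz
      rw [if_pos h2', cl_insert_of_eq h, cl_insert_of_ne (by rw [h]; decide), hB.one hxm h, hA.zero hxm (by rw [h]; decide),
        A.b12_insert_apply hc (fun h => hx (hu1 h)), pp_insert_right _ (fun h => hx (hu1 h)),
        pp_insert_left _ (fun h => hx (hu1 h)), ← ha, ← hψ]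
      simp only [mul_zero, zero_smul, map_zero, zero_add, map_smul, LinearMap.zero_apply, smul_smul, hF]
      congr 1; ring
    · have h2' : ¬ ∀ z ∈ insert x u, σ z ≠ 2 := fun h' => h' x (by simp) h
      rw [if_neg h2', hB.zero hxm (by rw [h]; decide), hA.zero hxm (by rw [h]; decide)]
      simp

end splitting

/-! ### Transposed models and dual Bethe vectors -/

section transpose
variable {c : ℂ} {V W : Type*} [AddCommGroup V] [Module ℂ V] [AddCommGroup W] [Module ℂ W]

theorem transpose_mul (a b : Module.End ℂ V) :
    (Module.Dual.transpose (R := ℂ) (a * b) : Module.End ℂ (Module.Dual ℂ V)) =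
      (Module.Dual.transpose (R := ℂ) b : Module.End ℂ (Module.Dual ℂ V)) * Module.Dual.transpose (R := ℂ) a := rfl

theorem transpose_one : (Module.Dual.transpose (R := ℂ) (1 : Module.End ℂ V) : Module.End ℂ (Module.Dual ℂ V)) = 1 := rfl

/-- Transposition of endomorphisms. -/
abbrev trHom : Module.End ℂ V →ₗ[ℂ] Module.End ℂ (Module.Dual ℂ V) := Module.Dual.transpose (R := ℂ)

/-- The model on the dual space with transposed monodromy matrix. -/
def Model.tr (M : Model c V) : Model c (Module.Dual ℂ V) where
  T i j u := Module.Dual.transpose (R := ℂ) (M.T j i u)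
  rtt i j k l u v huv := by
    have := congrArg (fun x : Module.End ℂ V => (Module.Dual.transpose (R := ℂ) x : Module.End ℂ (Module.Dual ℂ V)))
      (M.rtt j i l k u v huv)
    simp only [map_sub, map_smul, transpose_mul] at this
    set a := (Module.Dual.transpose (R := ℂ) (M.T j i u) : Module.End ℂ (Module.Dual ℂ V))
    have hs : (-1 : ℂ) ^ ((par i + par j) * (par k + par l)) * (-1 : ℂ) ^ ((par i + par j) * (par k + par l)) = 1 := by
      rw [← mul_pow]; simp
    have h1 : (-1 : ℂ) ^ ((par j + par i) * (par l + par k)) = (-1 : ℂ) ^ ((par i + par j) * (par k + par l)) := by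
      rw [add_comm (par j), add_comm (par l)]
    have h2 : (-1 : ℂ) ^ (par j * (par l + par k) + par l * par k) =
        (-1 : ℂ) ^ ((par i + par j) * (par k + par l)) * (-1) ^ (par i * (par k + par l) + par k * par l) := by
      rw [← pow_add]; apply neg_one_pow_congr; clear * -; revert i j k l; decide
    rw [h1, h2] at this
    generalize (-1 : ℂ) ^ ((par i + par j) * (par k + par l)) = s at hs this ⊢
    generalize (-1 : ℂ) ^ (par i * (par k + par l) + par k * par l) = ε at this ⊢
    generalize g c u v = γ at this ⊢
    -- Transposition reverses the products on the left, which exchanges the two terms of the graded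
    -- commutator; multiplication by the sign -s restores their order.
    have h3 := congrArg (fun x : Module.End ℂ (Module.Dual ℂ V) => (-s) • x) this
    simp only [smul_sub, smul_smul] at h3
    have e1 : -s * s = -1 := by linear_combination -hs
    have e2 : -s * (s * ε * γ) = -(ε * γ) := by linear_combination -(ε * γ) * hs
    rw [e1, e2] at h3
    rw [smul_sub]
    linear_combination (norm := module) h3
  vac := M.dualVac
  dualVac := Module.Dual.eval ℂ V M.vac
  lam := M.lam
  dualVac_vac := by simp [M.dualVac_vac]
  diag_vac i u := M.dualVac_diag i u
  dualVac_diag i u := by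
    ext θ
    change θ (M.T i i u M.vac) = _
    rw [M.diag_vac, map_smul]; rfl
  lower_vac i j u hij := M.dualVac_upper i j u hij
  dualVac_upper i j u hij := by
    ext θ
    change θ (M.T j i u M.vac) = _
    rw [M.lower_vac i j u hij, map_zero]; rfl

theorem Model.tr_T (M : Model c V) (i j : Fin 3) (u : ℂ) (θ : Module.Dual ℂ V) : M.tr.T i j u θ = θ ∘ₗ M.T j i u := rfl

/-- The parity operator of the transposed model. -/
def Parity.tr {M : Model c V} (P : Parity M) : Parity M.tr where
  Θ := Module.Dual.transpose (R := ℂ) P.Θ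
  sq := by rw [← transpose_mul, P.sq, transpose_one]
  comm i j u := by
    change (Module.Dual.transpose (R := ℂ) (M.T j i u) : Module.End ℂ (Module.Dual ℂ V)) * Module.Dual.transpose (R := ℂ) P.Θ =
      _ • ((Module.Dual.transpose (R := ℂ) P.Θ : Module.End ℂ (Module.Dual ℂ V)) * Module.Dual.transpose (R := ℂ) (M.T j i u))
    rw [← transpose_mul, ← transpose_mul, P.comm, map_smul, smul_smul, ← pow_add, add_comm (par j), ← two_mul, pow_mul]
    simp
  vac := P.dualVac
  dualVac := by
    ext θ
    change θ (P.Θ M.vac) = θ M.vac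
    rw [P.vac]

theorem Indicates.tr {M : Model c V} {σ : ℂ → Fin 3} {Z : Finset ℂ} (h : Indicates M σ Z) : Indicates M.tr σ Z := h

theorem Model.tr_b23 (M : Model c V) (hc : c ≠ 0) {S : Finset ℂ} (hS : Gen c S) (θ : Module.Dual ℂ V) :
    M.tr.b23 S θ = θ ∘ₗ M.c32 S := by
  have e := LinearMap.congr_fun (map_sp (trHom (V := V)) transpose_one transpose_mul
    ((M.oddDown₃₂ hc).symmOn hc hS)) θ
  exact e.symm

theorem Model.tr_b13 (M : Model c V) (hc : c ≠ 0) {S : Finset ℂ} (hS : Gen c S) (θ : Module.Dual ℂ V) :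
    M.tr.b13 S θ = θ ∘ₗ M.c31 S := by
  have e := LinearMap.congr_fun (map_sp (trHom (V := V)) transpose_one transpose_mul
    ((M.oddDown₃₁ hc).symmOn hc hS)) θ
  exact e.symm

theorem Model.tr_b12 (M : Model c V) (hc : c ≠ 0) (S : Finset ℂ) (θ : Module.Dual ℂ V) :
    M.tr.b12 S θ = θ ∘ₗ M.c21 S := by
  have e := LinearMap.congr_fun (map_sp (trHom (V := V)) transpose_one transpose_mul
    ((M.comm₂₁ hc).symmOn S)) θ
  exact e.symm

theorem Model.tr_c21 (M : Model c V) (hc : c ≠ 0) (S : Finset ℂ) (θ : Module.Dual ℂ V) :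
    M.tr.c21 S θ = θ ∘ₗ M.b12 S := by
  have e := LinearMap.congr_fun (map_sp (trHom (V := V)) transpose_one transpose_mul
    ((M.comm₁₂ hc).symmOn S)) θ
  exact e.symm

theorem Model.tr_c32 (M : Model c V) (hc : c ≠ 0) {S : Finset ℂ} (hS : Gen c S) (θ : Module.Dual ℂ V) :
    M.tr.c32 S θ = θ ∘ₗ M.b23 S := by
  have e := LinearMap.congr_fun (map_sp (trHom (V := V)) transpose_one transpose_mul
    ((M.oddUp₂₃ hc).symmOn hc hS)) θ
  exact e.symm

variable (A : Model c V) (P : Parity A) (B : Model c W) (Q : Parity B)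

/-- A composite model is split by the tensor product. -/
def tensorSplitting : Splitting A P B (tensorModel A P B) where
  m := TensorProduct.mk ℂ V W
  T_m i j u x y := tensorT_tmul A P B i j u x y
  m_vac := rfl
  lam_eq _ _ := rfl

/-- The graded tensor product of functionals. -/
def gradedDual : Module.Dual ℂ W →ₗ[ℂ] Module.Dual ℂ V →ₗ[ℂ] Module.Dual ℂ (V ⊗[ℂ] W) :=
  LinearMap.mk₂ ℂ (fun φ₂ φ₁ => (2⁻¹ : ℂ) • TensorProduct.dualDistrib ℂ V W
      (φ₁ ⊗ₜ φ₂ + (φ₁ ∘ₗ P.Θ) ⊗ₜ φ₂ + φ₁ ⊗ₜ (φ₂ ∘ₗ Q.Θ) - (φ₁ ∘ₗ P.Θ) ⊗ₜ (φ₂ ∘ₗ Q.Θ)))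
    (fun _ _ _ => by
      rw [← smul_add, ← map_add]; congr 2
      simp only [LinearMap.add_comp, TensorProduct.tmul_add]; abel)
    (fun r _ _ => by
      rw [smul_comm r (2⁻¹ : ℂ)]; congr 1; rw [← map_smul]; congr 1
      simp only [LinearMap.smul_comp, TensorProduct.tmul_smul, smul_add, smul_sub])
    (fun _ _ _ => by
      rw [← smul_add, ← map_add]; congr 2
      simp only [LinearMap.add_comp, TensorProduct.add_tmul]; abel)
    (fun r _ _ => by
      rw [smul_comm r (2⁻¹ : ℂ)]; congr 1; rw [← map_smul]; congr 1
      simp only [LinearMap.smul_comp, ← TensorProduct.smul_tmul', smul_add, smul_sub])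

theorem gradedDual_apply (φ₂ : Module.Dual ℂ W) (φ₁ : Module.Dual ℂ V) (x : V) (y : W) :
    gradedDual A P B Q φ₂ φ₁ (x ⊗ₜ y) =
      2⁻¹ * (φ₁ x * φ₂ y + φ₁ (P.Θ x) * φ₂ y + φ₁ x * φ₂ (Q.Θ y) - φ₁ (P.Θ x) * φ₂ (Q.Θ y)) := by
  simp [gradedDual, LinearMap.mk₂_apply]

/-- For signs p, q the combination (1 + p + q - pq)/2 is -1 if both are -1 and 1 otherwise: the
Koszul sign, needed because transposition reverses the order of the tensor factors. -/
theorem gradedDual_apply_of_parity (φ₂ : Module.Dual ℂ W) (φ₁ : Module.Dual ℂ V) {x : V} {y : W} {p q : ℕ}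
    (hx : P.Θ x = ((-1 : ℂ) ^ p) • x) (hy : Q.Θ y = ((-1 : ℂ) ^ q) • y) :
    gradedDual A P B Q φ₂ φ₁ (x ⊗ₜ y) = (-1) ^ (p * q) * (φ₁ x * φ₂ y) := by
  rw [gradedDual_apply, hx, hy, map_smul, map_smul, smul_eq_mul, smul_eq_mul]
  rcases Nat.even_or_odd p with hp | hp <;> rcases Nat.even_or_odd q with hq | hq
  · rw [hp.neg_one_pow, hq.neg_one_pow, (hp.mul_right q).neg_one_pow]; ring
  · rw [hp.neg_one_pow, hq.neg_one_pow, (hp.mul_right q).neg_one_pow]; ring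
  · rw [hp.neg_one_pow, hq.neg_one_pow, (hq.mul_left p).neg_one_pow]; ring
  · rw [hp.neg_one_pow, hq.neg_one_pow, (hp.mul hq).neg_one_pow]; ring

/-- The transpose of a composite model is split by the graded tensor product of functionals. -/
def transposedSplitting : Splitting B.tr Q.tr A.tr (tensorModel A P B).tr where
  m := gradedDual A P B Q
  T_m i j u φ₂ φ₁ := by
    refine TensorProduct.ext' fun x y => ?_
    change gradedDual A P B Q φ₂ φ₁ (tensorT A P B j i u (x ⊗ₜ y)) = _
    rw [tensorT_tmul, map_sum, LinearMap.sum_apply]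
    refine Finset.sum_congr rfl fun k _ => ?_
    have hA : ∀ z, A.T j k u (P.Θ z) = ((-1 : ℂ) ^ (par j + par k)) • P.Θ (A.T j k u z) := fun z =>
      LinearMap.congr_fun (P.comm j k u) z
    have hB : ∀ z, B.T k i u (Q.Θ z) = ((-1 : ℂ) ^ (par k + par i)) • Q.Θ (B.T k i u z) := fun z =>
      LinearMap.congr_fun (Q.comm k i u) z
    have hQ : ∀ (θ : Module.Dual ℂ W), Q.tr.Θ θ = θ ∘ₗ Q.Θ := fun θ => rfl
    have hp : ∀ a : Fin 3, par a = 0 ∨ par a = 1 := by decide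
    rw [gradedDual_apply, gradedDual_apply]
    simp only [Model.tr_T]
    rcases hp i with h1 | h1 <;> rcases hp j with h2 | h2 <;> rcases hp k with h3 | h3 <;>
      simp [h1, h2, h3, hA, hB, hQ, pow_two, P.sq, Q.tr.sq, P.Θ_Θ, Q.Θ_Θ] <;> ring
  m_vac := by
    refine TensorProduct.ext' fun x y => ?_
    have h1 := LinearMap.congr_fun P.dualVac x
    have h2 := LinearMap.congr_fun Q.dualVac y
    simp only [LinearMap.comp_apply] at h1 h2
    change gradedDual A P B Q B.dualVac A.dualVac (x ⊗ₜ y) = TensorProduct.dualDistrib ℂ V W (A.dualVac ⊗ₜ B.dualVac) (x ⊗ₜ y)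
    rw [gradedDual_apply, h1, h2, TensorProduct.dualDistrib_apply]; ring
  lam_eq i u := mul_comm _ _

end transpose

/-! ### The highest coefficient as a vacuum expectation value -/

namespace Model
variable {c : ℂ} {V : Type*} [AddCommGroup V] [Module ℂ V] (M : Model c V)

theorem g_add_g_mul_f (z a l : ℂ) (h1 : z ≠ a) (h2 : z ≠ l) (h3 : a ≠ l) :
    g c z l + g c z a * f c z l * g c a l = g c z l * f c a l * f c z a := by
  rw [f_eq_one_add h1, f_eq_one_add h2, f_eq_one_add h3]
  simp only [g]
  have := sub_ne_zero.2 h1; have := sub_ne_zero.2 h2; have := sub_ne_zero.2 h3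
  field_simp; ring

/-- As λ_2 vanishes on A, only the term of the commutator with T_{22}(z) survives; T_{11}(a) then
spreads over the remaining points, and `g_add_g_mul_f` merges the two contributions to each of them.
-/
theorem T₂₁_b12_vac (hc : c ≠ 0) {z : ℂ} {A : Finset ℂ} (hz : z ∉ A) (h2 : ∀ a ∈ A, M.lam 1 a = 0) :
    M.T 1 0 z (M.b12 A M.vac) = ∑ a ∈ A, (M.lam 1 z * M.lam 0 a * (g c z a * pp (f c) (A.erase a) {a} *
      pp (f c) {z} (A.erase a))) • M.b12 (A.erase a) M.vac := by
  induction A using Finset.induction_on with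
  | empty => simpa using M.lower_vac 0 1 z (by decide)
  | insert a A ha ih =>
    rw [Finset.mem_insert, not_or] at hz
    have h2' : ∀ a ∈ A, M.lam 1 a = 0 := fun l hl => h2 l (by simp [hl])
    have e1 : M.T 1 1 a (M.b12 A M.vac) = 0 := by rw [M.T₂₂_b12_vac hc ha h2', h2 a (by simp)]; simp
    have e2 := M.T₂₂_b12_vac hc hz.2 h2'
    have e3 : M.T 0 0 a (M.b12 A M.vac) = (pp (f c) A {a} * M.lam 0 a) • M.b12 A M.vac +
        ∑ l ∈ A, (g c a l * pp (f c) (A.erase l) {l} * M.lam 0 l) • M.T 0 1 a (M.b12 (A.erase l) M.vac) := by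
      have := LinearMap.congr_fun (mul_evenP_action (M.comm₁₂ hc) M.rel₁₁_₁₂ ha) M.vac
      simp only [Module.End.mul_apply, LinearMap.add_apply, LinearMap.smul_apply, LinearMap.sum_apply, M.diag_vac,
        map_smul, smul_smul, pp_f_neg] at this
      rw [this]
      congr 1
      refine Finset.sum_congr rfl fun l _ => ?_
      congr 3
      rw [g, g, ← neg_sub a l, neg_div_neg_eq]
    have e4 := LinearMap.congr_fun (M.rel₂₁_₁₂ z a hz.1) (M.b12 A M.vac)
    simp only [Module.End.mul_apply, LinearMap.add_apply, LinearMap.sub_apply, LinearMap.smul_apply, e1, e2, map_zero,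
      sub_zero, map_smul, e3] at e4
    rw [M.b12_insert_apply hc ha, e4, ih hz.2 h2', Finset.sum_insert ha, Finset.erase_insert ha]
    have key : ∀ l ∈ A, (M.lam 1 z * M.lam 0 l * (g c z l * pp (f c) ((insert a A).erase l) {l} *
      pp (f c) {z} ((insert a A).erase l))) • M.b12 ((insert a A).erase l) M.vac =
        (M.lam 1 z * M.lam 0 l * (g c z l * pp (f c) (A.erase l) {l} * pp (f c) {z} (A.erase l))) •
          M.T 0 1 a (M.b12 (A.erase l) M.vac) +
        (g c z a * (pp (f c) {z} A * M.lam 1 z) * (g c a l * pp (f c) (A.erase l) {l} * M.lam 0 l)) •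
          M.T 0 1 a (M.b12 (A.erase l) M.vac) := by
      intro l hl
      have hla : a ≠ l := fun e => ha (e ▸ hl)
      have hzl : z ≠ l := fun e => hz.2 (e ▸ hl)
      have haA : a ∉ A.erase l := by simp [ha]
      rw [Finset.erase_insert_of_ne hla, M.b12_insert_apply hc haA, pp_insert_left _ haA, pp_insert_right _ haA,
        pp_pair, pp_pair, ← pp_erase_right (f c) hl, pp_pair, ← add_smul]
      congr 1
      linear_combination -(M.lam 1 z * M.lam 0 l * pp (f c) (A.erase l) {l} * pp (f c) {z} (A.erase l)) *
        g_add_g_mul_f (c := c) z a l hz.1 hzl hla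
    rw [Finset.sum_congr rfl key, Finset.sum_add_distrib]
    simp only [map_sum, map_smul, smul_add, Finset.smul_sum, smul_smul]
    simp only [← mul_assoc]
    have e5 : g c z a * pp (f c) {z} A * M.lam 1 z * pp (f c) A {a} * M.lam 0 a =
      M.lam 1 z * M.lam 0 a * g c z a * pp (f c) A {a} * pp (f c) {z} A := by ring
    rw [e5]; abel

/-- Removing the operators T_{21} one by one reproduces the recursion `dw_rec`. -/
theorem c21_b12_vac (hc : c ≠ 0) {σ : ℂ → Fin 3} {A Z : Finset ℂ} (hM : Indicates M σ (A ∪ Z)) (hA : Gen c A)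
    (hσA : ∀ a ∈ A, σ a = 0) (hσZ : ∀ z ∈ Z, σ z = 1) (hne : ∀ w ∈ Z, ∀ a ∈ A, w ≠ a ∧ a - w ≠ c)
    (hcard : A.card = Z.card) : M.c21 Z (M.b12 A M.vac) = dw c A Z • M.vac := by
  induction Z using Finset.induction_on generalizing A with
  | empty =>
    have : A = ∅ := Finset.card_eq_zero.1 (by simpa using hcard)
    subst this; simp [dw_empty hc hA]
  | insert z Z hz ih =>
    have hzA : z ∉ A := fun h => (hne z (by simp) z h).1 rfl
    rw [Finset.card_insert_of_notMem hz] at hcard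
    rw [c21, ← evenP_mul (M.comm₂₁ hc) hz, Module.End.mul_apply, M.T₂₁_b12_vac hc hzA (fun a ha => hM.zero (by simp [ha])
      (by rw [hσA a ha]; decide)), dw_rec hc hz hA hne hcard, map_sum, Finset.sum_smul]
    refine Finset.sum_congr rfl fun a ha => ?_
    have hsub := Finset.erase_subset a A
    have := ih (A := A.erase a) (hM.mono (Finset.union_subset_union hsub (Finset.subset_insert _ _))) (hA.mono hsub)
      (fun b hb => hσA b (hsub hb)) (fun b hb => hσZ b (by simp [hb])) (fun w hw b hb => hne w (by simp [hw]) b (hsub hb))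
      (by rw [Finset.card_erase_of_mem ha, hcard]; rfl)
    rw [map_smul, this, smul_smul, hM.one (by simp) (hσZ z (by simp)), hM.one (by simp [ha]) (hσA a ha)]
    congr 1; ring

/-- Here the annihilation operators carry the label 0 and the creation operators the label 1, the
opposite of `c21_b12_vac`. Transposition exchanges the two kinds. -/
theorem dualVac_c21_b12 (hc : c ≠ 0) {σ : ℂ → Fin 3} {A Z : Finset ℂ} (hM : Indicates M σ (A ∪ Z)) (hA : Gen c A)
    (hσA : ∀ a ∈ A, σ a = 0) (hσZ : ∀ z ∈ Z, σ z = 1) (hne : ∀ w ∈ Z, ∀ a ∈ A, w ≠ a ∧ a - w ≠ c)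
    (hcard : A.card = Z.card) : M.dualVac (M.c21 A (M.b12 Z M.vac)) = dw c A Z := by
  have h1 := M.tr.c21_b12_vac hc hM.tr hA hσA hσZ hne hcard
  rw [M.tr_c21 hc, M.tr_b12 hc] at h1
  have h2 := LinearMap.congr_fun h1 M.vac
  change M.dualVac (M.c21 A (M.b12 Z M.vac)) = dw c A Z * M.dualVac M.vac at h2
  rw [h2, M.dualVac_vac, mul_one]

theorem T₃₂_mul_b12 (hc : c ≠ 0) {z : ℂ} {X : Finset ℂ} (hz : z ∉ X) :
    M.T 2 1 z * M.b12 X = ∑ l ∈ insert z X, (pp (g c) {l} ((insert z X).erase l) * pp (h c) {l} X) •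
      (M.b12 ((insert z X).erase l) * M.T 2 1 l) := by
  rw [b12, mul_evenP_action (M.comm₁₂ hc) M.rel₃₂_₁₂ hz, Finset.sum_insert hz, Finset.erase_insert hz, ← pp_f_eq hc]
  congr 1
  refine Finset.sum_congr rfl fun l hl => ?_
  have hzl : z ≠ l := fun e => hz (e ▸ hl)
  have hzX : z ∉ X.erase l := by simp [hz]
  rw [Finset.erase_insert_of_ne hzl, mul_evenP (M.comm₁₂ hc) hzX, pp_insert_right _ hzX, pp_pair,
    ← pp_erase_right (h c) hl, pp_pair, h_self hc, pp_f_eq hc, one_mul, mul_assoc]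

/-- The coefficient comparison for moving one more T_{32}(z) through the T_{12}. If z lies in η,
only the term l = z remains; otherwise all l in η contribute and sum by Lagrange interpolation. -/
theorem sum_exchange_coeff (hc : c ≠ 0) {x s X η : Finset ℂ} {z : ℂ} (hX : X = x ∪ s) (hd : Disjoint x s) (hzX : z ∉ X)
    (hηX : η ⊆ insert z X) (hηc : η.card = s.card + 1) :
    ∑ l ∈ η, (if z ∈ η.erase l then 0 else pp (g c) (η.erase l) (X \ η.erase l) * pp (h c) (η.erase l) x *
      (pp (g c) {l} (insert z X \ insert l (η.erase l)) * (pp (h c) {l} (X \ η.erase l) * pp (h c) {l} (η.erase l)))) =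
      pp (h c) {z} s * (pp (g c) η (insert z X \ η) * pp (h c) η x) := by
  have hhX : ∀ l (η' : Finset ℂ), η' ⊆ X → pp (h c) {l} (X \ η') * pp (h c) {l} η' = pp (h c) {l} x * pp (h c) {l} s := by
    intro l η' hη'
    rw [mul_comm, pp_sdiff_right _ hη', hX, pp_union_right _ hd]
  by_cases hzη : z ∈ η
  · have hsubX : η.erase z ⊆ X := by
      intro y hy
      rcases Finset.mem_insert.1 (hηX (Finset.mem_of_mem_erase hy)) with h | h
      · exact absurd h (Finset.ne_of_mem_erase hy)
      · exact h
    rw [Finset.sum_eq_single z]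
    · have e4 : X \ η.erase z = insert z X \ η := by
        ext y; simp only [Finset.mem_sdiff, Finset.mem_insert, Finset.mem_erase]
        by_cases hy : y = z
        · subst hy; tauto
        · tauto
      rw [if_neg (Finset.notMem_erase _ _)]
      rw [hhX z _ hsubX, Finset.insert_erase hzη, e4, ← pp_erase_left (g c) hzη, ← pp_erase_left (h c) hzη]
      ring
    · intro l hl hlz
      rw [if_pos (Finset.mem_erase.2 ⟨hlz.symm, hzη⟩)]
    · exact fun h => absurd hzη h
  · have hηX' : η ⊆ X := by
      intro y hy
      rcases Finset.mem_insert.1 (hηX hy) with rfl | h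
      · exact absurd hy hzη
      · exact h
    have hzd : z ∈ insert z X \ η := by simp [hzη]
    rw [← sum_pp_h_lagrange hc hηc hzη, Finset.sum_mul]
    refine Finset.sum_congr rfl fun l hl => ?_
    have hsubX : η.erase l ⊆ X := (Finset.erase_subset _ _).trans hηX'
    have hzl : z ∉ η.erase l := fun h => hzη (Finset.mem_of_mem_erase h)
    have e4 : X \ η.erase l = insert l ((insert z X \ η).erase z) := by
      ext y; simp only [Finset.mem_sdiff, Finset.mem_insert, Finset.mem_erase]
      have := @hηX' l hl
      by_cases hy : y = l
      · subst hy; tauto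
      · have hyz : y ∈ X → y ≠ z := fun h e => hzX (e ▸ h)
        tauto
    have hlz : l ∉ (insert z X \ η).erase z := by simp [hl]
    have hne : pp (g c) (η.erase l) {z} ≠ 0 := pp_g_ne_zero hc (by simpa using hzl)
    rw [if_neg hzl, hhX l _ hsubX, Finset.insert_erase hl, e4, pp_insert_right _ hlz, ← pp_erase_left (g c) hl,
      ← pp_erase_left (h c) hl (T := x), ← pp_erase_right (g c) hzd (S := η.erase l)]
    field_simp

/-- Each T_{32} may leave with any of the points available to the T_{12}. After all exchanges the
arguments x ∪ s are redistributed arbitrarily, η being those now carried by the T_{32}; this is the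
sum that defines `zf`. -/
theorem c32_mul_b12 (hc : c ≠ 0) {x s : Finset ℂ} (hG : Gen c (x ∪ s)) (hd : Disjoint x s) :
    M.c32 s * M.b12 x = ∑ η ∈ (x ∪ s).powersetCard s.card,
      (pp (g c) η ((x ∪ s) \ η) * pp (h c) η x) • (M.b12 ((x ∪ s) \ η) * M.c32 η) := by
  induction s using Finset.induction_on with
  | empty => simp
  | insert z s hz ih =>
    rw [Finset.disjoint_insert_right] at hd
    have hXX : x ∪ insert z s = insert z (x ∪ s) := Finset.union_insert _ _ _
    rw [hXX] at hG ⊢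
    set X := x ∪ s with hX
    have hzX : z ∉ X := by simp [hX, hz, hd.1]
    have hsub : X ⊆ insert z X := Finset.subset_insert _ _
    have hzs : Gen c (insert z s) := hG.mono (Finset.insert_subset_insert _ Finset.subset_union_right)
    have hH : pp (h c) {z} s ≠ 0 := pp_h_ne_zero hc hzs (by simp) (Finset.subset_insert _ _)
    rw [c32, oddD_insert hc (M.oddDown₃₂ hc) hzs hz, smul_mul_assoc, mul_assoc, ih (hG.mono hsub) hd.2, Finset.mul_sum,
      Finset.card_insert_of_notMem hz]
    -- the coefficients of the double sum
    set k : ℂ → Finset ℂ → ℂ := fun l η => if z ∈ η then 0 else pp (g c) η (X \ η) * pp (h c) η x *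
      (pp (g c) {l} (insert z X \ insert l η) * (pp (h c) {l} (X \ η) * pp (h c) {l} η)) with hk
    have e1 : ∑ η ∈ X.powersetCard s.card, M.T 2 1 z * ((pp (g c) η (X \ η) * pp (h c) η x) • (M.b12 (X \ η) * M.c32 η)) =
        ∑ η ∈ (insert z X).powersetCard s.card, ∑ l ∈ insert z X \ η,
          k l η • (M.b12 (insert z X \ insert l η) * M.c32 (insert l η)) := by
      rw [← Finset.sum_subset (Finset.powersetCard_mono hsub)]
      · refine Finset.sum_congr rfl fun η hη => ?_
        have hηX := (Finset.mem_powersetCard.1 hη).1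
        have hzη : z ∉ η := fun h => hzX (hηX h)
        have hzd : z ∉ X \ η := fun h => hzX (Finset.sdiff_subset h)
        rw [mul_smul_comm, ← mul_assoc, M.T₃₂_mul_b12 hc hzd, Finset.sum_mul, Finset.smul_sum,
          Finset.insert_sdiff_of_notMem _ hzη]
        refine Finset.sum_congr rfl fun l hl => ?_
        have hlη : l ∉ η := by
          rcases Finset.mem_insert.1 hl with rfl | hl
          · exact hzη
          · exact (Finset.mem_sdiff.1 hl).2
        have hlX : l ∈ insert z X := by
          rcases Finset.mem_insert.1 hl with rfl | hl
          · simp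
          · exact hsub (Finset.mem_sdiff.1 hl).1
        have hGl : Gen c (insert l η) := hG.mono (Finset.insert_subset hlX (hηX.trans hsub))
        have hHl : pp (h c) {l} η ≠ 0 := pp_h_ne_zero hc hGl (by simp) (Finset.subset_insert _ _)
        have e : (insert z (X \ η)).erase l = insert z X \ insert l η := by
          rw [← Finset.insert_sdiff_of_notMem _ hzη]
          ext y; simp only [Finset.mem_sdiff, Finset.mem_insert, Finset.mem_erase, not_or]; tauto
        rw [e, smul_mul_assoc, smul_smul, mul_assoc, c32, c32, oddD_insert hc (M.oddDown₃₂ hc) hGl hlη, mul_smul_comm,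
          smul_smul, hk]
        simp only [if_neg hzη]
        congr 1
        field_simp
      · intro η hη hηX
        have hzη : z ∈ η := by
          by_contra hzη
          obtain ⟨h1, h2⟩ := Finset.mem_powersetCard.1 hη
          refine hηX (Finset.mem_powersetCard.2 ⟨fun y hy => ?_, h2⟩)
          rcases Finset.mem_insert.1 (h1 hy) with rfl | h
          · exact absurd hy hzη
          · exact h
        refine Finset.sum_eq_zero fun l _ => ?_
        rw [hk]; simp only [if_pos hzη, zero_smul]
    have e2 : ∑ η ∈ (insert z X).powersetCard s.card, ∑ l ∈ insert z X \ η,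
          k l η • (M.b12 (insert z X \ insert l η) * M.c32 (insert l η)) =
        ∑ l ∈ insert z X, ∑ η ∈ ((insert z X).erase l).powersetCard s.card,
          k l η • (M.b12 (insert z X \ insert l η) * M.c32 (insert l η)) := by
      refine Finset.sum_comm' fun η l => ?_
      simp only [Finset.mem_powersetCard, Finset.mem_sdiff, Finset.subset_erase]
      tauto
    rw [e1, e2, sum_powersetCard_mem, Finset.smul_sum]
    refine Finset.sum_congr rfl fun η hη => ?_
    obtain ⟨hηX, hηc⟩ := Finset.mem_powersetCard.1 hη
    have e3 : ∑ l ∈ η, k l (η.erase l) • (M.b12 (insert z X \ insert l (η.erase l)) * M.c32 (insert l (η.erase l))) =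
        (∑ l ∈ η, k l (η.erase l)) • (M.b12 (insert z X \ η) * M.c32 η) := by
      rw [Finset.sum_smul]
      exact Finset.sum_congr rfl fun l hl => by rw [Finset.insert_erase hl]
    rw [e3, smul_smul]
    congr 1
    rw [inv_mul_eq_iff_eq_mul₀ hH]
    exact sum_exchange_coeff hc hX hd.2 hzX hηX hηc

/-- Removing the point u of η from the product turns the expectation value into a sum over its
partner in K, and `sum_pp_h_lagrange'` shows that the sum is the product form. The triangular sign
comes from reordering g at every step. -/
theorem c32_b23_vac (hc : c ≠ 0) {σ : ℂ → Fin 3} {η K : Finset ℂ} (hM : Indicates M σ (η ∪ K)) (hη : Gen c η)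
    (hK : Gen c K) (hd : Disjoint η K) (hση : ∀ a ∈ η, σ a = 1) (hσK : ∀ z ∈ K, σ z = 2) (hcard : K.card = η.card) :
    M.c32 η (M.b23 K M.vac) = ((-1) ^ (K.card * (K.card - 1) / 2) * pp (g c) η K) • M.vac := by
  induction η using Finset.induction_on generalizing K with
  | empty =>
    have : K = ∅ := Finset.card_eq_zero.1 (by simpa using hcard)
    subst this; simp
  | insert u η hu ih =>
    rw [Finset.disjoint_insert_left] at hd
    rw [Finset.card_insert_of_notMem hu] at hcard
    have hH : pp (h c) η {u} ≠ 0 := pp_h_ne_zero hc hη (Finset.subset_insert _ _) (by simp)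
    rw [c32, oddD_insert_right hc (M.oddDown₃₂ hc) hη hu, LinearMap.smul_apply, Module.End.mul_apply,
      M.T₃₂_b23_vac hc hK hd.1 (fun l hl => hM.zero (by simp [hl]) (by rw [hσK l hl]; decide)), map_sum]
    have key : ∀ l ∈ K, M.c32 η ((M.lam 1 u * (g c u l * M.lam 2 l * pp (f c) (K.erase l) {u} * pp (g c) (K.erase l) {l})) •
        M.b23 (K.erase l) M.vac) = ((-1) ^ (K.card * (K.card - 1) / 2) * pp (g c) (insert u η) K *
          (pp (h c) (K.erase l) {u} * (pp (g c) (K.erase l) {l} * (pp (g c) η {l})⁻¹))) • M.vac := by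
      intro l hl
      have hsub := Finset.erase_subset l K
      have hcl : (K.erase l).card = η.card := by rw [Finset.card_erase_of_mem hl, hcard]; rfl
      have hlη : pp (g c) η {l} ≠ 0 := pp_g_ne_zero hc (by
        rw [Finset.disjoint_singleton_right]; exact fun h => Finset.disjoint_left.1 hd.2 h hl)
      rw [map_smul, ih (hM.mono (Finset.union_subset_union (Finset.subset_insert _ _) hsub))
        (hη.mono (Finset.subset_insert _ _)) (hK.mono hsub) (hd.2.mono_right hsub) (fun a ha => hση a (by simp [ha]))
        (fun z hz => hσK z (hsub hz)) hcl, smul_smul, hM.one (by simp) (hση u (by simp)), hM.one (by simp [hl]) (hσK l hl),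
        hcl, hcard, Nat.triangle_succ, pow_add, pp_insert_left _ hu, pp_f_eq hc, pp_g_swap c (K.erase l) {u},
        hcl, Finset.card_singleton, ← pp_erase_right (g c) hl (S := η), ← pp_erase_right (g c) hl (S := {u}), pp_pair]
      congr 1
      simp only [mul_one]
      field_simp
    rw [Finset.sum_congr rfl key, ← Finset.sum_smul, ← Finset.mul_sum, sum_pp_h_lagrange' hc hcard, smul_smul]
    congr 1
    field_simp

/-- The highest coefficient of the scalar product as a vacuum expectation value. -/
theorem dualVac_eq_zf (hc : c ≠ 0) {σ : ℂ → Fin 3} {R x s K : Finset ℂ} (hM : Indicates M σ (R ∪ x ∪ (s ∪ K)))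
    (hG : Gen c (R ∪ x ∪ (s ∪ K))) (hσR : ∀ z ∈ R, σ z = 0) (hσx : ∀ z ∈ x, σ z = 1) (hσs : ∀ z ∈ s, σ z = 1)
    (hσK : ∀ z ∈ K, σ z = 2) (hd : Disjoint x s) (hRx : R.card = x.card) (hsK : s.card = K.card) :
    M.dualVac (M.c21 R (M.c32 s (M.b12 x (M.b23 K M.vac)))) =
      (-1) ^ (K.card * (K.card - 1) / 2) * zf c R x s K := by
  have hxs : x ∪ s ⊆ R ∪ x ∪ (s ∪ K) := by
    intro y; simp only [Finset.mem_union]; tauto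
  have hRs : R ⊆ R ∪ x ∪ (s ∪ K) := by intro y; simp only [Finset.mem_union]; tauto
  have hKs : K ⊆ R ∪ x ∪ (s ∪ K) := by intro y; simp only [Finset.mem_union]; tauto
  have hσ1 : ∀ z ∈ x ∪ s, σ z = 1 := by
    intro z hz
    rcases Finset.mem_union.1 hz with h | h
    · exact hσx z h
    · exact hσs z h
  -- Once the T_{32} stand next to the T_{23}, the latter are used up completely, leaving a domain
  -- wall expectation value of the T_{21} and T_{12}.
  have h1 := LinearMap.congr_fun (M.c32_mul_b12 hc (hG.mono hxs) hd) (M.b23 K M.vac)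
  simp only [Module.End.mul_apply, LinearMap.sum_apply, LinearMap.smul_apply] at h1
  rw [h1, map_sum, map_sum, zf, Finset.mul_sum, ← hsK]
  refine Finset.sum_congr rfl fun η hη => ?_
  obtain ⟨hηX, hηc⟩ := Finset.mem_powersetCard.1 hη
  have hηs := hηX.trans hxs
  have hdK : Disjoint η K := by
    rw [Finset.disjoint_left]; intro y h1 h2
    have := hσ1 y (hηX h1); rw [hσK y h2] at this; exact absurd this (by decide)
  have hcd : ((x ∪ s) \ η).card = R.card := by
    rw [Finset.card_sdiff_of_subset hηX, Finset.card_union_of_disjoint hd, hηc, hRx]; omega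
  have hXs : (x ∪ s) \ η ⊆ x ∪ s := Finset.sdiff_subset
  rw [M.c32_b23_vac hc (hM.mono (Finset.union_subset hηs hKs)) (hG.mono hηs) (hG.mono hKs) hdK
    (fun a ha => hσ1 a (hηX ha)) hσK (by rw [hηc, hsK])]
  simp only [map_smul, smul_eq_mul]
  rw [M.dualVac_c21_b12 hc (hM.mono (Finset.union_subset hRs (hXs.trans hxs))) (hG.mono hRs) hσR
    (fun z hz => hσ1 z (hXs hz)) _ hcd.symm, hsK]
  · ring
  · intro w hw a ha
    have hwa : w ≠ a := by
      rintro rfl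
      have := hσ1 w (hXs hw); rw [hσR w ha] at this; exact absurd this (by decide)
    exact ⟨hwa, hG a (hRs ha) w (hxs (hXs hw)) hwa.symm⟩

end Model

/-! ### Scalar products in the composite of an indicator model with itself -/

section scalar
variable {c : ℂ} {V : Type*} [AddCommGroup V] [Module ℂ V]

/-- The scalar product of Bethe vectors over finite sets of parameters, without normalization factors. -/
def Model.sc (M : Model c V) (A B W Y : Finset ℂ) : ℂ :=
  (-1) ^ (W.card * (W.card - 1) / 2) * M.tr.bet A W (M.bet B Y)

variable {N : Model c V} {A B W Y : Finset ℂ} {σ : ℂ → Fin 3}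

theorem Indicates.tensor (P : Parity N) {Z : Finset ℂ} (hN : Indicates N σ Z) : Indicates (tensorModel N P N) σ Z := by
  intro z hz i
  change N.lam i z * N.lam i z = _
  rw [hN z hz]; split_ifs <;> simp

theorem sc_tensor_eq_zero (P : Parity N) (hc : c ≠ 0) (H : General c A B W Y)
    (hN : Indicates N σ (A ∪ B ∪ (W ∪ Y))) (h : (∃ z ∈ W ∪ Y, σ z = 0) ∨ ∃ z ∈ A ∪ B, σ z = 2) :
    (tensorModel N P N).sc A B W Y = 0 := by
  have sA : A ⊆ A ∪ B ∪ (W ∪ Y) := by intro x; simp; tauto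
  have sB : B ⊆ A ∪ B ∪ (W ∪ Y) := by intro x; simp; tauto
  have sW : W ⊆ A ∪ B ∪ (W ∪ Y) := by intro x; simp; tauto
  have sY : Y ⊆ A ∪ B ∪ (W ∪ Y) := by intro x; simp; tauto
  rw [Model.sc]
  by_cases hW : ∃ z ∈ W, σ z = 0
  · obtain ⟨z, hz, h0⟩ := hW
    rw [(transposedSplitting N P N P).bet_eq_zero hc (H.gen.mono sA) (H.gen.mono sW) H.AW (hN.mono sW).tr (hN.mono sW).tr hz h0]
    simp
  by_cases hY : ∃ z ∈ Y, σ z = 0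
  · obtain ⟨z, hz, h0⟩ := hY
    rw [(tensorSplitting N P N).bet_eq_zero hc (H.gen.mono sB) (H.gen.mono sY) H.BY (hN.mono sY) (hN.mono sY) hz h0]
    simp
  push Not at hW hY
  rcases h with ⟨z, hz, h0⟩ | ⟨z, hz, h2⟩
  · rcases Finset.mem_union.1 hz with hz | hz
    · exact absurd h0 (hW z hz)
    · exact absurd h0 (hY z hz)
  have sAW := Finset.union_subset sA sW
  have sBY := Finset.union_subset sB sY
  rcases Finset.mem_union.1 hz with hz | hz
  · rw [(transposedSplitting N P N P).bet_eq hc (H.gen.mono sAW) H.AW (hN.mono sAW).tr (hN.mono sAW).tr hW,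
      if_neg fun h => h z hz h2]
    simp
  · rw [(tensorSplitting N P N).bet_eq hc (H.gen.mono sBY) H.BY (hN.mono sBY) (hN.mono sBY) hY,
      if_neg fun h => h z hz h2]
    simp

theorem neg_one_pow_triangle_add (j k : ℕ) :
    (-1 : ℂ) ^ ((j + k) * (j + k - 1) / 2) =
      (-1) ^ (j * (j - 1) / 2) * (-1) ^ (k * (k - 1) / 2) * (-1) ^ (j * k) := by
  rw [← pow_add, ← pow_add]
  congr 1
  induction k with
  | zero => simp
  | succ k ih => rw [← add_assoc, Nat.triangle_succ, Nat.triangle_succ, ih]; ring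

/-- Both vectors are single tensors, so their pairing is the Koszul sign times two expectation
values in N. One is a highest coefficient directly, the other is one for the transposed model. The
prefactor (-1)^{b(b-1)/2} and the reversals of g absorb all signs. -/
theorem sc_tensor_eq (P : Parity N) (hc : c ≠ 0) (H : General c A B W Y)
    (hN : Indicates N σ (A ∪ B ∪ (W ∪ Y))) (h0 : ∀ z ∈ W ∪ Y, σ z ≠ 0) (h2 : ∀ z ∈ A ∪ B, σ z ≠ 2)
    (hAB : (cl σ 0 A).card = (cl σ 1 B).card) (hWY : (cl σ 1 W).card = (cl σ 2 Y).card) :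
    (tensorModel N P N).sc A B W Y =
      (pp (f c) (cl σ 1 A) (cl σ 0 A) * pp (f c) (cl σ 1 B) (cl σ 0 B) * pp (f c) (cl σ 1 W) (cl σ 1 A) *
        pp (f c) (cl σ 1 Y) (cl σ 1 B) * pp (g c) (cl σ 2 W) (cl σ 1 W) * pp (g c) (cl σ 2 Y) (cl σ 1 Y)) *
      zf c (cl σ 0 A) (cl σ 1 B) (cl σ 1 W) (cl σ 2 Y) * zf c (cl σ 0 B) (cl σ 1 A) (cl σ 1 Y) (cl σ 2 W) := by
  have sA : A ⊆ A ∪ B ∪ (W ∪ Y) := by intro x; simp; tauto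
  have sB : B ⊆ A ∪ B ∪ (W ∪ Y) := by intro x; simp; tauto
  have sW : W ⊆ A ∪ B ∪ (W ∪ Y) := by intro x; simp; tauto
  have sY : Y ⊆ A ∪ B ∪ (W ∪ Y) := by intro x; simp; tauto
  have sAW := Finset.union_subset sA sW
  have sBY := Finset.union_subset sB sY
  have sub : ∀ i {S : Finset ℂ}, S ⊆ A ∪ B ∪ (W ∪ Y) → cl σ i S ⊆ A ∪ B ∪ (W ∪ Y) := fun i S hS => (cl_subset σ i S).trans hS
  have cA : (cl σ 0 A).card + (cl σ 1 A).card = A.card := by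
    rw [← Finset.card_union_of_disjoint (disjoint_cl (by decide) _ _), cl_union_cl (k := 2) (by decide)
      fun z hz => h2 z (Finset.mem_union_left _ hz)]
  have cB : (cl σ 0 B).card + (cl σ 1 B).card = B.card := by
    rw [← Finset.card_union_of_disjoint (disjoint_cl (by decide) _ _), cl_union_cl (k := 2) (by decide)
      fun z hz => h2 z (Finset.mem_union_right _ hz)]
  have cW : (cl σ 2 W).card + (cl σ 1 W).card = W.card := by
    rw [← Finset.card_union_of_disjoint (disjoint_cl (by decide) _ _), cl_union_cl (k := 0) (by decide)
      fun z hz => h0 z (Finset.mem_union_left _ hz)]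
  have cY : (cl σ 2 Y).card + (cl σ 1 Y).card = Y.card := by
    rw [← Finset.card_union_of_disjoint (disjoint_cl (by decide) _ _), cl_union_cl (k := 0) (by decide)
      fun z hz => h0 z (Finset.mem_union_right _ hz)]
  have hcAB := H.cardAB
  have hcWY := H.cardWY
  have eAB : (cl σ 0 B).card = (cl σ 1 A).card := by omega
  have eWY : (cl σ 1 Y).card = (cl σ 2 W).card := by omega
  rw [Model.sc, (transposedSplitting N P N P).bet_eq hc (H.gen.mono sAW) H.AW (hN.mono sAW).tr (hN.mono sAW).tr
      (fun z hz => h0 z (Finset.mem_union_left _ hz)), if_pos fun z hz => h2 z (Finset.mem_union_left _ hz),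
    (tensorSplitting N P N).bet_eq hc (H.gen.mono sBY) H.BY (hN.mono sBY) (hN.mono sBY)
      (fun z hz => h0 z (Finset.mem_union_right _ hz)), if_pos fun z hz => h2 z (Finset.mem_union_right _ hz)]
  have gen : ∀ i {S : Finset ℂ}, S ⊆ A ∪ B ∪ (W ∪ Y) → Gen c (cl σ i S) := fun i S hS => H.gen.mono (sub i hS)
  have pX : P.Θ (N.b12 (cl σ 1 B) (N.b23 (cl σ 2 Y) N.vac)) =
      ((-1 : ℂ) ^ (cl σ 2 Y).card) • N.b12 (cl σ 1 B) (N.b23 (cl σ 2 Y) N.vac) := by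
    rw [P.Θ_b12 hc, P.Θ_b23 hc (gen 2 sY), P.vac, map_smul]
  have pY : P.Θ (N.b23 (cl σ 1 Y) (N.b12 (cl σ 0 B) N.vac)) =
      ((-1 : ℂ) ^ (cl σ 1 Y).card) • N.b23 (cl σ 1 Y) (N.b12 (cl σ 0 B) N.vac) := by
    rw [P.Θ_b23 hc (gen 1 sY), P.Θ_b12 hc, P.vac]
  have z1 := N.dualVac_eq_zf hc (σ := σ) (R := cl σ 0 A) (x := cl σ 1 B) (s := cl σ 1 W) (K := cl σ 2 Y)
    (hN.mono (Finset.union_subset (Finset.union_subset (sub 0 sA) (sub 1 sB)) (Finset.union_subset (sub 1 sW) (sub 2 sY))))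
    (H.gen.mono (Finset.union_subset (Finset.union_subset (sub 0 sA) (sub 1 sB)) (Finset.union_subset (sub 1 sW) (sub 2 sY))))
    (fun z hz => (mem_cl.1 hz).2) (fun z hz => (mem_cl.1 hz).2) (fun z hz => (mem_cl.1 hz).2) (fun z hz => (mem_cl.1 hz).2)
    (H.BW.mono (cl_subset _ _ _) (cl_subset _ _ _)) hAB hWY
  have z2 := N.tr.dualVac_eq_zf hc (σ := σ) (R := cl σ 0 B) (x := cl σ 1 A) (s := cl σ 1 Y) (K := cl σ 2 W)
    (hN.mono (Finset.union_subset (Finset.union_subset (sub 0 sB) (sub 1 sA)) (Finset.union_subset (sub 1 sY) (sub 2 sW)))).tr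
    (H.gen.mono (Finset.union_subset (Finset.union_subset (sub 0 sB) (sub 1 sA)) (Finset.union_subset (sub 1 sY) (sub 2 sW))))
    (fun z hz => (mem_cl.1 hz).2) (fun z hz => (mem_cl.1 hz).2) (fun z hz => (mem_cl.1 hz).2) (fun z hz => (mem_cl.1 hz).2)
    (H.AY.mono (cl_subset _ _ _) (cl_subset _ _ _)) eAB eWY
  rw [N.tr_c21 hc, N.tr_c32 hc (gen 1 sY)] at z2
  simp only [map_smul, LinearMap.smul_apply, smul_eq_mul]
  have e := gradedDual_apply_of_parity N P N P (N.tr.b12 (cl σ 1 A) (N.tr.b23 (cl σ 2 W) N.tr.vac))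
    (N.tr.b23 (cl σ 1 W) (N.tr.b12 (cl σ 0 A) N.tr.vac)) pX pY
  have z1' : N.tr.b23 (cl σ 1 W) (N.tr.b12 (cl σ 0 A) N.tr.vac) (N.b12 (cl σ 1 B) (N.b23 (cl σ 2 Y) N.vac)) =
      (-1) ^ ((cl σ 2 Y).card * ((cl σ 2 Y).card - 1) / 2) * zf c (cl σ 0 A) (cl σ 1 B) (cl σ 1 W) (cl σ 2 Y) := by
    rw [N.tr_b23 hc (gen 1 sW), N.tr_b12 hc]; exact z1
  have z2' : N.tr.b12 (cl σ 1 A) (N.tr.b23 (cl σ 2 W) N.tr.vac) (N.b23 (cl σ 1 Y) (N.b12 (cl σ 0 B) N.vac)) =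
      (-1) ^ ((cl σ 2 W).card * ((cl σ 2 W).card - 1) / 2) * zf c (cl σ 0 B) (cl σ 1 A) (cl σ 1 Y) (cl σ 2 W) := z2
  rw [z1', z2'] at e
  have e' : (transposedSplitting N P N P).m (N.tr.b12 (cl σ 1 A) (N.tr.b23 (cl σ 2 W) N.tr.vac))
    (N.tr.b23 (cl σ 1 W) (N.tr.b12 (cl σ 0 A) N.tr.vac)) ((tensorSplitting N P N).m
      (N.b12 (cl σ 1 B) (N.b23 (cl σ 2 Y) N.vac)) (N.b23 (cl σ 1 Y) (N.b12 (cl σ 0 B) N.vac))) =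
      (-1) ^ ((cl σ 2 Y).card * (cl σ 1 Y).card) * ((-1) ^ ((cl σ 2 Y).card * ((cl σ 2 Y).card - 1) / 2) * zf c (cl σ 0 A) (cl σ 1 B) (cl σ 1 W) (cl σ 2 Y) *
        ((-1) ^ ((cl σ 2 W).card * ((cl σ 2 W).card - 1) / 2) * zf c (cl σ 0 B) (cl σ 1 A) (cl σ 1 Y) (cl σ 2 W))) := e
  rw [e', pp_g_swap c (cl σ 1 W) (cl σ 2 W), pp_g_swap c (cl σ 1 Y) (cl σ 2 Y), ← cW, hWY, eWY, neg_one_pow_triangle_add]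
  have sq : ∀ n : ℕ, (-1 : ℂ) ^ n * (-1) ^ n = 1 := fun n => by rw [← mul_pow]; simp
  have m1 : (cl σ 2 Y).card * (cl σ 2 W).card = (cl σ 2 W).card * (cl σ 2 Y).card := mul_comm _ _
  rw [m1]
  generalize (cl σ 2 W).card * (cl σ 2 Y).card = n
  have s1 := sq n
  have s2 := sq ((cl σ 2 W).card * ((cl σ 2 W).card - 1) / 2)
  have s3 := sq ((cl σ 2 Y).card * ((cl σ 2 Y).card - 1) / 2)
  generalize (-1 : ℂ) ^ ((cl σ 2 W).card * ((cl σ 2 W).card - 1) / 2) = x2 at s2 ⊢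
  generalize (-1 : ℂ) ^ ((cl σ 2 Y).card * ((cl σ 2 Y).card - 1) / 2) = x3 at s3 ⊢
  generalize (-1 : ℂ) ^ n = x1 at s1 ⊢
  generalize zf c (cl σ 0 A) (cl σ 1 B) (cl σ 1 W) (cl σ 2 Y) = Z1
  generalize zf c (cl σ 0 B) (cl σ 1 A) (cl σ 1 Y) (cl σ 2 W) = Z2
  have s4 : x1 * x1 * (x1 * x1) * (x2 * x2) * (x3 * x3) = 1 := by rw [s1, s2, s3]; ring
  linear_combination (pp (f c) (cl σ 1 A) (cl σ 0 A) * pp (f c) (cl σ 1 B) (cl σ 0 B) * pp (f c) (cl σ 1 W) (cl σ 1 A) *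
        pp (f c) (cl σ 1 Y) (cl σ 1 B) * pp (g c) (cl σ 2 W) (cl σ 1 W) * pp (g c) (cl σ 2 Y) (cl σ 1 Y)) * Z1 * Z2 * s4

end scalar

/-! ### Recovering the scalar product from indicator models -/

section extraction
variable {c : ℂ}

/-- The labelling with value `0` on `P`, `2` on `Q \ P` and `1` elsewhere. -/
def lab (P Q : Finset ℂ) (z : ℂ) : Fin 3 := if z ∈ P then 0 else if z ∈ Q then 2 else 1

theorem mem_cl_lab_zero {P Q S : Finset ℂ} {z : ℂ} : z ∈ cl (lab P Q) 0 S ↔ z ∈ S ∧ z ∈ P := by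
  rw [mem_cl, lab]; split_ifs <;> simp_all

theorem mem_cl_lab_one {P Q S : Finset ℂ} {z : ℂ} : z ∈ cl (lab P Q) 1 S ↔ z ∈ S ∧ z ∉ P ∧ z ∉ Q := by
  rw [mem_cl, lab]; split_ifs <;> simp_all

theorem mem_cl_lab_two {P Q S : Finset ℂ} {z : ℂ} : z ∈ cl (lab P Q) 2 S ↔ z ∈ S ∧ z ∉ P ∧ z ∈ Q := by
  rw [mem_cl, lab]; split_ifs <;> simp_all

/-- Every point occurs exactly once, so a monomial is the same as a labelling of the points. -/
theorem exists_label {s : Multiset (Fin 3 × ℂ)} {Z : Finset ℂ} (hs : s.map Prod.snd = Z.val) :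
    ∃ τ : ℂ → Fin 3, s = Z.val.map fun z => (τ z, z) := by
  have h : ∀ z, ∃ i, z ∈ Z → (i, z) ∈ s := by
    intro z
    by_cases hz : z ∈ Z
    · have : z ∈ s.map Prod.snd := by rw [hs]; exact hz
      obtain ⟨⟨i, w⟩, hp, rfl⟩ := Multiset.mem_map.1 this
      exact ⟨i, fun _ => hp⟩
    · exact ⟨0, fun h => absurd h hz⟩
  choose τ hτ using h
  have hnd : (s.map Prod.snd).Nodup := by rw [hs]; exact Z.nodup
  refine ⟨τ, (Multiset.Nodup.ext (Multiset.Nodup.of_map _ hnd) (Z.nodup.map fun x y e => (Prod.mk.inj e).2)).2 fun p => ?_⟩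
  rw [Multiset.mem_map]
  constructor
  · intro hp
    have hz : p.2 ∈ Z := by
      have := Multiset.mem_map_of_mem Prod.snd hp
      rwa [hs] at this
    exact ⟨p.2, hz, Multiset.inj_on_of_nodup_map hnd _ (hτ _ hz) _ hp rfl⟩
  · rintro ⟨z, hz, rfl⟩
    exact hτ z hz

/-- A combination of monomials in the vacuum eigenvalues is determined by its values at indicator models. -/
theorem eq_sum_of_mem_lamSpan {r : Multiset (Fin 3)} {Z : Finset ℂ} {F : BModel.{u} c → ℂ} (hF : F ∈ lamSpan c r Z.val)
    (N : Finset ℂ → Finset ℂ → BModel.{u} c) (hN : ∀ P Q, Indicates (N P Q).M (lab P Q) Z) (X : BModel.{u} c) :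
    F X = ∑ P ∈ Z.powerset, ∑ Q ∈ Z.powerset,
      if Disjoint P Q ∧ P.card = r.count 0 ∧ Q.card = r.count 2 then
        F (N P Q) * ((∏ z ∈ P, X.M.lam 0 z) * (∏ z ∈ Q, X.M.lam 2 z) * ∏ z ∈ (Z \ P) \ Q, X.M.lam 1 z) else 0 := by
  induction hF using Submodule.span_induction with
  | zero => simp
  | add F G _ _ hF hG =>
    rw [Pi.add_apply, hF, hG, ← Finset.sum_add_distrib]
    refine Finset.sum_congr rfl fun P _ => ?_
    rw [← Finset.sum_add_distrib]
    refine Finset.sum_congr rfl fun Q _ => ?_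
    split_ifs
    · rw [Pi.add_apply, add_mul]
    · rw [add_zero]
  | smul a F _ hF =>
    rw [Pi.smul_apply, hF, Finset.smul_sum]
    refine Finset.sum_congr rfl fun P _ => ?_
    rw [Finset.smul_sum]
    refine Finset.sum_congr rfl fun Q _ => ?_
    split_ifs
    · rw [Pi.smul_apply, smul_mul_assoc]
    · rw [smul_zero]
  | mem F hF =>
    obtain ⟨s, ⟨rfl, hs⟩, rfl⟩ := hF
    obtain ⟨τ, rfl⟩ := exists_label hs
    have hmono : ∀ X : BModel.{u} c, lamMono (Z.val.map fun z => (τ z, z)) X = ∏ z ∈ Z, X.M.lam (τ z) z := by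
      intro X; rw [lamMono, Multiset.map_map]; rfl
    have hval : ∀ P Q, lamMono (Z.val.map fun z => (τ z, z)) (N P Q) = if ∀ z ∈ Z, τ z = lab P Q z then 1 else 0 := by
      intro P Q
      rw [hmono]
      split_ifs with h
      · exact Finset.prod_eq_one fun z hz => by rw [hN P Q z hz, if_pos (h z hz)]
      · push Not at h
        obtain ⟨z, hz, hne⟩ := h
        exact Finset.prod_eq_zero hz (by rw [hN P Q z hz, if_neg hne])
    have hcount : ∀ i, ((Z.val.map fun z => (τ z, z)).map Prod.fst).count i = (cl τ i Z).card := by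
      intro i
      rw [Multiset.map_map, Multiset.count_map, cl, Finset.card_def, Finset.filter_val]
      congr 1
      exact Multiset.filter_congr fun z _ => ⟨fun h => h.symm, fun h => h.symm⟩
    have hlab : ∀ P Q, P ⊆ Z → Q ⊆ Z → Disjoint P Q → (∀ z ∈ Z, τ z = lab P Q z) → P = cl τ 0 Z ∧ Q = cl τ 2 Z := by
      intro P Q hP hQ hd h
      have e : ∀ i, cl τ i Z = cl (lab P Q) i Z := fun i => Finset.filter_congr fun z hz => by rw [h z hz]
      rw [e, e]
      constructor
      · ext z; rw [mem_cl_lab_zero]; exact ⟨fun hz => ⟨hP hz, hz⟩, fun hz => hz.2⟩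
      · ext z; rw [mem_cl_lab_two]
        exact ⟨fun hz => ⟨hQ hz, fun hz' => Finset.disjoint_left.1 hd hz' hz, hz⟩, fun hz => hz.2.2⟩
    -- A monomial takes the value 1 on the indicator model with its own labels and 0 on all the
    -- others, so just the pair (P, Q) of its own label classes contributes.
    rw [Finset.sum_eq_single (cl τ 0 Z), Finset.sum_eq_single (cl τ 2 Z), if_pos ⟨disjoint_cl (by decide) _ _, (hcount 0).symm, (hcount 2).symm⟩,
      hval, if_pos, one_mul, hmono]
    · have e1 : (Z \ cl τ 0 Z) \ cl τ 2 Z = cl τ 1 Z := by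
        ext z
        simp only [Finset.mem_sdiff, mem_cl]
        have : ∀ i : Fin 3, i = 1 ↔ ¬ i = 0 ∧ ¬ i = 2 := by decide
        rw [this]; tauto
      have e2 : ∀ i, ∏ z ∈ cl τ i Z, X.M.lam i z = ∏ z ∈ cl τ i Z, X.M.lam (τ z) z := fun i =>
        Finset.prod_congr rfl fun z hz => by rw [(mem_cl.1 hz).2]
      rw [e2 0, e2 2, show ∏ z ∈ (Z \ cl τ 0 Z) \ cl τ 2 Z, X.M.lam 1 z = ∏ z ∈ (Z \ cl τ 0 Z) \ cl τ 2 Z, X.M.lam (τ z) z by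
        rw [e1]; exact e2 1, mul_assoc, mul_comm (∏ z ∈ cl τ 2 Z, _),
        Finset.prod_sdiff (Finset.subset_sdiff.2 ⟨cl_subset _ _ _, disjoint_cl (by decide) _ _⟩), mul_comm,
        Finset.prod_sdiff (cl_subset _ _ _)]
    · intro z hz
      have : ∀ i : Fin 3, i = 0 ∨ i = 1 ∨ i = 2 := by decide
      rw [lab]; simp only [mem_cl, hz, true_and]
      rcases this (τ z) with h | h | h <;> simp [h]
    · intro Q hQ hne
      split_ifs with h
      · rw [hval, if_neg, zero_mul]
        exact fun hl => hne (hlab _ Q (cl_subset _ _ _) (Finset.mem_powerset.1 hQ) h.1 hl).2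
      · rfl
    · exact fun h => absurd (Finset.mem_powerset.2 (cl_subset _ _ _)) h
    · intro P hP hne
      refine Finset.sum_eq_zero fun Q hQ => ?_
      split_ifs with h
      · rw [hval, if_neg, zero_mul]
        exact fun hl => hne (hlab P Q (Finset.mem_powerset.1 hP) (Finset.mem_powerset.1 hQ) h.1 hl).1
      · rfl
    · exact fun h => absurd (Finset.mem_powerset.2 (cl_subset _ _ _)) h

/-- The normalization constant is the same for all models, as the universality argument requires. -/
theorem exists_spL_eq_wordOp (w : ℂ → ℂ → ℂ) (i j : Fin 3) (l : List ℂ) :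
    ∃ κ : ℂ, ∀ X : BModel.{u} c, spL w (X.M.T i j) l = κ • X.M.wordOp (l.map fun z => (i, j, z)) := by
  induction l with
  | nil => exact ⟨1, fun X => by simp [spL, Model.wordOp]⟩
  | cons x l ih =>
    obtain ⟨κ, hκ⟩ := ih
    refine ⟨((l.map (w x)).prod)⁻¹ * κ, fun X => ?_⟩
    rw [spL, hκ, mul_smul_comm, smul_smul]; simp [Model.wordOp]

theorem Model.wordOp_append {V : Type*} [AddCommGroup V] [Module ℂ V] (M : Model c V) (w w' : List (Fin 3 × Fin 3 × ℂ)) :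
    M.wordOp (w ++ w') = M.wordOp w * M.wordOp w' := by simp [Model.wordOp]

/-- The eigenvalues λ_2 on J and J' stand in for the points on which no operator acts, so that each
of the 2a + 2b points occurs once. Since |J| = |I| and |J'| = |I'|, the numbers of the three indices
do not depend on the chosen partitions. -/
theorem bethe_term_mem_lamSpan {A B W Y : Finset ℂ} (hc : c ≠ 0) (H : General c A B W Y) {I J I' J' : Finset ℂ}
    (hI : I ⊆ A) (hJ : J ⊆ W) (hIJ : J.card = I.card) (hI' : I' ⊆ B) (hJ' : J' ⊆ Y) (hIJ' : J'.card = I'.card) :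
    (fun X : BModel.{u} c => (∏ l ∈ J, X.M.lam 1 l) * (∏ l ∈ J', X.M.lam 1 l) *
      X.M.tr.b13 I (X.M.tr.b12 (A \ I) (X.M.tr.b23 (W \ J) X.M.tr.vac))
        (X.M.b13 I' (X.M.b12 (B \ I') (X.M.b23 (Y \ J') X.M.vac)))) ∈
      lamSpan c (Multiset.replicate A.card 0 + Multiset.replicate (A.card + W.card) 1 + Multiset.replicate W.card 2)
        (A ∪ B ∪ (W ∪ Y)).val := by
  have sA : A ⊆ A ∪ B ∪ (W ∪ Y) := by intro x; simp; tauto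
  have sW : W ⊆ A ∪ B ∪ (W ∪ Y) := by intro x; simp; tauto
  obtain ⟨κ₁, h₁⟩ := exists_spL_eq_wordOp.{u} (c := c) (h c) 2 1 (W \ J).toList
  obtain ⟨κ₂, h₂⟩ := exists_spL_eq_wordOp.{u} (c := c) (fun _ _ => 1) 1 0 (A \ I).toList
  obtain ⟨κ₃, h₃⟩ := exists_spL_eq_wordOp.{u} (c := c) (h c) 2 0 I.toList
  obtain ⟨κ₄, h₄⟩ := exists_spL_eq_wordOp.{u} (c := c) (fun x y => h c y x) 0 2 I'.toList
  obtain ⟨κ₅, h₅⟩ := exists_spL_eq_wordOp.{u} (c := c) (fun _ _ => 1) 0 1 (B \ I').toList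
  obtain ⟨κ₆, h₆⟩ := exists_spL_eq_wordOp.{u} (c := c) (fun x y => h c y x) 1 2 (Y \ J').toList
  set w : List (Fin 3 × Fin 3 × ℂ) := ((W \ J).toList.map fun z => (2, 1, z)) ++ (((A \ I).toList.map fun z => (1, 0, z)) ++
    ((I.toList.map fun z => (2, 0, z)) ++ ((I'.toList.map fun z => (0, 2, z)) ++ (((B \ I').toList.map fun z => (0, 1, z)) ++
      ((Y \ J').toList.map fun z => (1, 2, z)))))) with hw
  set s : Multiset (Fin 3 × ℂ) := (J.val.map fun z => (1, z)) + (J'.val.map fun z => (1, z)) with hs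
  have e : (fun X : BModel.{u} c => (∏ l ∈ J, X.M.lam 1 l) * (∏ l ∈ J', X.M.lam 1 l) *
      X.M.tr.b13 I (X.M.tr.b12 (A \ I) (X.M.tr.b23 (W \ J) X.M.tr.vac))
        (X.M.b13 I' (X.M.b12 (B \ I') (X.M.b23 (Y \ J') X.M.vac)))) =
      (κ₁ * κ₂ * κ₃ * κ₄ * κ₅ * κ₆) • (lamMono s * fun X : BModel.{u} c => X.M.vev w) := by
    funext X
    rw [X.M.tr_b23 hc (H.gen.mono (Finset.sdiff_subset.trans sW)), X.M.tr_b12 hc, X.M.tr_b13 hc (H.gen.mono (hI.trans sA))]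
    have e1 : X.M.c32 (W \ J) = κ₁ • _ := h₁ X
    have e2 : X.M.c21 (A \ I) = κ₂ • _ := h₂ X
    have e3 : X.M.c31 I = κ₃ • _ := h₃ X
    have e4 : X.M.b13 I' = κ₄ • _ := h₄ X
    have e5 : X.M.b12 (B \ I') = κ₅ • _ := h₅ X
    have e6 : X.M.b23 (Y \ J') = κ₆ • _ := h₆ X
    rw [e1, e2, e3, e4, e5, e6]
    have e7 : lamMono s X = (∏ l ∈ J, X.M.lam 1 l) * (∏ l ∈ J', X.M.lam 1 l) := by
      rw [lamMono, hs, Multiset.map_add, Multiset.prod_add, Multiset.map_map, Multiset.map_map]; rfl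
    rw [Pi.smul_apply, Pi.mul_apply, e7, Model.vev, hw]
    simp only [Model.wordOp_append, LinearMap.comp_apply, LinearMap.smul_apply, map_smul, Module.End.mul_apply, smul_eq_mul]
    change _ * (_ * (_ * (_ * (_ * (_ * (_ * X.M.dualVac _)))))) = _
    ring
  rw [e]
  have vI : I.val + (A \ I).val = A.val := by
    rw [← Finset.disjUnion_val, Finset.disjUnion_eq_union, Finset.union_sdiff_of_subset hI]; exact Finset.disjoint_sdiff
  have vJ : J.val + (W \ J).val = W.val := by
    rw [← Finset.disjUnion_val, Finset.disjUnion_eq_union, Finset.union_sdiff_of_subset hJ]; exact Finset.disjoint_sdiff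
  have vI' : I'.val + (B \ I').val = B.val := by
    rw [← Finset.disjUnion_val, Finset.disjUnion_eq_union, Finset.union_sdiff_of_subset hI']; exact Finset.disjoint_sdiff
  have vJ' : J'.val + (Y \ J').val = Y.val := by
    rw [← Finset.disjUnion_val, Finset.disjUnion_eq_union, Finset.union_sdiff_of_subset hJ']; exact Finset.disjoint_sdiff
  have vZ : (A ∪ B ∪ (W ∪ Y)).val = A.val + B.val + (W.val + Y.val) := by
    have hd : Disjoint (A ∪ B) (W ∪ Y) := by
      simp only [Finset.disjoint_union_left, Finset.disjoint_union_right]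
      exact ⟨⟨H.AW, H.BW⟩, H.AY, H.BY⟩
    rw [← Finset.disjUnion_eq_union _ _ hd, Finset.disjUnion_val, ← Finset.disjUnion_eq_union _ _ H.AB, Finset.disjUnion_val,
      ← Finset.disjUnion_eq_union _ _ H.WY, Finset.disjUnion_val]
  have wpts : ((w.map fun p => p.2.2 : List ℂ) : Multiset ℂ) =
      (W \ J).val + ((A \ I).val + (I.val + (I'.val + ((B \ I').val + (Y \ J').val)))) := by
    simp [hw, Function.comp_def, ← Multiset.coe_add]
  have wrow : ((w.map fun p => p.1 : List (Fin 3)) : Multiset (Fin 3)) =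
      Multiset.replicate (W \ J).card 2 + (Multiset.replicate (A \ I).card 1 + (Multiset.replicate I.card 2 +
        (Multiset.replicate I'.card 0 + (Multiset.replicate (B \ I').card 0 + Multiset.replicate (Y \ J').card 1)))) := by
    simp [hw, Function.comp_def, ← Multiset.coe_add, List.map_const', ← Multiset.coe_replicate]
  have spts : s.map Prod.snd = J.val + J'.val := by simp [hs]
  have srow : s.map Prod.fst = Multiset.replicate J.card 1 + Multiset.replicate J'.card 1 := by
    simp [hs, Multiset.map_const']
  have tot : s.map Prod.snd + ((w.map fun p => p.2.2 : List ℂ) : Multiset ℂ) = (A ∪ B ∪ (W ∪ Y)).val := by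
    rw [wpts, spts, vZ, ← vI, ← vJ, ← vI', ← vJ']; abel
  have hnd : (w.map fun p => p.2.2).Nodup := by
    rw [← Multiset.coe_nodup]
    have := (A ∪ B ∪ (W ∪ Y)).nodup
    rw [← tot] at this
    exact (Multiset.nodup_add.1 this).2.1
  have key := lamMono_mul_mem s (vev_mem_lamSpan.{u} (c := c) w hnd)
  rw [tot] at key
  refine Submodule.smul_mem _ _ ?_
  convert key using 2
  rw [srow, wrow]
  have hAB := H.cardAB
  have hWY := H.cardWY
  have c1 := Finset.card_sdiff_add_card_eq_card hI
  have c2 := Finset.card_sdiff_add_card_eq_card hJ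
  have c3 := Finset.card_sdiff_add_card_eq_card hI'
  have c4 := Finset.card_sdiff_add_card_eq_card hJ'
  refine Multiset.ext.2 fun i => ?_
  have : i = 0 ∨ i = 1 ∨ i = 2 := by revert i; decide
  rcases this with rfl | rfl | rfl <;> simp [Multiset.count_replicate] <;> omega

theorem sc_mem_lamSpan {A B W Y : Finset ℂ} (hc : c ≠ 0) (H : General c A B W Y) :
    (fun X : BModel.{u} c => X.M.sc A B W Y) ∈
      lamSpan c (Multiset.replicate A.card 0 + Multiset.replicate (A.card + W.card) 1 + Multiset.replicate W.card 2)
        (A ∪ B ∪ (W ∪ Y)).val := by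
  have e : (fun X : BModel.{u} c => X.M.sc A B W Y) =
      ∑ I ∈ A.powerset, ∑ J ∈ W.powersetCard I.card, ∑ I' ∈ B.powerset, ∑ J' ∈ Y.powersetCard I'.card,
      ((-1 : ℂ) ^ (W.card * (W.card - 1) / 2) *
        (pp (g c) J I * pp (f c) I (A \ I) * pp (g c) (W \ J) J * pp (h c) I I) *
        (pp (g c) J' I' * pp (f c) I' (B \ I') * pp (g c) (Y \ J') J' * pp (h c) I' I')) •
      (fun X : BModel.{u} c => (∏ l ∈ J, X.M.lam 1 l) * (∏ l ∈ J', X.M.lam 1 l) *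
        X.M.tr.b13 I (X.M.tr.b12 (A \ I) (X.M.tr.b23 (W \ J) X.M.tr.vac))
          (X.M.b13 I' (X.M.b12 (B \ I') (X.M.b23 (Y \ J') X.M.vac)))) := by
    funext X
    simp only [Finset.sum_apply, Pi.smul_apply, smul_eq_mul]
    rw [Model.sc, Model.bet, LinearMap.sum_apply, Finset.mul_sum]
    refine Finset.sum_congr rfl fun I _ => ?_
    rw [LinearMap.sum_apply, Finset.mul_sum]
    refine Finset.sum_congr rfl fun J _ => ?_
    rw [Model.bet, map_sum, Finset.mul_sum]
    refine Finset.sum_congr rfl fun I' _ => ?_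
    rw [map_sum, Finset.mul_sum]
    refine Finset.sum_congr rfl fun J' _ => ?_
    rw [map_smul, LinearMap.smul_apply, smul_eq_mul, smul_eq_mul]
    change _ = _ * ((∏ l ∈ J, X.M.tr.lam 1 l) * _ * _)
    ring
  rw [e]
  refine Submodule.sum_mem _ fun I hI => Submodule.sum_mem _ fun J hJ => Submodule.sum_mem _ fun I' hI' =>
    Submodule.sum_mem _ fun J' hJ' => Submodule.smul_mem _ _ ?_
  rw [Finset.mem_powerset] at hI hI'
  rw [Finset.mem_powersetCard] at hJ hJ'
  exact bethe_term_mem_lamSpan hc H hI hJ.1 hJ.2 hI' hJ'.1 hJ'.2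

end extraction

/-! ### The sum formula for generic Bethe vectors -/

theorem sum_powerset_union {M : Type*} [AddCommMonoid M] {S T : Finset ℂ} (hd : Disjoint S T) (G : Finset ℂ → M) :
    ∑ P ∈ (S ∪ T).powerset, G P = ∑ R ∈ S.powerset, ∑ I ∈ T.powerset, G (R ∪ I) := by
  rw [← Finset.sum_product']
  refine Finset.sum_bij' (fun P _ => (P ∩ S, P ∩ T)) (fun p _ => p.1 ∪ p.2) ?_ ?_ ?_ ?_ ?_
  · intro P _; simp
  · rintro ⟨R, I⟩ h
    simp only [Finset.mem_product, Finset.mem_powerset] at h ⊢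
    exact Finset.union_subset_union h.1 h.2
  · intro P hP
    rw [← Finset.inter_union_distrib_left, Finset.inter_eq_left.2 (Finset.mem_powerset.1 hP)]
  · rintro ⟨R, I⟩ h
    simp only [Finset.mem_product, Finset.mem_powerset] at h
    have h1 : I ∩ S = ∅ := Finset.disjoint_iff_inter_eq_empty.1 (hd.symm.mono_left h.2)
    have h2 : R ∩ T = ∅ := Finset.disjoint_iff_inter_eq_empty.1 (hd.mono_left h.1)
    simp only [Finset.union_inter_distrib_right, h1, h2, Finset.inter_eq_left.2 h.1, Finset.inter_eq_left.2 h.2,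
      Finset.union_empty, Finset.empty_union]
  · intro P hP
    rw [← Finset.inter_union_distrib_left, Finset.inter_eq_left.2 (Finset.mem_powerset.1 hP)]

theorem sum_powersetCard_eq_ite {M : Type*} [AddCommMonoid M] (S : Finset ℂ) (n : ℕ) (G : Finset ℂ → M) :
    ∑ R ∈ S.powersetCard n, G R = ∑ R ∈ S.powerset, if R.card = n then G R else 0 := by
  rw [Finset.powersetCard_eq_filter, Finset.sum_filter]

theorem cl_lab_zero {S R I Q : Finset ℂ} (hR : R ⊆ S) (hI : Disjoint S I) : cl (lab (R ∪ I) Q) 0 S = R := by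
  ext z; rw [mem_cl_lab_zero, Finset.mem_union]
  have := @hR z; have := fun h : z ∈ S => Finset.disjoint_left.1 hI h; tauto

theorem cl_lab_two {S P J K : Finset ℂ} (hJ : J ⊆ S) (hK : Disjoint S K) (hP : Disjoint S P) :
    cl (lab P (J ∪ K)) 2 S = J := by
  ext z; rw [mem_cl_lab_two, Finset.mem_union]
  have := @hJ z; have := fun h : z ∈ S => Finset.disjoint_left.1 hK h; have := fun h : z ∈ S => Finset.disjoint_left.1 hP h; tauto

theorem cl_lab_one_of_disjoint_right {S R I Q : Finset ℂ} (hI : Disjoint S I) (hQ : Disjoint S Q) :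
    cl (lab (R ∪ I) Q) 1 S = S \ R := by
  ext z; rw [mem_cl_lab_one, Finset.mem_union, Finset.mem_sdiff]
  have := fun h : z ∈ S => Finset.disjoint_left.1 hI h; have := fun h : z ∈ S => Finset.disjoint_left.1 hQ h; tauto

theorem cl_lab_one_of_disjoint_left {S P J K : Finset ℂ} (hK : Disjoint S K) (hP : Disjoint S P) :
    cl (lab P (J ∪ K)) 1 S = S \ J := by
  ext z; rw [mem_cl_lab_one, Finset.mem_union, Finset.mem_sdiff]
  have := fun h : z ∈ S => Finset.disjoint_left.1 hK h; have := fun h : z ∈ S => Finset.disjoint_left.1 hP h; tauto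

section
variable {c : ℂ} {V : Type u} [AddCommGroup V] [Module ℂ V]

/-- The sum formula for the scalar product of generic Bethe vectors. -/
theorem sc_eq_sumFormula (M : Model c V) (hc : c ≠ 0) {A B W Y : Finset ℂ} (H : General c A B W Y)
    (hlam : ∀ z ∈ A ∪ B ∪ (W ∪ Y), M.lam 1 z ≠ 0) :
    M.sc A B W Y = (∏ z ∈ A ∪ B ∪ (W ∪ Y), M.lam 1 z) * sumFormula c M.r₁ M.r₃ A B W Y := by
  have hex : ∀ P Q, ∃ X : BModel.{u} c, Indicates X.M (lab P Q) (A ∪ B ∪ (W ∪ Y)) ∧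
      (((∃ z ∈ W ∪ Y, lab P Q z = 0) ∨ ∃ z ∈ A ∪ B, lab P Q z = 2) → X.M.sc A B W Y = 0) ∧
      ((∀ z ∈ W ∪ Y, lab P Q z ≠ 0) → (∀ z ∈ A ∪ B, lab P Q z ≠ 2) → (cl (lab P Q) 0 A).card = (cl (lab P Q) 1 B).card →
        (cl (lab P Q) 1 W).card = (cl (lab P Q) 2 Y).card → X.M.sc A B W Y =
      (pp (f c) (cl (lab P Q) 1 A) (cl (lab P Q) 0 A) * pp (f c) (cl (lab P Q) 1 B) (cl (lab P Q) 0 B) *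
        pp (f c) (cl (lab P Q) 1 W) (cl (lab P Q) 1 A) * pp (f c) (cl (lab P Q) 1 Y) (cl (lab P Q) 1 B) *
        pp (g c) (cl (lab P Q) 2 W) (cl (lab P Q) 1 W) * pp (g c) (cl (lab P Q) 2 Y) (cl (lab P Q) 1 Y)) *
      zf c (cl (lab P Q) 0 A) (cl (lab P Q) 1 B) (cl (lab P Q) 1 W) (cl (lab P Q) 2 Y) *
        zf c (cl (lab P Q) 0 B) (cl (lab P Q) 1 A) (cl (lab P Q) 1 Y) (cl (lab P Q) 2 W)) := by
    intro P Q
    obtain ⟨X, p, hX⟩ := exists_indicator_model.{u} hc H.gen (lab P Q)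
    -- The test model is the square of an indicator model, which has the same eigenvalues at the
    -- points considered and in which the scalar product factorizes.
    exact ⟨⟨_, tensorModel X.M p X.M⟩, Indicates.tensor p hX, sc_tensor_eq_zero p hc H hX, sc_tensor_eq p hc H hX⟩
  choose N hN hz hv using hex
  -- The test models live in the universe of V, so the universal expansion may be evaluated both on
  -- them and on the given model.
  have key := eq_sum_of_mem_lamSpan (sc_mem_lamSpan.{u} hc H) N hN ⟨V, M⟩
  simp only [Multiset.count_add, Multiset.count_replicate] at key
  simp only [if_true, show ¬ ((1 : Fin 3) = 0) by decide, show ¬ ((2 : Fin 3) = 0) by decide,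
    show ¬ ((1 : Fin 3) = 2) by decide, show ¬ ((0 : Fin 3) = 2) by decide, if_false, add_zero, zero_add] at key
  have hdis : Disjoint (A ∪ B) (W ∪ Y) := by
    simp only [Finset.disjoint_union_left, Finset.disjoint_union_right]
    exact ⟨⟨H.AW, H.BW⟩, H.AY, H.BY⟩
  have hPz : ∀ P Q, P ⊆ A ∪ B ∪ (W ∪ Y) → ¬ P ⊆ A ∪ B → (N P Q).M.sc A B W Y = 0 := by
    intro P Q hP hn
    obtain ⟨z, hzP, hzn⟩ := Finset.not_subset.1 hn
    exact hz P Q (Or.inl ⟨z, (Finset.mem_union.1 (hP hzP)).resolve_left hzn, by rw [lab, if_pos hzP]⟩)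
  have hQz : ∀ P Q, Disjoint P Q → Q ⊆ A ∪ B ∪ (W ∪ Y) → ¬ Q ⊆ W ∪ Y → (N P Q).M.sc A B W Y = 0 := by
    intro P Q hd hQ hn
    obtain ⟨z, hzQ, hzn⟩ := Finset.not_subset.1 hn
    exact hz P Q (Or.inr ⟨z, (Finset.mem_union.1 (hQ hzQ)).resolve_right hzn, by
      rw [lab, if_neg (fun h => Finset.disjoint_left.1 hd h hzQ), if_pos hzQ]⟩)
  rw [key, ← Finset.sum_subset (Finset.powerset_mono.2 (Finset.subset_union_left (s₁ := A ∪ B) (s₂ := W ∪ Y))), sumFormula]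
  swap
  · intro P hP hn
    rw [Finset.mem_powerset] at hP hn
    refine Finset.sum_eq_zero fun Q _ => ?_
    rw [hPz P Q hP hn]; simp
  have e1 : ∀ P ∈ (A ∪ B).powerset, ∀ G : Finset ℂ → ℂ, (∀ Q ⊆ A ∪ B ∪ (W ∪ Y), ¬ Q ⊆ W ∪ Y → G Q = 0) →
      ∑ Q ∈ (A ∪ B ∪ (W ∪ Y)).powerset, G Q = ∑ J ∈ W.powerset, ∑ K ∈ Y.powerset, G (J ∪ K) := by
    intro P _ G hG
    rw [← sum_powerset_union H.WY, Finset.sum_subset (Finset.powerset_mono.2 (Finset.subset_union_right (s₁ := A ∪ B) (s₂ := W ∪ Y)))]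
    intro Q hQ hn
    exact hG Q (Finset.mem_powerset.1 hQ) fun h => hn (Finset.mem_powerset.2 h)
  rw [Finset.sum_congr rfl fun P hP => e1 P hP _ fun Q hQ hn => by
    split_ifs with h
    · rw [hQz P Q h.1 hQ hn, zero_mul]
    · rfl]
  -- The set with label 0 is R ∪ I with R in A and I in B; the set with label 2 is J ∪ K with J in W
  -- and K in Y. The index counts become |R| = |B \ I| and |K| = |W \ J|.
  rw [sum_powerset_union H.AB, Finset.sum_comm, Finset.mul_sum]
  refine Finset.sum_congr rfl fun I hI => ?_
  rw [Finset.sum_comm, Finset.mul_sum]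
  refine Finset.sum_congr rfl fun J hJ => ?_
  rw [sum_powersetCard_eq_ite, Finset.mul_sum]
  refine Finset.sum_congr rfl fun R hR => ?_
  rw [sum_powersetCard_eq_ite]
  rw [Finset.mem_powerset] at hI hJ hR
  have cB := Finset.card_sdiff_add_card_eq_card hI
  have cW := Finset.card_sdiff_add_card_eq_card hJ
  have dRI : Disjoint R I := H.AB.mono hR hI
  have cAB := H.cardAB
  have cWY := H.cardWY
  have cRI := Finset.card_union_of_disjoint dRI
  have hRI : R ∪ I ⊆ A ∪ B := Finset.union_subset_union hR hI
  by_cases hRc : R.card = (B \ I).card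
  swap
  · rw [if_neg hRc, mul_zero]
    refine Finset.sum_eq_zero fun K _ => if_neg fun h => hRc ?_
    omega
  rw [if_pos hRc, Finset.mul_sum]
  refine Finset.sum_congr rfl fun K hK => ?_
  rw [Finset.mem_powerset] at hK
  have dJK : Disjoint J K := H.WY.mono hJ hK
  have cJK := Finset.card_union_of_disjoint dJK
  have hJK : J ∪ K ⊆ W ∪ Y := Finset.union_subset_union hJ hK
  by_cases hKc : K.card = (W \ J).card
  swap
  · rw [if_neg hKc, mul_zero]
    refine if_neg fun h => hKc ?_
    omega
  have dPQ : Disjoint (R ∪ I) (J ∪ K) := hdis.mono hRI hJK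
  rw [if_pos hKc, if_pos ⟨dPQ, by omega, by omega⟩]
  have dA : Disjoint A (J ∪ K) := hdis.mono Finset.subset_union_left hJK
  have dB : Disjoint B (J ∪ K) := hdis.mono Finset.subset_union_right hJK
  have dW : Disjoint W (R ∪ I) := hdis.symm.mono Finset.subset_union_left hRI
  have dY : Disjoint Y (R ∪ I) := hdis.symm.mono Finset.subset_union_right hRI
  have E1 : cl (lab (R ∪ I) (J ∪ K)) 0 A = R := cl_lab_zero hR (H.AB.mono_right hI)
  have E2 : cl (lab (R ∪ I) (J ∪ K)) 0 B = I := by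
    rw [Finset.union_comm R]; exact cl_lab_zero hI (H.AB.symm.mono_right hR)
  have E3 : cl (lab (R ∪ I) (J ∪ K)) 1 A = A \ R := cl_lab_one_of_disjoint_right (H.AB.mono_right hI) dA
  have E4 : cl (lab (R ∪ I) (J ∪ K)) 1 B = B \ I := by
    rw [Finset.union_comm R]; exact cl_lab_one_of_disjoint_right (H.AB.symm.mono_right hR) dB
  have E5 : cl (lab (R ∪ I) (J ∪ K)) 2 W = J := cl_lab_two hJ (H.WY.mono_right hK) dW
  have E6 : cl (lab (R ∪ I) (J ∪ K)) 2 Y = K := by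
    rw [Finset.union_comm J]; exact cl_lab_two hK (H.WY.symm.mono_right hJ) dY
  have E7 : cl (lab (R ∪ I) (J ∪ K)) 1 W = W \ J := cl_lab_one_of_disjoint_left (H.WY.mono_right hK) dW
  have E8 : cl (lab (R ∪ I) (J ∪ K)) 1 Y = Y \ K := by
    rw [Finset.union_comm J]; exact cl_lab_one_of_disjoint_left (H.WY.symm.mono_right hJ) dY
  have hval := hv (R ∪ I) (J ∪ K)
  rw [E1, E2, E3, E4, E5, E6, E7, E8] at hval
  rw [hval ?_ ?_ hRc hKc.symm]
  · have hsub : J ∪ K ⊆ (A ∪ B ∪ (W ∪ Y)) \ (R ∪ I) :=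
      Finset.subset_sdiff.2 ⟨hJK.trans Finset.subset_union_right, dPQ.symm⟩
    rw [← Finset.prod_sdiff (hRI.trans (Finset.subset_union_left (s₂ := W ∪ Y))), ← Finset.prod_sdiff hsub]
    have er1 : ∏ z ∈ R ∪ I, M.lam 0 z = (∏ z ∈ R ∪ I, M.lam 1 z) * ((∏ z ∈ R, M.r₁ z) * ∏ z ∈ I, M.r₁ z) := by
      rw [← Finset.prod_union dRI, ← Finset.prod_mul_distrib]
      refine Finset.prod_congr rfl fun z hz => ?_
      rw [Model.r₁, mul_div_cancel₀ _ (hlam z (Finset.mem_union_left _ (hRI hz)))]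
    have er3 : ∏ z ∈ J ∪ K, M.lam 2 z = (∏ z ∈ J ∪ K, M.lam 1 z) * ((∏ z ∈ J, M.r₃ z) * ∏ z ∈ K, M.r₃ z) := by
      rw [← Finset.prod_union dJK, ← Finset.prod_mul_distrib]
      refine Finset.prod_congr rfl fun z hz => ?_
      rw [Model.r₃, mul_div_cancel₀ _ (hlam z (Finset.mem_union_right _ (hJK hz)))]
    rw [er1, er3]
    ring
  · intro z hzm h
    have : z ∈ cl (lab (R ∪ I) (J ∪ K)) 0 (W ∪ Y) := mem_cl.2 ⟨hzm, h⟩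
    rw [mem_cl_lab_zero] at this
    exact Finset.disjoint_left.1 hdis (hRI this.2) hzm
  · intro z hzm h
    have : z ∈ cl (lab (R ∪ I) (J ∪ K)) 2 (A ∪ B) := mem_cl.2 ⟨hzm, h⟩
    rw [mem_cl_lab_two] at this
    exact Finset.disjoint_left.1 hdis hzm (hJK this.2.2)

end

/-! ### From finite sets to the indexed definitions -/

section transfer
variable {c : ℂ} {V : Type*} [AddCommGroup V] [Module ℂ V]

theorem pp_image (k : ℂ → ℂ → ℂ) {m n : ℕ} {x : Fin m → ℂ} {y : Fin n → ℂ} (hx : Function.Injective x)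
    (hy : Function.Injective y) (I : Finset (Fin m)) (J : Finset (Fin n)) :
    pp k (I.image x) (J.image y) = ∏ i ∈ I, ∏ j ∈ J, k (x i) (y j) := by
  rw [pp, Finset.prod_image hx.injOn]
  exact Finset.prod_congr rfl fun i _ => Finset.prod_image hy.injOn

theorem sum_powerset_image {M : Type*} [AddCommMonoid M] {n : ℕ} {x : Fin n → ℂ} (hx : Function.Injective x)
    (G : Finset ℂ → M) : ∑ S ∈ (Finset.univ.image x).powerset, G S = ∑ I : Finset (Fin n), G (I.image x) := by
  rw [Finset.powerset_image, Finset.sum_image (Finset.image_injective hx).injOn, Finset.powerset_univ]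

theorem image_sdiff_image {n : ℕ} {x : Fin n → ℂ} (hx : Function.Injective x) (I : Finset (Fin n)) :
    Finset.univ.image x \ I.image x = Iᶜ.image x := by
  rw [← Finset.image_sdiff _ _ hx, Finset.compl_eq_univ_sdiff]

theorem spL_map_of_pairwise {R : Type*} [Ring R] [Algebra ℂ R] (w : ℂ → ℂ → ℂ) (T : ℂ → R) {n : ℕ} (x : Fin n → ℂ)
    {l : List (Fin n)} (hl : l.Pairwise (· < ·)) :
    spL w T (l.map x) = (∏ j ∈ l.toFinset, ∏ k ∈ l.toFinset with j < k, w (x j) (x k))⁻¹ •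
      (l.map fun k => T (x k)).prod := by
  induction l with
  | nil => simp [spL]
  | cons a l ih =>
    rw [List.pairwise_cons] at hl
    have ha : a ∉ l.toFinset := fun h => lt_irrefl _ (hl.1 a (by simpa using h))
    have hnd : l.Nodup := hl.2.imp fun h => h.ne
    have e1 : (insert a l.toFinset).filter (fun k => a < k) = l.toFinset := by
      ext k
      simp only [Finset.mem_filter, Finset.mem_insert, List.mem_toFinset]
      constructor
      · rintro ⟨rfl | h, h'⟩
        · exact absurd h' (lt_irrefl _)
        · exact h
      · exact fun h => ⟨Or.inr h, hl.1 k h⟩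
    have e2 : ∀ j ∈ l.toFinset, (insert a l.toFinset).filter (fun k => j < k) = l.toFinset.filter (fun k => j < k) := by
      intro j hj
      rw [Finset.filter_insert, if_neg (hl.1 j (by simpa using hj)).not_gt]
    have e3 : ∏ j ∈ l.toFinset, ∏ k ∈ insert a l.toFinset with j < k, w (x j) (x k) =
        ∏ j ∈ l.toFinset, ∏ k ∈ l.toFinset with j < k, w (x j) (x k) :=
      Finset.prod_congr rfl fun j hj => by rw [e2 j hj]
    rw [List.map_cons, spL, ih hl.2, List.toFinset_cons, Finset.prod_insert ha, e1,
      e3, List.map_cons, List.prod_cons, mul_inv, mul_smul_comm, smul_smul,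
      List.map_map]
    congr 3
    rw [List.prod_toFinset _ hnd]; rfl

theorem sp_image {R : Type*} [Ring R] [Algebra ℂ R] {w : ℂ → ℂ → ℂ} {T : ℂ → R} {n : ℕ} {x : Fin n → ℂ}
    (hx : Function.Injective x) {I : Finset (Fin n)} (h : SymmOn w T (I.image x)) :
    sp w T (I.image x) = (∏ j ∈ I, ∏ k ∈ I with j < k, w (x j) (x k))⁻¹ •
      (((List.finRange n).filter (fun k => k ∈ I)).map (fun k => T (x k))).prod := by
  have e : ((List.finRange n).filter (fun k => k ∈ I)).toFinset = I := by ext; simp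
  have hp : ((List.finRange n).filter (fun k => k ∈ I)).Pairwise (· < ·) :=
    (List.pairwise_lt_finRange n).filter _
  rw [sp_eq_spL (l := ((List.finRange n).filter (fun k => k ∈ I)).map x) h
    ((List.nodup_map_iff hx).2 (hp.imp fun h => h.ne)) (by ext y; simp), spL_map_of_pairwise w T x hp, e]

variable (M : Model c V)

theorem Model.opProd_eq {n : ℕ} {x : Fin n → ℂ} (hx : Function.Injective x) (I : Finset (Fin n)) {i j : Fin 3}
    (h : SymmOn (fun _ _ => 1) (M.T i j) (I.image x)) : M.opProd i j x I = evenP (M.T i j) (I.image x) := by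
  rw [evenP, sp_image hx h]; simp [Model.opProd]

theorem Model.oddUp_eq {n : ℕ} {x : Fin n → ℂ} (hx : Function.Injective x) (I : Finset (Fin n)) {i : Fin 3}
    (hs : SymmOn (fun x y => h c y x) (M.T i 2) (I.image x)) : M.oddUp i x I = oddU c (M.T i 2) (I.image x) := by
  rw [oddU, sp_image hx hs]; rfl

theorem Model.oddDown_eq {n : ℕ} {x : Fin n → ℂ} (hx : Function.Injective x) (I : Finset (Fin n)) {i : Fin 3}
    (hs : SymmOn (h c) (M.T 2 i) (I.image x)) : M.oddDown i x I = oddD c (M.T 2 i) (I.image x) := by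
  rw [oddD, sp_image hx hs]; rfl

/-- The normalization factor of a Bethe vector. -/
def Model.norm {a b : ℕ} (u : Fin a → ℂ) (v : Fin b → ℂ) : ℂ :=
  (∏ i, M.lam 1 (u i)) * (∏ j, M.lam 1 (v j)) * ∏ j, ∏ i, f c (v j) (u i)

/-- The denominator λ_2(v_II) becomes λ_2(v) with a compensating λ_2(v_I) in the numerator, so the
normalization no longer depends on the partition. -/
theorem Model.sum_coeff_smul {U : Type*} [AddCommGroup U] [Module ℂ U] {a b : ℕ} {u : Fin a → ℂ} {v : Fin b → ℂ}
    (hu : Function.Injective u) (hv : Function.Injective v) (hlam : ∀ j, M.lam 1 (v j) ≠ 0) (G : Finset ℂ → Finset ℂ → U) :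
    ∑ I : Finset (Fin a), ∑ J : Finset (Fin b) with J.card = I.card, M.coeff u v I J • G (I.image u) (J.image v) =
      (M.norm u v)⁻¹ • ∑ I ∈ (Finset.univ.image u).powerset, ∑ J ∈ (Finset.univ.image v).powersetCard I.card,
        (pp (g c) J I * pp (f c) I (Finset.univ.image u \ I) * pp (g c) (Finset.univ.image v \ J) J * pp (h c) I I *
          ∏ l ∈ J, M.lam 1 l) • G I J := by
  rw [sum_powerset_image hu, Finset.smul_sum]
  refine Finset.sum_congr rfl fun I _ => ?_
  rw [sum_powersetCard_eq_ite, sum_powerset_image hv, Finset.sum_filter, Finset.smul_sum]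
  refine Finset.sum_congr rfl fun J _ => ?_
  rw [Finset.card_image_of_injective _ hu, Finset.card_image_of_injective _ hv]
  split_ifs
  · rw [image_sdiff_image hu, image_sdiff_image hv, pp_image _ hv hu, pp_image _ hu hu, pp_image _ hv hv, pp_image _ hu hu,
      Finset.prod_image hv.injOn, smul_smul]
    congr 1
    have hJ : ∏ j ∈ J, M.lam 1 (v j) ≠ 0 := Finset.prod_ne_zero_iff.2 fun j _ => hlam j
    rw [Model.coeff, Model.norm, ← Finset.prod_compl_mul_prod J (fun j => M.lam 1 (v j)), ← mul_div_mul_right _ _ hJ,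
      div_eq_inv_mul]
    congr 2; ring
  · rw [smul_zero]

theorem Model.betheVector_eq (hc : c ≠ 0) {a b : ℕ} {u : Fin a → ℂ} {v : Fin b → ℂ} (hu : Function.Injective u)
    (hv : Function.Injective v) (hlam : ∀ j, M.lam 1 (v j) ≠ 0) (gu : Gen c (Finset.univ.image u))
    (gv : Gen c (Finset.univ.image v)) :
    M.betheVector u v = (M.norm u v)⁻¹ • M.bet (Finset.univ.image u) (Finset.univ.image v) := by
  rw [Model.bet, ← M.sum_coeff_smul hu hv hlam fun I J => M.b13 I (M.b12 (Finset.univ.image u \ I)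
    (M.b23 (Finset.univ.image v \ J) M.vac)), Model.betheVector]
  refine Finset.sum_congr rfl fun I _ => Finset.sum_congr rfl fun J _ => ?_
  have su : ∀ S : Finset (Fin a), S.image u ⊆ Finset.univ.image u := fun S => Finset.image_subset_image (Finset.subset_univ S)
  have sv : ∀ S : Finset (Fin b), S.image v ⊆ Finset.univ.image v := fun S => Finset.image_subset_image (Finset.subset_univ S)
  rw [image_sdiff_image hu, image_sdiff_image hv, M.oddUp_eq hu I ((M.oddUp₁₃ hc).symmOn hc (gu.mono (su I))),
    M.opProd_eq hu _ ((M.comm₁₂ hc).symmOn _), M.oddUp_eq hv _ ((M.oddUp₂₃ hc).symmOn hc (gv.mono (sv _)))]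
  rfl

theorem Model.dualBetheVector_eq (hc : c ≠ 0) {a b : ℕ} {u : Fin a → ℂ} {v : Fin b → ℂ} (hu : Function.Injective u)
    (hv : Function.Injective v) (hlam : ∀ j, M.lam 1 (v j) ≠ 0) (gu : Gen c (Finset.univ.image u))
    (gv : Gen c (Finset.univ.image v)) :
    M.dualBetheVector u v =
      ((-1) ^ (b * (b - 1) / 2) * (M.norm u v)⁻¹) • M.tr.bet (Finset.univ.image u) (Finset.univ.image v) := by
  rw [Model.bet]
  change _ = _ • ∑ I ∈ (Finset.univ.image u).powerset, ∑ J ∈ (Finset.univ.image v).powersetCard I.card,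
    (pp (g c) J I * pp (f c) I (Finset.univ.image u \ I) * pp (g c) (Finset.univ.image v \ J) J * pp (h c) I I *
      ∏ l ∈ J, M.lam 1 l) • M.tr.b13 I (M.tr.b12 (Finset.univ.image u \ I) (M.tr.b23 (Finset.univ.image v \ J) M.tr.vac))
  rw [← smul_smul, ← M.sum_coeff_smul hu hv hlam fun I J => M.tr.b13 I (M.tr.b12 (Finset.univ.image u \ I)
    (M.tr.b23 (Finset.univ.image v \ J) M.tr.vac)), Model.dualBetheVector]
  congr 1
  refine Finset.sum_congr rfl fun I _ => Finset.sum_congr rfl fun J _ => ?_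
  have su : ∀ S : Finset (Fin a), S.image u ⊆ Finset.univ.image u := fun S => Finset.image_subset_image (Finset.subset_univ S)
  have sv : ∀ S : Finset (Fin b), S.image v ⊆ Finset.univ.image v := fun S => Finset.image_subset_image (Finset.subset_univ S)
  rw [image_sdiff_image hu, image_sdiff_image hv, M.oddDown_eq hu I ((M.oddDown₃₁ hc).symmOn hc (gu.mono (su I))),
    M.opProd_eq hu _ ((M.comm₂₁ hc).symmOn _), M.oddDown_eq hv _ ((M.oddDown₃₂ hc).symmOn hc (gv.mono (sv _))),
    M.tr_b23 hc (gv.mono (sv _)), M.tr_b12 hc, M.tr_b13 hc (gu.mono (su I))]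
  rfl

theorem image_append {m n : ℕ} (x : Fin m → ℂ) (y : Fin n → ℂ) :
    Finset.univ.image (Fin.append x y) = Finset.univ.image x ∪ Finset.univ.image y := by
  ext z
  simp only [Finset.mem_image, Finset.mem_univ, true_and, Finset.mem_union]
  constructor
  · rintro ⟨i, rfl⟩
    refine Fin.addCases (fun i => ?_) (fun i => ?_) i
    · exact Or.inl ⟨i, by simp⟩
    · exact Or.inr ⟨i, by simp⟩
  · rintro (⟨i, rfl⟩ | ⟨i, rfl⟩)
    · exact ⟨Fin.castAdd n i, by simp⟩
    · exact ⟨Fin.natAdd m i, by simp⟩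

theorem pp_image_singleton (k : ℂ → ℂ → ℂ) {m : ℕ} {x : Fin m → ℂ} (hx : Function.Injective x) (z : ℂ) :
    pp k (Finset.univ.image x) {z} = ∏ i, k (x i) z := by
  rw [pp_singleton_right, Finset.prod_image hx.injOn]

theorem pp_singleton_image (k : ℂ → ℂ → ℂ) {m : ℕ} {x : Fin m → ℂ} (hx : Function.Injective x) (z : ℂ) :
    pp k {z} (Finset.univ.image x) = ∏ i, k z (x i) := by
  rw [pp_singleton_left, Finset.prod_image hx.injOn]

theorem Model.matrixN_eq (ϰ : ℂ) {a b : ℕ} {uC : Fin a → ℂ} {vC : Fin b → ℂ} {uB : Fin a → ℂ} {vB : Fin b → ℂ}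
    (huC : Function.Injective uC) (hvC : Function.Injective vC) (huB : Function.Injective uB) (hvB : Function.Injective vB)
    (hd : Disjoint (Finset.univ.image uC) (Finset.univ.image vC)) :
    M.matrixN ϰ uC vC uB vB = Matrix.of fun i k => entry c ϰ M.r₁ M.r₃ (Finset.univ.image uC) (Finset.univ.image uB)
      (Finset.univ.image vC) (Finset.univ.image vB) (Fin.append uC vC i) (Fin.append uB vC k) := by
  have hcard : (Finset.univ.image uC).card = a := by rw [Finset.card_image_of_injective _ huC]; simp
  rw [Model.matrixN]
  congr 1
  funext i k
  generalize Fin.append uB vC k = x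
  refine Fin.addCases (fun j => ?_) (fun j => ?_) i
  · rw [Fin.append_left, Fin.append_left, entry, if_pos (Finset.mem_image_of_mem _ (Finset.mem_univ _)), Model.upperEntry, hcard,
      Finset.prod_image hvC.injOn, pp_image_singleton _ huC, pp_singleton_image _ huC]
  · rw [Fin.append_right, Fin.append_right, entry,
      if_neg (Finset.disjoint_right.1 hd (Finset.mem_image_of_mem _ (Finset.mem_univ _))), Model.lowerEntry, hcard,
      Finset.prod_image hvC.injOn, Finset.prod_image huB.injOn, ← Finset.image_erase hvC, Finset.prod_image hvC.injOn,
      pp_image_singleton _ huB, pp_image_singleton _ hvB, pp_singleton_image _ huC, pp_singleton_image _ huB,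
      pp_singleton_image _ hvB]

/-- The determinant representation of the scalar product of a twisted on-shell dual Bethe vector and a partially
on-shell Bethe vector. -/
theorem Model.scalarProduct_eq_det (hc : c ≠ 0) {a b : ℕ}
    (uC : Fin a → ℂ) (vC : Fin b → ℂ) (uB : Fin a → ℂ) (vB : Fin b → ℂ)
    (hgen : Generic c (Sum.elim (Fin.append uC vC) (Fin.append uB vB)))
    (hlam : ∀ i, M.lam 1 (Sum.elim (Fin.append uC vC) (Fin.append uB vB) i) ≠ 0)
    (ϰ : ℂ) (hϰ : ϰ ≠ 0)
    (hC : ∀ j : Fin a, M.r₁ (uC j) =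
      ϰ * (∏ k ∈ Finset.univ.erase j, f c (uC j) (uC k) / f c (uC k) (uC j)) *
        ∏ l, f c (vC l) (uC j))
    (hB : ∀ k : Fin b, M.r₃ (vB k) = ∏ l, f c (vB k) (uB l)) :
    M.scalarProduct uC vC uB vB =
      Delta c (Fin.append uB vC) * DeltaPrime c uC * DeltaPrime c vC *
        (M.matrixN ϰ uC vC uB vB).det := by
  set z := Sum.elim (Fin.append uC vC) (Fin.append uB vB) with hz
  have zinj : Function.Injective z := fun i j e => by
    by_contra hne; exact (hgen i j hne).1 e
  have zuC : ∀ i, uC i = z (Sum.inl (Fin.castAdd b i)) := fun i => by simp [hz]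
  have zvC : ∀ i, vC i = z (Sum.inl (Fin.natAdd a i)) := fun i => by simp [hz]
  have zuB : ∀ i, uB i = z (Sum.inr (Fin.castAdd b i)) := fun i => by simp [hz]
  have zvB : ∀ i, vB i = z (Sum.inr (Fin.natAdd a i)) := fun i => by simp [hz]
  have huC : Function.Injective uC := fun i j e => by
    rw [zuC, zuC] at e; exact Fin.castAdd_injective _ _ (Sum.inl_injective (zinj e))
  have hvC : Function.Injective vC := fun i j e => by
    rw [zvC, zvC] at e; exact Fin.natAdd_injective _ _ (Sum.inl_injective (zinj e))
  have huB : Function.Injective uB := fun i j e => by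
    rw [zuB, zuB] at e; exact Fin.castAdd_injective _ _ (Sum.inr_injective (zinj e))
  have hvB : Function.Injective vB := fun i j e => by
    rw [zvB, zvB] at e; exact Fin.natAdd_injective _ _ (Sum.inr_injective (zinj e))
  have himg : ∀ x ∈ Finset.univ.image uC ∪ Finset.univ.image uB ∪ (Finset.univ.image vC ∪ Finset.univ.image vB),
      ∃ i, x = z i := by
    intro x hx
    simp only [Finset.mem_union, Finset.mem_image, Finset.mem_univ, true_and] at hx
    rcases hx with (⟨i, rfl⟩ | ⟨i, rfl⟩) | ⟨i, rfl⟩ | ⟨i, rfl⟩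
    exacts [⟨_, zuC i⟩, ⟨_, zuB i⟩, ⟨_, zvC i⟩, ⟨_, zvB i⟩]
  have hdisj : ∀ {m n : ℕ} {x : Fin m → ℂ} {y : Fin n → ℂ}, (∀ i j, x i ≠ y j) →
      Disjoint (Finset.univ.image x) (Finset.univ.image y) := by
    intro m n x y hxy
    rw [Finset.disjoint_left]
    intro w h1 h2
    obtain ⟨i, _, rfl⟩ := Finset.mem_image.1 h1
    obtain ⟨j, _, e⟩ := Finset.mem_image.1 h2
    exact hxy i j e.symm
  have hcd : ∀ i j, Fin.castAdd b (i : Fin a) ≠ Fin.natAdd a (j : Fin b) := fun i j e => by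
    have := congrArg Fin.val e; simp at this; omega
  have H : General c (Finset.univ.image uC) (Finset.univ.image uB) (Finset.univ.image vC) (Finset.univ.image vB) := by
    refine ⟨?_, hdisj fun i j => ?_, hdisj fun i j => ?_, hdisj fun i j => ?_, hdisj fun i j => ?_, hdisj fun i j => ?_,
      hdisj fun i j => ?_, ?_, ?_⟩
    · intro x hx y hy hxy
      obtain ⟨i, rfl⟩ := himg x hx
      obtain ⟨j, rfl⟩ := himg y hy
      exact (hgen i j fun e => hxy (by rw [e])).2
    · rw [zuC, zuB]; exact fun e => nomatch zinj e
    · rw [zuC, zvC]; exact fun e => hcd _ _ (Sum.inl_injective (zinj e))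
    · rw [zuC, zvB]; exact fun e => nomatch zinj e
    · rw [zuB, zvC]; exact fun e => nomatch zinj e
    · rw [zuB, zvB]; exact fun e => hcd _ _ (Sum.inr_injective (zinj e))
    · rw [zvC, zvB]; exact fun e => nomatch zinj e
    · rw [Finset.card_image_of_injective _ huC, Finset.card_image_of_injective _ huB]
    · rw [Finset.card_image_of_injective _ hvC, Finset.card_image_of_injective _ hvB]
  have hlamZ : ∀ x ∈ Finset.univ.image uC ∪ Finset.univ.image uB ∪ (Finset.univ.image vC ∪ Finset.univ.image vB),
      M.lam 1 x ≠ 0 := by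
    intro x hx; obtain ⟨i, rfl⟩ := himg x hx; exact hlam i
  have cardW : (Finset.univ.image vC).card = b := by rw [Finset.card_image_of_injective _ hvC]; simp
  have gA := H.gen.mono (Finset.subset_union_left.trans Finset.subset_union_left)
  have gB := H.gen.mono (Finset.subset_union_right.trans Finset.subset_union_left)
  have gW := H.gen.mono (Finset.subset_union_left.trans Finset.subset_union_right)
  have gY := H.gen.mono (Finset.subset_union_right.trans Finset.subset_union_right)
  have nfWA : pp (f c) (Finset.univ.image vC) (Finset.univ.image uC) ≠ 0 :=
    H.pp_f_ne hc (Finset.subset_union_left.trans Finset.subset_union_right)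
      (Finset.subset_union_left.trans Finset.subset_union_left) H.AW.symm
  have nfYB : pp (f c) (Finset.univ.image vB) (Finset.univ.image uB) ≠ 0 :=
    H.pp_f_ne hc (Finset.subset_union_right.trans Finset.subset_union_right)
      (Finset.subset_union_right.trans Finset.subset_union_left) H.BY.symm
  have hS : M.scalarProduct uC vC uB vB = mixedSum c ϰ M.r₁ M.r₃ (Finset.univ.image uC) (Finset.univ.image uB)
      (Finset.univ.image vC) (Finset.univ.image vB) := by
    have hsc := sc_eq_sumFormula M hc H hlamZ
    -- The prefactors f(W, A) f(Y, B) and the product of all λ_2 are the normalizations of the two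
    -- Bethe vectors, so the scalar product is `mixedSum` without any factor.
    rw [sumFormula_eq_mixedSum hc H (ϰ := ϰ)] at hsc
    · rw [Model.sc, cardW, Finset.prod_union (by
          simp only [Finset.disjoint_union_left, Finset.disjoint_union_right]
          exact ⟨⟨H.AW, H.BW⟩, H.AY, H.BY⟩), Finset.prod_union H.AB, Finset.prod_union H.WY,
        Finset.prod_image huC.injOn, Finset.prod_image huB.injOn, Finset.prod_image hvC.injOn, Finset.prod_image hvB.injOn,
        pp_image _ hvC huC, pp_image _ hvB huB] at hsc
      rw [pp_image _ hvC huC] at nfWA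
      rw [pp_image _ hvB huB] at nfYB
      rw [Model.scalarProduct, M.dualBetheVector_eq hc huC hvC (fun j => zvC j ▸ hlam _) gA gW,
        M.betheVector_eq hc huB hvB (fun j => zvB j ▸ hlam _) gB gY, map_smul, LinearMap.smul_apply, smul_eq_mul, smul_eq_mul,
        mul_assoc, mul_left_comm, mul_comm ((-1 : ℂ) ^ _)]
      have l1 : ∏ i, M.lam 1 (uC i) ≠ 0 := Finset.prod_ne_zero_iff.2 fun i _ => zuC i ▸ hlam _
      have l2 : ∏ i, M.lam 1 (uB i) ≠ 0 := Finset.prod_ne_zero_iff.2 fun i _ => zuB i ▸ hlam _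
      have l3 : ∏ i, M.lam 1 (vC i) ≠ 0 := Finset.prod_ne_zero_iff.2 fun i _ => zvC i ▸ hlam _
      have l4 : ∏ i, M.lam 1 (vB i) ≠ 0 := Finset.prod_ne_zero_iff.2 fun i _ => zvB i ▸ hlam _
      rw [Model.norm, Model.norm]
      field_simp
      linear_combination hsc
    · intro x hx
      obtain ⟨j, _, rfl⟩ := Finset.mem_image.1 hx
      rw [hC, ← Finset.image_erase huC, Finset.prod_image huC.injOn, pp_image_singleton _ hvC]
    · intro y hy
      obtain ⟨k, _, rfl⟩ := Finset.mem_image.1 hy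
      rw [hB, pp_singleton_image _ huB]
  have happC : Function.Injective (Fin.append uC vC) := fun i j e => Sum.inl_injective (zinj (by simpa [hz] using e))
  have happB : Function.Injective (Fin.append uB vC) := by
    rw [Fin.append_injective_iff]
    refine ⟨huB, hvC, fun i j => ?_⟩
    rw [zuB, zvC]; exact fun e => nomatch zinj e
  have hdet := alt_entry hc H hϰ M.r₁ M.r₃
  rw [← image_append, ← image_append, alt_image_image c _ happC happB, ← M.matrixN_eq ϰ huC hvC huB hvB H.AW,
    DeltaPrime_append, pp_image _ huC hvC] at hdet
  -- The common factor g(u^C, v^C): on one side it comes from `alt_entry`, on the other from Δ' of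
  -- the concatenation.
  have ng : ∏ i, ∏ j, g c (uC i) (vC j) ≠ 0 := by
    have := pp_g_ne_zero hc H.AW
    rwa [pp_image _ huC hvC] at this
  rw [hS]
  refine mul_left_cancel₀ ng ?_
  linear_combination -hdet

end transfer

end GL21

end

theorem proposition3p1 {V : Type*} [AddCommGroup V] [Module ℂ V]
    (c : ℂ) (hc : c ≠ 0) (M : GL21.Model c V) (a b : ℕ)
    (uC : Fin a → ℂ) (vC : Fin b → ℂ) (uB : Fin a → ℂ) (vB : Fin b → ℂ)
    (hgen : GL21.Generic c (Sum.elim (Fin.append uC vC) (Fin.append uB vB)))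
    (hlam : ∀ i, M.lam 1 (Sum.elim (Fin.append uC vC) (Fin.append uB vB) i) ≠ 0)
    (ϰ : ℂ) (hϰ : ϰ ≠ 0)
    (hC : ∀ j : Fin a, M.r₁ (uC j) =
      ϰ * (∏ k ∈ Finset.univ.erase j, GL21.f c (uC j) (uC k) / GL21.f c (uC k) (uC j)) *
        ∏ l, GL21.f c (vC l) (uC j))
    (hB : ∀ k : Fin b, M.r₃ (vB k) = ∏ l, GL21.f c (vB k) (uB l)) :
    M.scalarProduct uC vC uB vB =
      GL21.Delta c (Fin.append uB vC) * GL21.DeltaPrime c uC * GL21.DeltaPrime c vC *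
        (M.matrixN ϰ uC vC uB vB).det :=
  M.scalarProduct_eq_det hc uC vC uB vB hgen hlam ϰ hϰ hC hB
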